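/- Let $n,k\ge 1$ and fix norms $\|\cdot\|$ on $\mathbb R^n$ and $\mathbb R^k$; linear maps carry the operator norms. Let $V\subset\mathbb R^n$ be open and star-shaped with respect to $0$, i.e. $0\in\partial V$ and $\lambda x\in V$ for all $x\in V$, $\lambda\in(0,1]$. For $\rho>0$ put $V_\rho=V\cap B_\rho$, where $B_\rho$ is the open ball of radius $\rho$ centered at $0$. For a set $W$, $\mathcal H^{\ell}$ on $W$ denotes the continuous functions $f$ on $W$ such that $f(\lambda u)=\lambda^{\ell}f(u)$ whenever $\lambda\in\mathbb R$ and $u,\lambda u\in W$. Let $N\ge2$ and $m\ge1$ be integers, let $p:\mathbb R^n\to\mathbb R^n$, $p\in\mathcal H^{N}$, and $Q:\mathbb R^n\to L(\mathbb R^k,\mathbb R^k)$, $Q\in\mathcal H^{N-1}$, be defined on $\mathbb R^n$, and let $T:V\to\mathbb R^k$, $T\in\mathcal H^{m+N}$ on $V$. Let $1\le r\le\infty$ and assume that $p,Q$ are $C^r$ in a neighborhood $U$ of the origin and that $T$ is $C^r$ in $V$. Assume that for some $\rho_0>0$: (HP1) $p$ is $C^1$ in $V_{\rho_0}$ and $a_p:=-\sup_{x\in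 V_{\rho_0}}\frac{\|x+p(x)\|-\|x\|}{\|x\|^N}>0$; (HP2) there is $C>0$ with $\operatorname{dist}\big(x+p(x),(V_{\rho_0})^c\big)\ge C\|x\|^N$ for all $x\in V_{\rho_0}$. Define $$b_p=\sup_{x\in V_{\rho_0}}\frac{\|p(x)\|}{\|x\|^N},\qquad A_p=-\sup_{x\in V_{\rho_0}}\frac{\|\mathrm{Id}+Dp(x)\|-1}{\|x\|^{N-1}},\qquad B_Q=-\sup_{x\in V_{\rho_0}}\frac{\|\mathrm{Id}-Q(x)\|-1}{\|x\|^{N-1}},$$ $c_p=a_p$ if $B_Q\le0$ and $c_p=b_p$ otherwise, $d_p=a_p$ if $A_p<0$ and $d_p=b_p$ otherwise. Assume $$m+1+\frac{B_Q}{c_p}>\max\Big\{1-\frac{A_p}{d_p},\,0\Big\}.$$ Then for every $x\in V$ the solution $t\mapsto\varphi(t,x)$ of $\dot x=p(x)$ with $\varphi(0,x)=x$ is defined for all $t\ge0$ and stays in the cone $V^{e}=\{sy: s>0,\ y\in V\}$. Let $M(t,x)$ be the fundamental matrix of $\dot\psi=Q(\varphi(t,x))\psi$ with $M(0,x)=\mathrm{Id}$,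 and extend $T$ to $V^{e}$ by homogeneity of degree $m+N$. The equation $$Dh(x)\,p(x)-Q(x)\,h(x)=T(x),\qquad x\in V,$$ has a unique differentiable solution $h:V\to\mathbb R^k$ in $\mathcal H^{m+1}$. It is given by the absolutely convergent integral $$h(x)=\int_\infty^0M^{-1}(t,x)\,T(\varphi(t,x))\,dt,\qquad x\in V,$$ and it is of class $C^1$ on $V$. Moreover: (1) If $A_p\ge d_p$, then $h$ is $C^r$ in $V$. (2) If $A_p<d_p$, then there is a largest integer $r_0$ with $1\le r_0\le r$ and $m+1+\frac{B_Q}{c_p}-r_0\big(1-\frac{A_p}{d_p}\big)>0$, and $h$ is $C^{r_0}$ in $V$. (3) For $\gamma>0$ let $\Omega(\gamma)=\{z\in\mathbb C^n:\ \mathrm{Re}\,z\in V,\ \|\mathrm{Im}\,z\|<\gamma\|\mathrm{Re}\,z\|\}$. If $A_p>d_p$ and, for some $\gamma_0>0$, the functions $p,Q,T$ (restricted to $V$) have complex analytic extensions to $\Omega(\gamma_0)$, the one of $p$ satisfying $\|Dp(z)\|\le L\|z\|^{N-1}$ on $\Omega(\gamma_0)$ for some constant $L$ (which is automatic if $p$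 is a polynomial), then $h$ has a complex analytic extension to $\Omega(\gamma)$ for all sufficiently small $\gamma>0$. In particular $h$ is real analytic in $V$. -/

import Mathlib

open scoped ContDiff

noncomputable section

namespace Cohomological

variable {E F G : Type*} [NormedAddCommGroup E] [NormedSpace ℝ E]
  [NormedAddCommGroup F] [NormedSpace ℝ F] [NormedAddCommGroup G] [NormedSpace ℝ G]

/-- `V` is star-shaped with respect to `0`, where `0` is a boundary point of `V`. -/
def StarShapedAtZero (V : Set E) : Prop :=
  0 ∈ frontier V ∧ ∀ x ∈ V, ∀ c : ℝ, 0 < c → c ≤ 1 → c • x ∈ V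

/-- The truncation `V_ρ = V ∩ B_ρ`. -/
def trunc (V : Set E) (ρ : ℝ) : Set E := V ∩ Metric.ball 0 ρ

/-- The class `H^d` on `W`: continuous functions, homogeneous of degree `d` (all real factors). -/
def IsHomog (d : ℕ) (W : Set E) (f : E → G) : Prop :=
  ContinuousOn f W ∧ ∀ c : ℝ, ∀ u ∈ W, c • u ∈ W → f (c • u) = c ^ d • f u

/-- The constant `a_p`. -/
def constA (V : Set E) (ρ : ℝ) (N : ℕ) (p : E → E) : ℝ :=
  -⨆ x : trunc V ρ, (‖(x : E) + p x‖ - ‖(x : E)‖) / ‖(x : E)‖ ^ N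

/-- The constant `b_p`. -/
def constB (V : Set E) (ρ : ℝ) (N : ℕ) (p : E → E) : ℝ :=
  ⨆ x : trunc V ρ, ‖p x‖ / ‖(x : E)‖ ^ N

/-- The constant `A_p`. -/
def constAp (V : Set E) (ρ : ℝ) (N : ℕ) (p : E → E) : ℝ :=
  -⨆ x : trunc V ρ, (‖ContinuousLinearMap.id ℝ E + fderiv ℝ p x‖ - 1) / ‖(x : E)‖ ^ (N - 1)

/-- The constant `B_Q`. -/
def constBQ (V : Set E) (ρ : ℝ) (N : ℕ) (Q : E → F →L[ℝ] F) : ℝ :=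
  -⨆ x : trunc V ρ, (‖ContinuousLinearMap.id ℝ F - Q x‖ - 1) / ‖(x : E)‖ ^ (N - 1)

open Classical in
/-- The constant `c_p`. -/
def constC (V : Set E) (ρ : ℝ) (N : ℕ) (p : E → E) (Q : E → F →L[ℝ] F) : ℝ :=
  if constBQ V ρ N Q ≤ 0 then constA V ρ N p else constB V ρ N p

open Classical in
/-- The constant `d_p`. -/
def constD (V : Set E) (ρ : ℝ) (N : ℕ) (p : E → E) : ℝ :=
  if constAp V ρ N p < 0 then constA V ρ N p else constB V ρ N p

/-- Hypothesis HP1. -/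
def HP1 (V : Set E) (ρ : ℝ) (N : ℕ) (p : E → E) : Prop :=
  ContDiffOn ℝ 1 p (trunc V ρ) ∧ 0 < constA V ρ N p

/-- Hypothesis HP2. -/
def HP2 (V : Set E) (ρ : ℝ) (N : ℕ) (p : E → E) : Prop :=
  ∃ C : ℝ, 0 < C ∧ ∀ x ∈ trunc V ρ, C * ‖x‖ ^ N ≤ Metric.infDist (x + p x) (trunc V ρ)ᶜ

/-- The open cone `{t x : t > 0, x ∈ V}` generated by `V`. -/
def posCone (V : Set E) : Set E := {y | ∃ s : ℝ, 0 < s ∧ s • y ∈ V}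

open Classical in
/-- The extension to `posCone V`, by homogeneity of degree `d`, of a function on `V`
(and `0` outside the cone); see `homExtend_eq`. -/
def homExtend (V : Set E) (d : ℕ) (T : E → F) (y : E) : F :=
  if h : ∃ s : ℝ, 0 < s ∧ s • y ∈ V then (h.choose ^ d)⁻¹ • T (h.choose • y) else 0

/-- The extension by homogeneity does not depend on the factor chosen to compute it. -/
theorem homExtend_eq {V : Set E} {d : ℕ} {T : E → F} (hT : IsHomog d V T) {y : E} {s : ℝ}
    (hs : 0 < s) (hy : s • y ∈ V) : homExtend V d T y = (s ^ d)⁻¹ • T (s • y) := by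
  have h : ∃ s : ℝ, 0 < s ∧ s • y ∈ V := ⟨s, hs, hy⟩
  obtain ⟨h0, h1⟩ := h.choose_spec
  have e : (h.choose / s) • (s • y) = h.choose • y := by
    rw [smul_smul, div_mul_cancel₀ _ hs.ne']
  have k := hT.2 (h.choose / s) (s • y) hy (by rw [e]; exact h1)
  rw [e] at k
  rw [homExtend, dif_pos h, k, smul_smul, div_pow]
  congr 1
  field_simp

/-- `φ t x`, for `t ≥ 0` and `x ∈ V`, is the flow of `x' = p x`. -/
def IsForwardFlow (p : E → E) (V : Set E) (φ : ℝ → E → E) : Prop :=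
  ∀ x ∈ V, φ 0 x = x ∧
    ∀ t : ℝ, 0 ≤ t → HasDerivWithinAt (fun s => φ s x) (p (φ t x)) (Set.Ici 0) t

/-- `M t x`, for `t ≥ 0` and `x ∈ V`, is the fundamental matrix of `ψ' = Q (φ t x) ψ` with
`M 0 x = Id`. -/
def IsFundamentalMatrix (Q : E → F →L[ℝ] F) (V : Set E) (φ : ℝ → E → E)
    (M : ℝ → E → F ≃L[ℝ] F) : Prop :=
  ∀ x ∈ V, M 0 x = ContinuousLinearEquiv.refl ℝ F ∧
    ∀ t : ℝ, 0 ≤ t → HasDerivWithinAt (fun s => (M s x : F →L[ℝ] F))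
      ((Q (φ t x)).comp (M t x : F →L[ℝ] F)) (Set.Ici 0) t

/-- `h : V → F` is a differentiable solution of `Dh(x) p(x) - Q(x) h(x) = T(x)` in `H^d`. -/
def IsSolution (V : Set E) (p : E → E) (Q : E → F →L[ℝ] F) (T : E → F) (d : ℕ)
    (h : E → F) : Prop :=
  IsHomog d V h ∧ DifferentiableOn ℝ h V ∧
    ∀ x ∈ V, fderiv ℝ h x (p x) - Q x (h x) = T x

/-- The point of `E ≅ ℝⁿ` whose coordinates are the real parts of those of `z ∈ ℂⁿ`. -/
def rePart {n : ℕ} (e : Module.Basis (Fin n) ℝ E) (z : Fin n → ℂ) : E :=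
  ∑ i, (z i).re • e i

/-- The point of `E ≅ ℝⁿ` whose coordinates are the imaginary parts of those of `z ∈ ℂⁿ`. -/
def imPart {n : ℕ} (e : Module.Basis (Fin n) ℝ E) (z : Fin n → ℂ) : E :=
  ∑ i, (z i).im • e i

/-- The inclusion of `E ≅ ℝⁿ` in `ℂⁿ`. -/
def toComplex {n : ℕ} (e : Module.Basis (Fin n) ℝ E) (x : E) : Fin n → ℂ :=
  fun i => ((e.repr x i : ℝ) : ℂ)

/-- `Ω(γ) = {z ∈ ℂⁿ : Re z ∈ V, ‖Im z‖ < γ ‖Re z‖}`. -/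
def Omega {n : ℕ} (e : Module.Basis (Fin n) ℝ E) (V : Set E) (γ : ℝ) : Set (Fin n → ℂ) :=
  {z | rePart e z ∈ V ∧ ‖imPart e z‖ < γ * ‖rePart e z‖}

/-- The function `f : V → ℝ` is the restriction of the complex analytic `g : Ω(γ) → ℂ`. -/
def IsComplexExtension {n : ℕ} (e : Module.Basis (Fin n) ℝ E) (V : Set E) (γ : ℝ)
    (f : E → ℝ) (g : (Fin n → ℂ) → ℂ) : Prop :=
  AnalyticOnNhd ℂ g (Omega e V γ) ∧ ∀ x ∈ V, g (toComplex e x) = (f x : ℂ)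

/-- `f : V → G`, with `G` finite-dimensional, extends analytically to `Ω(γ)`: every (real linear)
coordinate of `f` does. -/
def ExtendsToOmega {n : ℕ} (e : Module.Basis (Fin n) ℝ E) (V : Set E) (γ : ℝ)
    (f : E → G) : Prop :=
  ∀ l : G →L[ℝ] ℝ, ∃ g, IsComplexExtension e V γ (fun x => l (f x)) g

/-- As `ExtendsToOmega`, with the derivative of the extension of size `O(‖z‖ ^ j)` on `Ω(γ)`. -/
def ExtendsToOmegaWithBound {n : ℕ} (e : Module.Basis (Fin n) ℝ E) (V : Set E) (γ : ℝ)
    (j : ℕ) (f : E → G) : Prop :=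
  ∀ l : G →L[ℝ] ℝ, ∃ g, IsComplexExtension e V γ (fun x => l (f x)) g ∧
    ∃ L : ℝ, ∀ z ∈ Omega e V γ, ‖fderiv ℂ g z‖ ≤ L * ‖z‖ ^ j

end Cohomological

end

/-!
# The cohomological equation of a homogeneous field on a star-shaped set

Write `N = ν + 1`. The equation `Dh p - Q h = T` says that `h` solves the linear equation
`d/dt h(φ) = Q(φ) h(φ) + T(φ)` along the trajectories of `p`, so variation of constants suggests the
solution `cohIntegral`, the integral of `-M⁻¹(t, x) T(φ(t, x))` over `t > 0`. Everything rests on the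
decay of `φ`, of `M⁻¹` and of `Dφ` as `t → ∞`.

*The flow.* By homogeneity, a step `l x ↦ l x + p(l x)` of the map of the hypotheses is, after scaling
by `l`, an Euler step of length `l ^ ν` at `x`. The second hypothesis leaves room for the error of
Euler's method, so that trajectories of `p`, and even trajectories perturbed by a small multiple of
`‖x‖ ^ (ν + 1)` (`PseudoOrbit`), cannot leave the cone `posCone V` (`mem_posCone_of_pseudoOrbit`,
`IsRobustCone`). As small moving shifts of a trajectory are such perturbations, trajectories gain
distance from the boundary of the cone: after a time `O(‖x‖ ^ (-ν))` they lie in a closed subcone with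
compact base (`IsRobustCone.exists_zone`). The outcome is the notion `IsConeFlow`, on which the rest of
the real theory is built.

*Decay.* A bound `‖x + s p(x)‖ ≤ ‖x‖ - s a ‖x‖ ^ (ν + 1)` for small `s` is a bound for the Dini
derivative of the norm along trajectories, and comparison with `w' = -a w ^ (ν + 1)` and
`w' = -b w ^ (ν + 1)` shows that `‖φ‖` is of size `t ^ (-1 / ν)`. In the same way, bounds for
`‖Id - s Q‖` and `‖Id + s Dp‖` give powers of `t` for `M⁻¹` and for the Lipschitz constant of `φ`,
where the sign of the constant decides which of `a`, `b` enters (`rate`). The integral converges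
locally uniformly if `m + 1 + B / c > 0`, and it is the only solution (`isFlowSol_cohIntegral`,
`eq_cohIntegral`). A negative homogeneity factor between points of the cone forces `p` to be odd
(`IsRobustCone.even_of_neg_mem`), and then parity of the data gives homogeneity of the solution.

*Regularity.* The derivative `H` of a solution satisfies an equation of the same kind, with coefficient
`H ↦ Q H - H Dp` and right-hand side `DT + DQ h`; its degree is lower by one and its constant is
`B + A`, so that the margin of convergence drops by at most `1 - A / d`. The integral solution of this
equation is the derivative of `h`, because the error of the first-order expansion along two
trajectories decays (`hasFDerivAt_cohIntegral`). Induction gives `contDiffOn_cohIntegral`.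

*Analyticity.* The complexification of `E` is `E × E`, with `mulI` as multiplication by `i`. If `A > d`,
then `d = b`, and the imaginary part of a trajectory of the complexified field decays faster than
the real part can, so the slope `‖Im z‖ / ‖Re z‖` tends to `0` (`IsHomogExt.slope_le`). As the real
part is a perturbed real trajectory, the complexified field has a flow in the sense of `IsConeFlow`,
with almost the same constants, near the real cone (`IsHomogExt.exists_isConeFlow`). The real theory
applies to the complexified equation. Its solution is continuously differentiable, and its derivative
`H` commutes with `i`, since `-i H i` solves the same differentiated equation
(`fderiv_cohIntegral_mulI`). It is therefore holomorphic, hence analytic by Osgood's lemma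
(`analyticOnNhd_of_differentiableOn`), and it restricts to the real solution
(`cohIntegral_complex_real`).
-/

open scoped ContDiff

noncomputable section

namespace Cohomological

open Set Filter Topology Metric MeasureTheory

/-! ### Upper right Dini derivatives -/

/-- The upper right Dini derivative of `g` at `t` is at most `c`. -/
def DiniLe (g : ℝ → ℝ) (c t : ℝ) : Prop := ∀ r, c < r → ∀ᶠ z in 𝓝[>] t, slope g t z < r

theorem DiniLe.mono {g : ℝ → ℝ} {c c' t : ℝ} (h : DiniLe g c t) (hc : c ≤ c') : DiniLe g c' t :=
  fun r hr => h r (hc.trans_lt hr)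

theorem tendsto_add_nhdsGT (t : ℝ) : Tendsto (fun z => z - t) (𝓝[>] t) (𝓝[>] 0) := by
  refine tendsto_nhdsWithin_iff.2 ⟨?_, ?_⟩
  · have : Tendsto (fun z : ℝ => z - t) (𝓝 t) (𝓝 (t - t)) := (continuous_id.sub continuous_const).tendsto t
    rw [sub_self] at this
    exact this.mono_left nhdsWithin_le_nhds
  · filter_upwards [self_mem_nhdsWithin] with z hz
    simpa using hz

section NormCurve

variable {X : Type*} [NormedAddCommGroup X] [NormedSpace ℝ X]

/-- The first-order expansion of a curve with a right derivative. -/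
theorem eventually_norm_sub_le_of_hasDerivWithinAt {f : ℝ → X} {f' : X} {t : ℝ}
    (hf : HasDerivWithinAt f f' (Ici t) t) {ε : ℝ} (hε : 0 < ε) :
    ∀ᶠ z in 𝓝[>] t, ‖f z - (f t + (z - t) • f')‖ ≤ ε * (z - t) := by
  have h := (hasDerivWithinAt_iff_isLittleO.1 hf).def hε
  have h' := h.filter_mono (nhdsWithin_mono t Ioi_subset_Ici_self)
  filter_upwards [h', self_mem_nhdsWithin] with z hz hzt
  rw [Real.norm_of_nonneg (sub_nonneg.2 (le_of_lt hzt))] at hz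
  rwa [← sub_sub]

/-- The norm of a curve grows at most at the rate given by the first-order growth of the norm in
the direction of its right derivative. -/
theorem diniLe_norm {f : ℝ → X} {f' : X} {t c : ℝ}
    (hf : HasDerivWithinAt f f' (Ici t) t)
    (h : ∀ ε > 0, ∀ᶠ s : ℝ in 𝓝[>] 0, ‖f t + s • f'‖ ≤ ‖f t‖ + s * (c + ε)) :
    DiniLe (fun s => ‖f s‖) c t := by
  intro r hr
  have hε : 0 < (r - c) / 3 := by linarith
  filter_upwards [eventually_norm_sub_le_of_hasDerivWithinAt hf hε,
    (tendsto_add_nhdsGT t).eventually (h _ hε), self_mem_nhdsWithin] with z h1 h2 hz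
  have hz' : 0 < z - t := sub_pos.2 hz
  have h3 : ‖f z‖ ≤ ‖f z - (f t + (z - t) • f')‖ + ‖f t + (z - t) • f'‖ := by
    simpa using norm_add_le (f z - (f t + (z - t) • f')) (f t + (z - t) • f')
  rw [slope_def_field, div_lt_iff₀ hz']
  nlinarith

theorem diniLe_norm_of_norm_le {f : ℝ → X} {f' : X} {t c : ℝ}
    (hf : HasDerivWithinAt f f' (Ici t) t) (h : ‖f'‖ ≤ c) :
    DiniLe (fun s => ‖f s‖) c t := by
  refine diniLe_norm hf fun ε hε => ?_
  filter_upwards [self_mem_nhdsWithin] with s hs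
  have hs : 0 < s := hs
  refine (norm_add_le _ _).trans ?_
  rw [norm_smul, Real.norm_of_nonneg hs.le]
  nlinarith

theorem diniLe_neg_norm_of_norm_le {f : ℝ → X} {f' : X} {t c : ℝ}
    (hf : HasDerivWithinAt f f' (Ici t) t) (h : ‖f'‖ ≤ c) :
    DiniLe (fun s => -‖f s‖) c t := by
  intro r hr
  have hε : 0 < (r - c) / 3 := by linarith
  filter_upwards [eventually_norm_sub_le_of_hasDerivWithinAt hf hε,
    self_mem_nhdsWithin] with z h1 hz
  have hz' : 0 < z - t := sub_pos.2 hz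
  have h3 : ‖f t‖ ≤ ‖f z - (f t + (z - t) • f')‖ + ‖f z‖ + ‖(z - t) • f'‖ := by
    have := norm_sub_le (f z - (z - t) • f') (f z - (f t + (z - t) • f'))
    have h4 := norm_sub_le (f z) ((z - t) • f')
    have e : (f z - (z - t) • f') - (f z - (f t + (z - t) • f')) = f t := by abel
    rw [e] at this
    linarith
  rw [norm_smul, Real.norm_of_nonneg hz'.le] at h3
  rw [slope_def_field, div_lt_iff₀ hz']
  nlinarith

end NormCurve

/-- Comparison for Dini derivatives, with a strict inequality where the two functions touch. -/
theorem le_of_diniLe_of_lt {f f' B B' : ℝ → ℝ} {a b : ℝ} (hf : ContinuousOn f (Icc a b))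
    (hf' : ∀ t ∈ Ico a b, DiniLe f (f' t) t) (ha : f a ≤ B a) (hB : ContinuousOn B (Icc a b))
    (hB' : ∀ t ∈ Ico a b, HasDerivWithinAt B (B' t) (Ici t) t)
    (bound : ∀ t ∈ Ico a b, f t = B t → f' t < B' t) : ∀ t ∈ Icc a b, f t ≤ B t :=
  image_le_of_liminf_slope_right_lt_deriv_boundary' hf
    (fun x hx r hr => (hf' x hx r hr).frequently) ha hB hB' bound

/-- Grönwall's inequality for Dini derivatives, with a variable rate `α` whose primitive is `P`. -/
theorem le_mul_exp_of_diniLe {g α P : ℝ → ℝ} {a b : ℝ} (hab : a ≤ b)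
    (hg : ContinuousOn g (Icc a b)) (h0 : 0 ≤ g a)
    (hg' : ∀ t ∈ Ico a b, DiniLe g (α t * g t) t) (hP : ContinuousOn P (Icc a b))
    (hP' : ∀ t ∈ Ico a b, HasDerivWithinAt P (α t) (Ici t) t) :
    g b ≤ g a * Real.exp (P b - P a) := by
  have key : ∀ ε > 0, g b ≤ (g a + ε) * Real.exp (P b - P a + ε * (b - a)) := by
    intro ε hε
    have := le_of_diniLe_of_lt (B := fun t => (g a + ε) * Real.exp (P t - P a + ε * (t - a)))
      (B' := fun t => (g a + ε) * (Real.exp (P t - P a + ε * (t - a)) * (α t + ε)))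
      hg hg' (by simp; exact hε.le) (by fun_prop) ?_ ?_ b ⟨hab, le_rfl⟩
    · exact this
    · intro t ht
      have h1 : HasDerivWithinAt (fun t => P t - P a + ε * (t - a)) (α t + ε) (Ici t) t := by
        have h2 := ((hasDerivWithinAt_id t (Ici t)).sub_const a).const_mul ε
        rw [mul_one] at h2
        exact ((hP' t ht).sub_const (P a)).fun_add h2
      exact (h1.exp).const_mul _
    · intro t ht hgt
      rw [hgt]
      have : 0 < (g a + ε) * Real.exp (P t - P a + ε * (t - a)) := by positivity
      nlinarith
  have hlim : Tendsto (fun ε => (g a + ε) * Real.exp (P b - P a + ε * (b - a))) (𝓝[>] 0)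
      (𝓝 (g a * Real.exp (P b - P a))) := by
    have : Continuous (fun ε => (g a + ε) * Real.exp (P b - P a + ε * (b - a))) := by fun_prop
    have h := this.tendsto 0
    simp only [add_zero, zero_mul] at h
    exact h.mono_left nhdsWithin_le_nhds
  exact ge_of_tendsto hlim (by filter_upwards [self_mem_nhdsWithin] with ε hε using key ε hε)

/-! ### Local and global Lipschitz constants -/

/-- A function whose local Lipschitz constant is at most `C` at each point of a convex set is
`C`-Lipschitz there. -/
theorem norm_sub_le_of_local {X Y : Type*} [NormedAddCommGroup X] [NormedSpace ℝ X]
    [NormedAddCommGroup Y] {s : Set X} (hs : Convex ℝ s) {f : X → Y} {C : ℝ}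
    (h : ∀ x ∈ s, ∀ ε > 0, ∀ᶠ y in 𝓝 x, ‖f y - f x‖ ≤ (C + ε) * ‖y - x‖) :
    ∀ x ∈ s, ∀ y ∈ s, ‖f y - f x‖ ≤ C * ‖y - x‖ := by
  intro x hx y hy
  have hcont : ContinuousOn f s := by
    intro z hz
    refine ContinuousAt.continuousWithinAt ?_
    rw [ContinuousAt, tendsto_iff_norm_sub_tendsto_zero]
    have h1 : Tendsto (fun w => (C + 1) * ‖w - z‖) (𝓝 z) (𝓝 0) := by
      have : Continuous (fun w => (C + 1) * ‖w - z‖) := by fun_prop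
      simpa using this.tendsto z
    exact squeeze_zero' (Eventually.of_forall fun _ => norm_nonneg _) (h z hz 1 one_pos) h1
  let γ : ℝ → X := fun t => x + t • (y - x)
  have hγ : Continuous γ := by fun_prop
  have hγs : ∀ t ∈ Icc (0 : ℝ) 1, γ t ∈ s := by
    intro t ht
    exact hs.add_smul_sub_mem hx hy ht
  have hg : ContinuousOn (fun t => ‖f (γ t) - f x‖) (Icc 0 1) :=
    ((hcont.comp hγ.continuousOn hγs).sub continuousOn_const).norm
  have hsub : ∀ z t : ℝ, γ z - γ t = (z - t) • (y - x) := by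
    intro z t
    simp only [γ, sub_smul]
    abel
  have := image_le_of_liminf_slope_right_le_deriv_boundary (B := fun t => C * ‖y - x‖ * t)
    (B' := fun _ => C * ‖y - x‖) hg (by simp [γ]) (by fun_prop)
    (fun t _ => by simpa using (hasDerivWithinAt_id t (Ici t)).const_mul (C * ‖y - x‖)) ?_
    (right_mem_Icc.2 zero_le_one)
  · simpa [γ] using this
  · intro t ht r hr
    refine Eventually.frequently ?_
    obtain ⟨ε, hε, hεr⟩ : ∃ ε > 0, (C + ε) * ‖y - x‖ < r := by
      have hc : Tendsto (fun ε : ℝ => (C + ε) * ‖y - x‖) (𝓝[>] 0) (𝓝 (C * ‖y - x‖)) := by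
        have : Continuous (fun ε : ℝ => (C + ε) * ‖y - x‖) := by fun_prop
        have h := this.tendsto 0
        simp only [add_zero] at h
        exact h.mono_left nhdsWithin_le_nhds
      obtain ⟨ε, h1, h2⟩ := ((hc.eventually_lt_const hr).and self_mem_nhdsWithin).exists
      exact ⟨ε, h2, h1⟩
    have h1 := (hγ.tendsto t).eventually (h (γ t) (hγs t ⟨ht.1, ht.2.le⟩) ε hε)
    filter_upwards [h1.filter_mono nhdsWithin_le_nhds, self_mem_nhdsWithin] with z hz hzt
    have hz' : 0 < z - t := sub_pos.2 hzt
    rw [slope_def_field, div_lt_iff₀ hz']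
    rw [hsub, norm_smul, Real.norm_of_nonneg hz'.le] at hz
    have h3 : ‖f (γ z) - f x‖ ≤ ‖f (γ z) - f (γ t)‖ + ‖f (γ t) - f x‖ := by
      simpa using norm_add_le (f (γ z) - f (γ t)) (f (γ t) - f x)
    nlinarith

/-! ### Solutions of differential equations -/

/-- `y` solves `y' = v t y` on the set `S` of times, within the region `D`. -/
def SolOn {X : Type*} [NormedAddCommGroup X] [NormedSpace ℝ X] (v : ℝ → X → X) (D : Set X)
    (S : Set ℝ) (y : ℝ → X) : Prop :=
  ∀ t ∈ S, y t ∈ D ∧ HasDerivWithinAt y (v t (y t)) S t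

section ODE

variable {X : Type*} [NormedAddCommGroup X] [NormedSpace ℝ X] {v w : ℝ → X → X} {D D' : Set X}
  {S S' : Set ℝ} {y y' : ℝ → X}

theorem SolOn.mono (h : SolOn v D S y) (hS : S' ⊆ S) : SolOn v D S' y :=
  fun t ht => ⟨(h t (hS ht)).1, (h t (hS ht)).2.mono hS⟩

theorem SolOn.mono_set (h : SolOn v D S y) (hD : ∀ t ∈ S, y t ∈ D') : SolOn v D' S y :=
  fun t ht => ⟨hD t ht, (h t ht).2⟩

theorem SolOn.congr_field (h : SolOn v D S y) (hvw : ∀ t ∈ S, v t (y t) = w t (y t)) :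
    SolOn w D S y :=
  fun t ht => ⟨(h t ht).1, hvw t ht ▸ (h t ht).2⟩

theorem SolOn.continuousOn (h : SolOn v D S y) : ContinuousOn y S :=
  fun t ht => (h t ht).2.continuousWithinAt

theorem SolOn.hasDerivWithinAt_Ici_of_Icc {T : ℝ} (h : SolOn v D (Icc 0 T) y) {t : ℝ}
    (ht : t ∈ Ico 0 T) : HasDerivWithinAt y (v t (y t)) (Ici t) t := by
  refine ((h t ⟨ht.1, ht.2.le⟩).2.mono (Icc_subset_Icc_left ht.1 : Icc t T ⊆ Icc 0 T)).mono_of_mem_nhdsWithin ?_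
  exact Icc_mem_nhdsGE ht.2

theorem SolOn.hasDerivWithinAt_Ici (h : SolOn v D (Ici 0) y) {t : ℝ} (ht : 0 ≤ t) :
    HasDerivWithinAt y (v t (y t)) (Ici t) t :=
  (h t ht).2.mono (Ici_subset_Ici.2 ht)

theorem SolOn.dist_le {T : ℝ} {K : NNReal} (hv : ∀ t, LipschitzWith K (v t))
    (h : SolOn v D (Icc 0 T) y) (h' : SolOn v D' (Icc 0 T) y') :
    ∀ t ∈ Icc 0 T, dist (y t) (y' t) ≤ dist (y 0) (y' 0) * Real.exp (K * t) := by
  intro t ht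
  have := dist_le_of_trajectories_ODE hv h.continuousOn (fun t ht => h.hasDerivWithinAt_Ici_of_Icc ht)
    h'.continuousOn (fun t ht => h'.hasDerivWithinAt_Ici_of_Icc ht) le_rfl t ht
  simpa using this

/-- A bounded field, Lipschitz in space and continuous in time, has solutions on any interval. -/
theorem exists_solOn_Icc [CompleteSpace X] {K : NNReal} {L : ℝ} (hv : ∀ t, LipschitzWith K (v t))
    (hc : ∀ x, Continuous fun t => v t x) (hL : ∀ t x, ‖v t x‖ ≤ L) {T : ℝ} (hT : 0 ≤ T) (x₀ : X) :
    ∃ y, y 0 = x₀ ∧ SolOn v univ (Icc 0 T) y := by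
  have hL0 : 0 ≤ L := (norm_nonneg _).trans (hL 0 x₀)
  have hpl : IsPicardLindelof v (tmin := 0) (tmax := T) ⟨0, le_rfl, hT⟩ x₀
      (L.toNNReal * T.toNNReal) 0 L.toNNReal K := by
    refine ⟨fun t _ => (hv t).lipschitzOnWith, fun x _ => (hc x).continuousOn, fun t _ x _ => ?_, ?_⟩
    · rw [Real.coe_toNNReal _ hL0]; exact hL t x
    · simp [hT]
  obtain ⟨y, h0, hy⟩ := hpl.exists_eq_forall_mem_Icc_hasDerivWithinAt₀
  exact ⟨y, h0, fun t ht => ⟨trivial, hy t ht⟩⟩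

/-- Solutions on all compact intervals, if they are unique, glue to a global solution. -/
theorem exists_solOn_Ici {x₀ : X}
    (hex : ∀ T > 0, ∃ y, y 0 = x₀ ∧ SolOn v D (Icc 0 T) y)
    (huniq : ∀ T > 0, ∀ y y', y 0 = x₀ → y' 0 = x₀ → SolOn v D (Icc 0 T) y →
      SolOn v D (Icc 0 T) y' → EqOn y y' (Icc 0 T)) :
    ∃ y, y 0 = x₀ ∧ SolOn v D (Ici 0) y := by
  choose Y hY0 hY using fun n : ℕ => hex (n + 1) (by positivity)
  have hpos : ∀ n : ℕ, (0 : ℝ) < n + 1 := fun n => by positivity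
  have hle : ∀ m n : ℕ, m ≤ n → EqOn (Y m) (Y n) (Icc 0 (m + 1)) := by
    intro m n hmn
    refine huniq _ (hpos m) _ _ (hY0 m) (hY0 n) (hY m) ((hY n).mono (Icc_subset_Icc_right ?_))
    gcongr
  have heq : ∀ m n : ℕ, ∀ t : ℝ, 0 ≤ t → t ≤ m + 1 → t ≤ n + 1 → Y m t = Y n t := by
    intro m n t h0 h1 h2
    rcases le_total m n with h | h
    · exact hle m n h ⟨h0, h1⟩
    · exact (hle n m h ⟨h0, h2⟩).symm
  refine ⟨fun t => Y ⌈t⌉₊ t, by simp [hY0], fun t ht => ?_⟩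
  set n := ⌈t⌉₊ with hn
  have htn : t < n + 1 := (Nat.le_ceil t).trans_lt (lt_add_one _)
  have htn' : t ∈ Icc (0 : ℝ) (n + 1) := ⟨ht, htn.le⟩
  refine ⟨(hY n t htn').1, ?_⟩
  have h1 : HasDerivWithinAt (Y n) (v t (Y n t)) (Ici 0) t := by
    refine (hY n t htn').2.mono_of_mem_nhdsWithin ?_
    rw [← Ici_inter_Iic]
    exact inter_mem self_mem_nhdsWithin (mem_nhdsWithin_of_mem_nhds (Iic_mem_nhds htn))
  refine h1.congr_of_eventuallyEq ?_ rfl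
  filter_upwards [self_mem_nhdsWithin, mem_nhdsWithin_of_mem_nhds (Iio_mem_nhds htn)] with s hs hs'
  exact heq _ _ s hs ((Nat.le_ceil s).trans (lt_add_one _).le) (le_of_lt hs')

/-! ### Linear equations -/

/-- The radial cut-off of the identity is Lipschitz. -/
theorem lipschitzWith_radial_cutoff {ρ : ℝ} (hρ : 0 < ρ) :
    LipschitzWith 3 (fun x : X => max 0 (min 1 (2 - ‖x‖ / ρ)) • x) := by
  set l : X → ℝ := fun x => max 0 (min 1 (2 - ‖x‖ / ρ)) with hl
  have l0 : ∀ x, 0 ≤ l x := fun x => le_max_left _ _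
  have l1 : ∀ x, l x ≤ 1 := fun x => max_le zero_le_one (min_le_left _ _)
  have lz : ∀ x, 2 * ρ ≤ ‖x‖ → l x = 0 := by
    intro x hx
    refine max_eq_left ((min_le_right _ _).trans ?_)
    have : 2 ≤ ‖x‖ / ρ := (le_div_iff₀ hρ).2 hx
    linarith
  have ll : ∀ x y, |l x - l y| ≤ ‖x - y‖ / ρ := by
    intro x y
    have h1 := abs_max_sub_max_le_abs (min 1 (2 - ‖x‖ / ρ)) (min 1 (2 - ‖y‖ / ρ)) 0
    have h2 := abs_min_sub_min_le_max (1 : ℝ) (2 - ‖x‖ / ρ) 1 (2 - ‖y‖ / ρ)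
    have h3 : |2 - ‖x‖ / ρ - (2 - ‖y‖ / ρ)| ≤ ‖x - y‖ / ρ := by
      have e : 2 - ‖x‖ / ρ - (2 - ‖y‖ / ρ) = -((‖x‖ - ‖y‖) / ρ) := by ring
      rw [e, abs_neg, abs_div, abs_of_pos hρ]
      gcongr
      exact abs_norm_sub_norm_le x y
    rw [max_comm _ (0 : ℝ), max_comm _ (0 : ℝ)] at h1
    refine h1.trans (h2.trans (max_le ?_ h3))
    simp only [sub_self, abs_zero]; positivity
  have main : ∀ x y : X, ‖y‖ ≤ 2 * ρ → ‖l x • x - l y • y‖ ≤ 3 * ‖x - y‖ := by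
    intro x y hy
    have e : l x • x - l y • y = l x • (x - y) + (l x - l y) • y := by
      rw [smul_sub, sub_smul]; abel
    rw [e]
    refine (norm_add_le _ _).trans ?_
    rw [norm_smul, norm_smul, Real.norm_of_nonneg (l0 x), Real.norm_eq_abs]
    have h1 : l x * ‖x - y‖ ≤ 1 * ‖x - y‖ := by gcongr; exact l1 x
    have h2 : |l x - l y| * ‖y‖ ≤ ‖x - y‖ / ρ * (2 * ρ) := by
      gcongr; exact ll x y
    have h3 : ‖x - y‖ / ρ * (2 * ρ) = 2 * ‖x - y‖ := by field_simp
    linarith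
  refine LipschitzWith.of_dist_le_mul fun x y => ?_
  rw [dist_eq_norm, dist_eq_norm]
  change ‖l x • x - l y • y‖ ≤ 3 * ‖x - y‖
  rcases le_total ‖y‖ (2 * ρ) with hy | hy
  · exact main x y hy
  rcases le_total ‖x‖ (2 * ρ) with hx | hx
  · rw [norm_sub_rev, norm_sub_rev x]; exact main y x hx
  · rw [lz x hx, lz y hy]; simp

/-- A linear equation with continuous coefficients has global forward solutions. -/
theorem exists_linear_solution [CompleteSpace X] (S : ℝ → X →L[ℝ] X) (hS : Continuous S) (x₀ : X) :
    ∃ y : ℝ → X, y 0 = x₀ ∧ SolOn (fun t x => S t x) univ (Ici 0) y := by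
  have hbd : ∀ T : ℝ, ∃ K : NNReal, ∀ t ∈ Icc 0 T, ‖S t‖ ≤ K := by
    intro T
    obtain ⟨K, hK⟩ := (isCompact_Icc (a := (0 : ℝ)) (b := T)).exists_bound_of_continuousOn hS.continuousOn
    exact ⟨K.toNNReal, fun t ht => (hK t ht).trans (Real.le_coe_toNNReal K)⟩
  apply exists_solOn_Ici
  · intro T hT
    obtain ⟨K, hK⟩ := hbd T
    set ρ : ℝ := (‖x₀‖ + 1) * Real.exp (K * T) with hρ
    have hρ0 : 0 < ρ := by positivity
    let l : X → ℝ := fun x => max 0 (min 1 (2 - ‖x‖ / ρ))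
    have l0 : ∀ x, 0 ≤ l x := fun x => le_max_left _ _
    have l1 : ∀ x, l x ≤ 1 := fun x => max_le zero_le_one (min_le_left _ _)
    let τ : ℝ → ℝ := fun t => max 0 (min t T)
    have hτ : ∀ t, τ t ∈ Icc 0 T := fun t => ⟨le_max_left _ _, max_le hT.le (min_le_right _ _)⟩
    have hτ' : ∀ t ∈ Icc 0 T, τ t = t := by
      intro t ht
      simp [τ, ht.1, ht.2]
    let u : ℝ → X → X := fun t x => S (τ t) (l x • x)
    have hu : ∀ t, LipschitzWith (K * 3) (u t) := by
      intro t
      have h1 : LipschitzWith K (S (τ t)) :=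
        (S (τ t)).lipschitz.weaken (hK _ (hτ t))
      exact h1.comp (lipschitzWith_radial_cutoff hρ0)
    have huc : ∀ x, Continuous fun t => u t x := by
      intro x
      have : Continuous τ := by fun_prop
      exact (hS.comp this).clm_apply continuous_const
    have hnl : ∀ x : X, ‖l x • x‖ ≤ 2 * ρ := by
      intro x
      rw [norm_smul, Real.norm_of_nonneg (l0 x)]
      rcases le_total ‖x‖ (2 * ρ) with h | h
      · calc l x * ‖x‖ ≤ 1 * (2 * ρ) := by gcongr; exact l1 x
          _ = _ := one_mul _
      · have : l x = 0 := by
          refine max_eq_left ((min_le_right _ _).trans ?_)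
          have : 2 ≤ ‖x‖ / ρ := (le_div_iff₀ hρ0).2 h
          linarith
        rw [this, zero_mul]; positivity
    obtain ⟨y, hy0, hy⟩ := exists_solOn_Icc (L := K * (2 * ρ)) hu huc (fun t x => by
      refine (ContinuousLinearMap.le_opNorm _ _).trans ?_
      gcongr
      · exact hK _ (hτ t)
      · exact hnl x) hT.le x₀
    have hbound : ∀ t ∈ Icc 0 T, ‖y t‖ ≤ ρ := by
      intro t ht
      have := norm_le_gronwallBound_of_norm_deriv_right_le (f := y) (f' := fun s => u s (y s))
        (δ := ‖x₀‖) (K := K) (ε := 0) (a := 0) (b := T) hy.continuousOn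
        (fun s hs => hy.hasDerivWithinAt_Ici_of_Icc hs) (by rw [hy0]) (fun s hs => ?_) t ht
      · rw [gronwallBound_ε0, sub_zero] at this
        refine this.trans ?_
        rw [hρ]
        gcongr
        · linarith
        · exact ht.2
      · rw [add_zero]
        refine (ContinuousLinearMap.le_opNorm _ _).trans ?_
        gcongr
        · exact hK _ (hτ s)
        · rw [norm_smul, Real.norm_of_nonneg (l0 _)]
          exact mul_le_of_le_one_left (norm_nonneg _) (l1 _)
    refine ⟨y, hy0, hy.congr_field fun t ht => ?_⟩
    have h1 : l (y t) = 1 := by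
      have : ‖y t‖ / ρ ≤ 1 := (div_le_one hρ0).2 (hbound t ht)
      have h2 : min 1 (2 - ‖y t‖ / ρ) = 1 := min_eq_left (by linarith)
      simp [l, h2]
    simp only [u, h1, one_smul, hτ' t ht]
  · intro T hT y y' h0 h0' hy hy'
    obtain ⟨K, hK⟩ := hbd T
    refine ODE_solution_unique_of_mem_Icc_right (v := fun t x => S t x) (s := fun _ => univ) (K := K)
      (fun t ht => ?_)
      hy.continuousOn (fun t ht => hy.hasDerivWithinAt_Ici_of_Icc ht) (fun _ _ => trivial)
      hy'.continuousOn (fun t ht => hy'.hasDerivWithinAt_Ici_of_Icc ht) (fun _ _ => trivial)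
      (h0.trans h0'.symm)
    exact ((S t).lipschitz.weaken (hK _ ⟨ht.1, ht.2.le⟩)).lipschitzOnWith

/-- Forward solutions of a linear equation with continuous coefficients are unique. -/
theorem linear_solution_unique {S : ℝ → X →L[ℝ] X} (hS : Continuous S) {y y' : ℝ → X}
    (h0 : y 0 = y' 0) (hy : ∀ t, 0 ≤ t → HasDerivWithinAt y (S t (y t)) (Ici 0) t)
    (hy' : ∀ t, 0 ≤ t → HasDerivWithinAt y' (S t (y' t)) (Ici 0) t) : ∀ t, 0 ≤ t → y t = y' t := by
  intro T hT
  obtain ⟨K, hK⟩ := (isCompact_Icc (a := (0 : ℝ)) (b := T)).exists_bound_of_continuousOn hS.continuousOn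
  have h1 : SolOn (fun t x => S t x) univ (Icc 0 T) y :=
    SolOn.mono (S := Ici 0) (fun t ht => ⟨trivial, hy t ht⟩) (Icc_subset_Ici_self)
  have h2 : SolOn (fun t x => S t x) univ (Icc 0 T) y' :=
    SolOn.mono (S := Ici 0) (fun t ht => ⟨trivial, hy' t ht⟩) (Icc_subset_Ici_self)
  refine ODE_solution_unique_of_mem_Icc_right (v := fun t x => S t x) (s := fun _ => univ)
      (K := K.toNNReal) (fun t ht => ?_)
      h1.continuousOn (fun t ht => h1.hasDerivWithinAt_Ici_of_Icc ht) (fun _ _ => trivial)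
      h2.continuousOn (fun t ht => h2.hasDerivWithinAt_Ici_of_Icc ht) (fun _ _ => trivial)
      h0 ⟨hT, le_rfl⟩
  exact ((S t).lipschitz.weaken ((hK _ ⟨ht.1, ht.2.le⟩).trans (Real.le_coe_toNNReal K))).lipschitzOnWith

end ODE

/-! ### Flows of continuously differentiable fields on open sets -/

section Autonomous

variable {E : Type*} [NormedAddCommGroup E] [NormedSpace ℝ E] [FiniteDimensional ℝ E]
  {p : E → E} {D K : Set E}

/-- A `C¹` field on an open set agrees, near a compact subset, with a bounded Lipschitz field on the
whole space. -/
theorem exists_lipschitz_cutoff (hD : IsOpen D) (hp : ContDiffOn ℝ 1 p D) (hK : IsCompact K)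
    (hKD : K ⊆ D) :
    ∃ (w : E → E) (L : NNReal) (M : ℝ) (U : Set E), LipschitzWith L w ∧ (∀ x, ‖w x‖ ≤ M) ∧
      IsOpen U ∧ K ⊆ U ∧ U ⊆ D ∧ EqOn w p U := by
  obtain ⟨K', hK', hKK', hK'D⟩ := exists_compact_between hK hD hKD
  obtain ⟨f, hf1, hf0, -⟩ := exists_contMDiffMap_one_nhds_of_subset_interior
    (modelWithCornersSelf ℝ E) (n := 1) hK.isClosed hKK'
  have hf : ContDiff ℝ 1 f := f.contMDiff.contDiff
  have hsupp : ∀ x ∉ K', f x • p x = 0 := fun x hx => by rw [hf0 x hx, zero_smul]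
  have hw : ContDiff ℝ 1 (fun x => f x • p x) := by
    rw [contDiff_iff_contDiffAt]
    intro x
    by_cases hx : x ∈ D
    · exact hf.contDiffAt.smul (hp.contDiffAt (hD.mem_nhds hx))
    · have : (fun x => f x • p x) =ᶠ[𝓝 x] fun _ => 0 := by
        filter_upwards [hK'.isClosed.isOpen_compl.mem_nhds fun h => hx (hK'D h)] with y hy
        exact hsupp y hy
      exact contDiffAt_const.congr_of_eventuallyEq this
  have hc : HasCompactSupport (fun x => f x • p x) := HasCompactSupport.intro hK' hsupp
  obtain ⟨L, hL⟩ := ContDiff.lipschitzWith_of_hasCompactSupport hc hw one_ne_zero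
  obtain ⟨M, hM⟩ := hw.continuous.bounded_above_of_compact_support hc
  obtain ⟨U, hU, hKU, hU1⟩ := mem_nhdsSet_iff_exists.1 hf1
  refine ⟨_, L, M, U ∩ D, hL, hM, hU.inter hD, subset_inter hKU hKD, inter_subset_right, ?_⟩
  intro x hx
  have : f x = 1 := hU1 hx.1
  simp [this]

theorem solOn_unique (hD : IsOpen D) (hp : ContDiffOn ℝ 1 p D) {T : ℝ} {y z : ℝ → E}
    (hy : SolOn (fun _ => p) D (Icc 0 T) y) (hz : SolOn (fun _ => p) D (Icc 0 T) z)
    (h0 : y 0 = z 0) : EqOn y z (Icc 0 T) := by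
  obtain ⟨w, L, M, U, hw, -, -, hKU, -, hwp⟩ := exists_lipschitz_cutoff hD hp
    ((isCompact_Icc.image_of_continuousOn hy.continuousOn).union
      (isCompact_Icc.image_of_continuousOn hz.continuousOn))
    (union_subset (image_subset_iff.2 fun t ht => (hy t ht).1)
      (image_subset_iff.2 fun t ht => (hz t ht).1))
  have hy' : SolOn (fun _ => w) D (Icc 0 T) y :=
    hy.congr_field fun t ht => (hwp (hKU (Or.inl (mem_image_of_mem y ht)))).symm
  have hz' : SolOn (fun _ => w) D (Icc 0 T) z :=
    hz.congr_field fun t ht => (hwp (hKU (Or.inr (mem_image_of_mem z ht)))).symm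
  intro t ht
  have := SolOn.dist_le (fun _ => hw) hy' hz' t ht
  rw [h0, dist_self, zero_mul] at this
  exact dist_le_zero.1 this

theorem solOn_Ici_unique (hD : IsOpen D) (hp : ContDiffOn ℝ 1 p D) {y z : ℝ → E}
    (hy : SolOn (fun _ => p) D (Ici 0) y) (hz : SolOn (fun _ => p) D (Ici 0) z)
    (h0 : y 0 = z 0) : ∀ t, 0 ≤ t → y t = z t := fun _ ht =>
  solOn_unique hD hp (hy.mono Icc_subset_Ici_self) (hz.mono Icc_subset_Ici_self) h0
    (right_mem_Icc.2 ht)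

/-- Near a solution on a compact time interval, solutions exist on the same interval and depend in a
Lipschitz way on the initial value. -/
theorem exists_solOn_near (hD : IsOpen D) (hp : ContDiffOn ℝ 1 p D) {T : ℝ} (hT : 0 ≤ T)
    {y : ℝ → E} (hy : SolOn (fun _ => p) D (Icc 0 T) y) :
    ∃ C > 0, ∃ r > 0, (∀ x ∈ ball (y 0) r, ∃ z, z 0 = x ∧ SolOn (fun _ => p) D (Icc 0 T) z) ∧
      ∀ z z', z 0 ∈ ball (y 0) r → z' 0 ∈ ball (y 0) r → SolOn (fun _ => p) D (Icc 0 T) z →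
        SolOn (fun _ => p) D (Icc 0 T) z' →
        ∀ t ∈ Icc 0 T, dist (z t) (z' t) ≤ C * dist (z 0) (z' 0) := by
  have hK := isCompact_Icc.image_of_continuousOn hy.continuousOn
  obtain ⟨w, L, M, U, hw, hM, hU, hKU, hUD, hwp⟩ := exists_lipschitz_cutoff hD hp hK
    (image_subset_iff.2 fun t ht => (hy t ht).1)
  obtain ⟨δ, hδ, hδU⟩ := hK.exists_cthickening_subset_open hU hKU
  have hy' : SolOn (fun _ => w) D (Icc 0 T) y :=
    hy.congr_field fun t ht => (hwp (hKU (mem_image_of_mem y ht))).symm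
  set C := Real.exp (L * T) with hC
  have hC0 : 0 < C := Real.exp_pos _
  have hCt : ∀ t ∈ Icc 0 T, Real.exp (L * t) ≤ C := fun t ht => by
    rw [hC]; gcongr; exact ht.2
  have hex : ∀ x ∈ ball (y 0) (δ / C), ∃ z, z 0 = x ∧ SolOn (fun _ => p) D (Icc 0 T) z ∧
      SolOn (fun _ => w) univ (Icc 0 T) z := by
    intro x hx
    obtain ⟨z, hz0, hz⟩ := exists_solOn_Icc (v := fun _ => w) (fun _ => hw)
      (fun x => continuous_const) (fun _ x => hM x) hT x
    have hzU : ∀ t ∈ Icc 0 T, z t ∈ U := by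
      intro t ht
      refine hδU (mem_cthickening_of_dist_le _ (y t) _ _ (mem_image_of_mem y ht) ?_)
      have h1 := SolOn.dist_le (fun _ => hw) hz hy' t ht
      rw [hz0] at h1
      calc dist (z t) (y t) ≤ dist x (y 0) * Real.exp (L * t) := h1
        _ ≤ δ / C * C := by gcongr; exacts [(mem_ball.1 hx).le, hCt t ht]
        _ = δ := by field_simp
    exact ⟨z, hz0, (hz.mono_set fun t ht => hUD (hzU t ht)).congr_field
      fun t ht => hwp (hzU t ht), hz⟩
  refine ⟨C, hC0, δ / C, by positivity, fun x hx => ?_, fun z z' hz0 hz0' hz hz' t ht => ?_⟩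
  · obtain ⟨z, h0, h1, -⟩ := hex x hx
    exact ⟨z, h0, h1⟩
  · obtain ⟨ζ, h0, h1, h2⟩ := hex _ hz0
    obtain ⟨ζ', h0', h1', h2'⟩ := hex _ hz0'
    rw [solOn_unique hD hp hz h1 h0.symm ht, solOn_unique hD hp hz' h1' h0'.symm ht, ← h0, ← h0']
    have := SolOn.dist_le (fun _ => hw) h2 h2' t ht
    rw [mul_comm]
    exact this.trans (by gcongr; exact hCt t ht)

/-- A solution exists as long as a priori bounds confine it to a compact subset. -/
theorem exists_solOn_of_apriori (hD : IsOpen D) (hp : ContDiffOn ℝ 1 p D) (hK : IsCompact K)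
    (hKD : K ⊆ D) {T : ℝ} (hT : 0 ≤ T) {x : E} (hx : x ∈ K)
    (h : ∀ T' ∈ Icc 0 T, ∀ y, y 0 = x → SolOn (fun _ => p) D (Icc 0 T') y → y T' ∈ K) :
    ∃ y, y 0 = x ∧ SolOn (fun _ => p) D (Icc 0 T) y := by
  obtain ⟨w, L, M, U, hw, hM, hU, hKU, hUD, hwp⟩ := exists_lipschitz_cutoff hD hp hK hKD
  obtain ⟨y, hy0, hy⟩ := exists_solOn_Icc (v := fun _ => w) (fun _ => hw)
    (fun x => continuous_const) (fun _ x => hM x) hT x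
  have hsol : ∀ T' ∈ Icc 0 T, (∀ t ∈ Icc 0 T', y t ∈ U) → SolOn (fun _ => p) D (Icc 0 T') y := by
    intro T' hT' hyU
    exact ((hy.mono (Icc_subset_Icc_right hT'.2)).mono_set fun t ht => hUD (hyU t ht)).congr_field
      fun t ht => hwp (hyU t ht)
  suffices hyU : ∀ t ∈ Icc 0 T, y t ∈ U from ⟨y, hy0, hsol T ⟨hT, le_rfl⟩ hyU⟩
  by_contra! hcon
  obtain ⟨t₀, ht₀, ht₀U⟩ := hcon
  have hcl : IsClosed (Icc 0 T ∩ y ⁻¹' Uᶜ) :=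
    hy.continuousOn.preimage_isClosed_of_isClosed isClosed_Icc hU.isClosed_compl
  have hcpt : IsCompact (Icc 0 T ∩ y ⁻¹' Uᶜ) :=
    isCompact_Icc.of_isClosed_subset hcl inter_subset_left
  obtain ⟨t, ⟨htT, htU⟩, hmin⟩ := hcpt.exists_isLeast ⟨t₀, ht₀, ht₀U⟩
  have hlt : ∀ s ∈ Ico 0 t, y s ∈ K := by
    intro s hs
    have hsT : s ∈ Icc 0 T := ⟨hs.1, hs.2.le.trans htT.2⟩
    refine h s hsT y hy0 (hsol s hsT fun τ hτ => ?_)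
    by_contra hτU
    exact absurd (hmin ⟨⟨hτ.1, hτ.2.trans hsT.2⟩, hτU⟩) (not_le.2 (hτ.2.trans_lt hs.2))
  refine htU (hKU ?_)
  rcases eq_or_lt_of_le htT.1 with h0 | h0
  · rw [← h0, hy0]; exact hx
  have hc : ContinuousWithinAt y (Ico 0 t) t :=
    (hy.continuousOn t htT).mono fun s hs => ⟨hs.1, hs.2.le.trans htT.2⟩
  have hne : (𝓝[Ico 0 t] t).NeBot := by
    rw [← mem_closure_iff_nhdsWithin_neBot, closure_Ico h0.ne]
    exact ⟨h0.le, le_rfl⟩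
  exact hK.isClosed.mem_of_tendsto hc (eventually_of_mem self_mem_nhdsWithin hlt)

end Autonomous

/-! ### Flows on open cones with an absorbing zone -/

/-- The flow `φ` of a field `p`, homogeneous of degree `ν + 1`, on an open cone `W`, together with a
closed subcone `Z` of compact base in which every trajectory ends up. On `Z` the norm decays at
least at the rate `a ‖x‖ ^ (ν + 1)` and at most at the rate `b ‖x‖ ^ (ν + 1)`, and `-A ‖x‖ ^ ν` bounds
the logarithmic norm of the derivative of `p`. -/
structure IsConeFlow {E : Type*} [NormedAddCommGroup E] [NormedSpace ℝ E] (W Z : Set E) (p : E → E)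
    (φ : ℝ → E → E) (ν : ℕ) (a b A : ℝ) : Prop where
  nu_pos : 0 < ν
  isOpen : IsOpen W
  smul_mem : ∀ x ∈ W, ∀ c : ℝ, 0 < c → c • x ∈ W
  zero_notMem : (0 : E) ∉ W
  contDiffOn : ContDiffOn ℝ 1 p W
  homog : ∀ x ∈ W, ∀ c : ℝ, 0 < c → p (c • x) = c ^ (ν + 1) • p x
  flow_zero : ∀ x ∈ W, φ 0 x = x
  flow_sol : ∀ x ∈ W, SolOn (fun _ => p) W (Ici 0) (fun t => φ t x)
  zone_subset : Z ⊆ W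
  zone_smul : ∀ x ∈ Z, ∀ c : ℝ, 0 < c → c • x ∈ Z
  zone_compact : IsCompact (Z ∩ sphere 0 1)
  entry : ∀ x₀ ∈ W, ∃ T₀ : ℝ, 0 ≤ T₀ ∧ ∀ᶠ x in 𝓝 x₀, ∀ t, T₀ ≤ t → φ t x ∈ Z
  a_pos : 0 < a
  a_le_b : a ≤ b
  norm_decay : ∀ x ∈ Z, ∀ ε > 0, ∀ᶠ s : ℝ in 𝓝[>] 0,
    ‖x + s • p x‖ ≤ ‖x‖ + s * (-(a * ‖x‖ ^ (ν + 1)) + ε)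
  norm_field : ∀ x ∈ Z, ‖p x‖ ≤ b * ‖x‖ ^ (ν + 1)
  log_deriv : ∀ x ∈ Z, ∀ ε > 0, ∀ᶠ s : ℝ in 𝓝[>] 0,
    ‖ContinuousLinearMap.id ℝ E + s • fderiv ℝ p x‖ ≤ 1 + s * (-(A * ‖x‖ ^ ν) + ε)

/-- The exponent with which a quantity decaying at the rate `β ‖x‖ ^ ν` is controlled by powers of
`‖x‖`, when the norm decays at a rate between `a ‖x‖ ^ (ν + 1)` and `b ‖x‖ ^ (ν + 1)`. -/
def rate (a b β : ℝ) : ℝ := if β ≤ 0 then β / a else β / b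

theorem rate_add_le {a b : ℝ} (ha : 0 < a) (hab : a ≤ b) (β γ : ℝ) :
    rate a b β + rate a b γ ≤ rate a b (β + γ) := by
  have hb : 0 < b := ha.trans_le hab
  have key : ∀ x : ℝ, rate a b x ≤ x / a ∧ rate a b x ≤ x / b := by
    intro x
    unfold rate
    split_ifs with h
    · refine ⟨le_rfl, ?_⟩
      rw [div_le_div_iff₀ ha hb]; nlinarith
    · refine ⟨?_, le_rfl⟩
      push Not at h
      rw [div_le_div_iff₀ hb ha]; nlinarith
  have h1 := key β
  have h2 := key γ
  by_cases h : β + γ ≤ 0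
  · rw [show rate a b (β + γ) = (β + γ) / a from if_pos h, add_div]; linarith
  · rw [show rate a b (β + γ) = (β + γ) / b from if_neg h, add_div]; linarith

theorem rpow_le_of_comparable {s w K r : ℝ} (hs : 0 < s) (hw : 0 < w) (hK : 1 ≤ K)
    (h1 : s ≤ K * w) (h2 : w ≤ K * s) : s ^ r ≤ K ^ |r| * w ^ r := by
  have hK0 : 0 < K := by linarith
  rcases le_total 0 r with hr | hr
  · rw [abs_of_nonneg hr, ← Real.mul_rpow hK0.le hw.le]
    exact Real.rpow_le_rpow hs.le h1 hr
  · rw [abs_of_nonpos hr]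
    have h3 : w / K ≤ s := by rw [div_le_iff₀ hK0]; linarith
    calc s ^ r ≤ (w / K) ^ r := Real.rpow_le_rpow_of_nonpos (by positivity) h3 hr
      _ = K ^ (-r) * w ^ r := by
        rw [Real.div_rpow hw.le hK0.le, Real.rpow_neg hK0.le]; field_simp

/-- The solution of the scalar equation `w' = -e w ^ (ν + 1)` with `w 0 = u`. -/
theorem hasDerivAt_scalar_decay {ν : ℕ} (hν : 0 < ν) {e u t : ℝ} (hu : 0 < u)
    (hpos : 0 < 1 + e * ν * u ^ ν * t) :
    HasDerivAt (fun t => u * (1 + e * ν * u ^ ν * t) ^ (-(1 / ν : ℝ)))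
      (-(e * (u * (1 + e * ν * u ^ ν * t) ^ (-(1 / ν : ℝ))) ^ (ν + 1))) t := by
  have hν' : (ν : ℝ) ≠ 0 := by positivity
  have h1 : HasDerivAt (fun t => 1 + e * ν * u ^ ν * t) (e * ν * u ^ ν) t := by
    simpa using ((hasDerivAt_id t).const_mul (e * ν * u ^ ν)).const_add 1
  have h2 := (h1.rpow_const (p := -(1 / ν : ℝ)) (Or.inl hpos.ne')).const_mul u
  refine h2.congr_deriv (Eq.symm ?_)
  rw [mul_pow, ← Real.rpow_natCast (_ ^ _) (ν + 1), ← Real.rpow_mul hpos.le]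
  have : -(1 / (ν : ℝ)) * ((ν + 1 : ℕ) : ℝ) = -(1 / ν) - 1 := by
    push_cast; field_simp; ring
  rw [this, pow_succ]
  field_simp

namespace IsConeFlow

variable {E : Type*} [NormedAddCommGroup E] [NormedSpace ℝ E]
  {W Z : Set E} {p : E → E} {φ : ℝ → E → E} {ν : ℕ} {a b A : ℝ}

theorem b_pos (h : IsConeFlow W Z p φ ν a b A) : 0 < b := h.a_pos.trans_le h.a_le_b

theorem flow_mem (h : IsConeFlow W Z p φ ν a b A) {x : E} (hx : x ∈ W) {t : ℝ} (ht : 0 ≤ t) :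
    φ t x ∈ W := (h.flow_sol x hx t ht).1

theorem eventually_mem (h : IsConeFlow W Z p φ ν a b A) {x₀ : E} (hx₀ : x₀ ∈ W) :
    ∀ᶠ x in 𝓝 x₀, x ∈ W := h.isOpen.mem_nhds hx₀

theorem norm_pos (h : IsConeFlow W Z p φ ν a b A) {x : E} (hx : x ∈ W) : 0 < ‖x‖ :=
  norm_pos_iff.2 fun h0 => h.zero_notMem (h0 ▸ hx)

theorem flow_continuousOn (h : IsConeFlow W Z p φ ν a b A) {x : E} (hx : x ∈ W) :
    ContinuousOn (fun t => φ t x) (Ici 0) := (h.flow_sol x hx).continuousOn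

theorem flow_hasDerivWithinAt (h : IsConeFlow W Z p φ ν a b A) {x : E} (hx : x ∈ W) {t : ℝ}
    (ht : 0 ≤ t) : HasDerivWithinAt (fun t => φ t x) (p (φ t x)) (Ici t) t :=
  (h.flow_sol x hx).hasDerivWithinAt_Ici ht

/-! ### Decay of norms along trajectories in the zone -/

/-- The norm is bounded by the solution of `w' = -a w ^ (ν + 1)` with the same initial value. -/
theorem norm_flow_le (h : IsConeFlow W Z p φ ν a b A) {x : E} (hx : x ∈ W)
    (hZ : ∀ t, 0 ≤ t → φ t x ∈ Z) {t : ℝ} (ht : 0 ≤ t) :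
    ‖φ t x‖ ≤ ‖x‖ * (1 + a * ν * ‖x‖ ^ ν * t) ^ (-(1 / ν : ℝ)) := by
  have hu := h.norm_pos hx
  have ha := h.a_pos
  have key : ∀ e ∈ Ioo 0 a, ‖φ t x‖ ≤ ‖x‖ * (1 + e * ν * ‖x‖ ^ ν * t) ^ (-(1 / ν : ℝ)) := by
    intro e he
    have he0 : 0 < e := he.1
    have hpos : ∀ s : ℝ, 0 ≤ s → 0 < 1 + e * ν * ‖x‖ ^ ν * s := fun s hs => by positivity
    refine le_of_diniLe_of_lt (a := 0) (b := t) (f' := fun s => -(a * ‖φ s x‖ ^ (ν + 1)))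
      ((h.flow_continuousOn hx).norm.mono Icc_subset_Ici_self) (fun s hs => ?_) ?_
      (fun s hs => ((hasDerivAt_scalar_decay h.nu_pos hu (hpos s hs.1)).continuousAt.continuousWithinAt))
      (fun s hs => (hasDerivAt_scalar_decay h.nu_pos hu (hpos s hs.1)).hasDerivWithinAt) ?_ t ⟨ht, le_rfl⟩
    · exact diniLe_norm (h.flow_hasDerivWithinAt hx hs.1) (h.norm_decay _ (hZ s hs.1))
    · simp [h.flow_zero x hx]
    · intro s hs hs'
      rw [← hs']
      have := h.norm_pos (h.flow_mem hx hs.1)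
      have h1 : 0 < ‖φ s x‖ ^ (ν + 1) := by positivity
      nlinarith [he.2]
  have hpos : 0 < 1 + a * ν * ‖x‖ ^ ν * t := by positivity
  have hlim : Tendsto (fun e : ℝ => ‖x‖ * (1 + e * ν * ‖x‖ ^ ν * t) ^ (-(1 / ν : ℝ))) (𝓝[<] a)
      (𝓝 (‖x‖ * (1 + a * ν * ‖x‖ ^ ν * t) ^ (-(1 / ν : ℝ)))) := by
    have : ContinuousAt (fun e : ℝ => ‖x‖ * (1 + e * ν * ‖x‖ ^ ν * t) ^ (-(1 / ν : ℝ))) a := by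
      refine continuousAt_const.mul (ContinuousAt.rpow_const (by fun_prop) (Or.inl hpos.ne'))
    exact this.tendsto.mono_left nhdsWithin_le_nhds
  exact ge_of_tendsto hlim (by filter_upwards [Ioo_mem_nhdsLT ha] with e he using key e he)

/-- The norm is bounded below by the solution of `w' = -b w ^ (ν + 1)` with the same initial
value. -/
theorem le_norm_flow (h : IsConeFlow W Z p φ ν a b A) {x : E} (hx : x ∈ W)
    (hZ : ∀ t, 0 ≤ t → φ t x ∈ Z) {t : ℝ} (ht : 0 ≤ t) :
    ‖x‖ * (1 + b * ν * ‖x‖ ^ ν * t) ^ (-(1 / ν : ℝ)) ≤ ‖φ t x‖ := by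
  have hu := h.norm_pos hx
  have hb := h.b_pos
  have key : ∀ e ∈ Ioi b, ‖x‖ * (1 + e * ν * ‖x‖ ^ ν * t) ^ (-(1 / ν : ℝ)) ≤ ‖φ t x‖ := by
    intro e he
    have he0 : 0 < e := hb.trans he
    have hpos : ∀ s : ℝ, 0 ≤ s → 0 < 1 + e * ν * ‖x‖ ^ ν * s := fun s hs => by positivity
    have hd : ∀ s : ℝ, 0 ≤ s → _ :=
      fun s hs => (hasDerivAt_scalar_decay h.nu_pos (e := e) hu (hpos s hs)).neg
    have := le_of_diniLe_of_lt (a := 0) (b := t) (f := fun s => -‖φ s x‖)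
      (f' := fun s => (b * ‖φ s x‖ ^ (ν + 1)))
      ((h.flow_continuousOn hx).norm.neg.mono Icc_subset_Ici_self) (fun s hs => ?_) ?_
      (fun s hs => ((hd s hs.1).continuousAt.continuousWithinAt))
      (fun s hs => (hd s hs.1).hasDerivWithinAt) ?_ t ⟨ht, le_rfl⟩
    · simpa using this
    · exact diniLe_neg_norm_of_norm_le (h.flow_hasDerivWithinAt hx hs.1) (h.norm_field _ (hZ s hs.1))
    · simp [h.flow_zero x hx]
    · intro s hs hs'
      have hs'' : ‖φ s x‖ = ‖x‖ * (1 + e * ν * ‖x‖ ^ ν * s) ^ (-(1 / ν : ℝ)) := by simpa using hs'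
      rw [← hs'', neg_neg]
      have := h.norm_pos (h.flow_mem hx hs.1)
      have h1 : 0 < ‖φ s x‖ ^ (ν + 1) := by positivity
      have he : b < e := he
      nlinarith
  have hpos : 0 < 1 + b * ν * ‖x‖ ^ ν * t := by positivity
  have hlim : Tendsto (fun e : ℝ => ‖x‖ * (1 + e * ν * ‖x‖ ^ ν * t) ^ (-(1 / ν : ℝ))) (𝓝[>] b)
      (𝓝 (‖x‖ * (1 + b * ν * ‖x‖ ^ ν * t) ^ (-(1 / ν : ℝ)))) := by
    have : ContinuousAt (fun e : ℝ => ‖x‖ * (1 + e * ν * ‖x‖ ^ ν * t) ^ (-(1 / ν : ℝ))) b := by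
      refine continuousAt_const.mul (ContinuousAt.rpow_const (by fun_prop) (Or.inl hpos.ne'))
    exact this.tendsto.mono_left nhdsWithin_le_nhds
  exact le_of_tendsto hlim (by filter_upwards [self_mem_nhdsWithin] with e he using key e he)

theorem pow_scalar_decay {ν : ℕ} (hν : 0 < ν) {u s : ℝ} (hs : 0 < s) :
    (u * s ^ (-(1 / ν : ℝ))) ^ ν = u ^ ν / s := by
  have hν' : (ν : ℝ) ≠ 0 := by positivity
  rw [mul_pow, ← Real.rpow_natCast (_ ^ _) ν, ← Real.rpow_mul hs.le]
  have : -(1 / (ν : ℝ)) * ν = -1 := by field_simp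
  rw [this, Real.rpow_neg_one, div_eq_mul_inv]

/-- A nonnegative function whose Dini derivative along a trajectory in the zone is at most
`(-β ‖φ‖ ^ ν + ε)` times the function decays, up to the factor `exp (ε t)`, like the power
`-rate a b β / ν` of a time scale. -/
theorem le_of_diniLe_flow (h : IsConeFlow W Z p φ ν a b A) {x : E} (hx : x ∈ W)
    (hZ : ∀ t, 0 ≤ t → φ t x ∈ Z) (β : ℝ) :
    ∃ e ∈ Icc a b, ∀ (ε : ℝ) (g : ℝ → ℝ) (t : ℝ), ContinuousOn g (Ici 0) → (∀ t, 0 ≤ g t) →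
      0 ≤ t → (∀ s ∈ Ico 0 t, DiniLe g ((-(β * ‖φ s x‖ ^ ν) + ε) * g s) s) →
      g t ≤ g 0 * ((1 + e * ν * ‖x‖ ^ ν * t) ^ (-(rate a b β / ν)) * Real.exp (ε * t)) := by
  have hu := h.norm_pos hx
  have hν := h.nu_pos
  have hν' : (0 : ℝ) < ν := by positivity
  have ha := h.a_pos
  have hb := h.b_pos
  obtain ⟨e, he, hrate, hcmp⟩ : ∃ e ∈ Icc a b, rate a b β = β / e ∧
      ∀ t, 0 ≤ t → -(β * ‖φ t x‖ ^ ν) ≤ -(β * (‖x‖ ^ ν / (1 + e * ν * ‖x‖ ^ ν * t))) := by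
    by_cases hβ : β ≤ 0
    · refine ⟨a, ⟨le_rfl, h.a_le_b⟩, if_pos hβ, fun t ht => ?_⟩
      have h1 := pow_le_pow_left₀ (norm_nonneg _) (h.norm_flow_le hx hZ ht) ν
      rw [pow_scalar_decay hν (by positivity)] at h1
      nlinarith
    · refine ⟨b, ⟨h.a_le_b, le_rfl⟩, if_neg hβ, fun t ht => ?_⟩
      have h1 := pow_le_pow_left₀ (by positivity) (h.le_norm_flow hx hZ ht) ν
      rw [pow_scalar_decay hν (by positivity)] at h1
      nlinarith
  have he0 : 0 < e := ha.trans_le he.1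
  refine ⟨e, he, fun ε g t hg g0 ht hg' => ?_⟩
  have hpos : ∀ s : ℝ, 0 ≤ s → 0 < 1 + e * ν * ‖x‖ ^ ν * s := fun s hs => by positivity
  let P : ℝ → ℝ := fun s => -(β / e / ν) * Real.log (1 + e * ν * ‖x‖ ^ ν * s) + ε * s
  have hP : ∀ s, 0 ≤ s → HasDerivAt P
      (-(β * (‖x‖ ^ ν / (1 + e * ν * ‖x‖ ^ ν * s))) + ε) s := by
    intro s hs
    have h1 : HasDerivAt (fun t => 1 + e * ν * ‖x‖ ^ ν * t) (e * ν * ‖x‖ ^ ν) s := by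
      simpa using ((hasDerivAt_id s).const_mul (e * ν * ‖x‖ ^ ν)).const_add 1
    have h2 := ((h1.log (hpos s hs).ne').const_mul (-(β / e / ν))).fun_add
      ((hasDerivAt_id s).const_mul ε)
    refine h2.congr_deriv ?_
    have := (hpos s hs).ne'
    field_simp
  have := le_mul_exp_of_diniLe (P := P) (g := g) (a := 0) (b := t) ht
    (hg.mono Icc_subset_Ici_self) (g0 0)
    (α := fun s => -(β * (‖x‖ ^ ν / (1 + e * ν * ‖x‖ ^ ν * s))) + ε)
    (fun s hs => (hg' s hs).mono (by
      have := hcmp s hs.1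
      have := g0 s
      gcongr)) (fun s hs => (hP s hs.1).continuousAt.continuousWithinAt)
    (fun s hs => (hP s hs.1).hasDerivWithinAt)
  refine this.trans_eq ?_
  congr 1
  simp only [P, mul_zero, add_zero, Real.log_one, sub_zero]
  rw [Real.exp_add, Real.rpow_def_of_pos (hpos t ht), hrate]
  congr 2
  ring

end IsConeFlow

/-- First-order Taylor expansion of a `C¹` function, uniform along a compact set. -/
theorem exists_uniform_taylor {E G : Type*} [NormedAddCommGroup E] [NormedSpace ℝ E]
    [NormedAddCommGroup G] [NormedSpace ℝ G] {D K : Set E} {f : E → G} (hD : IsOpen D)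
    (hf : ContDiffOn ℝ 1 f D) (hK : IsCompact K) (hKD : K ⊆ D) {ε : ℝ} (hε : 0 < ε) :
    ∃ δ > 0, ∀ x ∈ K, ∀ y, ‖y - x‖ < δ → ‖f y - f x - fderiv ℝ f x (y - x)‖ ≤ ε * ‖y - x‖ := by
  have hfd : ContinuousOn (fderiv ℝ f) D := hf.continuousOn_fderiv_of_isOpen hD le_rfl
  obtain ⟨δ₁, hδ₁, hδD⟩ := hK.exists_thickening_subset_open hD hKD
  have hloc : ∀ x ∈ K, ∃ δ > 0, ∀ z ∈ ball x δ, ∀ y, ‖y - z‖ < δ → z ∈ K →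
      ‖f y - f z - fderiv ℝ f z (y - z)‖ ≤ ε * ‖y - z‖ := by
    intro x hx
    have h1 : ∀ᶠ z in 𝓝 x, ‖fderiv ℝ f z - fderiv ℝ f x‖ ≤ ε / 2 := by
      have := (hfd.continuousAt (hD.mem_nhds (hKD hx))).tendsto
      rw [tendsto_iff_norm_sub_tendsto_zero] at this
      exact (this.eventually_lt_const (half_pos hε)).mono fun _ h => h.le
    obtain ⟨δ₂, hδ₂, h2⟩ := Metric.eventually_nhds_iff_ball.1 (h1.and (hD.mem_nhds (hKD hx)))
    refine ⟨δ₂ / 2, half_pos hδ₂, fun z hz y hy hzK => ?_⟩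
    have hz' : z ∈ ball x δ₂ := ball_subset_ball (by linarith) hz
    have hy' : y ∈ ball x δ₂ := by
      rw [mem_ball, dist_eq_norm] at hz ⊢
      calc ‖y - x‖ = ‖(y - z) + (z - x)‖ := by congr 1; abel
        _ ≤ ‖y - z‖ + ‖z - x‖ := norm_add_le _ _
        _ < δ₂ := by linarith
    refine (convex_ball x δ₂).norm_image_sub_le_of_norm_hasFDerivWithin_le'
      (f' := fderiv ℝ f) (fun w hw => ?_) (fun w hw => ?_) hz' hy'
    · exact ((hf.contDiffAt (hD.mem_nhds (h2 w hw).2)).differentiableAt one_ne_zero).hasFDerivAt.hasFDerivWithinAt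
    · calc ‖fderiv ℝ f w - fderiv ℝ f z‖
          = ‖(fderiv ℝ f w - fderiv ℝ f x) - (fderiv ℝ f z - fderiv ℝ f x)‖ := by congr 1; abel
        _ ≤ ε / 2 + ε / 2 := (norm_sub_le _ _).trans (add_le_add (h2 w hw).1 (h2 z hz').1)
        _ = ε := by ring
  choose! δ hδ0 hδ using hloc
  obtain ⟨t, ht, hcov⟩ := hK.elim_nhds_subcover (fun x => ball x (δ x))
    (fun x hx => ball_mem_nhds x (hδ0 x hx))
  by_cases hne : t.Nonempty
  · refine ⟨t.inf' hne δ, by rw [gt_iff_lt, Finset.lt_inf'_iff]; exact fun x hx => hδ0 x (ht x hx),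
      fun z hz y hy => ?_⟩
    obtain ⟨x, hx, hzx⟩ := mem_iUnion₂.1 (hcov hz)
    exact hδ x (ht x hx) z hzx y (hy.trans_le (Finset.inf'_le δ hx)) hz
  · rw [Finset.not_nonempty_iff_eq_empty] at hne
    refine ⟨1, one_pos, fun z hz => ?_⟩
    have := hcov hz
    simp [hne] at this

namespace IsConeFlow

variable {E : Type*} [NormedAddCommGroup E] [NormedSpace ℝ E] [FiniteDimensional ℝ E]
  {W Z : Set E} {p : E → E} {φ : ℝ → E → E} {ν : ℕ} {a b A : ℝ}

/-! ### Dependence of the flow on the initial value -/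

/-- Over a bounded time interval the flow is locally Lipschitz in the initial value. -/
theorem flow_near (h : IsConeFlow W Z p φ ν a b A) {x₀ : E} (hx₀ : x₀ ∈ W) {T : ℝ} (hT : 0 ≤ T) :
    ∃ C > 0, ∃ r > 0, ball x₀ r ⊆ W ∧ ∀ x ∈ ball x₀ r, ∀ x' ∈ ball x₀ r, ∀ t ∈ Icc 0 T,
      ‖φ t x - φ t x'‖ ≤ C * ‖x - x'‖ := by
  obtain ⟨C, hC, r, hr, -, hdist⟩ := exists_solOn_near h.isOpen h.contDiffOn hT
    ((h.flow_sol x₀ hx₀).mono Icc_subset_Ici_self)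
  obtain ⟨r', hr', hrW⟩ := Metric.isOpen_iff.1 h.isOpen x₀ hx₀
  refine ⟨C, hC, min r r', lt_min hr hr', (ball_subset_ball (min_le_right _ _)).trans hrW,
    fun x hx x' hx' t ht => ?_⟩
  have hxW := hrW (ball_subset_ball (min_le_right _ _) hx)
  have hxW' := hrW (ball_subset_ball (min_le_right _ _) hx')
  have := hdist (fun t => φ t x) (fun t => φ t x')
    (by simp only [h.flow_zero _ hxW, h.flow_zero _ hx₀]; exact ball_subset_ball (min_le_left _ _) hx)
    (by simp only [h.flow_zero _ hxW', h.flow_zero _ hx₀]; exact ball_subset_ball (min_le_left _ _) hx')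
    ((h.flow_sol x hxW).mono Icc_subset_Ici_self) ((h.flow_sol x' hxW').mono Icc_subset_Ici_self) t ht
  simpa only [dist_eq_norm, h.flow_zero _ hxW, h.flow_zero _ hxW'] using this

theorem flow_unique (h : IsConeFlow W Z p φ ν a b A) {x : E} (hx : x ∈ W) {y : ℝ → E}
    (hy : SolOn (fun _ => p) W (Ici 0) y) (h0 : y 0 = x) {t : ℝ} (ht : 0 ≤ t) : y t = φ t x :=
  solOn_Ici_unique h.isOpen h.contDiffOn hy (h.flow_sol x hx) (h0.trans (h.flow_zero x hx).symm) t ht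

theorem flow_add (h : IsConeFlow W Z p φ ν a b A) {x : E} (hx : x ∈ W) {s t : ℝ} (hs : 0 ≤ s)
    (ht : 0 ≤ t) : φ (s + t) x = φ t (φ s x) := by
  refine h.flow_unique (h.flow_mem hx hs) (y := fun t => φ (s + t) x) (fun τ hτ => ?_) (by simp) ht
  have hτ : 0 ≤ τ := hτ
  refine ⟨h.flow_mem hx (by positivity), ?_⟩
  have h1 := (h.flow_sol x hx (s + τ) (by simp; positivity)).2
  have h2 : HasDerivWithinAt (fun τ : ℝ => s + τ) 1 (Ici 0) τ :=
    ((hasDerivWithinAt_id τ (Ici 0)).const_add s)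
  have h3 := h1.scomp τ h2 (fun u hu => by simp at hu ⊢; positivity)
  rw [one_smul] at h3
  exact h3

theorem flow_smul (h : IsConeFlow W Z p φ ν a b A) {x : E} (hx : x ∈ W) {c : ℝ} (hc : 0 < c)
    {t : ℝ} (ht : 0 ≤ t) : φ t (c • x) = c • φ (c ^ ν * t) x := by
  refine (h.flow_unique (h.smul_mem x hx c hc) (y := fun t => c • φ (c ^ ν * t) x)
    (fun τ hτ => ?_) (by simp [h.flow_zero x hx]) ht).symm
  have hτ : 0 ≤ τ := hτ
  have hm : φ (c ^ ν * τ) x ∈ W := h.flow_mem hx (by positivity)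
  refine ⟨h.smul_mem _ hm c hc, ?_⟩
  have h1 := (h.flow_sol x hx (c ^ ν * τ) (by simp; positivity)).2
  have h2 : HasDerivWithinAt (fun τ : ℝ => c ^ ν * τ) (c ^ ν) (Ici 0) τ := by
    simpa using (hasDerivWithinAt_id τ (Ici 0)).const_mul (c ^ ν)
  have h3 := (h1.scomp τ h2 (fun u hu => by simp at hu ⊢; positivity)).const_smul c
  change HasDerivWithinAt _ (p (c • φ (c ^ ν * τ) x)) _ _
  rw [h.homog _ hm c hc, pow_succ', mul_smul]
  exact h3

theorem flow_continuousOn_uncurry (h : IsConeFlow W Z p φ ν a b A) :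
    ContinuousOn (fun q : ℝ × E => φ q.1 q.2) (Ici 0 ×ˢ W) := by
  rintro ⟨t₀, x₀⟩ ⟨ht₀, hx₀⟩
  have ht₀ : 0 ≤ t₀ := ht₀
  have hx₀ : x₀ ∈ W := hx₀
  obtain ⟨C, hC, r, hr, hrW, hlip⟩ := h.flow_near hx₀ (T := t₀ + 1) (by positivity)
  rw [ContinuousWithinAt, tendsto_iff_norm_sub_tendsto_zero]
  have h1 : Tendsto (fun q : ℝ × E => C * ‖q.2 - x₀‖ + ‖φ q.1 x₀ - φ t₀ x₀‖)
      (𝓝[Ici 0 ×ˢ W] (t₀, x₀)) (𝓝 (C * 0 + 0)) := by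
    refine Tendsto.add (Tendsto.const_mul C ?_) ?_
    · have : Continuous (fun q : ℝ × E => ‖q.2 - x₀‖) := by fun_prop
      have h2 := this.tendsto (t₀, x₀)
      simp only [sub_self, norm_zero] at h2
      exact h2.mono_left nhdsWithin_le_nhds
    · have h2 : Tendsto (fun t => ‖φ t x₀ - φ t₀ x₀‖) (𝓝[Ici 0] t₀) (𝓝 0) :=
        tendsto_iff_norm_sub_tendsto_zero.1 (h.flow_continuousOn hx₀ t₀ ht₀)
      refine h2.comp (f := fun q : ℝ × E => q.1) (tendsto_nhdsWithin_iff.2 ⟨?_, ?_⟩)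
      · exact (continuous_fst.tendsto (t₀, x₀)).mono_left nhdsWithin_le_nhds
      · filter_upwards [self_mem_nhdsWithin] with q hq using hq.1
  rw [mul_zero, add_zero] at h1
  refine squeeze_zero' (Eventually.of_forall fun _ => norm_nonneg _) ?_ h1
  have h3 : ∀ᶠ q : ℝ × E in 𝓝[Ici 0 ×ˢ W] (t₀, x₀), q.1 < t₀ + 1 ∧ q.2 ∈ ball x₀ r :=
    mem_nhdsWithin_of_mem_nhds (prod_mem_nhds (Iio_mem_nhds (by simp)) (ball_mem_nhds _ hr))
  filter_upwards [h3, self_mem_nhdsWithin] with q hq hq'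
  have h4 := hlip q.2 hq.2 x₀ (mem_ball_self hr) q.1 ⟨hq'.1, hq.1.le⟩
  calc ‖φ q.1 q.2 - φ t₀ x₀‖ = ‖(φ q.1 q.2 - φ q.1 x₀) + (φ q.1 x₀ - φ t₀ x₀)‖ := by congr 1; abel
    _ ≤ _ := (norm_add_le _ _).trans (by gcongr)

theorem flow_continuousAt (h : IsConeFlow W Z p φ ν a b A) {x₀ : E} (hx₀ : x₀ ∈ W) {t : ℝ}
    (ht : 0 ≤ t) : ContinuousAt (φ t) x₀ := by
  have h1 := h.flow_continuousOn_uncurry.comp (f := fun x => ((t, x) : ℝ × E)) (s := W)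
    (by fun_prop) (fun x hx => ⟨ht, hx⟩)
  exact h1.continuousAt (h.isOpen.mem_nhds hx₀)

/-- Over a bounded time interval, the trajectories of nearby points stay in a common compact set. -/
theorem exists_compact_flow (h : IsConeFlow W Z p φ ν a b A) {x₀ : E} (hx₀ : x₀ ∈ W) (T : ℝ) :
    ∃ K, IsCompact K ∧ K ⊆ W ∧ ∀ᶠ x in 𝓝 x₀, ∀ t ∈ Icc 0 T, φ t x ∈ K := by
  obtain ⟨r, hr, hrW⟩ := Metric.nhds_basis_closedBall.mem_iff.1 (h.isOpen.mem_nhds hx₀)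
  have hsub : Icc 0 T ×ˢ closedBall x₀ r ⊆ Ici 0 ×ˢ W := prod_mono Icc_subset_Ici_self hrW
  refine ⟨(fun q : ℝ × E => φ q.1 q.2) '' (Icc 0 T ×ˢ closedBall x₀ r),
    (isCompact_Icc.prod (isCompact_closedBall x₀ r)).image_of_continuousOn
      (h.flow_continuousOn_uncurry.mono hsub), ?_, ?_⟩
  · rintro _ ⟨q, hq, rfl⟩
    exact h.flow_mem (hsub hq).2 (hsub hq).1
  · filter_upwards [closedBall_mem_nhds x₀ hr] with x hx t ht
    exact ⟨(t, x), ⟨ht, hx⟩, rfl⟩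

/-! ### Power bounds along trajectories, locally uniform in the initial value -/

theorem eventually_norm_flow_mem (h : IsConeFlow W Z p φ ν a b A) {x₀ : E} (hx₀ : x₀ ∈ W) {T : ℝ}
    (hT : 0 ≤ T) : ∀ᶠ x in 𝓝 x₀, ‖φ T x‖ ∈ Ioo (‖φ T x₀‖ / 2) (2 * ‖φ T x₀‖) := by
  have := h.norm_pos (h.flow_mem hx₀ hT)
  exact (h.flow_continuousAt hx₀ hT).norm.eventually (Ioo_mem_nhds (by linarith) (by linarith))

/-- The time scales `1 + e ν ‖φ T₀ x‖ ^ ν (t - T₀)` and `1 + t` are comparable. -/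
theorem exists_comparable (h : IsConeFlow W Z p φ ν a b A) {x₀ : E} (hx₀ : x₀ ∈ W) {T₀ : ℝ}
    (hT : 0 ≤ T₀) : ∃ K : ℝ, 1 ≤ K ∧ ∀ᶠ x in 𝓝 x₀, ∀ e ∈ Icc a b, ∀ t, T₀ ≤ t →
      0 < 1 + e * ν * ‖φ T₀ x‖ ^ ν * (t - T₀) ∧
      1 + e * ν * ‖φ T₀ x‖ ^ ν * (t - T₀) ≤ K * (1 + t) ∧
      1 + t ≤ K * (1 + e * ν * ‖φ T₀ x‖ ^ ν * (t - T₀)) := by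
  have hν : (0 : ℝ) < ν := by exact_mod_cast h.nu_pos
  have ha := h.a_pos
  have hb := h.b_pos
  set u := ‖φ T₀ x₀‖ with hu
  have hu0 : 0 < u := h.norm_pos (h.flow_mem hx₀ hT)
  set k₁ := a * ν * (u / 2) ^ ν with hk₁
  set k₂ := b * ν * (2 * u) ^ ν with hk₂
  have hk₁0 : 0 < k₁ := by positivity
  have hk₂0 : 0 < k₂ := by positivity
  have h1k : 0 < 1 / k₁ := by positivity
  refine ⟨1 + T₀ + 1 / k₁ + k₂, by linarith, ?_⟩
  filter_upwards [h.eventually_norm_flow_mem hx₀ hT] with x hx e he t ht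
  have he0 : 0 < e := ha.trans_le he.1
  set k := e * ν * ‖φ T₀ x‖ ^ ν with hk
  have hkk₁ : k₁ ≤ k := by
    rw [hk, hk₁]; gcongr; exacts [he.1, hx.1.le]
  have hkk₂ : k ≤ k₂ := by
    rw [hk, hk₂]; gcongr; exacts [he.2, hx.2.le]
  have hs : 0 ≤ t - T₀ := sub_nonneg.2 ht
  have hk0 : 0 < k := hk₁0.trans_le hkk₁
  have h2 : 1 ≤ 1 / k₁ * k := by
    rw [one_div, inv_mul_eq_div, one_le_div hk₁0]; exact hkk₁
  refine ⟨by positivity, ?_, ?_⟩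
  · have h3 : k * (t - T₀) ≤ k₂ * (1 + t) := by
      apply mul_le_mul hkk₂ (by linarith) hs hk₂0.le
    have h4 : 0 ≤ (T₀ + 1 / k₁) * (1 + t) := by
      have : 0 ≤ t := hT.trans ht
      positivity
    nlinarith
  · have h3 : t - T₀ ≤ 1 / k₁ * (k * (t - T₀)) := by nlinarith
    have h4 : 0 ≤ k * (t - T₀) := by positivity
    have h5 : 0 ≤ T₀ * (k * (t - T₀)) := by positivity
    have h6 : 0 ≤ k₂ * (k * (t - T₀)) := by positivity
    nlinarith

/-- Bound a function on `[0, ∞)` by a power of `1 + t`, from a bound up to time `T₀` and one after. -/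
theorem exists_rpow_bound_of_bounded {T₀ C₁ r : ℝ} (hT : 0 ≤ T₀) :
    ∃ K > 0, ∀ t ∈ Icc 0 T₀, ∀ g ≤ C₁, g ≤ K * (1 + t) ^ r := by
  have hcont : ContinuousOn (fun t : ℝ => (1 + t) ^ (-r)) (Icc 0 T₀) := by
    intro t ht
    refine (ContinuousAt.rpow_const (by fun_prop) (Or.inl ?_)).continuousWithinAt
    have := ht.1
    positivity
  obtain ⟨C, hC⟩ := isCompact_Icc.exists_bound_of_continuousOn hcont
  have hC0 : 0 ≤ C := (norm_nonneg _).trans (hC 0 ⟨le_rfl, hT⟩)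
  refine ⟨|C₁| * C + 1, by positivity, fun t ht g hg => ?_⟩
  have h1t : 0 < 1 + t := by linarith [ht.1]
  have h1 := hC t ht
  have h2 : 0 < (1 + t) ^ (-r) := Real.rpow_pos_of_pos h1t _
  have h3 : 0 < (1 + t) ^ r := Real.rpow_pos_of_pos h1t _
  rw [Real.norm_of_nonneg h2.le, Real.rpow_neg h1t.le] at h1
  have h4 : 1 ≤ C * (1 + t) ^ r := by
    rw [inv_le_iff_one_le_mul₀ h3] at h1; exact h1
  calc g ≤ |C₁| * 1 := by rw [mul_one]; exact hg.trans (le_abs_self _)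
    _ ≤ |C₁| * (C * (1 + t) ^ r) := by gcongr
    _ ≤ (|C₁| * C + 1) * (1 + t) ^ r := by nlinarith

theorem flow_zone_shift (h : IsConeFlow W Z p φ ν a b A) {x : E} (hx : x ∈ W) {T₀ : ℝ}
    (hT : 0 ≤ T₀) (hZ : ∀ t, T₀ ≤ t → φ t x ∈ Z) : ∀ t, 0 ≤ t → φ t (φ T₀ x) ∈ Z := by
  intro t ht
  rw [← h.flow_add hx hT ht]
  exact hZ _ (by linarith)

/-- Along trajectories the norm is comparable to `t ^ (-1 / ν)`. -/
theorem exists_norm_flow_bounds (h : IsConeFlow W Z p φ ν a b A) {x₀ : E} (hx₀ : x₀ ∈ W) :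
    ∃ K > 0, ∀ᶠ x in 𝓝 x₀, ∀ t, 0 ≤ t → ‖φ t x‖ ≤ K * (1 + t) ^ (-(1 / ν : ℝ)) ∧
      (1 + t) ^ (-(1 / ν : ℝ)) ≤ K * ‖φ t x‖ := by
  obtain ⟨T₀, hT, hent⟩ := h.entry x₀ hx₀
  obtain ⟨K, hK, hcmp⟩ := h.exists_comparable hx₀ hT
  obtain ⟨S, hS, hSW, hflow⟩ := h.exists_compact_flow hx₀ T₀
  have ha := h.a_pos
  have hb := h.b_pos
  obtain ⟨C₁, hC₁⟩ := hS.exists_bound_of_continuousOn continuous_norm.continuousOn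
  obtain ⟨C₂, hC₂⟩ := hS.exists_bound_of_continuousOn
    (f := fun x => ‖x‖⁻¹) (continuous_norm.continuousOn.inv₀ fun x hx => (h.norm_pos (hSW hx)).ne')
  obtain ⟨K₁, hK₁, hb₁⟩ := exists_rpow_bound_of_bounded (C₁ := C₁) (r := -(1 / ν : ℝ)) hT
  obtain ⟨K₂, hK₂, hb₂⟩ := exists_rpow_bound_of_bounded (C₁ := C₂) (r := (1 / ν : ℝ)) hT
  set u := ‖φ T₀ x₀‖ with hu
  have hu0 : 0 < u := h.norm_pos (h.flow_mem hx₀ hT)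
  set K₃ := K ^ |-(1 / ν : ℝ)| with hK₃
  have hK₃0 : 0 < K₃ := Real.rpow_pos_of_pos (by linarith) _
  refine ⟨K₁ + K₂ + 2 * u * K₃ + K₃ * (2 / u), by positivity, ?_⟩
  filter_upwards [hent, hcmp, hflow, h.eventually_norm_flow_mem hx₀ hT, h.eventually_mem hx₀]
    with x hZ hc hS' hux hx t ht
  have h1t : 0 < 1 + t := by linarith
  have hr : 0 < (1 + t) ^ (-(1 / ν : ℝ)) := Real.rpow_pos_of_pos h1t _
  have hn := h.norm_pos (h.flow_mem hx ht)
  have e1 : 0 < 2 * u * K₃ := by positivity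
  have e2 : 0 < K₃ * (2 / u) := by positivity
  rcases le_total t T₀ with htT | htT
  · have htI : t ∈ Icc 0 T₀ := ⟨ht, htT⟩
    have h1 := hb₁ t htI ‖φ t x‖ (by simpa using hC₁ _ (hS' t htI))
    have h2 := hb₂ t htI ‖φ t x‖⁻¹ (by simpa using hC₂ _ (hS' t htI))
    have h3 : (1 + t) ^ (-(1 / ν : ℝ)) ≤ K₂ * ‖φ t x‖ := by
      rw [Real.rpow_neg h1t.le]
      rw [inv_le_iff_one_le_mul₀ hn] at h2
      rw [inv_le_iff_one_le_mul₀ (Real.rpow_pos_of_pos h1t _)]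
      linarith
    constructor
    · refine h1.trans ?_
      gcongr; linarith
    · refine h3.trans ?_
      gcongr; linarith
  · have hy : φ T₀ x ∈ W := h.flow_mem hx hT
    have hZ' := h.flow_zone_shift hx hT hZ
    have hs : 0 ≤ t - T₀ := sub_nonneg.2 htT
    have hφ : φ (t - T₀) (φ T₀ x) = φ t x := by
      rw [← h.flow_add hx hT hs]; congr 1; ring
    have h1 := h.norm_flow_le hy hZ' hs
    have h2 := h.le_norm_flow hy hZ' hs
    rw [hφ] at h1 h2
    obtain ⟨p1, p2, p3⟩ := hc a ⟨le_rfl, h.a_le_b⟩ t htT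
    obtain ⟨q1, q2, q3⟩ := hc b ⟨h.a_le_b, le_rfl⟩ t htT
    have h3 := rpow_le_of_comparable (r := -(1 / ν : ℝ)) p1 h1t hK p2 p3
    have h4 := rpow_le_of_comparable (r := -(1 / ν : ℝ)) h1t q1 hK q3 q2
    rw [← hK₃] at h3 h4
    constructor
    · refine h1.trans ((mul_le_mul hux.2.le h3 (Real.rpow_nonneg p1.le _) (by positivity)).trans ?_)
      rw [← mul_assoc]
      gcongr; linarith
    · have h5 : (1 + b * ν * ‖φ T₀ x‖ ^ ν * (t - T₀)) ^ (-(1 / ν : ℝ)) ≤ 2 / u * ‖φ t x‖ := by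
        have h6 : 1 ≤ 2 / u * ‖φ T₀ x‖ := by
          have := hux.1
          rw [div_mul_eq_mul_div, one_le_div hu0]; linarith
        calc _ = 1 * (1 + b * ν * ‖φ T₀ x‖ ^ ν * (t - T₀)) ^ (-(1 / ν : ℝ)) := (one_mul _).symm
          _ ≤ (2 / u * ‖φ T₀ x‖) * (1 + b * ν * ‖φ T₀ x‖ ^ ν * (t - T₀)) ^ (-(1 / ν : ℝ)) := by
            gcongr
          _ = 2 / u * (‖φ T₀ x‖ * (1 + b * ν * ‖φ T₀ x‖ ^ ν * (t - T₀)) ^ (-(1 / ν : ℝ))) := by ring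
          _ ≤ _ := by gcongr
      refine h4.trans ((mul_le_mul_of_nonneg_left h5 hK₃0.le).trans ?_)
      rw [← mul_assoc]
      gcongr; linarith

/-- A nonnegative function which, past the entry time `T₀`, grows along a trajectory at most at the
rate `-β ‖φ‖ ^ ν + ε` decays, up to the factor `exp (ε (t - T₀))`, like `(1 + t) ^ (-rate a b β / ν)`,
with a constant locally uniform in the initial value. -/
theorem exists_rate_bound (h : IsConeFlow W Z p φ ν a b A) {x₀ : E} (hx₀ : x₀ ∈ W) {T₀ : ℝ}
    (hT : 0 ≤ T₀) (hent : ∀ᶠ x in 𝓝 x₀, ∀ t, T₀ ≤ t → φ t x ∈ Z) (β : ℝ) :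
    ∃ K > 0, ∀ᶠ x in 𝓝 x₀, ∀ (ε : ℝ) (g : ℝ → ℝ) (t : ℝ), ContinuousOn g (Ici 0) →
      (∀ t, 0 ≤ g t) → T₀ ≤ t →
      (∀ s ∈ Ico T₀ t, DiniLe g ((-(β * ‖φ s x‖ ^ ν) + ε) * g s) s) →
      g t ≤ g T₀ * (K * (1 + t) ^ (-(rate a b β / ν)) * Real.exp (ε * (t - T₀))) := by
  obtain ⟨K, hK, hcmp⟩ := h.exists_comparable hx₀ hT
  refine ⟨K ^ |-(rate a b β / ν)|, Real.rpow_pos_of_pos (by linarith) _, ?_⟩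
  filter_upwards [hent, hcmp, h.eventually_mem hx₀] with x hZ hc hx ε g t hg g0 ht hg'
  obtain ⟨e, he, hb⟩ := h.le_of_diniLe_flow (h.flow_mem hx hT) (h.flow_zone_shift hx hT hZ) β
  have hs : 0 ≤ t - T₀ := sub_nonneg.2 ht
  have h1 := hb ε (fun s => g (T₀ + s)) (t - T₀) (hg.comp (by fun_prop) fun s hs => by
    simp at hs ⊢; positivity) (fun _ => g0 _) hs (fun s hs => ?_)
  · simp only [add_sub_cancel, add_zero] at h1
    refine h1.trans ?_
    obtain ⟨p1, p2, p3⟩ := hc e he t ht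
    have h1t : 0 < 1 + t := by linarith
    gcongr
    · exact g0 _
    · exact rpow_le_of_comparable p1 h1t hK p2 p3
  · intro r hr
    rw [← h.flow_add hx hT hs.1] at hr
    have h2 := hg' (T₀ + s) ⟨by linarith [hs.1], by linarith [hs.2]⟩ r hr
    have h3 : Tendsto (fun z => T₀ + z) (𝓝[>] s) (𝓝[>] (T₀ + s)) := by
      refine tendsto_nhdsWithin_iff.2 ⟨?_, ?_⟩
      · exact ((continuous_const.add continuous_id).tendsto s).mono_left nhdsWithin_le_nhds
      · filter_upwards [self_mem_nhdsWithin] with z hz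
        simpa using hz
    filter_upwards [h3.eventually h2] with z hz
    simpa [slope_def_field] using hz

/-- Functions which are continuous and homogeneous of degree `j` on the cone obey along trajectories
the bounds suggested by their homogeneity. -/
theorem exists_homog_bound (h : IsConeFlow W Z p φ ν a b A) {G : Type*} [NormedAddCommGroup G]
    [NormedSpace ℝ G] {f : E → G} {j : ℝ} (hf : ContinuousOn f W)
    (hfj : ∀ x ∈ W, ∀ c : ℝ, 0 < c → f (c • x) = c ^ j • f x) {x₀ : E} (hx₀ : x₀ ∈ W) :
    ∃ K > 0, ∀ᶠ x in 𝓝 x₀, ∀ t, 0 ≤ t → ‖f (φ t x)‖ ≤ K * (1 + t) ^ (-(j / ν)) := by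
  obtain ⟨T₀, hT, hent⟩ := h.entry x₀ hx₀
  obtain ⟨S, hS, hSW, hflow⟩ := h.exists_compact_flow hx₀ T₀
  obtain ⟨C₁, hC₁⟩ := hS.exists_bound_of_continuousOn (hf.mono hSW)
  obtain ⟨C₂, hC₂⟩ := h.zone_compact.exists_bound_of_continuousOn
    (hf.mono (inter_subset_left.trans h.zone_subset))
  obtain ⟨K₁, hK₁, hb₁⟩ := exists_rpow_bound_of_bounded (C₁ := C₁) (r := -(j / ν)) hT
  obtain ⟨K₂, hK₂, hn⟩ := h.exists_norm_flow_bounds hx₀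
  set K₃ := (max K₂ 1) ^ |j| with hK₃
  have hK₃0 : 0 < K₃ := Real.rpow_pos_of_pos (by positivity) _
  refine ⟨K₁ + |C₂| * K₃, by positivity, ?_⟩
  filter_upwards [hent, hflow, hn, h.eventually_mem hx₀] with x hZ hS' hn' hx t ht
  have h1t : 0 < 1 + t := by linarith
  have hr : 0 < (1 + t) ^ (-(j / ν)) := Real.rpow_pos_of_pos h1t _
  rcases le_total t T₀ with htT | htT
  · have htI : t ∈ Icc 0 T₀ := ⟨ht, htT⟩
    refine (hb₁ t htI _ (hC₁ _ (hS' t htI))).trans ?_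
    have : 0 ≤ |C₂| * K₃ := by positivity
    gcongr; linarith
  · have hm := h.flow_mem hx ht
    have hpos := h.norm_pos hm
    set y := φ t x with hy
    have hyZ : ‖y‖⁻¹ • y ∈ Z ∩ sphere 0 1 := by
      refine ⟨h.zone_smul _ (hZ t htT) _ (by positivity), ?_⟩
      rw [mem_sphere_zero_iff_norm, norm_smul, norm_inv, norm_norm, inv_mul_cancel₀ hpos.ne']
    have h1 : f y = ‖y‖ ^ j • f (‖y‖⁻¹ • y) := by
      rw [← hfj _ (h.zone_subset hyZ.1) _ hpos, smul_smul, mul_inv_cancel₀ hpos.ne', one_smul]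
    have h2 : ‖y‖ ^ j ≤ K₃ * (1 + t) ^ (-(j / ν)) := by
      have h3 := rpow_le_of_comparable (r := j) hpos (Real.rpow_pos_of_pos h1t (-(1 / ν : ℝ)))
        (le_max_right K₂ 1)
        ((hn' t ht).1.trans (by gcongr; exact le_max_left _ _))
        ((hn' t ht).2.trans (by gcongr; exact le_max_left _ _))
      rw [← Real.rpow_mul h1t.le] at h3
      convert h3 using 3
      ring
    rw [h1, norm_smul, Real.norm_of_nonneg (Real.rpow_nonneg (norm_nonneg _) _)]
    calc ‖y‖ ^ j * ‖f (‖y‖⁻¹ • y)‖ ≤ (K₃ * (1 + t) ^ (-(j / ν))) * |C₂| := by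
          gcongr; exact (hC₂ _ hyZ).trans (le_abs_self _)
      _ = |C₂| * K₃ * (1 + t) ^ (-(j / ν)) := by ring
      _ ≤ _ := by gcongr; linarith

/-- The flow at time `t` is Lipschitz, near a given point, with a constant decaying like a power of
`1 + t`. -/
theorem exists_lipschitz_flow (h : IsConeFlow W Z p φ ν a b A) {x₀ : E} (hx₀ : x₀ ∈ W) :
    ∃ K > 0, ∃ r > 0, ball x₀ r ⊆ W ∧ ∀ x ∈ ball x₀ r, ∀ x' ∈ ball x₀ r, ∀ t, 0 ≤ t →
      ‖φ t x' - φ t x‖ ≤ K * (1 + t) ^ (-(rate a b A / ν)) * ‖x' - x‖ := by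
  obtain ⟨T₀, hT, hent⟩ := h.entry x₀ hx₀
  obtain ⟨C, hC, r₁, hr₁, hr₁W, hlip⟩ := h.flow_near hx₀ hT
  obtain ⟨K₁, hK₁, hrate⟩ := h.exists_rate_bound hx₀ hT hent A
  obtain ⟨K₂, hK₂, hb₂⟩ := exists_rpow_bound_of_bounded (C₁ := C) (r := -(rate a b A / ν)) hT
  obtain ⟨r₂, hr₂, hr₂'⟩ := Metric.eventually_nhds_iff_ball.1 (hent.and hrate)
  have hrpos : 0 < min r₁ r₂ := lt_min hr₁ hr₂
  have hs1 : ball x₀ (min r₁ r₂) ⊆ ball x₀ r₁ := ball_subset_ball (min_le_left _ _)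
  refine ⟨K₂ + C * K₁, by positivity, min r₁ r₂, hrpos, hs1.trans hr₁W, ?_⟩
  suffices hloc : ∀ t, 0 ≤ t → ∀ x ∈ ball x₀ (min r₁ r₂), ∀ ε > 0, ∀ᶠ y in 𝓝 x,
      ‖φ t y - φ t x‖ ≤ ((K₂ + C * K₁) * (1 + t) ^ (-(rate a b A / ν)) + ε) * ‖y - x‖ by
    intro x hx x' hx' t ht
    exact norm_sub_le_of_local (convex_ball _ _) (hloc t ht) x hx x' hx'
  intro t ht x hx η hη
  have h1t : 0 < 1 + t := by linarith
  have hr0 : 0 < (1 + t) ^ (-(rate a b A / ν)) := Real.rpow_pos_of_pos h1t _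
  have hxW : x ∈ W := hr₁W (hs1 hx)
  have hnear : ∀ᶠ y in 𝓝 x, y ∈ ball x₀ (min r₁ r₂) := isOpen_ball.mem_nhds hx
  rcases le_total t T₀ with htT | htT
  · filter_upwards [hnear] with y hy
    refine (hlip y (hs1 hy) x (hs1 hx) t ⟨ht, htT⟩).trans ?_
    gcongr
    refine (hb₂ t ⟨ht, htT⟩ C le_rfl).trans ?_
    have : 0 ≤ C * K₁ * (1 + t) ^ (-(rate a b A / ν)) := by positivity
    nlinarith
  · obtain ⟨hZ, hrx⟩ := hr₂' x (ball_subset_ball (min_le_right _ _) hx)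
    obtain ⟨C', hC', r', hr', hr'W, hlip'⟩ := h.flow_near hxW ht
    obtain ⟨ε, hε, hεη⟩ : ∃ ε > 0, C * (K₁ * (1 + t) ^ (-(rate a b A / ν)) *
        Real.exp (2 * ε * (t - T₀))) < C * (K₁ * (1 + t) ^ (-(rate a b A / ν))) + η := by
      have hc : Continuous (fun ε : ℝ => C * (K₁ * (1 + t) ^ (-(rate a b A / ν)) *
        Real.exp (2 * ε * (t - T₀)))) := by fun_prop
      have h2 := (hc.tendsto 0).mono_left (nhdsWithin_le_nhds (s := Ioi 0))
      simp only [mul_zero, zero_mul, Real.exp_zero, mul_one] at h2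
      obtain ⟨ε, h3, h4⟩ := ((h2.eventually_lt_const (lt_add_of_pos_right _ hη)).and
        self_mem_nhdsWithin).exists
      exact ⟨ε, h4, h3⟩
    have hcpt : IsCompact ((fun s => φ s x) '' Icc 0 t) := isCompact_Icc.image_of_continuousOn
      ((h.flow_continuousOn hxW).mono Icc_subset_Ici_self)
    obtain ⟨δ, hδ, htay⟩ := exists_uniform_taylor h.isOpen h.contDiffOn hcpt
      (image_subset_iff.2 fun s hs => h.flow_mem hxW hs.1) hε
    have hsmall : ∀ᶠ y in 𝓝 x, C' * ‖y - x‖ < δ := by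
      have : Continuous fun y => C' * ‖y - x‖ := by fun_prop
      have h2 := this.tendsto x
      simp only [sub_self, norm_zero, mul_zero] at h2
      exact h2.eventually_lt_const hδ
    filter_upwards [hnear, hsmall, ball_mem_nhds x hr'] with y hy hyδ hy'
    have hyW : y ∈ W := hr'W hy'
    have hD : ∀ s, 0 ≤ s → HasDerivWithinAt (fun s => φ s y - φ s x) (p (φ s y) - p (φ s x)) (Ici s) s :=
      fun s hs => (h.flow_hasDerivWithinAt hyW hs).sub (h.flow_hasDerivWithinAt hxW hs)
    have hdini : ∀ s ∈ Ico T₀ t, DiniLe (fun s => ‖φ s y - φ s x‖)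
        ((-(A * ‖φ s x‖ ^ ν) + 2 * ε) * ‖φ s y - φ s x‖) s := by
      intro s hs
      have hs0 : 0 ≤ s := hT.trans hs.1
      refine diniLe_norm (hD s hs0) fun ε' hε' => ?_
      have ht1 := htay (φ s x) ⟨s, ⟨hs0, hs.2.le⟩, rfl⟩ (φ s y)
        ((hlip' y hy' x (mem_ball_self hr') s ⟨hs0, hs.2.le⟩).trans_lt hyδ)
      filter_upwards [h.log_deriv _ (hZ s hs.1) ε hε, self_mem_nhdsWithin] with σ h2 hσ
      have hσ : 0 < σ := hσ
      set d := φ s y - φ s x with hd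
      have e : d + σ • (p (φ s y) - p (φ s x)) =
          (ContinuousLinearMap.id ℝ E + σ • fderiv ℝ p (φ s x)) d +
            σ • (p (φ s y) - p (φ s x) - fderiv ℝ p (φ s x) d) := by
        simp [smul_sub]
      rw [e]
      refine (norm_add_le _ _).trans ?_
      rw [norm_smul, Real.norm_of_nonneg hσ.le]
      have h3 := ((ContinuousLinearMap.id ℝ E + σ • fderiv ℝ p (φ s x)).le_opNorm d).trans
        (mul_le_mul_of_nonneg_right h2 (norm_nonneg d))
      have h4 := mul_le_mul_of_nonneg_left ht1 hσ.le
      nlinarith [mul_pos hσ hε']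
    have hcont : ContinuousOn (fun s => ‖φ s y - φ s x‖) (Ici 0) :=
      ((h.flow_continuousOn hyW).sub (h.flow_continuousOn hxW)).norm
    have hfin : ‖φ t y - φ t x‖ ≤ ‖φ T₀ y - φ T₀ x‖ *
        (K₁ * (1 + t) ^ (-(rate a b A / ν)) * Real.exp (2 * ε * (t - T₀))) :=
      hrx (2 * ε) (fun s => ‖φ s y - φ s x‖) t hcont (fun _ => norm_nonneg _) htT hdini
    calc ‖φ t y - φ t x‖ ≤ _ := hfin
      _ ≤ (C * ‖y - x‖) * (K₁ * (1 + t) ^ (-(rate a b A / ν)) * Real.exp (2 * ε * (t - T₀))) := by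
        gcongr
        exact hlip y (hs1 hy) x (hs1 hx) T₀ ⟨hT, le_rfl⟩
      _ = (C * (K₁ * (1 + t) ^ (-(rate a b A / ν)) * Real.exp (2 * ε * (t - T₀)))) * ‖y - x‖ := by ring
      _ ≤ ((K₂ + C * K₁) * (1 + t) ^ (-(rate a b A / ν)) + η) * ‖y - x‖ := by
        gcongr
        refine hεη.le.trans ?_
        have : 0 ≤ K₂ * (1 + t) ^ (-(rate a b A / ν)) := by positivity
        nlinarith

end IsConeFlow

/-! ### Fundamental solutions of linear equations -/

/-- `M` is the fundamental solution of `ψ' = R ψ` on `[0, ∞)`, and `Y` its inverse. -/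
structure IsFundPair {F : Type*} [NormedAddCommGroup F] [NormedSpace ℝ F] (R : ℝ → F →L[ℝ] F)
    (M Y : ℝ → F →L[ℝ] F) : Prop where
  M_zero : M 0 = ContinuousLinearMap.id ℝ F
  Y_zero : Y 0 = ContinuousLinearMap.id ℝ F
  M_deriv : ∀ t, 0 ≤ t → HasDerivWithinAt M ((R t).comp (M t)) (Ici 0) t
  Y_deriv : ∀ t, 0 ≤ t → HasDerivWithinAt Y (-((Y t).comp (R t))) (Ici 0) t
  M_Y : ∀ t, 0 ≤ t → (M t).comp (Y t) = ContinuousLinearMap.id ℝ F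
  Y_M : ∀ t, 0 ≤ t → (Y t).comp (M t) = ContinuousLinearMap.id ℝ F

section Linear

variable {F : Type*} [NormedAddCommGroup F] [NormedSpace ℝ F]

theorem hasDerivWithinAt_comp {f g : ℝ → F →L[ℝ] F} {f' g' : F →L[ℝ] F} {s : Set ℝ} {t : ℝ}
    (hf : HasDerivWithinAt f f' s t) (hg : HasDerivWithinAt g g' s t) :
    HasDerivWithinAt (fun t => (f t).comp (g t)) (f'.comp (g t) + (f t).comp g') s t := by
  have := ((ContinuousLinearMap.compL ℝ F F F).isBoundedBilinearMap.hasFDerivAt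
    (f t, g t)).comp_hasDerivWithinAt t (hf.prodMk hg)
  simp only [IsBoundedBilinearMap.deriv_apply] at this
  rw [add_comm]
  exact this

theorem continuous_comp_max {X : Type*} [TopologicalSpace X] {R : ℝ → X}
    (hR : ContinuousOn R (Ici 0)) : Continuous fun t => R (max 0 t) :=
  hR.comp_continuous (by fun_prop) fun t => le_max_left 0 t

/-- Solutions of `Y' = -Y R` are determined by their initial value. -/
theorem right_mul_solution_unique {R : ℝ → F →L[ℝ] F} (hR : ContinuousOn R (Ici 0))
    {Y Y' : ℝ → F →L[ℝ] F} (h0 : Y 0 = Y' 0)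
    (hY : ∀ t, 0 ≤ t → HasDerivWithinAt Y (-((Y t).comp (R t))) (Ici 0) t)
    (hY' : ∀ t, 0 ≤ t → HasDerivWithinAt Y' (-((Y' t).comp (R t))) (Ici 0) t) :
    ∀ t, 0 ≤ t → Y t = Y' t := by
  refine linear_solution_unique
    (S := fun t => -((ContinuousLinearMap.compL ℝ F F F).flip (R (max 0 t)))) ?_ h0 ?_ ?_
  · exact ((ContinuousLinearMap.compL ℝ F F F).flip.continuous.comp (continuous_comp_max hR)).neg
  · intro t ht
    simpa [max_eq_right ht] using hY t ht
  · intro t ht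
    simpa [max_eq_right ht] using hY' t ht

/-- The solutions of `M' = R M` and `Y' = -Y R` with value `Id` at `0` are inverse to each other:
`Y M` is constant, and `M Y` solves a linear equation that `Id` solves too. -/
theorem exists_fundPair [CompleteSpace F] {R : ℝ → F →L[ℝ] F} (hR : ContinuousOn R (Ici 0)) :
    ∃ M Y, IsFundPair R M Y := by
  have hR' := continuous_comp_max hR
  obtain ⟨M, hM0, hM⟩ := exists_linear_solution
    (fun t => ContinuousLinearMap.compL ℝ F F F (R (max 0 t)))
    ((ContinuousLinearMap.compL ℝ F F F).continuous.comp hR') (ContinuousLinearMap.id ℝ F)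
  obtain ⟨Y, hY0, hY⟩ := exists_linear_solution
    (fun t => -((ContinuousLinearMap.compL ℝ F F F).flip (R (max 0 t))))
    ((ContinuousLinearMap.compL ℝ F F F).flip.continuous.comp hR').neg (ContinuousLinearMap.id ℝ F)
  have hM' : ∀ t, 0 ≤ t → HasDerivWithinAt M ((R t).comp (M t)) (Ici 0) t := by
    intro t ht
    simpa [max_eq_right ht] using (hM t ht).2
  have hY' : ∀ t, 0 ≤ t → HasDerivWithinAt Y (-((Y t).comp (R t))) (Ici 0) t := by
    intro t ht
    simpa [max_eq_right ht] using (hY t ht).2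
  refine ⟨M, Y, hM0, hY0, hM', hY', ?_, ?_⟩
  · refine linear_solution_unique (y' := fun _ => ContinuousLinearMap.id ℝ F)
      (S := fun t => ContinuousLinearMap.compL ℝ F F F (R (max 0 t)) -
        (ContinuousLinearMap.compL ℝ F F F).flip (R (max 0 t)))
      (((ContinuousLinearMap.compL ℝ F F F).continuous.comp hR').sub
        ((ContinuousLinearMap.compL ℝ F F F).flip.continuous.comp hR')) (by simp [hM0, hY0]) ?_ ?_
    · intro t ht
      refine (hasDerivWithinAt_comp (hM' t ht) (hY' t ht)).congr_deriv ?_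
      ext v
      simp [max_eq_right ht, sub_eq_add_neg]
    · intro t ht
      simpa [max_eq_right ht] using hasDerivWithinAt_const t (Ici 0) (ContinuousLinearMap.id ℝ F)
  · refine linear_solution_unique (y' := fun _ => ContinuousLinearMap.id ℝ F)
      (S := fun _ => 0) continuous_const (by simp [hM0, hY0]) ?_ ?_
    · intro t ht
      refine (hasDerivWithinAt_comp (hY' t ht) (hM' t ht)).congr_deriv ?_
      ext v
      simp
    · intro t ht
      simpa using hasDerivWithinAt_const t (Ici 0) (ContinuousLinearMap.id ℝ F)

/-- The integral of a function continuous on `[0, ∞)` is a primitive there. -/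
theorem hasDerivWithinAt_integral_Ici [CompleteSpace F] {f : ℝ → F} (hf : ContinuousOn f (Ici 0))
    {t : ℝ} (ht : 0 ≤ t) : HasDerivWithinAt (fun s => ∫ τ in (0 : ℝ)..s, f τ) (f t) (Ici 0) t := by
  have hc := continuous_comp_max hf
  have h1 : HasDerivAt (fun s => ∫ τ in (0 : ℝ)..s, f (max 0 τ)) (f (max 0 t)) t :=
    intervalIntegral.integral_hasDerivAt_right (hc.intervalIntegrable _ _)
      (hc.stronglyMeasurableAtFilter _ _) hc.continuousAt
  rw [max_eq_right ht] at h1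
  refine h1.hasDerivWithinAt.congr_of_mem (fun s hs => ?_) ht
  refine intervalIntegral.integral_congr fun τ hτ => ?_
  rw [uIcc_of_le hs] at hτ
  simp [max_eq_right hτ.1]

theorem aestronglyMeasurable_of_continuousOn_Ici {X : Type*} [NormedAddCommGroup X] {f : ℝ → X}
    (hf : ContinuousOn f (Ici 0)) : AEStronglyMeasurable f (volume.restrict (Ioi 0)) :=
  (hf.mono Ioi_subset_Ici_self).aestronglyMeasurable measurableSet_Ioi

theorem setIntegral_Ioi_shift {f : ℝ → F} (s : ℝ) :
    ∫ t in Ioi (0 : ℝ), f (s + t) = ∫ t in Ioi s, f t := by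
  have := (measurePreserving_add_left volume s).setIntegral_preimage_emb
    (measurableEmbedding_addLeft s) f (Ioi s)
  simpa using this

end Linear

open Classical in
/-- The fundamental solution of `ψ' = Q (φ t x) ψ` and its inverse. -/
def fundPair {E F : Type*} [NormedAddCommGroup F] [NormedSpace ℝ F] (Q : E → F →L[ℝ] F)
    (φ : ℝ → E → E) (x : E) : (ℝ → F →L[ℝ] F) × (ℝ → F →L[ℝ] F) :=
  if h : ∃ P : (ℝ → F →L[ℝ] F) × (ℝ → F →L[ℝ] F), IsFundPair (fun t => Q (φ t x)) P.1 P.2 then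
    h.choose else 0

/-- The integral `∫_∞^0 M⁻¹(t, x) T(φ(t, x)) dt`. -/
def cohIntegral {E F : Type*} [NormedAddCommGroup F] [NormedSpace ℝ F] (Q : E → F →L[ℝ] F)
    (T : E → F) (φ : ℝ → E → E) (x : E) : F :=
  -∫ t in Ioi (0 : ℝ), (fundPair Q φ x).2 t (T (φ t x))

/-- Coefficients of the cohomological equation on the cone `W` for a solution homogeneous of
degree `j`: `-B ‖x‖ ^ ν` bounds the logarithmic norm of `-Q x` on the zone `Z`. -/
structure IsCohData {E F : Type*} [NormedAddCommGroup E] [NormedSpace ℝ E] [NormedAddCommGroup F]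
    [NormedSpace ℝ F] (W Z : Set E) (ν : ℕ) (Q : E → F →L[ℝ] F) (T : E → F) (B j : ℝ) : Prop where
  cont_Q : ContinuousOn Q W
  homog_Q : ∀ x ∈ W, ∀ c : ℝ, 0 < c → Q (c • x) = c ^ ν • Q x
  log_Q : ∀ x ∈ Z, ∀ ε > 0, ∀ᶠ s : ℝ in 𝓝[>] 0,
    ‖ContinuousLinearMap.id ℝ F - s • Q x‖ ≤ 1 + s * (-(B * ‖x‖ ^ ν) + ε)
  cont_T : ContinuousOn T W
  homog_T : ∀ x ∈ W, ∀ c : ℝ, 0 < c → T (c • x) = c ^ (j + ν) • T x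

/-- `h` is continuous and homogeneous of degree `j` on the cone `W`, and `d/dt h(φ) = Q(φ) h(φ) + T(φ)`
along trajectories: the cohomological equation without differentiability of `h`. -/
structure IsFlowSol {E F : Type*} [NormedAddCommGroup E] [NormedSpace ℝ E] [NormedAddCommGroup F]
    [NormedSpace ℝ F] (W : Set E) (φ : ℝ → E → E) (Q : E → F →L[ℝ] F) (T : E → F) (j : ℝ)
    (h : E → F) : Prop where
  cont : ContinuousOn h W
  homog : ∀ x ∈ W, ∀ c : ℝ, 0 < c → h (c • x) = c ^ j • h x
  deriv : ∀ x ∈ W, ∀ t, 0 ≤ t →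
    HasDerivWithinAt (fun s => h (φ s x)) (Q (φ t x) (h (φ t x)) + T (φ t x)) (Ici 0) t

theorem IsFundPair.continuousOn_Y {F : Type*} [NormedAddCommGroup F] [NormedSpace ℝ F]
    {R M Y : ℝ → F →L[ℝ] F} (h : IsFundPair R M Y) : ContinuousOn Y (Ici 0) :=
  fun t ht => (h.Y_deriv t ht).continuousWithinAt

theorem integrableOn_one_add_rpow {η : ℝ} (hη : 0 < η) :
    IntegrableOn (fun t : ℝ => (1 + t) ^ (-(1 + η))) (Ioi 0) := by
  have := integrableOn_add_rpow_Ioi_of_lt (a := -(1 + η)) (c := 0) (m := 1) (by linarith) (by norm_num)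
  simpa only [add_comm] using this

theorem tendsto_one_add_rpow {η : ℝ} (hη : 0 < η) :
    Tendsto (fun t : ℝ => (1 + t) ^ (-η)) atTop (𝓝 0) :=
  (tendsto_rpow_neg_atTop hη).comp (tendsto_atTop_add_const_left _ 1 tendsto_id)

namespace IsConeFlow

variable {E : Type*} [NormedAddCommGroup E] [NormedSpace ℝ E]
  {W Z : Set E} {p : E → E} {φ : ℝ → E → E} {ν : ℕ} {a b A : ℝ}
  {F : Type*} [NormedAddCommGroup F] [NormedSpace ℝ F] [CompleteSpace F]
  {Q : E → F →L[ℝ] F} {T : E → F} {B j : ℝ}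

/-! ### The integral solution of the cohomological equation -/

theorem continuousOn_comp_flow (h : IsConeFlow W Z p φ ν a b A) {X : Type*} [TopologicalSpace X]
    {f : E → X} (hf : ContinuousOn f W) {x : E} (hx : x ∈ W) :
    ContinuousOn (fun t => f (φ t x)) (Ici 0) :=
  hf.comp (h.flow_continuousOn hx) fun _ ht => h.flow_mem hx ht

theorem fundPair_spec (h : IsConeFlow W Z p φ ν a b A) (hQ : ContinuousOn Q W) {x : E}
    (hx : x ∈ W) : IsFundPair (fun t => Q (φ t x)) (fundPair Q φ x).1 (fundPair Q φ x).2 := by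
  obtain ⟨M, Y, hMY⟩ := exists_fundPair (h.continuousOn_comp_flow hQ hx)
  have hex : ∃ P : (ℝ → F →L[ℝ] F) × (ℝ → F →L[ℝ] F), IsFundPair (fun t => Q (φ t x)) P.1 P.2 :=
    ⟨(M, Y), hMY⟩
  rw [fundPair, dif_pos hex]
  exact hex.choose_spec

theorem continuousOn_integrand (h : IsConeFlow W Z p φ ν a b A) (hd : IsCohData W Z ν Q T B j)
    {x : E} (hx : x ∈ W) :
    ContinuousOn (fun t => (fundPair Q φ x).2 t (T (φ t x))) (Ici 0) :=
  (h.fundPair_spec hd.cont_Q hx).continuousOn_Y.clm_apply (h.continuousOn_comp_flow hd.cont_T hx)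

variable [FiniteDimensional ℝ E]

/-- The logarithmic norm of `-Q` controls the decay of the inverse of the fundamental matrix,
because `Y t` is evolved by right multiplication by `-Q`. -/
theorem exists_Y_bound (h : IsConeFlow W Z p φ ν a b A) (hd : IsCohData W Z ν Q T B j) {x₀ : E}
    (hx₀ : x₀ ∈ W) : ∃ K > 0, ∀ᶠ x in 𝓝 x₀, ∀ t, 0 ≤ t →
      ‖(fundPair Q φ x).2 t‖ ≤ K * (1 + t) ^ (-(rate a b B / ν)) := by
  obtain ⟨T₀, hT, hent⟩ := h.entry x₀ hx₀
  obtain ⟨S, hS, hSW, hflow⟩ := h.exists_compact_flow hx₀ T₀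
  obtain ⟨C, hC⟩ := hS.exists_bound_of_continuousOn (hd.cont_Q.mono hSW)
  obtain ⟨K₁, hK₁, hrate⟩ := h.exists_rate_bound hx₀ hT hent B
  obtain ⟨K₂, hK₂, hb₂⟩ := exists_rpow_bound_of_bounded (r := -(rate a b B / ν))
    (C₁ := Real.exp (|C| * T₀)) hT
  refine ⟨K₂ + Real.exp (|C| * T₀) * K₁, by positivity, ?_⟩
  filter_upwards [hent, hflow, hrate, h.eventually_mem hx₀] with x hZ hxS hr hx t ht
  have hP := h.fundPair_spec hd.cont_Q hx
  set Y := (fundPair Q φ x).2 with hY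
  have h1t : 0 < 1 + t := by linarith
  have hr0 : 0 < (1 + t) ^ (-(rate a b B / ν)) := Real.rpow_pos_of_pos h1t _
  have hcont : ContinuousOn (fun t => ‖Y t‖) (Ici 0) := hP.continuousOn_Y.norm
  have hD : ∀ t, 0 ≤ t → HasDerivWithinAt Y (-((Y t).comp (Q (φ t x)))) (Ici t) t :=
    fun t ht => (hP.Y_deriv t ht).mono (Ici_subset_Ici.2 ht)
  have hY0 : ‖Y 0‖ ≤ 1 := by rw [hP.Y_zero]; exact ContinuousLinearMap.norm_id_le
  have hsmall : ∀ s ∈ Icc 0 T₀, ‖Y s‖ ≤ Real.exp (|C| * T₀) := by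
    intro s hs
    have := le_mul_exp_of_diniLe (g := fun t => ‖Y t‖) (α := fun _ => |C|) (P := fun t => |C| * t)
      hs.1 (hcont.mono Icc_subset_Ici_self) (norm_nonneg _) (fun τ hτ => ?_) (by fun_prop)
      (fun τ _ => by simpa using (hasDerivWithinAt_id τ (Ici τ)).const_mul |C|)
    · rw [mul_zero, sub_zero] at this
      refine this.trans ?_
      calc ‖Y 0‖ * Real.exp (|C| * s) ≤ 1 * Real.exp (|C| * T₀) := by
            gcongr; exact hs.2
        _ = _ := one_mul _
    · refine diniLe_norm_of_norm_le (hD τ hτ.1) ?_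
      rw [norm_neg, mul_comm]
      refine (ContinuousLinearMap.opNorm_comp_le _ _).trans ?_
      gcongr
      exact (hC _ (hxS τ ⟨hτ.1, hτ.2.le.trans hs.2⟩)).trans (le_abs_self _)
  rcases le_total t T₀ with htT | htT
  · refine (hb₂ t ⟨ht, htT⟩ _ (hsmall t ⟨ht, htT⟩)).trans ?_
    have : 0 < Real.exp (|C| * T₀) * K₁ := by positivity
    gcongr; linarith
  · have h1 := hr 0 (fun t => ‖Y t‖) t hcont (fun _ => norm_nonneg _) htT (fun s hs => ?_)
    · rw [zero_mul, Real.exp_zero, mul_one] at h1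
      refine h1.trans ((mul_le_mul_of_nonneg_right (hsmall T₀ ⟨hT, le_rfl⟩) (by positivity)).trans ?_)
      rw [← mul_assoc]
      gcongr; linarith
    · have hs0 : 0 ≤ s := hT.trans hs.1
      refine diniLe_norm (hD s hs0) fun ε hε => ?_
      have hε' : 0 < ε / (‖Y s‖ + 1) := by positivity
      filter_upwards [hd.log_Q _ (hZ s hs.1) _ hε', self_mem_nhdsWithin] with σ h2 hσ
      have hσ : 0 < σ := hσ
      have e : Y s + σ • -((Y s).comp (Q (φ s x))) =
          (Y s).comp (ContinuousLinearMap.id ℝ F - σ • Q (φ s x)) := by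
        ext v; simp [sub_eq_add_neg]
      rw [e]
      refine (ContinuousLinearMap.opNorm_comp_le _ _).trans
        ((mul_le_mul_of_nonneg_left h2 (norm_nonneg _)).trans ?_)
      have h3 : ‖Y s‖ * (ε / (‖Y s‖ + 1)) ≤ ε := by
        rw [mul_div_assoc', div_le_iff₀ (by positivity)]; nlinarith [norm_nonneg (Y s)]
      nlinarith [mul_le_mul_of_nonneg_left h3 hσ.le]

/-- The inverse of the fundamental matrix depends continuously on the initial point of the
trajectory, by Grönwall's inequality. -/
theorem continuousAt_Y (h : IsConeFlow W Z p φ ν a b A) (hd : IsCohData W Z ν Q T B j) {x₀ : E}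
    (hx₀ : x₀ ∈ W) {t : ℝ} (ht : 0 ≤ t) : ContinuousAt (fun x => (fundPair Q φ x).2 t) x₀ := by
  obtain ⟨K, hK, hKb⟩ := h.exists_Y_bound hd hx₀
  have hcpt : ContinuousOn (fun s => Q (φ s x₀)) (Icc 0 t) :=
    (h.continuousOn_comp_flow hd.cont_Q hx₀).mono Icc_subset_Ici_self
  obtain ⟨Cq, hCq⟩ := isCompact_Icc.exists_bound_of_continuousOn hcpt
  obtain ⟨Cr, hCr⟩ := (isCompact_Icc (a := (0 : ℝ)) (b := t)).exists_bound_of_continuousOn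
    (f := fun s : ℝ => (1 + s) ^ (-(rate a b B / ν))) (fun s hs =>
      (ContinuousAt.rpow_const (by fun_prop) (Or.inl (by linarith [hs.1]))).continuousWithinAt)
  have hunif : ∀ η > 0, ∀ᶠ x in 𝓝 x₀, ∀ s ∈ Icc 0 t, ‖Q (φ s x) - Q (φ s x₀)‖ < η := by
    intro η hη
    have hc : ContinuousOn (Function.uncurry fun (x : E) (s : ℝ) => Q (φ s x)) (W ×ˢ Icc 0 t) := by
      refine hd.cont_Q.comp (h.flow_continuousOn_uncurry.comp (f := fun q : E × ℝ => (q.2, q.1))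
        (by fun_prop) (fun q hq => ⟨hq.2.1, hq.1⟩)) (fun q hq => h.flow_mem hq.1 hq.2.1)
    obtain ⟨v, hv, hv'⟩ := IsCompact.mem_uniformity_of_prod isCompact_Icc hc hx₀
      (Metric.dist_mem_uniformity hη)
    rw [h.isOpen.nhdsWithin_eq hx₀] at hv
    filter_upwards [hv] with x hx s hs
    have := hv' x hx s hs
    simpa [dist_eq_norm] using this
  rw [ContinuousAt, tendsto_iff_norm_sub_tendsto_zero]
  set L := |Cq| + 1 with hL
  set C' := K * |Cr| with hC'
  rw [Metric.tendsto_nhds]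
  intro ε hε
  have hg : Continuous fun η => gronwallBound 0 L (C' * η) t :=
    (gronwallBound_continuous_ε 0 L t).comp (by fun_prop)
  have hg0 := hg.tendsto 0
  simp only [mul_zero, gronwallBound_ε0_δ0] at hg0
  obtain ⟨η, h1, hη⟩ := (((hg0.mono_left nhdsWithin_le_nhds).eventually_lt_const hε).and
    (self_mem_nhdsWithin (s := Ioi 0))).exists
  filter_upwards [hunif η hη, hKb, h.eventually_mem hx₀] with x hxη hxK hx
  have hP := h.fundPair_spec hd.cont_Q hx
  have hP₀ := h.fundPair_spec hd.cont_Q hx₀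
  rw [dist_zero_right, norm_norm]
  refine lt_of_le_of_lt ?_ h1
  have := norm_le_gronwallBound_of_norm_deriv_right_le
    (f := fun s => (fundPair Q φ x).2 s - (fundPair Q φ x₀).2 s) (δ := 0) (K := L) (ε := C' * η)
    (a := 0) (b := t)
    ((hP.continuousOn_Y.sub hP₀.continuousOn_Y).mono Icc_subset_Ici_self)
    (fun s hs => ((hP.Y_deriv s hs.1).sub (hP₀.Y_deriv s hs.1)).mono (Ici_subset_Ici.2 hs.1))
    (by simp [hP.Y_zero, hP₀.Y_zero]) (fun s hs => ?_) t ⟨ht, le_rfl⟩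
  · simpa using this
  · have hsI : s ∈ Icc 0 t := ⟨hs.1, hs.2.le⟩
    set Y := (fundPair Q φ x).2 s
    set Y₀ := (fundPair Q φ x₀).2 s
    have e : -(Y.comp (Q (φ s x))) - -(Y₀.comp (Q (φ s x₀))) =
        -(Y.comp (Q (φ s x) - Q (φ s x₀))) - (Y - Y₀).comp (Q (φ s x₀)) := by
      ext v; simp; abel
    rw [e]
    refine (norm_sub_le _ _).trans ?_
    rw [norm_neg, add_comm]
    refine add_le_add ((ContinuousLinearMap.opNorm_comp_le _ _).trans ?_)
      ((ContinuousLinearMap.opNorm_comp_le _ _).trans ?_)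
    · rw [mul_comm]
      gcongr
      exact (hCq s hsI).trans ((le_abs_self _).trans (by linarith))
    · refine mul_le_mul ?_ (hxη s hsI).le (norm_nonneg _) (by positivity)
      exact (hxK s hs.1).trans (mul_le_mul_of_nonneg_left
        ((le_abs_self _).trans ((hCr s hsI).trans (le_abs_self _))) hK.le)

/-- The integrand of the integral solution is integrable, locally uniformly in the initial point,
as soon as `j + rate a b B` is positive. -/
theorem exists_integrand_bound (h : IsConeFlow W Z p φ ν a b A) (hd : IsCohData W Z ν Q T B j)
    {x₀ : E} (hx₀ : x₀ ∈ W) : ∃ K > 0, ∀ᶠ x in 𝓝 x₀, ∀ t, 0 ≤ t →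
      ‖(fundPair Q φ x).2 t (T (φ t x))‖ ≤ K * (1 + t) ^ (-(1 + (j + rate a b B) / ν)) := by
  obtain ⟨K₁, hK₁, hY⟩ := h.exists_Y_bound hd hx₀
  obtain ⟨K₂, hK₂, hT⟩ := h.exists_homog_bound hd.cont_T hd.homog_T hx₀
  refine ⟨K₁ * K₂, by positivity, ?_⟩
  filter_upwards [hY, hT] with x h1 h2 t ht
  have h1t : 0 < 1 + t := by linarith
  have hν : (ν : ℝ) ≠ 0 := by have := h.nu_pos; positivity
  calc _ ≤ _ := ContinuousLinearMap.le_opNorm _ _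
    _ ≤ (K₁ * (1 + t) ^ (-(rate a b B / ν))) * (K₂ * (1 + t) ^ (-((j + ν) / ν))) :=
      mul_le_mul (h1 t ht) (h2 t ht) (norm_nonneg _)
        (mul_nonneg hK₁.le (Real.rpow_nonneg h1t.le _))
    _ = K₁ * K₂ * ((1 + t) ^ (-(rate a b B / ν)) * (1 + t) ^ (-((j + ν) / ν))) := by ring
    _ = _ := by
      rw [← Real.rpow_add h1t]
      congr 2
      field_simp
      ring

theorem integrand_integrableOn (h : IsConeFlow W Z p φ ν a b A) (hd : IsCohData W Z ν Q T B j)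
    (hj : 0 < j + rate a b B) {x : E} (hx : x ∈ W) :
    IntegrableOn (fun t => (fundPair Q φ x).2 t (T (φ t x))) (Ioi 0) := by
  obtain ⟨K, hK, hb⟩ := h.exists_integrand_bound hd hx
  have hν : (0 : ℝ) < ν := by have := h.nu_pos; positivity
  refine Integrable.mono' ((integrableOn_one_add_rpow (div_pos hj hν)).const_mul K)
    (aestronglyMeasurable_of_continuousOn_Ici (h.continuousOn_integrand hd hx)) ?_
  filter_upwards [ae_restrict_mem measurableSet_Ioi] with t ht using hb.self_of_nhds t (le_of_lt ht)

theorem continuousOn_cohIntegral (h : IsConeFlow W Z p φ ν a b A) (hd : IsCohData W Z ν Q T B j)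
    (hj : 0 < j + rate a b B) : ContinuousOn (cohIntegral Q T φ) W := by
  intro x₀ hx₀
  refine ContinuousAt.continuousWithinAt (ContinuousAt.neg ?_)
  obtain ⟨K, hK, hb⟩ := h.exists_integrand_bound hd hx₀
  have hν : (0 : ℝ) < ν := by have := h.nu_pos; positivity
  refine continuousAt_of_dominated (bound := fun t => K * (1 + t) ^ (-(1 + (j + rate a b B) / ν)))
    ?_ ?_ ((integrableOn_one_add_rpow (div_pos hj hν)).const_mul K) ?_
  · filter_upwards [h.eventually_mem hx₀] with x hx using
      aestronglyMeasurable_of_continuousOn_Ici (h.continuousOn_integrand hd hx)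
  · filter_upwards [hb] with x hx
    filter_upwards [ae_restrict_mem measurableSet_Ioi] with t ht using hx t (le_of_lt ht)
  · filter_upwards [ae_restrict_mem measurableSet_Ioi] with t ht
    have ht : 0 ≤ t := le_of_lt ht
    exact (h.continuousAt_Y hd hx₀ ht).clm_apply (ContinuousAt.comp
      (hd.cont_T.continuousAt (h.isOpen.mem_nhds (h.flow_mem hx₀ ht))) (h.flow_continuousAt hx₀ ht))

theorem fundPair_add (h : IsConeFlow W Z p φ ν a b A) (hQ : ContinuousOn Q W) {x : E} (hx : x ∈ W)
    {s t : ℝ} (hs : 0 ≤ s) (ht : 0 ≤ t) :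
    (fundPair Q φ x).2 (s + t) = ((fundPair Q φ x).2 s).comp ((fundPair Q φ (φ s x)).2 t) := by
  have hP := h.fundPair_spec hQ hx
  have hP' := h.fundPair_spec hQ (h.flow_mem hx hs)
  refine right_mul_solution_unique (R := fun t => Q (φ t (φ s x)))
    (Y := fun t => (fundPair Q φ x).2 (s + t))
    (Y' := fun t => ((fundPair Q φ x).2 s).comp ((fundPair Q φ (φ s x)).2 t))
    (h.continuousOn_comp_flow hQ (h.flow_mem hx hs)) ?_ ?_ ?_ t ht
  · simp only [add_zero, hP'.Y_zero]; rfl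
  · intro τ hτ
    have h1 := hP.Y_deriv (s + τ) (by positivity)
    have h2 : HasDerivWithinAt (fun τ : ℝ => s + τ) 1 (Ici 0) τ :=
      ((hasDerivWithinAt_id τ (Ici 0)).const_add s)
    have h3 := h1.scomp τ h2 (fun u hu => by simp at hu ⊢; positivity)
    rw [one_smul, h.flow_add hx hs hτ] at h3
    exact h3
  · intro τ hτ
    have h1 := hasDerivWithinAt_comp (hasDerivWithinAt_const τ (Ici 0) ((fundPair Q φ x).2 s))
      (hP'.Y_deriv τ hτ)
    refine h1.congr_deriv ?_
    ext v; simp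

theorem fundPair_smul (h : IsConeFlow W Z p φ ν a b A) (hd : IsCohData W Z ν Q T B j) {x : E}
    (hx : x ∈ W) {c : ℝ} (hc : 0 < c) {t : ℝ} (ht : 0 ≤ t) :
    (fundPair Q φ (c • x)).2 t = (fundPair Q φ x).2 (c ^ ν * t) := by
  have hP := h.fundPair_spec hd.cont_Q hx
  have hcx := h.smul_mem x hx c hc
  have hP' := h.fundPair_spec hd.cont_Q hcx
  refine right_mul_solution_unique (R := fun t => Q (φ t (c • x)))
    (Y := (fundPair Q φ (c • x)).2) (Y' := fun t => (fundPair Q φ x).2 (c ^ ν * t))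
    (h.continuousOn_comp_flow hd.cont_Q hcx) ?_ hP'.Y_deriv ?_ t ht
  · simp only [mul_zero, hP.Y_zero, hP'.Y_zero]
  · intro τ hτ
    have h1 := hP.Y_deriv (c ^ ν * τ) (by positivity)
    have h2 : HasDerivWithinAt (fun τ : ℝ => c ^ ν * τ) (c ^ ν) (Ici 0) τ := by
      simpa using (hasDerivWithinAt_id τ (Ici 0)).const_mul (c ^ ν)
    have h3 := h1.scomp τ h2 (fun u hu => by simp at hu ⊢; positivity)
    refine h3.congr_deriv ?_
    rw [h.flow_smul hx hc hτ, hd.homog_Q _ (h.flow_mem hx (by positivity)) c hc]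
    ext v; simp

theorem cohIntegral_smul (h : IsConeFlow W Z p φ ν a b A) (hd : IsCohData W Z ν Q T B j) {x : E}
    (hx : x ∈ W) {c : ℝ} (hc : 0 < c) : cohIntegral Q T φ (c • x) = c ^ j • cohIntegral Q T φ x := by
  unfold cohIntegral
  rw [smul_neg]
  congr 1
  have h1 : ∀ t ∈ Ioi (0 : ℝ), (fundPair Q φ (c • x)).2 t (T (φ t (c • x))) =
      c ^ (j + ν) • (fun t => (fundPair Q φ x).2 t (T (φ t x))) (c ^ ν * t) := by
    intro t ht
    have ht : 0 ≤ t := le_of_lt ht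
    simp only [h.fundPair_smul hd hx hc ht, h.flow_smul hx hc ht,
      hd.homog_T _ (h.flow_mem hx (by positivity : 0 ≤ c ^ ν * t)) c hc, map_smul]
  rw [setIntegral_congr_fun measurableSet_Ioi h1, integral_smul,
    integral_comp_mul_left_Ioi (fun t => (fundPair Q φ x).2 t (T (φ t x))) 0 (by positivity : 0 < c ^ ν),
    mul_zero, smul_smul]
  congr 1
  rw [Real.rpow_add hc, Real.rpow_natCast]
  field_simp

/-- Along a trajectory the integral solution is given by variation of constants. -/
theorem Y_cohIntegral_flow (h : IsConeFlow W Z p φ ν a b A) (hd : IsCohData W Z ν Q T B j)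
    (hj : 0 < j + rate a b B) {x : E} (hx : x ∈ W) {s : ℝ} (hs : 0 ≤ s) :
    (fundPair Q φ x).2 s (cohIntegral Q T φ (φ s x)) =
      cohIntegral Q T φ x + ∫ t in (0 : ℝ)..s, (fundPair Q φ x).2 t (T (φ t x)) := by
  have hint := h.integrand_integrableOn hd hj hx
  have hint' := h.integrand_integrableOn hd hj (h.flow_mem hx hs)
  have h1 := intervalIntegral.integral_interval_add_Ioi hint (hint.mono_set (Ioi_subset_Ioi hs))
  have h2 : ∫ t in Ioi s, (fundPair Q φ x).2 t (T (φ t x)) =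
      (fundPair Q φ x).2 s (∫ t in Ioi (0 : ℝ), (fundPair Q φ (φ s x)).2 t (T (φ t (φ s x)))) := by
    rw [← ContinuousLinearMap.integral_comp_comm _ hint', ← setIntegral_Ioi_shift s]
    refine setIntegral_congr_fun measurableSet_Ioi fun t ht => ?_
    have ht : 0 ≤ t := le_of_lt ht
    simp only [h.fundPair_add hd.cont_Q hx hs ht, h.flow_add hx hs ht]
    rfl
  unfold cohIntegral
  rw [map_neg, ← h2, ← h1]
  abel

/-- The integral solves the cohomological equation along trajectories. -/
theorem isFlowSol_cohIntegral (h : IsConeFlow W Z p φ ν a b A) (hd : IsCohData W Z ν Q T B j)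
    (hj : 0 < j + rate a b B) : IsFlowSol W φ Q T j (cohIntegral Q T φ) := by
  refine ⟨h.continuousOn_cohIntegral hd hj, fun x hx c hc => h.cohIntegral_smul hd hx hc,
    fun x hx t ht => ?_⟩
  have hP := h.fundPair_spec hd.cont_Q hx
  set M := (fundPair Q φ x).1 with hM
  set Y := (fundPair Q φ x).2 with hY
  let u : ℝ → F := fun s => cohIntegral Q T φ x + ∫ t in (0 : ℝ)..s, Y t (T (φ t x))
  have hu : ∀ s, 0 ≤ s → cohIntegral Q T φ (φ s x) = M s (u s) := by
    intro s hs
    simp only [u]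
    rw [← h.Y_cohIntegral_flow hd hj hx hs, ← ContinuousLinearMap.comp_apply, hP.M_Y s hs]
    rfl
  have hu' : HasDerivWithinAt u (Y t (T (φ t x))) (Ici 0) t :=
    (hasDerivWithinAt_integral_Ici (h.continuousOn_integrand hd hx) ht).const_add _
  have h1 := (hP.M_deriv t ht).clm_apply hu'
  refine (h1.congr_of_mem (fun s hs => hu s hs) ht).congr_deriv ?_
  rw [hu t ht, ContinuousLinearMap.comp_apply, ← ContinuousLinearMap.comp_apply (M t) (Y t), hP.M_Y t ht]
  rfl

/-- A solution along trajectories is the integral solution. -/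
theorem eq_cohIntegral (h : IsConeFlow W Z p φ ν a b A) (hd : IsCohData W Z ν Q T B j)
    (hj : 0 < j + rate a b B) {f : E → F} (hf : IsFlowSol W φ Q T j f) :
    EqOn f (cohIntegral Q T φ) W := by
  intro x hx
  have hP := h.fundPair_spec hd.cont_Q hx
  have hν : (0 : ℝ) < ν := by have := h.nu_pos; positivity
  set Y := (fundPair Q φ x).2 with hY
  have hint := h.integrand_integrableOn hd hj hx
  have hconst : ∀ s, 0 ≤ s → Y s (f (φ s x)) - ∫ t in (0 : ℝ)..s, Y t (T (φ t x)) = f x := by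
    refine linear_solution_unique (S := fun _ => 0) continuous_const
      (y := fun s => Y s (f (φ s x)) - ∫ t in (0 : ℝ)..s, Y t (T (φ t x))) (y' := fun _ => f x)
      ?_ (fun t ht => ?_) (fun t _ => by simpa using hasDerivWithinAt_const t (Ici 0) (f x))
    · simp [hP.Y_zero, h.flow_zero x hx]
    · refine (((hP.Y_deriv t ht).clm_apply (hf.deriv x hx t ht)).sub
        (hasDerivWithinAt_integral_Ici (h.continuousOn_integrand hd hx) ht)).congr_deriv ?_
      simp [hY]
  have hlim1 : Tendsto (fun s => Y s (f (φ s x))) atTop (𝓝 0) := by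
    obtain ⟨K₁, hK₁, hY1⟩ := h.exists_Y_bound hd hx
    obtain ⟨K₂, hK₂, hf1⟩ := h.exists_homog_bound hf.cont hf.homog hx
    have hz : Tendsto (fun s : ℝ => K₁ * K₂ * (1 + s) ^ (-((j + rate a b B) / ν))) atTop (𝓝 0) := by
      simpa using (tendsto_one_add_rpow (div_pos hj hν)).const_mul (K₁ * K₂)
    refine squeeze_zero_norm' ?_ hz
    filter_upwards [eventually_ge_atTop 0] with s hs
    have h1s : 0 < 1 + s := by linarith
    calc _ ≤ _ := ContinuousLinearMap.le_opNorm _ _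
      _ ≤ (K₁ * (1 + s) ^ (-(rate a b B / ν))) * (K₂ * (1 + s) ^ (-(j / ν))) :=
        mul_le_mul (hY1.self_of_nhds s hs) (hf1.self_of_nhds s hs) (norm_nonneg _)
          (mul_nonneg hK₁.le (Real.rpow_nonneg h1s.le _))
      _ = K₁ * K₂ * ((1 + s) ^ (-(rate a b B / ν)) * (1 + s) ^ (-(j / ν))) := by ring
      _ = _ := by
        rw [← Real.rpow_add h1s]; congr 2; ring
  have hlim2 := intervalIntegral_tendsto_integral_Ioi 0 hint tendsto_id
  have hlim3 := hlim1.sub hlim2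
  rw [zero_sub] at hlim3
  refine tendsto_nhds_unique ?_ hlim3
  refine tendsto_const_nhds.congr' ?_
  filter_upwards [eventually_ge_atTop 0] with s hs
  exact (hconst s hs).symm

end IsConeFlow

/-! ### Differentiability of the integral solution -/

/-- The derivative of a function homogeneous of degree `q` is homogeneous of degree `q - 1`. -/
theorem fderiv_smul_of_homog {E G : Type*} [NormedAddCommGroup E] [NormedSpace ℝ E]
    [NormedAddCommGroup G] [NormedSpace ℝ G] {W : Set E} {f : E → G} {q : ℝ} (hW : IsOpen W)
    (hWc : ∀ x ∈ W, ∀ c : ℝ, 0 < c → c • x ∈ W)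
    (hfq : ∀ x ∈ W, ∀ c : ℝ, 0 < c → f (c • x) = c ^ q • f x) {x : E} (hx : x ∈ W)
    (hf : DifferentiableAt ℝ f x) {c : ℝ} (hc : 0 < c) :
    fderiv ℝ f (c • x) = c ^ (q - 1) • fderiv ℝ f x := by
  have h1 : HasFDerivAt (fun y => c ^ q • f (c⁻¹ • y)) (c ^ (q - 1) • fderiv ℝ f x) (c • x) := by
    have h2 : HasFDerivAt (fun y : E => c⁻¹ • y) (c⁻¹ • ContinuousLinearMap.id ℝ E) (c • x) :=
      (hasFDerivAt_id (c • x)).const_smul c⁻¹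
    have h3 : HasFDerivAt f (fderiv ℝ f x) (c⁻¹ • c • x) := by
      rw [smul_smul, inv_mul_cancel₀ hc.ne', one_smul]; exact hf.hasFDerivAt
    refine ((h3.comp (c • x) h2).const_smul (c ^ q)).congr_fderiv ?_
    ext v
    simp only [smul_apply, ContinuousLinearMap.comp_apply,
      ContinuousLinearMap.id_apply, map_smul, smul_smul]
    rw [Real.rpow_sub hc, Real.rpow_one, div_eq_mul_inv]
  refine (h1.congr_of_eventuallyEq ?_).fderiv
  filter_upwards [hW.mem_nhds (hWc x hx c hc)] with y hy
  rw [← hfq _ (hWc y hy _ (inv_pos.2 hc)) c hc, smul_smul, mul_inv_cancel₀ hc.ne', one_smul]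

/-- The coefficient `H ↦ Q H - H Dp` of the equation satisfied by the derivative of a solution. -/
def derivCoeff {E F : Type*} [NormedAddCommGroup E] [NormedSpace ℝ E] [NormedAddCommGroup F]
    [NormedSpace ℝ F] (p : E → E) (Q : E → F →L[ℝ] F) (x : E) : (E →L[ℝ] F) →L[ℝ] (E →L[ℝ] F) :=
  ContinuousLinearMap.compL ℝ E F F (Q x) - (ContinuousLinearMap.compL ℝ E E F).flip (fderiv ℝ p x)

/-- The right-hand side `DT + DQ · h` of the equation satisfied by the derivative of a solution `h`. -/
def derivRhs {E F : Type*} [NormedAddCommGroup E] [NormedSpace ℝ E] [NormedAddCommGroup F]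
    [NormedSpace ℝ F] (Q : E → F →L[ℝ] F) (T h : E → F) (x : E) : E →L[ℝ] F :=
  fderiv ℝ T x + (fderiv ℝ Q x).flip (h x)

theorem derivCoeff_apply {E F : Type*} [NormedAddCommGroup E] [NormedSpace ℝ E]
    [NormedAddCommGroup F] [NormedSpace ℝ F] (p : E → E) (Q : E → F →L[ℝ] F) (x : E)
    (H : E →L[ℝ] F) (v : E) : derivCoeff p Q x H v = Q x (H v) - H (fderiv ℝ p x v) := by
  simp [derivCoeff]

theorem derivRhs_apply {E F : Type*} [NormedAddCommGroup E] [NormedSpace ℝ E]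
    [NormedAddCommGroup F] [NormedSpace ℝ F] (Q : E → F →L[ℝ] F) (T h : E → F) (x v : E) :
    derivRhs Q T h x v = fderiv ℝ T x v + fderiv ℝ Q x v (h x) := by
  simp [derivRhs]

namespace IsConeFlow

variable {E : Type*} [NormedAddCommGroup E] [NormedSpace ℝ E]
  {W Z : Set E} {p : E → E} {φ : ℝ → E → E} {ν : ℕ} {a b A : ℝ}
  {F : Type*} [NormedAddCommGroup F] [NormedSpace ℝ F]
  {Q : E → F →L[ℝ] F} {T : E → F} {B j : ℝ}

theorem homog_rpow (h : IsConeFlow W Z p φ ν a b A) :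
    ∀ x ∈ W, ∀ c : ℝ, 0 < c → p (c • x) = c ^ ((ν : ℝ) + 1) • p x := by
  intro x hx c hc
  rw [h.homog x hx c hc]
  congr 1
  exact_mod_cast (Real.rpow_natCast c (ν + 1)).symm

theorem _root_.Cohomological.IsCohData.homog_Q_rpow (hd : IsCohData W Z ν Q T B j) :
    ∀ x ∈ W, ∀ c : ℝ, 0 < c → Q (c • x) = c ^ (ν : ℝ) • Q x := by
  intro x hx c hc
  rw [hd.homog_Q x hx c hc, Real.rpow_natCast]

theorem differentiableAt (h : IsConeFlow W Z p φ ν a b A) {G : Type*} [NormedAddCommGroup G]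
    [NormedSpace ℝ G] {f : E → G} (hf : ContDiffOn ℝ 1 f W) {x : E} (hx : x ∈ W) :
    DifferentiableAt ℝ f x :=
  (hf.contDiffAt (h.isOpen.mem_nhds hx)).differentiableAt one_ne_zero

theorem fderiv_homog (h : IsConeFlow W Z p φ ν a b A) {G : Type*} [NormedAddCommGroup G]
    [NormedSpace ℝ G] {f : E → G} {q : ℝ} (hf : ContDiffOn ℝ 1 f W)
    (hfq : ∀ x ∈ W, ∀ c : ℝ, 0 < c → f (c • x) = c ^ q • f x) :
    ∀ x ∈ W, ∀ c : ℝ, 0 < c → fderiv ℝ f (c • x) = c ^ (q - 1) • fderiv ℝ f x :=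
  fun _ hx _ hc => fderiv_smul_of_homog h.isOpen h.smul_mem hfq hx (h.differentiableAt hf hx) hc

/-- The derivative of a solution satisfies an equation of the same kind, whose degree is lower
by one. -/
theorem isCohData_deriv (h : IsConeFlow W Z p φ ν a b A) (hd : IsCohData W Z ν Q T B j)
    (hQ : ContDiffOn ℝ 1 Q W) (hT : ContDiffOn ℝ 1 T W) {f : E → F} (hf : ContinuousOn f W)
    (hfj : ∀ x ∈ W, ∀ c : ℝ, 0 < c → f (c • x) = c ^ j • f x) :
    IsCohData W Z ν (derivCoeff p Q) (derivRhs Q T f) (B + A) (j - 1) := by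
  have hDp := h.contDiffOn.continuousOn_fderiv_of_isOpen h.isOpen le_rfl
  have hDQ := hQ.continuousOn_fderiv_of_isOpen h.isOpen le_rfl
  have hDT := hT.continuousOn_fderiv_of_isOpen h.isOpen le_rfl
  refine ⟨?_, ?_, ?_, ?_, ?_⟩
  · exact ((ContinuousLinearMap.compL ℝ E F F).continuous.comp_continuousOn hd.cont_Q).sub
      ((ContinuousLinearMap.compL ℝ E E F).flip.continuous.comp_continuousOn hDp)
  · intro x hx c hc
    have := h.fderiv_homog h.contDiffOn h.homog_rpow x hx c hc
    rw [add_sub_cancel_right, Real.rpow_natCast] at this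
    ext H v
    simp only [derivCoeff_apply, smul_apply, hd.homog_Q x hx c hc, this,
      map_smul, smul_sub]
  · intro x hx ε hε
    set q := ‖Q x‖ * ‖fderiv ℝ p x‖ with hq
    have hε3 : 0 < ε / 4 := by positivity
    set β := -(B * ‖x‖ ^ ν) + ε / 4 with hβ
    set α := -(A * ‖x‖ ^ ν) + ε / 4 with hα
    have hsmall : ∀ᶠ s : ℝ in 𝓝[>] 0, s * (|β * α| + q) < ε / 4 := by
      have hc : Continuous fun s : ℝ => s * (|β * α| + q) := by fun_prop
      have h0 := hc.tendsto 0
      rw [zero_mul] at h0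
      exact (h0.mono_left nhdsWithin_le_nhds).eventually_lt_const hε3
    filter_upwards [hd.log_Q x hx _ hε3, h.log_deriv x hx _ hε3, hsmall, self_mem_nhdsWithin]
      with s h1 h2 h3 hs
    have hs : 0 < s := hs
    -- Up to `s ^ 2`, the operator `1 - s (H ↦ Q H - H Dp)` is `H ↦ (1 - s Q) H (1 + s Dp)`.
    have e : ∀ H : E →L[ℝ] F, (ContinuousLinearMap.id ℝ (E →L[ℝ] F) - s • derivCoeff p Q x) H =
        ((ContinuousLinearMap.id ℝ F - s • Q x).comp H).comp
          (ContinuousLinearMap.id ℝ E + s • fderiv ℝ p x) +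
        (s ^ 2) • ((Q x).comp H).comp (fderiv ℝ p x) := by
      intro H
      ext v
      simp only [sub_apply, ContinuousLinearMap.id_apply,
        smul_apply, derivCoeff_apply, add_apply,
        ContinuousLinearMap.comp_apply, map_add, map_smul, smul_sub, smul_smul, sq]
      abel
    have hpos : 0 ≤ 1 + s * β := (norm_nonneg _).trans h1
    have hn : ‖ContinuousLinearMap.id ℝ (E →L[ℝ] F) - s • derivCoeff p Q x‖ ≤
        (1 + s * β) * (1 + s * α) + s ^ 2 * q := by
      refine ContinuousLinearMap.opNorm_le_bound _ ?_ fun H => ?_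
      · have : 0 ≤ 1 + s * α := (norm_nonneg _).trans h2
        positivity
      rw [e H]
      refine (norm_add_le _ _).trans ?_
      rw [add_mul]
      gcongr
      · calc _ ≤ ‖ContinuousLinearMap.id ℝ F - s • Q x‖ * ‖H‖ *
              ‖ContinuousLinearMap.id ℝ E + s • fderiv ℝ p x‖ :=
              (ContinuousLinearMap.opNorm_comp_le _ _).trans
                (mul_le_mul_of_nonneg_right (ContinuousLinearMap.opNorm_comp_le _ _) (norm_nonneg _))
          _ ≤ (1 + s * β) * ‖H‖ * (1 + s * α) := by gcongr
          _ = _ := by ring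
      · rw [norm_smul, Real.norm_of_nonneg (sq_nonneg s)]
        calc _ ≤ s ^ 2 * (‖Q x‖ * ‖H‖ * ‖fderiv ℝ p x‖) := by
              gcongr
              exact (ContinuousLinearMap.opNorm_comp_le _ _).trans
                (mul_le_mul_of_nonneg_right (ContinuousLinearMap.opNorm_comp_le _ _) (norm_nonneg _))
          _ = _ := by rw [hq]; ring
    refine hn.trans ?_
    have h4 : s * (s * (β * α + q)) ≤ s * (ε / 4) := by
      have : s * (β * α + q) ≤ s * (|β * α| + q) := by gcongr; exact le_abs_self _
      gcongr; linarith
    have h5 : 0 ≤ s * ε := by positivity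
    nlinarith
  · exact hDT.add ((ContinuousLinearMap.flipₗᵢ ℝ E F F).continuous.comp_continuousOn hDQ |>.clm_apply hf)
  · intro x hx c hc
    have h1 := h.fderiv_homog hT hd.homog_T x hx c hc
    have h2 := h.fderiv_homog hQ hd.homog_Q_rpow x hx c hc
    have e1 : c ^ (j + ν - 1) = c ^ (j - 1 + ν) := by congr 1; ring
    have e2 : c ^ ((ν : ℝ) - 1) * c ^ j = c ^ (j - 1 + ν) := by
      rw [← Real.rpow_add hc]; congr 1; ring
    ext v
    simp only [derivRhs_apply, h1, h2, hfj x hx c hc, smul_apply, map_smul,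
      smul_smul, smul_add, e1, mul_comm (c ^ j), e2]

variable [FiniteDimensional ℝ E]

/-- Differences and first-order Taylor remainders of a homogeneous function along two neighbouring
trajectories decay at the rate which combines the homogeneity of the derivative with the decay of
the Lipschitz constant of the flow. -/
theorem exists_remainder_bound (h : IsConeFlow W Z p φ ν a b A) {G : Type*} [NormedAddCommGroup G]
    [NormedSpace ℝ G] {f : E → G} {q : ℝ} (hf : ContDiffOn ℝ 1 f W)
    (hfq : ∀ x ∈ W, ∀ c : ℝ, 0 < c → f (c • x) = c ^ q • f x) {x₀ : E} (hx₀ : x₀ ∈ W) :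
    ∃ K > 0, ∀ᶠ y in 𝓝 x₀, ∀ t, 0 ≤ t →
      ‖f (φ t y) - f (φ t x₀)‖ ≤ K * (1 + t) ^ (-((q - 1 + rate a b A) / ν)) * ‖y - x₀‖ ∧
      ‖f (φ t y) - f (φ t x₀) - fderiv ℝ f (φ t x₀) (φ t y - φ t x₀)‖ ≤
        K * (1 + t) ^ (-((q - 1 + rate a b A) / ν)) * ‖y - x₀‖ := by
  obtain ⟨K₁, hK₁, r, hr, hrW, hlip⟩ := h.exists_lipschitz_flow hx₀
  obtain ⟨K₂, hK₂, hD⟩ := h.exists_homog_bound (hf.continuousOn_fderiv_of_isOpen h.isOpen le_rfl)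
    (h.fderiv_homog hf hfq) hx₀
  obtain ⟨r', hr', hD'⟩ := Metric.eventually_nhds_iff_ball.1 hD
  have hpow : ∀ t : ℝ, 0 ≤ t → (K₂ * (1 + t) ^ (-((q - 1) / ν))) * (K₁ * (1 + t) ^ (-(rate a b A / ν)))
      = K₁ * K₂ * (1 + t) ^ (-((q - 1 + rate a b A) / ν)) := by
    intro t ht
    have h1t : 0 < 1 + t := by linarith
    have e : -((q - 1 + rate a b A) / ν) = -((q - 1) / ν) + -(rate a b A / ν) := by ring
    rw [e, Real.rpow_add h1t]; ring
  have hm : 0 < min r r' := lt_min hr hr'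
  have hx₀m := mem_ball_self (x := x₀) hm
  have hs1 : ball x₀ (min r r') ⊆ ball x₀ r := ball_subset_ball (min_le_left _ _)
  have hs2 : ball x₀ (min r r') ⊆ ball x₀ r' := ball_subset_ball (min_le_right _ _)
  have key : ∀ t, 0 ≤ t → ∀ x ∈ ball x₀ (min r r'), ∀ y ∈ ball x₀ (min r r'),
      ‖f (φ t y) - f (φ t x)‖ ≤ K₁ * K₂ * (1 + t) ^ (-((q - 1 + rate a b A) / ν)) * ‖y - x‖ := by
    intro t ht
    refine norm_sub_le_of_local (f := fun x => f (φ t x)) (convex_ball _ _) fun x hx ε hε => ?_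
    have hxW := hrW (hs1 hx)
    have h1t : 0 < 1 + t := by linarith
    set L := K₁ * (1 + t) ^ (-(rate a b A / ν)) with hL
    have hL0 : 0 < L := mul_pos hK₁ (Real.rpow_pos_of_pos h1t _)
    have hfd := (h.differentiableAt hf (h.flow_mem hxW ht)).hasFDerivAt
    have h1 := (hfd.isLittleO.def (div_pos hε hL0))
    have h2 := (h.flow_continuousAt hxW ht).eventually h1
    filter_upwards [h2, isOpen_ball.mem_nhds hx] with y hy hyb
    have h3 := hlip x (hs1 hx) y (hs1 hyb) t ht
    have h4 : ‖f (φ t y) - f (φ t x)‖ ≤ (ε / L + K₂ * (1 + t) ^ (-((q - 1) / ν))) * ‖φ t y - φ t x‖ := by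
      calc _ = ‖(f (φ t y) - f (φ t x) - fderiv ℝ f (φ t x) (φ t y - φ t x)) +
            fderiv ℝ f (φ t x) (φ t y - φ t x)‖ := by congr 1; abel
        _ ≤ ε / L * ‖φ t y - φ t x‖ + ‖fderiv ℝ f (φ t x)‖ * ‖φ t y - φ t x‖ :=
          (norm_add_le _ _).trans (add_le_add hy (ContinuousLinearMap.le_opNorm _ _))
        _ ≤ _ := by
          rw [add_mul]; gcongr
          exact hD' x (hs2 hx) t ht
    calc _ ≤ _ := h4
      _ ≤ (ε / L + K₂ * (1 + t) ^ (-((q - 1) / ν))) * (L * ‖y - x‖) := by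
        gcongr
      _ = (ε + (K₂ * (1 + t) ^ (-((q - 1) / ν))) * L) * ‖y - x‖ := by field_simp
      _ = _ := by rw [hL, hpow t ht, add_comm]
  refine ⟨2 * (K₁ * K₂), by positivity, ?_⟩
  filter_upwards [ball_mem_nhds x₀ hm] with y hy t ht
  have h1t : 0 < 1 + t := by linarith
  have h1 := key t ht x₀ hx₀m y hy
  have hnn : 0 ≤ K₁ * K₂ * (1 + t) ^ (-((q - 1 + rate a b A) / ν)) * ‖y - x₀‖ := by
    have := Real.rpow_nonneg h1t.le (-((q - 1 + rate a b A) / ν))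
    positivity
  have h2 : ‖fderiv ℝ f (φ t x₀) (φ t y - φ t x₀)‖ ≤
      K₁ * K₂ * (1 + t) ^ (-((q - 1 + rate a b A) / ν)) * ‖y - x₀‖ := by
    calc _ ≤ _ := ContinuousLinearMap.le_opNorm _ _
      _ ≤ (K₂ * (1 + t) ^ (-((q - 1) / ν))) * (K₁ * (1 + t) ^ (-(rate a b A / ν)) * ‖y - x₀‖) :=
        mul_le_mul (hD' x₀ (hs2 hx₀m) t ht) (hlip x₀ (hs1 hx₀m) y (hs1 hy) t ht) (norm_nonneg _)
          (mul_nonneg hK₂.le (Real.rpow_nonneg h1t.le _))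
      _ = _ := by rw [← hpow t ht]; ring
  constructor
  · linarith
  · have := norm_sub_le (f (φ t y) - f (φ t x₀)) (fderiv ℝ f (φ t x₀) (φ t y - φ t x₀))
    linarith

theorem flow_isBigO (h : IsConeFlow W Z p φ ν a b A) {x₀ : E} (hx₀ : x₀ ∈ W) {t : ℝ} (ht : 0 ≤ t) :
    (fun y => φ t y - φ t x₀) =O[𝓝 x₀] fun y => y - x₀ := by
  obtain ⟨C, hC, r, hr, hrW, hlip⟩ := h.flow_near hx₀ ht
  refine Asymptotics.IsBigO.of_bound C ?_
  filter_upwards [ball_mem_nhds x₀ hr] with y hy using hlip y hy x₀ (mem_ball_self hr) t ⟨ht, le_rfl⟩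

theorem remainder_isLittleO (h : IsConeFlow W Z p φ ν a b A) {G : Type*} [NormedAddCommGroup G]
    [NormedSpace ℝ G] {f : E → G} (hf : ContDiffOn ℝ 1 f W) {x₀ : E} (hx₀ : x₀ ∈ W) {t : ℝ}
    (ht : 0 ≤ t) :
    (fun y => f (φ t y) - f (φ t x₀) - fderiv ℝ f (φ t x₀) (φ t y - φ t x₀))
      =o[𝓝 x₀] fun y => y - x₀ :=
  ((h.differentiableAt hf (h.flow_mem hx₀ ht)).hasFDerivAt.isLittleO.comp_tendsto
    (h.flow_continuousAt hx₀ ht)).trans_isBigO (h.flow_isBigO hx₀ ht)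

end IsConeFlow

namespace IsConeFlow

section

variable {E : Type*} [NormedAddCommGroup E] [NormedSpace ℝ E] [FiniteDimensional ℝ E]
  {W Z : Set E} {p : E → E} {φ : ℝ → E → E} {ν : ℕ} {a b A : ℝ}
  {F : Type*} [NormedAddCommGroup F] [NormedSpace ℝ F] [CompleteSpace F]
  {Q : E → F →L[ℝ] F} {T : E → F} {B j : ℝ}

/-- The differentiated equation, in which the integral solution enters the right-hand side, has an
integral solution as well. -/
theorem isFlowSol_deriv (h : IsConeFlow W Z p φ ν a b A) (hd : IsCohData W Z ν Q T B j)
    (hQ : ContDiffOn ℝ 1 Q W) (hT : ContDiffOn ℝ 1 T W) (hj : 0 < j + rate a b B)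
    (hj' : 0 < j - 1 + rate a b B + rate a b A) :
    IsFlowSol W φ (derivCoeff p Q) (derivRhs Q T (cohIntegral Q T φ)) (j - 1)
      (cohIntegral (derivCoeff p Q) (derivRhs Q T (cohIntegral Q T φ)) φ) := by
  have hs := h.isFlowSol_cohIntegral hd hj
  refine h.isFlowSol_cohIntegral (h.isCohData_deriv hd hQ hT hs.cont hs.homog) ?_
  have := rate_add_le h.a_pos h.a_le_b B A
  linarith

/-- The integral solution is differentiable, and its derivative is the integral solution of the
differentiated equation. -/
theorem hasFDerivAt_cohIntegral (h : IsConeFlow W Z p φ ν a b A) (hd : IsCohData W Z ν Q T B j)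
    (hQ : ContDiffOn ℝ 1 Q W) (hT : ContDiffOn ℝ 1 T W) (hj : 0 < j + rate a b B)
    (hj' : 0 < j - 1 + rate a b B + rate a b A) {x₀ : E} (hx₀ : x₀ ∈ W) :
    HasFDerivAt (cohIntegral Q T φ)
      (cohIntegral (derivCoeff p Q) (derivRhs Q T (cohIntegral Q T φ)) φ x₀) x₀ := by
  have hν : (0 : ℝ) < ν := by have := h.nu_pos; positivity
  have hsol := h.isFlowSol_cohIntegral hd hj
  have hsol' := h.isFlowSol_deriv hd hQ hT hj hj'
  set f := cohIntegral Q T φ with hf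
  set H := cohIntegral (derivCoeff p Q) (derivRhs Q T f) φ with hH
  have hP := h.fundPair_spec hd.cont_Q hx₀
  set Y := (fundPair Q φ x₀).2 with hY
  -- The defect `g` between the increment of `f` and its linearization, along two trajectories,
  -- solves the linear equation with the quadratically small source `R`.
  let g : E → ℝ → F := fun y t => f (φ t y) - f (φ t x₀) - H (φ t x₀) (φ t y - φ t x₀)
  let rQ : E → ℝ → F →L[ℝ] F := fun y t =>
    Q (φ t y) - Q (φ t x₀) - fderiv ℝ Q (φ t x₀) (φ t y - φ t x₀)
  let rT : E → ℝ → F := fun y t =>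
    T (φ t y) - T (φ t x₀) - fderiv ℝ T (φ t x₀) (φ t y - φ t x₀)
  let rp : E → ℝ → E := fun y t =>
    p (φ t y) - p (φ t x₀) - fderiv ℝ p (φ t x₀) (φ t y - φ t x₀)
  let R : E → ℝ → F := fun y t => rQ y t (f (φ t x₀)) +
    (Q (φ t y) - Q (φ t x₀)) (f (φ t y) - f (φ t x₀)) + rT y t - H (φ t x₀) (rp y t)
  have hg : ∀ y ∈ W, ∀ t, 0 ≤ t →
      HasDerivWithinAt (g y) (Q (φ t x₀) (g y t) + R y t) (Ici 0) t := by
    intro y hy t ht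
    have h1 := ((hsol.deriv y hy t ht).sub (hsol.deriv x₀ hx₀ t ht)).sub
      ((hsol'.deriv x₀ hx₀ t ht).clm_apply ((h.flow_sol y hy t ht).2.sub (h.flow_sol x₀ hx₀ t ht).2))
    refine h1.congr_deriv ?_
    simp only [g, R, rQ, rT, rp, add_apply, derivCoeff_apply,
      derivRhs_apply, map_sub, sub_apply, Pi.sub_apply]
    abel
  have hYg : ∀ y ∈ W, ∀ t, 0 ≤ t →
      HasDerivWithinAt (fun t => Y t (g y t)) (Y t (R y t)) (Ici 0) t := by
    intro y hy t ht
    refine ((hP.Y_deriv t ht).clm_apply (hg y hy t ht)).congr_deriv ?_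
    simp [hY]
  have hRcont : ∀ y ∈ W, ContinuousOn (fun t => Y t (R y t)) (Ici 0) := by
    intro y hy
    have cΔ := (h.flow_continuousOn hy).sub (h.flow_continuousOn hx₀)
    have dQ := h.continuousOn_comp_flow (hQ.continuousOn_fderiv_of_isOpen h.isOpen le_rfl) hx₀
    have dT := h.continuousOn_comp_flow (hT.continuousOn_fderiv_of_isOpen h.isOpen le_rfl) hx₀
    have dp := h.continuousOn_comp_flow (h.contDiffOn.continuousOn_fderiv_of_isOpen h.isOpen le_rfl) hx₀
    have crQ : ContinuousOn (rQ y) (Ici 0) :=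
      ((h.continuousOn_comp_flow hd.cont_Q hy).sub (h.continuousOn_comp_flow hd.cont_Q hx₀)).sub
        (dQ.clm_apply cΔ)
    have crT : ContinuousOn (rT y) (Ici 0) :=
      ((h.continuousOn_comp_flow hd.cont_T hy).sub (h.continuousOn_comp_flow hd.cont_T hx₀)).sub
        (dT.clm_apply cΔ)
    have crp : ContinuousOn (rp y) (Ici 0) :=
      ((h.continuousOn_comp_flow h.contDiffOn.continuousOn hy).sub
        (h.continuousOn_comp_flow h.contDiffOn.continuousOn hx₀)).sub (dp.clm_apply cΔ)
    have cf := h.continuousOn_comp_flow hsol.cont hx₀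
    refine hP.continuousOn_Y.clm_apply ((((crQ.clm_apply cf).add
      (((h.continuousOn_comp_flow hd.cont_Q hy).sub (h.continuousOn_comp_flow hd.cont_Q hx₀)).clm_apply
        ((h.continuousOn_comp_flow hsol.cont hy).sub cf))).add crT).sub
      ((h.continuousOn_comp_flow hsol'.cont hx₀).clm_apply crp))
  -- Power bounds.
  obtain ⟨KY, hKY, bY⟩ := h.exists_Y_bound hd hx₀
  obtain ⟨Kf, hKf, bf⟩ := h.exists_homog_bound hsol.cont hsol.homog hx₀
  obtain ⟨KH, hKH, bH⟩ := h.exists_homog_bound hsol'.cont hsol'.homog hx₀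
  obtain ⟨KQ, hKQ, bQ⟩ := h.exists_remainder_bound hQ hd.homog_Q_rpow hx₀
  obtain ⟨KT, hKT, bT⟩ := h.exists_remainder_bound hT hd.homog_T hx₀
  obtain ⟨Kp, hKp, bp⟩ := h.exists_remainder_bound h.contDiffOn h.homog_rpow hx₀
  obtain ⟨KL, hKL, r, hr, hrW, hlip⟩ := h.exists_lipschitz_flow hx₀
  have bY := bY.self_of_nhds
  have bf₀ := bf.self_of_nhds
  have bH := bH.self_of_nhds
  set η := (j - 1 + rate a b B + rate a b A) / ν with hη
  have hη0 : 0 < η := div_pos hj' hν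
  have hpw : ∀ t : ℝ, 0 ≤ t → ∀ u v w : ℝ, u + v = w →
      (1 + t) ^ (-(u / ν)) * (1 + t) ^ (-(v / ν)) = (1 + t) ^ (-(w / ν)) := by
    intro t ht u v w huv
    rw [← Real.rpow_add (by linarith), ← huv]
    congr 1; ring
  have hRb : ∃ K > 0, ∀ᶠ y in 𝓝 x₀, ∀ t, 0 ≤ t →
      ‖Y t (R y t)‖ ≤ K * (1 + t) ^ (-(1 + η)) * ‖y - x₀‖ := by
    refine ⟨KY * (KQ * Kf + KQ * (2 * Kf) + KT + KH * Kp), by positivity, ?_⟩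
    filter_upwards [bf, bQ, bT, bp] with y yf yQ yT yp t ht
    have h1t : 0 < 1 + t := by linarith
    set δ := ‖y - x₀‖ with hδ
    have hw : ∀ u : ℝ, 0 ≤ (1 + t) ^ u := fun u => Real.rpow_nonneg h1t.le u
    set θ := (1 + t) ^ (-((j + ν - 1 + rate a b A) / ν)) with hθ
    have e1 := hpw t ht (ν - 1 + rate a b A) j (j + ν - 1 + rate a b A) (by ring)
    have e2 := hpw t ht (j - 1) (ν + 1 - 1 + rate a b A) (j + ν - 1 + rate a b A) (by ring)
    rw [← hθ] at e1 e2
    have hff : ‖f (φ t y) - f (φ t x₀)‖ ≤ 2 * Kf * (1 + t) ^ (-(j / ν)) := by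
      have := norm_sub_le (f (φ t y)) (f (φ t x₀))
      linarith [yf t ht, bf₀ t ht]
    have i1 : ‖rQ y t (f (φ t x₀))‖ ≤ KQ * Kf * θ * δ := by
      calc _ ≤ _ := ContinuousLinearMap.le_opNorm _ _
        _ ≤ (KQ * (1 + t) ^ (-((ν - 1 + rate a b A) / ν)) * δ) * (Kf * (1 + t) ^ (-(j / ν))) :=
          mul_le_mul (yQ t ht).2 (bf₀ t ht) (norm_nonneg _)
            (mul_nonneg (mul_nonneg hKQ.le (hw _)) (norm_nonneg _))
        _ = _ := by rw [← e1]; ring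
    have i2 : ‖(Q (φ t y) - Q (φ t x₀)) (f (φ t y) - f (φ t x₀))‖ ≤ KQ * (2 * Kf) * θ * δ := by
      calc _ ≤ _ := ContinuousLinearMap.le_opNorm _ _
        _ ≤ (KQ * (1 + t) ^ (-((ν - 1 + rate a b A) / ν)) * δ) * (2 * Kf * (1 + t) ^ (-(j / ν))) :=
          mul_le_mul (yQ t ht).1 hff (norm_nonneg _)
            (mul_nonneg (mul_nonneg hKQ.le (hw _)) (norm_nonneg _))
        _ = _ := by rw [← e1]; ring
    have i3 : ‖rT y t‖ ≤ KT * θ * δ := (yT t ht).2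
    have i4 : ‖H (φ t x₀) (rp y t)‖ ≤ KH * Kp * θ * δ := by
      calc _ ≤ _ := ContinuousLinearMap.le_opNorm _ _
        _ ≤ (KH * (1 + t) ^ (-((j - 1) / ν))) *
            (Kp * (1 + t) ^ (-((ν + 1 - 1 + rate a b A) / ν)) * δ) :=
          mul_le_mul (bH t ht) (yp t ht).2 (norm_nonneg _) (mul_nonneg hKH.le (hw _))
        _ = _ := by rw [← e2]; ring
    have hR : ‖R y t‖ ≤ (KQ * Kf + KQ * (2 * Kf) + KT + KH * Kp) * θ * δ := by
      have := norm_sub_le (rQ y t (f (φ t x₀)) +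
        (Q (φ t y) - Q (φ t x₀)) (f (φ t y) - f (φ t x₀)) + rT y t) (H (φ t x₀) (rp y t))
      have h2 := norm_add₃_le (a := rQ y t (f (φ t x₀)))
        (b := (Q (φ t y) - Q (φ t x₀)) (f (φ t y) - f (φ t x₀))) (c := rT y t)
      have h3 : ‖R y t‖ ≤ _ := this
      linarith
    have e3 := hpw t ht (rate a b B) (j + ν - 1 + rate a b A) (ν * (1 + η)) (by
      rw [hη]; field_simp; ring)
    rw [mul_div_cancel_left₀ _ hν.ne', ← hθ] at e3
    calc _ ≤ _ := ContinuousLinearMap.le_opNorm _ _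
      _ ≤ (KY * (1 + t) ^ (-(rate a b B / ν))) *
          ((KQ * Kf + KQ * (2 * Kf) + KT + KH * Kp) * θ * δ) :=
        mul_le_mul (bY t ht) hR (norm_nonneg _) (mul_nonneg hKY.le (hw _))
      _ = _ := by rw [← e3]; ring
  obtain ⟨K, hK, bR⟩ := hRb
  -- The defect decays at infinity, hence its initial value is the integral of the source.
  have hgint : ∀ᶠ y in 𝓝 x₀, g y 0 = -∫ t in Ioi (0 : ℝ), Y t (R y t) := by
    filter_upwards [bR, bf, ball_mem_nhds x₀ hr, h.eventually_mem hx₀] with y yR yf yr hy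
    have hint : IntegrableOn (fun t => Y t (R y t)) (Ioi 0) := by
      refine Integrable.mono' (((integrableOn_one_add_rpow hη0).const_mul K).mul_const ‖y - x₀‖)
        (aestronglyMeasurable_of_continuousOn_Ici (hRcont y hy)) ?_
      filter_upwards [ae_restrict_mem measurableSet_Ioi] with t ht using yR t (le_of_lt ht)
    have hconst : ∀ s, 0 ≤ s → Y s (g y s) - ∫ t in (0 : ℝ)..s, Y t (R y t) = g y 0 := by
      refine linear_solution_unique (S := fun _ => 0) continuous_const
        (y := fun s => Y s (g y s) - ∫ t in (0 : ℝ)..s, Y t (R y t)) (y' := fun _ => g y 0)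
        ?_ (fun t ht => ?_) (fun t _ => by simpa using hasDerivWithinAt_const t (Ici 0) (g y 0))
      · simp [hP.Y_zero]
      · refine ((hYg y hy t ht).sub
          (hasDerivWithinAt_integral_Ici (hRcont y hy) ht)).congr_deriv ?_
        simp
    have hlim1 : Tendsto (fun s => Y s (g y s)) atTop (𝓝 0) := by
      have hz : Tendsto (fun s : ℝ => KY * (2 * Kf) * (1 + s) ^ (-((j + rate a b B) / ν)) +
          KY * (KH * KL * ‖y - x₀‖) * (1 + s) ^ (-η)) atTop (𝓝 0) := by
        simpa using ((tendsto_one_add_rpow (div_pos hj hν)).const_mul (KY * (2 * Kf))).add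
          ((tendsto_one_add_rpow hη0).const_mul (KY * (KH * KL * ‖y - x₀‖)))
      refine squeeze_zero_norm' ?_ hz
      filter_upwards [eventually_ge_atTop 0] with s hs
      have h1s : 0 < 1 + s := by linarith
      have hw : ∀ u : ℝ, 0 ≤ (1 + s) ^ u := fun u => Real.rpow_nonneg h1s.le u
      have hgs : ‖g y s‖ ≤ 2 * Kf * (1 + s) ^ (-(j / ν)) +
          KH * KL * ‖y - x₀‖ * (1 + s) ^ (-((j - 1 + rate a b A) / ν)) := by
        have i1 := norm_sub_le (f (φ s y) - f (φ s x₀)) (H (φ s x₀) (φ s y - φ s x₀))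
        have i2 := norm_sub_le (f (φ s y)) (f (φ s x₀))
        have i3 : ‖H (φ s x₀) (φ s y - φ s x₀)‖ ≤
            KH * KL * ‖y - x₀‖ * (1 + s) ^ (-((j - 1 + rate a b A) / ν)) := by
          calc _ ≤ _ := ContinuousLinearMap.le_opNorm _ _
            _ ≤ (KH * (1 + s) ^ (-((j - 1) / ν))) *
                (KL * (1 + s) ^ (-(rate a b A / ν)) * ‖y - x₀‖) :=
              mul_le_mul (bH s hs) (hlip x₀ (mem_ball_self hr) y yr s hs) (norm_nonneg _)
                (mul_nonneg hKH.le (hw _))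
            _ = _ := by rw [← hpw s hs (j - 1) (rate a b A) _ rfl]; ring
        have i4 : ‖g y s‖ ≤ _ := i1
        linarith [yf s hs, bf₀ s hs]
      calc _ ≤ _ := ContinuousLinearMap.le_opNorm _ _
        _ ≤ (KY * (1 + s) ^ (-(rate a b B / ν))) * _ :=
          mul_le_mul (bY s hs) hgs (norm_nonneg _) (mul_nonneg hKY.le (hw _))
        _ = KY * (2 * Kf) * ((1 + s) ^ (-(rate a b B / ν)) * (1 + s) ^ (-(j / ν))) +
            KY * (KH * KL * ‖y - x₀‖) * ((1 + s) ^ (-(rate a b B / ν)) *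
              (1 + s) ^ (-((j - 1 + rate a b A) / ν))) := by ring
        _ = _ := by
          rw [hpw s hs (rate a b B) j (j + rate a b B) (by ring),
            hpw s hs (rate a b B) (j - 1 + rate a b A) (j - 1 + rate a b B + rate a b A) (by ring)]
    have hlim3 := hlim1.sub (intervalIntegral_tendsto_integral_Ioi 0 hint tendsto_id)
    rw [zero_sub] at hlim3
    refine tendsto_nhds_unique (tendsto_const_nhds.congr' ?_) hlim3
    filter_upwards [eventually_ge_atTop 0] with s hs
    exact (hconst s hs).symm
  -- The source is of smaller order than `y - x₀` at each time, and dominated.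
  have hRo : ∀ t, 0 ≤ t → (fun y => Y t (R y t)) =o[𝓝 x₀] fun y => y - x₀ := by
    intro t ht
    have oQ := h.remainder_isLittleO hQ hx₀ ht
    have oT := h.remainder_isLittleO hT hx₀ ht
    have op := h.remainder_isLittleO h.contDiffOn hx₀ ht
    have o1 : (fun y => rQ y t (f (φ t x₀))) =o[𝓝 x₀] fun y => y - x₀ :=
      ((ContinuousLinearMap.apply ℝ F (f (φ t x₀))).isBigO_comp _ _).trans_isLittleO oQ
    have o2 : (fun y => (Q (φ t y) - Q (φ t x₀)) (f (φ t y) - f (φ t x₀))) =o[𝓝 x₀]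
        fun y => y - x₀ := by
      have b1 : (fun y => Q (φ t y) - Q (φ t x₀)) =O[𝓝 x₀] fun y => y - x₀ :=
        ((h.differentiableAt hQ (h.flow_mem hx₀ ht)).isBigO_sub.comp_tendsto
          (h.flow_continuousAt hx₀ ht)).trans (h.flow_isBigO hx₀ ht)
      have b2 : (fun y => f (φ t y) - f (φ t x₀)) =o[𝓝 x₀] fun _ => (1 : ℝ) := by
        rw [Asymptotics.isLittleO_one_iff]
        have := (ContinuousAt.comp (f := φ t) (g := f) (hsol.cont.continuousAt
          (h.isOpen.mem_nhds (h.flow_mem hx₀ ht))) (h.flow_continuousAt hx₀ ht)).tendsto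
        simpa using this.sub_const (f (φ t x₀))
      have b3 := b1.norm_norm.mul_isLittleO b2.norm_norm
      refine Asymptotics.IsLittleO.of_norm_right ?_
      refine Asymptotics.IsBigO.trans_isLittleO (Asymptotics.isBigO_of_le _ fun y => ?_)
        (b3.congr_right fun y => by simp : _ =o[𝓝 x₀] fun y => ‖y - x₀‖)
      rw [Real.norm_of_nonneg (by positivity)]
      exact ContinuousLinearMap.le_opNorm _ _
    have o4 : (fun y => H (φ t x₀) (rp y t)) =o[𝓝 x₀] fun y => y - x₀ :=
      ((H (φ t x₀)).isBigO_comp _ _).trans_isLittleO op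
    exact ((Y t).isBigO_comp _ _).trans_isLittleO (((o1.add o2).add oT).sub o4)
  have hlim : Tendsto (fun y => ∫ t in Ioi (0 : ℝ), ‖y - x₀‖⁻¹ • Y t (R y t)) (𝓝 x₀)
      (𝓝 (∫ t in Ioi (0 : ℝ), (0 : F))) := by
    refine tendsto_integral_filter_of_dominated_convergence (fun t => K * (1 + t) ^ (-(1 + η)))
      ?_ ?_ ((integrableOn_one_add_rpow hη0).const_mul K) ?_
    · filter_upwards [h.eventually_mem hx₀] with y hy
      exact (aestronglyMeasurable_of_continuousOn_Ici (hRcont y hy)).const_smul _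
    · filter_upwards [bR] with y hy
      filter_upwards [ae_restrict_mem measurableSet_Ioi] with t ht
      have ht : 0 < t := ht
      rw [norm_smul, norm_inv, norm_norm, inv_mul_eq_div]
      refine div_le_of_le_mul₀ (norm_nonneg _) ?_ (hy t ht.le)
      exact mul_nonneg hK.le (Real.rpow_nonneg (by linarith) _)
    · filter_upwards [ae_restrict_mem measurableSet_Ioi] with t ht
      have := (hRo t (le_of_lt ht)).norm_right.tendsto_inv_smul_nhds_zero
      simpa using this
  rw [integral_zero] at hlim
  rw [hasFDerivAt_iff_isLittleO]
  have hgo : (fun y => g y 0) =o[𝓝 x₀] fun y => y - x₀ := by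
    rw [← Asymptotics.isLittleO_norm_right, ← Asymptotics.isLittleO_norm_left]
    have hlim' : Tendsto (fun y => ‖g y 0‖ / ‖y - x₀‖) (𝓝 x₀) (𝓝 0) := by
      have := hlim.norm
      rw [norm_zero] at this
      refine this.congr' ?_
      filter_upwards [hgint] with y hy
      rw [integral_smul, norm_smul, hy, norm_neg, norm_inv, norm_norm, inv_mul_eq_div]
    refine (Asymptotics.isLittleO_iff_tendsto fun y hy => ?_).2 hlim'
    rw [norm_eq_zero, sub_eq_zero] at hy
    simp [g, hy]
  refine hgo.congr' ?_ EventuallyEq.rfl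
  filter_upwards [h.eventually_mem hx₀] with y hy
  simp only [g, h.flow_zero y hy, h.flow_zero x₀ hx₀]

end

end IsConeFlow

namespace IsConeFlow

/-! ### Higher regularity of the integral solution -/

section Regularity

universe u v

variable {E : Type u} [NormedAddCommGroup E] [NormedSpace ℝ E]
  {W Z : Set E} {p : E → E} {φ : ℝ → E → E} {ν : ℕ} {a b A : ℝ}

theorem contDiffOn_derivCoeff {F : Type v} [NormedAddCommGroup F] [NormedSpace ℝ F]
    {Q : E → F →L[ℝ] F} {k : WithTop ℕ∞} (hQ : ContDiffOn ℝ k Q W)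
    (hp : ContDiffOn ℝ k (fderiv ℝ p) W) : ContDiffOn ℝ k (derivCoeff p Q) W := by
  have h1 : ContDiff ℝ k fun R : F →L[ℝ] F => ContinuousLinearMap.compL ℝ E F F R :=
    ContinuousLinearMap.contDiff (E := F →L[ℝ] F) (F := (E →L[ℝ] F) →L[ℝ] E →L[ℝ] F) _
  have h2 : ContDiff ℝ k fun R : E →L[ℝ] E => (ContinuousLinearMap.compL ℝ E E F).flip R :=
    ContinuousLinearMap.contDiff (E := E →L[ℝ] E) (F := (E →L[ℝ] F) →L[ℝ] E →L[ℝ] F) _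
  have h3 := h1.comp_contDiffOn hQ
  have h4 := h2.comp_contDiffOn hp
  exact ContDiffOn.sub h3 h4

theorem contDiffOn_derivRhs {F : Type v} [NormedAddCommGroup F] [NormedSpace ℝ F]
    {Q : E → F →L[ℝ] F} {T f : E → F} {k : WithTop ℕ∞} (hQ : ContDiffOn ℝ k (fderiv ℝ Q) W)
    (hT : ContDiffOn ℝ k (fderiv ℝ T) W) (hf : ContDiffOn ℝ k f W) :
    ContDiffOn ℝ k (derivRhs Q T f) W := by
  have h1 : ContDiff ℝ k fun R : E →L[ℝ] F →L[ℝ] F => ContinuousLinearMap.flipₗᵢ ℝ E F F R :=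
    LinearIsometryEquiv.contDiff (E := E →L[ℝ] F →L[ℝ] F) (F := F →L[ℝ] E →L[ℝ] F) _
  exact hT.add ((h1.comp_contDiffOn hQ).clm_apply hf)

variable [FiniteDimensional ℝ E]

/-- The inductive step for the regularity of the integral solution: its derivative solves the
differentiated equation, whose data lose one derivative. -/
theorem contDiffOn_cohIntegral_succ {F : Type v} [NormedAddCommGroup F] [NormedSpace ℝ F]
    [CompleteSpace F] {Q : E → F →L[ℝ] F} {T : E → F} {B j : ℝ} {k : ℕ}
    (h : IsConeFlow W Z p φ ν a b A) (hd : IsCohData W Z ν Q T B j)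
    (hp : ContDiffOn ℝ (k + 1 : ℕ) p W)
    (hQ : ContDiffOn ℝ (k + 1 : ℕ) Q W) (hT : ContDiffOn ℝ (k + 1 : ℕ) T W)
    (hj : 0 < j + rate a b B) (hj' : 0 < j + rate a b B - (k + 1 : ℕ) * (1 - rate a b A))
    (ih : 0 < j + rate a b B - k * (1 - rate a b A) → ContDiffOn ℝ k (cohIntegral Q T φ) W)
    (ih' : ∀ (Q' : E → (E →L[ℝ] F) →L[ℝ] (E →L[ℝ] F)) (T' : E → E →L[ℝ] F) (B' j' : ℝ),
      IsCohData W Z ν Q' T' B' j' → ContDiffOn ℝ k Q' W → ContDiffOn ℝ k T' W →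
      0 < j' + rate a b B' → 0 < j' + rate a b B' - k * (1 - rate a b A) →
      ContDiffOn ℝ k (cohIntegral Q' T' φ) W) :
    ContDiffOn ℝ (k + 1 : ℕ) (cohIntegral Q T φ) W := by
  have hadd := rate_add_le h.a_pos h.a_le_b B A
  push_cast at hj'
  have hk : (0 : ℝ) ≤ k := k.cast_nonneg
  have hone : (1 : WithTop ℕ∞) ≤ (k + 1 : ℕ) := by exact_mod_cast Nat.le_add_left 1 k
  have hj1 : 0 < j - 1 + rate a b B + rate a b A := by
    rcases le_total (1 - rate a b A) 0 with hs | hs <;> nlinarith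
  have hjk : 0 < j + rate a b B - k * (1 - rate a b A) := by
    rcases le_total (1 - rate a b A) 0 with hs | hs <;> nlinarith
  have hs := h.isFlowSol_cohIntegral hd hj
  have hQ1 := hQ.of_le hone
  have hT1 := hT.of_le hone
  have hd' := h.isCohData_deriv hd hQ1 hT1 hs.cont hs.homog
  have hle : ((k : ℕ) : WithTop ℕ∞) ≤ (k + 1 : ℕ) := by exact_mod_cast k.le_succ
  have dp := hp.fderiv_of_isOpen (m := (k : ℕ)) h.isOpen (by norm_cast)
  have dQ := hQ.fderiv_of_isOpen (m := (k : ℕ)) h.isOpen (by norm_cast)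
  have dT := hT.fderiv_of_isOpen (m := (k : ℕ)) h.isOpen (by norm_cast)
  have hD := fun x (hx : x ∈ W) => h.hasFDerivAt_cohIntegral hd hQ1 hT1 hj hj1 hx
  have cQ' := contDiffOn_derivCoeff (hQ.of_le hle) dp
  have cT' := contDiffOn_derivRhs dQ dT (ih hjk)
  have hH := ih' _ _ _ _ hd' cQ' cT' (by linarith) (by linarith)
  push_cast
  rw [contDiffOn_succ_iff_fderiv_of_isOpen h.isOpen]
  refine ⟨fun x hx => (hD x hx).differentiableAt.differentiableWithinAt, by simp, ?_⟩
  exact hH.congr fun x hx => (hD x hx).fderiv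

/-- Smoothness of the integral solution for values in a universe large enough that the
derivatives, which take values in `E →L[ℝ] F`, live there too, so that induction applies. -/
theorem contDiffOn_cohIntegral_max {F : Type (max u v)} [NormedAddCommGroup F] [NormedSpace ℝ F]
    [CompleteSpace F] {Q : E → F →L[ℝ] F} {T : E → F} {B j : ℝ} {k : ℕ}
    (h : IsConeFlow W Z p φ ν a b A) (hd : IsCohData W Z ν Q T B j)
    (hp : ContDiffOn ℝ k p W) (hQ : ContDiffOn ℝ k Q W) (hT : ContDiffOn ℝ k T W)
    (hj : 0 < j + rate a b B) (hj' : 0 < j + rate a b B - k * (1 - rate a b A)) :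
    ContDiffOn ℝ k (cohIntegral Q T φ) W := by
  induction k generalizing F B j with
  | zero => exact contDiffOn_zero.2 (h.isFlowSol_cohIntegral hd hj).cont
  | succ k ih =>
    have hle : ((k : ℕ) : WithTop ℕ∞) ≤ (k + 1 : ℕ) := by exact_mod_cast k.le_succ
    exact h.contDiffOn_cohIntegral_succ hd hp hQ hT hj hj'
      (ih hd (hp.of_le hle) (hQ.of_le hle) (hT.of_le hle) hj)
      fun Q' T' B' j' hd' hQ' hT' => ih hd' (hp.of_le hle) hQ' hT'

/-- The integral solution is as smooth as the data as long as each derivative lowers the margin of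
convergence by `1 - rate a b A` without exhausting it. -/
theorem contDiffOn_cohIntegral {F : Type v} [NormedAddCommGroup F] [NormedSpace ℝ F]
    [CompleteSpace F] {Q : E → F →L[ℝ] F} {T : E → F} {B j : ℝ} {k : ℕ}
    (h : IsConeFlow W Z p φ ν a b A) (hd : IsCohData W Z ν Q T B j)
    (hp : ContDiffOn ℝ k p W) (hQ : ContDiffOn ℝ k Q W) (hT : ContDiffOn ℝ k T W)
    (hj : 0 < j + rate a b B) (hj' : 0 < j + rate a b B - k * (1 - rate a b A)) :
    ContDiffOn ℝ k (cohIntegral Q T φ) W := by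
  induction k with
  | zero => exact contDiffOn_zero.2 (h.isFlowSol_cohIntegral hd hj).cont
  | succ k ih =>
    have hle : ((k : ℕ) : WithTop ℕ∞) ≤ (k + 1 : ℕ) := by exact_mod_cast k.le_succ
    -- The derivative takes values in a space of the larger universe, where the result is known.
    exact h.contDiffOn_cohIntegral_succ hd hp hQ hT hj hj'
      (ih (hp.of_le hle) (hQ.of_le hle) (hT.of_le hle))
      fun Q' T' B' j' hd' hQ' hT' =>
        contDiffOn_cohIntegral_max.{u, v} h hd' (hp.of_le hle) hQ' hT'

end Regularity

end IsConeFlow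

/-! ### Cones that perturbed trajectories cannot leave -/

/-- The curve `y` satisfies `y' = p y` on `[0, τ]` up to an error `ε ‖y‖ ^ (ν + 1)`. -/
def PseudoOrbit {E : Type*} [NormedAddCommGroup E] [NormedSpace ℝ E] (p : E → E) (ν : ℕ)
    (ε τ : ℝ) (y : ℝ → E) : Prop :=
  ContinuousOn y (Icc 0 τ) ∧ ∀ t ∈ Ico 0 τ, ∃ v, HasDerivWithinAt y v (Ici t) t ∧
    ‖v - p (y t)‖ ≤ ε * ‖y t‖ ^ (ν + 1)

namespace PseudoOrbit

variable {E : Type*} [NormedAddCommGroup E] [NormedSpace ℝ E] {p : E → E} {ν : ℕ} {ε τ : ℝ}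
  {y : ℝ → E}

theorem mono (h : PseudoOrbit p ν ε τ y) {ε' τ' : ℝ} (hε : ε ≤ ε') (hτ : τ' ≤ τ) :
    PseudoOrbit p ν ε' τ' y := by
  refine ⟨h.1.mono (Icc_subset_Icc_right hτ), fun t ht => ?_⟩
  obtain ⟨v, hv, hvp⟩ := h.2 t ⟨ht.1, ht.2.trans_le hτ⟩
  exact ⟨v, hv, hvp.trans (by gcongr)⟩

theorem of_solOn {D : Set E} (h : SolOn (fun _ => p) D (Icc 0 τ) y) (hε : 0 ≤ ε) :
    PseudoOrbit p ν ε τ y := by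
  refine ⟨h.continuousOn, fun t ht => ⟨_, h.hasDerivWithinAt_Ici_of_Icc ht, ?_⟩⟩
  rw [sub_self, norm_zero]
  positivity

theorem shift (h : PseudoOrbit p ν ε τ y) {t₀ : ℝ} (ht₀ : 0 ≤ t₀) :
    PseudoOrbit p ν ε (τ - t₀) (fun t => y (t₀ + t)) := by
  refine ⟨h.1.comp (by fun_prop) fun t ht => ⟨by linarith [ht.1], by linarith [ht.2]⟩,
    fun t ht => ?_⟩
  obtain ⟨v, hv, hvp⟩ := h.2 (t₀ + t) ⟨by linarith [ht.1], by linarith [ht.2]⟩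
  refine ⟨v, ?_, hvp⟩
  have h1 : HasDerivWithinAt (fun t => t₀ + t) 1 (Ici t) t :=
    (hasDerivWithinAt_id t _).const_add t₀
  have h2 := HasDerivWithinAt.scomp (h := fun t => t₀ + t) t hv h1
    fun s hs => add_le_add_right hs t₀
  rw [one_smul] at h2
  exact h2

/-- Perturbed trajectories of a homogeneous field are rescaled to such trajectories. -/
theorem rescale (hp : ∀ x, ∀ c : ℝ, 0 < c → p (c • x) = c ^ (ν + 1) • p x)
    (h : PseudoOrbit p ν ε τ y) {c : ℝ} (hc : 0 < c) :
    PseudoOrbit p ν ε (τ / c ^ ν) (fun t => c • y (c ^ ν * t)) := by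
  have hcν : 0 < c ^ ν := pow_pos hc ν
  refine ⟨(h.1.comp (by fun_prop) fun t ht => ⟨?_, ?_⟩).const_smul c, fun t ht => ?_⟩
  · have := ht.1; positivity
  · have := (le_div_iff₀ hcν).1 ht.2; linarith
  have hlt := (lt_div_iff₀ hcν).1 ht.2
  obtain ⟨v, hv, hvp⟩ := h.2 (c ^ ν * t) ⟨by have := ht.1; positivity, by linarith⟩
  have h1 : HasDerivWithinAt (fun t => c ^ ν * t) (c ^ ν) (Ici t) t := by
    simpa using (hasDerivWithinAt_id t (Ici t)).const_mul (c ^ ν)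
  have h2 := (HasDerivWithinAt.scomp (h := fun t => c ^ ν * t) t hv h1
    fun s hs => mul_le_mul_of_nonneg_left hs hcν.le).const_smul c
  refine ⟨_, h2, ?_⟩
  rw [hp _ c hc, smul_smul, ← pow_succ', ← smul_sub, norm_smul, norm_smul,
    Real.norm_of_nonneg (by positivity), Real.norm_of_nonneg hc.le, mul_pow]
  calc c ^ (ν + 1) * ‖v - p (y (c ^ ν * t))‖ ≤ c ^ (ν + 1) * (ε * ‖y (c ^ ν * t)‖ ^ (ν + 1)) := by
        gcongr
    _ = _ := by ring

/-- A perturbed trajectory approaches the origin at most exponentially fast. -/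
theorem exp_le_norm (h : PseudoOrbit p ν ε τ y) {K R : ℝ} (hK : 0 ≤ K) (hε : 0 ≤ ε)
    (hp : ∀ x, ‖p x‖ ≤ K * ‖x‖ ^ (ν + 1)) (h0 : y 0 ≠ 0) (hR : ∀ t ∈ Icc 0 τ, ‖y t‖ ≤ R) :
    ∀ t ∈ Icc 0 τ, ‖y 0‖ * Real.exp (-(((K + ε) * R ^ ν + 1) * t)) ≤ ‖y t‖ := by
  choose! v hv hvp using h.2
  have hpos := norm_pos_iff.2 h0
  set k := (K + ε) * R ^ ν with hk
  have := le_of_diniLe_of_lt (f := fun t => -‖y t‖) (f' := fun t => k * ‖y t‖)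
    (B := fun t => -(‖y 0‖ * Real.exp (-((k + 1) * t))))
    (B' := fun t => (k + 1) * (‖y 0‖ * Real.exp (-((k + 1) * t)))) (a := 0) (b := τ)
    h.1.norm.neg (fun t ht => ?_) (by simp) (by fun_prop) (fun t ht => ?_) (fun t ht he => ?_)
  · intro t ht
    have := this t ht
    linarith
  · refine (diniLe_neg_norm_of_norm_le (hv t ht) le_rfl).mono ?_
    have h1 : ‖v t‖ ≤ (K + ε) * ‖y t‖ ^ (ν + 1) := by
      have h2 := norm_add_le (v t - p (y t)) (p (y t))
      rw [sub_add_cancel] at h2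
      linarith [hvp t ht, hp (y t)]
    refine h1.trans ?_
    rw [pow_succ, hk, ← mul_assoc]
    gcongr
    exact hR t ⟨ht.1, ht.2.le⟩
  · have h1 : HasDerivAt (fun t => -((k + 1) * t)) (-(k + 1)) t := by
      simpa using ((hasDerivAt_id t).const_mul (k + 1)).fun_neg
    refine ((h1.exp.const_mul ‖y 0‖).neg.congr_deriv ?_).hasDerivWithinAt
    ring
  · have he' : ‖y t‖ = ‖y 0‖ * Real.exp (-((k + 1) * t)) := by linarith
    rw [← he']
    have : 0 < ‖y t‖ := he' ▸ by positivity
    linarith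

end PseudoOrbit

section Euler

variable {E : Type*} [NormedAddCommGroup E] [NormedSpace ℝ E] {p : E → E} {ν : ℕ}
  {V : Set E} {ρ C K : ℝ}

/-- If `x ↦ x + p x` maps `V ∩ B_ρ` into itself with some room, then perturbed trajectories stay in
the cone generated by `V`: the curve sampled with step `s` and scaled by `s ^ (1 / ν)` is, up to the
room, an orbit of that map. -/
theorem mem_posCone_of_pseudoOrbit (hν : 0 < ν) (hVs : ∀ x ∈ V, ∀ c : ℝ, 0 < c → c ≤ 1 → c • x ∈ V)
    (hV0 : (0 : E) ∉ V) (hpc : Continuous p)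
    (hp : ∀ x, ∀ c : ℝ, 0 < c → p (c • x) = c ^ (ν + 1) • p x)
    (hK : 0 ≤ K) (hpK : ∀ x, ‖p x‖ ≤ K * ‖x‖ ^ (ν + 1)) (hC : 0 < C) (hρ : 0 < ρ)
    (h2 : ∀ x ∈ trunc V ρ, C * ‖x‖ ^ (ν + 1) ≤ infDist (x + p x) (trunc V ρ)ᶜ)
    {τ : ℝ} (hτ : 0 ≤ τ) {y : ℝ → E} (hy : PseudoOrbit p ν (C / 2) τ y) (h0 : y 0 ∈ posCone V) :
    y τ ∈ posCone V := by
  rcases hτ.eq_or_lt with rfl | hτ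
  · exact h0
  obtain ⟨s₀, hs₀, hs₀V⟩ := h0
  have hy0 : y 0 ≠ 0 := fun h => hV0 (by rwa [h, smul_zero] at hs₀V)
  obtain ⟨R, hR⟩ := isCompact_Icc.exists_bound_of_continuousOn hy.1
  have hlow := hy.exp_le_norm hK (by positivity) hpK hy0 hR
  obtain ⟨t₁, ht₁, hmin⟩ := isCompact_Icc.exists_isMinOn (nonempty_Icc.2 hτ.le) hy.1.norm
  set μ := ‖y t₁‖ with hμ
  have hμ0 : 0 < μ := lt_of_lt_of_le (by have := norm_pos_iff.2 hy0; positivity) (hlow t₁ ht₁)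
  have hmin : ∀ t ∈ Icc 0 τ, μ ≤ ‖y t‖ := fun t ht => hmin ht
  set η := C * μ ^ (ν + 1) / (4 * (C / 2 + 1)) with hη
  have hη0 : 0 < η := by positivity
  have hηe : C / 2 * η + η = C * μ ^ (ν + 1) / 4 := by rw [hη]; field_simp
  have huc := isCompact_Icc.uniformContinuousOn_of_continuous
    ((hpc.comp_continuousOn hy.1).prodMk (hy.1.norm.pow (ν + 1)))
  obtain ⟨δ, hδ, hδu⟩ := Metric.uniformContinuousOn_iff.1 huc η hη0
  have hstep : Tendsto (fun k : ℕ => τ / ((k : ℝ) + 1)) atTop (𝓝 0) :=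
    tendsto_const_nhds.div_atTop (tendsto_natCast_atTop_atTop.atTop_add tendsto_const_nhds)
  have hν' : (0 : ℝ) < 1 / ν := by positivity
  have hscale : Tendsto (fun k : ℕ => (τ / ((k : ℝ) + 1)) ^ (1 / (ν : ℝ))) atTop (𝓝 0) := by
    have := hstep.rpow_const (p := 1 / (ν : ℝ)) (Or.inr hν'.le)
    rwa [Real.zero_rpow hν'.ne'] at this
  have hsc2 := hscale.mul_const ‖y 0‖
  rw [zero_mul] at hsc2
  obtain ⟨k, hk1, hk2, hk3⟩ := ((hstep.eventually_lt_const hδ).and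
    ((hscale.eventually_lt_const hs₀).and (hsc2.eventually_lt_const hρ))).exists
  set s := τ / ((k : ℝ) + 1) with hs
  set l := s ^ (1 / (ν : ℝ)) with hl
  have hs0 : 0 < s := by positivity
  have hl0 : 0 < l := Real.rpow_pos_of_pos hs0 _
  have hls : l ^ ν = s := by
    rw [hl, ← Real.rpow_natCast, ← Real.rpow_mul hs0.le, one_div_mul_cancel (by positivity),
      Real.rpow_one]
  have hks : ((k + 1 : ℕ) : ℝ) * s = τ := by rw [hs]; push_cast; field_simp
  choose! v hv hvp using hy.2
  have key : ∀ i : ℕ, i ≤ k + 1 → l • y (i * s) ∈ trunc V ρ := by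
    intro i
    induction i with
    | zero =>
      intro _
      rw [Nat.cast_zero, zero_mul]
      refine ⟨?_, ?_⟩
      · have := hVs _ hs₀V (l / s₀) (by positivity) ((div_le_one hs₀).2 hk2.le)
        rwa [smul_smul, div_mul_cancel₀ _ hs₀.ne'] at this
      · rwa [mem_ball_zero_iff, norm_smul, Real.norm_of_nonneg hl0.le]
    | succ i ih =>
      intro hi
      have ih := ih (by omega)
      have hiτ : ((i : ℝ) + 1) * s ≤ τ := by
        rw [← hks]
        gcongr
        exact_mod_cast hi
      push_cast
      set t := (i : ℝ) * s with ht
      have ht0 : 0 ≤ t := by positivity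
      have hte : ((i : ℝ) + 1) * s = t + s := by ring
      rw [hte] at hiτ ⊢
      have htI : t ∈ Icc 0 τ := ⟨ht0, by linarith⟩
      have hest : ‖y (t + s) - y t - s • p (y t)‖ ≤ 3 / 4 * C * ‖y t‖ ^ (ν + 1) * s := by
        have hd : ∀ u ∈ Ico t (t + s), HasDerivWithinAt (fun u => y u - (u - t) • p (y t))
            (v u - p (y t)) (Ici u) u := by
          intro u hu
          have h1 : HasDerivWithinAt (fun u : ℝ => (u - t) • p (y t)) ((1 : ℝ) • p (y t)) (Ici u) u :=
            ((hasDerivWithinAt_id u _).sub_const t).smul_const _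
          rw [one_smul] at h1
          exact (hv u ⟨by linarith [hu.1], by linarith [hu.2]⟩).sub h1
        have hb : ∀ u ∈ Ico t (t + s), ‖v u - p (y t)‖ ≤ 3 / 4 * C * ‖y t‖ ^ (ν + 1) := by
          intro u hu
          have huI : u ∈ Icc 0 τ := ⟨by linarith [hu.1], by linarith [hu.2]⟩
          have hdu := hδu u huI t htI (by
            rw [Real.dist_eq, abs_of_nonneg (by linarith [hu.1])]; linarith [hu.2])
          rw [Prod.dist_eq, max_lt_iff] at hdu
          have e1 : ‖p (y u) - p (y t)‖ < η := by rw [← dist_eq_norm]; exact hdu.1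
          have e2 : ‖y u‖ ^ (ν + 1) ≤ ‖y t‖ ^ (ν + 1) + η := by
            have := hdu.2
            rw [Real.dist_eq] at this
            simp only [Pi.pow_apply] at this
            linarith [(abs_lt.1 this).2]
          have e3 := hvp u ⟨huI.1, by linarith [hu.2]⟩
          have e4 := norm_add_le (v u - p (y u)) (p (y u) - p (y t))
          rw [sub_add_sub_cancel] at e4
          have e5 : μ ^ (ν + 1) ≤ ‖y t‖ ^ (ν + 1) := pow_le_pow_left₀ hμ0.le (hmin t htI) _
          nlinarith
        have := norm_image_sub_le_of_norm_deriv_right_le_segment (a := t) (b := t + s)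
          (f := fun u => y u - (u - t) • p (y t))
          ((hy.1.mono (Icc_subset_Icc ht0 hiτ)).sub (by fun_prop)) hd hb (t + s)
          ⟨by linarith, le_rfl⟩
        simp only [sub_self, zero_smul, sub_zero, add_sub_cancel_left] at this
        rwa [sub_right_comm] at this
      have h3 := h2 _ ih
      by_contra hcon
      have h4 := infDist_le_dist_of_mem (x := l • y t + p (l • y t)) (mem_compl hcon)
      have h5 : dist (l • y t + p (l • y t)) (l • y (t + s)) =
          l * ‖y (t + s) - y t - s • p (y t)‖ := by
        rw [dist_comm, dist_eq_norm, hp _ l hl0, pow_succ', hls, mul_smul, ← smul_add, ← smul_sub,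
          norm_smul, Real.norm_of_nonneg hl0.le, sub_sub]
      rw [h5] at h4
      have h6 : ‖l • y t‖ ^ (ν + 1) = l * s * ‖y t‖ ^ (ν + 1) := by
        rw [norm_smul, mul_pow, Real.norm_of_nonneg hl0.le, pow_succ' l, hls]
      rw [h6] at h3
      have h7 : l * ‖y (t + s) - y t - s • p (y t)‖ ≤ l * (3 / 4 * C * ‖y t‖ ^ (ν + 1) * s) := by
        gcongr
      have h8 : 0 < C * (l * s * ‖y t‖ ^ (ν + 1)) := by
        have := hμ0.trans_le (hmin t htI)
        positivity
      nlinarith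
  have := (key (k + 1) le_rfl).1
  rw [hks] at this
  exact ⟨l, hl0, this⟩

end Euler

/-- A continuous function, homogeneous of positive degree `d` for positive factors, is of size
`O(‖x‖ ^ d)`. -/
theorem exists_norm_le_of_homog {E G : Type*} [NormedAddCommGroup E] [NormedSpace ℝ E]
    [FiniteDimensional ℝ E] [NormedAddCommGroup G] [NormedSpace ℝ G] {f : E → G} {d : ℕ} (hd : d ≠ 0)
    (hf : Continuous f) (hfd : ∀ x, ∀ c : ℝ, 0 < c → f (c • x) = c ^ d • f x) :
    ∃ K, 0 ≤ K ∧ ∀ x, ‖f x‖ ≤ K * ‖x‖ ^ d := by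
  have : ProperSpace E := FiniteDimensional.proper_real E
  obtain ⟨K, hK⟩ := (isCompact_sphere (0 : E) 1).exists_bound_of_continuousOn hf.continuousOn
  refine ⟨max K 0, le_max_right _ _, fun x => ?_⟩
  rcases eq_or_ne x 0 with rfl | hx
  · have h1 := hfd 0 2 two_pos
    rw [smul_zero] at h1
    have h2 : ((1 : ℝ) - 2 ^ d) • f 0 = 0 := by rw [sub_smul, one_smul, ← h1, sub_self]
    have h3 : (1 : ℝ) - 2 ^ d ≠ 0 := (sub_neg.2 (one_lt_pow₀ one_lt_two hd)).ne
    rw [(smul_eq_zero.1 h2).resolve_left h3, norm_zero]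
    positivity
  · have hx' := norm_pos_iff.2 hx
    have h1 := hfd (‖x‖⁻¹ • x) ‖x‖ hx'
    rw [smul_smul, mul_inv_cancel₀ hx'.ne', one_smul] at h1
    have h2 := hK (‖x‖⁻¹ • x) (by simp [norm_smul, hx'.ne'])
    rw [h1, norm_smul, norm_pow, norm_norm, mul_comm]
    gcongr
    exact h2.trans (le_max_left _ _)

/-- A field `p`, homogeneous of degree `ν + 1`, and an open cone `W` on which the norm decays along
trajectories and which the trajectories perturbed by at most `C ‖x‖ ^ (ν + 1)` do not leave. -/
structure IsRobustCone {E : Type*} [NormedAddCommGroup E] [NormedSpace ℝ E] (W : Set E) (p : E → E)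
    (ν : ℕ) (a C : ℝ) : Prop where
  nu_pos : 0 < ν
  isOpen : IsOpen W
  smul_mem : ∀ x ∈ W, ∀ c : ℝ, 0 < c → c • x ∈ W
  zero_notMem : (0 : E) ∉ W
  contDiff : ContDiff ℝ 1 p
  homog : ∀ x, ∀ c : ℝ, 0 < c → p (c • x) = c ^ (ν + 1) • p x
  a_pos : 0 < a
  C_pos : 0 < C
  invariant : ∀ τ, 0 ≤ τ → ∀ y, PseudoOrbit p ν C τ y → y 0 ∈ W → y τ ∈ W
  norm_decay : ∀ x ∈ W, ∀ᶠ s : ℝ in 𝓝[>] 0,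
    ‖x + s • p x‖ ≤ ‖x‖ + s * (-(a * ‖x‖ ^ (ν + 1)))

namespace IsRobustCone

variable {E : Type*} [NormedAddCommGroup E] [NormedSpace ℝ E]
  {W : Set E} {p : E → E} {ν : ℕ} {a C ε τ : ℝ} {y : ℝ → E}

theorem norm_pos (h : IsRobustCone W p ν a C) {x : E} (hx : x ∈ W) : 0 < ‖x‖ :=
  norm_pos_iff.2 fun h0 => h.zero_notMem (h0 ▸ hx)

theorem mem (h : IsRobustCone W p ν a C) (hy : PseudoOrbit p ν ε τ y) (hεC : ε ≤ C)
    (h0 : y 0 ∈ W) {t : ℝ} (ht : t ∈ Icc 0 τ) : y t ∈ W :=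
  h.invariant t ht.1 y (hy.mono hεC ht.2) h0

theorem norm_le (h : IsRobustCone W p ν a C) (hy : PseudoOrbit p ν ε τ y) (hεC : ε ≤ C)
    (hεa : ε ≤ a) (h0 : y 0 ∈ W) {t : ℝ} (ht : t ∈ Icc 0 τ) : ‖y t‖ ≤ ‖y 0‖ := by
  have := le_mul_exp_of_diniLe (g := fun t => ‖y t‖) (α := fun _ => 0) (P := fun _ => 0) ht.1
    (hy.1.norm.mono (Icc_subset_Icc_right ht.2)) (norm_nonneg _) (fun s hs => ?_)
    continuousOn_const (fun s _ => hasDerivWithinAt_const _ _ _)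
  · simpa using this
  have hs' : s ∈ Ico 0 τ := ⟨hs.1, hs.2.trans_le ht.2⟩
  obtain ⟨v, hv, hvp⟩ := hy.2 s hs'
  refine diniLe_norm hv fun ε' hε' => ?_
  filter_upwards [h.norm_decay (y s) (h.mem hy hεC h0 ⟨hs'.1, hs'.2.le⟩), self_mem_nhdsWithin]
    with r hr hr0
  have hr0 : 0 < r := hr0
  have h1 := norm_add_le (y s + r • p (y s)) (r • (v - p (y s)))
  rw [norm_smul, Real.norm_of_nonneg hr0.le, smul_sub, add_assoc, add_sub_cancel] at h1
  have h2 : r * ‖v - p (y s)‖ ≤ r * (a * ‖y s‖ ^ (ν + 1)) := by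
    gcongr
    exact hvp.trans (by gcongr)
  have := mul_pos hr0 hε'
  linarith

/-- Perturbing a trajectory by a small moving shift leaves it in the cone. -/
theorem add_mem (h : IsRobustCone W p ν a C) (hy : PseudoOrbit p ν ε τ y)
    (hεC : 2 ^ (ν + 2) * ε ≤ C) (hε : 0 ≤ ε) (hτ : 0 ≤ τ) {c L R δ : ℝ} {u w : E} (hc : 0 < c)
    (hlow : ∀ t ∈ Icc 0 τ, 2 * c ≤ ‖y t‖) (hL0 : 0 ≤ L)
    (hL : ∀ x z, ‖x‖ ≤ R → ‖z‖ ≤ R → ‖p x - p z‖ ≤ L * ‖x - z‖)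
    (hup : ∀ t ∈ Icc 0 τ, ‖y t‖ + δ ≤ R) (hu : ∀ t ∈ Icc 0 τ, ‖u + t • w‖ ≤ δ) (hδ : δ ≤ c)
    (hsmall : L * δ + ‖w‖ ≤ C / 2 * c ^ (ν + 1)) (h0 : y 0 + u ∈ W) :
    y τ + (u + τ • w) ∈ W := by
  refine h.invariant τ hτ (fun t => y t + (u + t • w)) ⟨?_, fun t ht => ?_⟩ (by simpa using h0)
  · exact hy.1.add (by fun_prop)
  obtain ⟨v, hv, hvp⟩ := hy.2 t ht
  have htI : t ∈ Icc 0 τ := ⟨ht.1, ht.2.le⟩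
  have hd : HasDerivWithinAt (fun t : ℝ => u + t • w) w (Ici t) t := by
    simpa using ((hasDerivWithinAt_id t (Ici t)).smul_const w).const_add u
  refine ⟨v + w, hv.add hd, ?_⟩
  have hut := hu t htI
  have hδ0 : 0 ≤ δ := (norm_nonneg _).trans hut
  have e1 : ‖y t‖ ≤ ‖y t + (u + t • w)‖ + δ := by
    have := norm_sub_le (y t + (u + t • w)) (u + t • w)
    rw [add_sub_cancel_right] at this
    linarith
  have e2 : c ≤ ‖y t + (u + t • w)‖ := by linarith [hlow t htI]
  have e3 : ‖p (y t) - p (y t + (u + t • w))‖ ≤ L * δ := by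
    refine (hL _ _ (by linarith [hup t htI]) ?_).trans ?_
    · exact (norm_add_le _ _).trans (by linarith [hup t htI])
    · rw [sub_add_cancel_left, norm_neg]
      gcongr
  have e4 : v + w - p (y t + (u + t • w)) =
      (v - p (y t)) + (p (y t) - p (y t + (u + t • w))) + w := by abel
  rw [e4]
  refine norm_add₃_le.trans ?_
  have e5 : ‖y t‖ ^ (ν + 1) ≤ 2 ^ (ν + 1) * ‖y t + (u + t • w)‖ ^ (ν + 1) := by
    rw [← mul_pow]
    gcongr
    linarith
  have e6 : c ^ (ν + 1) ≤ ‖y t + (u + t • w)‖ ^ (ν + 1) := by gcongr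
  have e7 : ε * ‖y t‖ ^ (ν + 1) ≤ C / 2 * ‖y t + (u + t • w)‖ ^ (ν + 1) := by
    calc _ ≤ ε * (2 ^ (ν + 1) * ‖y t + (u + t • w)‖ ^ (ν + 1)) := by gcongr
      _ = 2 ^ (ν + 2) * ε / 2 * ‖y t + (u + t • w)‖ ^ (ν + 1) := by ring
      _ ≤ _ := by gcongr
  have e8 : C / 2 * c ^ (ν + 1) ≤ C / 2 * ‖y t + (u + t • w)‖ ^ (ν + 1) := by
    have := h.C_pos
    gcongr
  linarith

variable [FiniteDimensional ℝ E]

theorem exists_norm_field_le (h : IsRobustCone W p ν a C) :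
    ∃ K, 0 ≤ K ∧ ∀ x, ‖p x‖ ≤ K * ‖x‖ ^ (ν + 1) :=
  exists_norm_le_of_homog (Nat.succ_ne_zero ν) h.contDiff.continuous h.homog

theorem exists_lipschitz_ball (h : IsRobustCone W p ν a C) (R : ℝ) :
    ∃ L, 0 ≤ L ∧ ∀ x z, ‖x‖ ≤ R → ‖z‖ ≤ R → ‖p x - p z‖ ≤ L * ‖x - z‖ := by
  have : ProperSpace E := FiniteDimensional.proper_real E
  obtain ⟨L, hL⟩ := (isCompact_closedBall (0 : E) R).exists_bound_of_continuousOn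
    (h.contDiff.continuous_fderiv one_ne_zero).continuousOn
  refine ⟨max L 0, le_max_right _ _, fun x z hx hz => ?_⟩
  refine (convex_closedBall (0 : E) R).norm_image_sub_le_of_norm_fderiv_le (𝕜 := ℝ)
    (fun w _ => (h.contDiff.differentiable one_ne_zero) w)
    (fun w hw => (hL w hw).trans (le_max_left _ _)) ?_ ?_
  · simpa using hz
  · simpa using hx

/-- Perturbed trajectories remain, during a bounded time, in a compact subset of the cone. -/
theorem exists_compact_confinement (h : IsRobustCone W p ν a C) (hε : 0 ≤ ε) (hεa : ε ≤ a)
    (hεC : 2 ^ (ν + 2) * ε ≤ C) {x : E} (hx : x ∈ W) {T : ℝ} :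
    ∃ K, IsCompact K ∧ K ⊆ W ∧ ∀ τ ∈ Icc 0 T, ∀ y, PseudoOrbit p ν ε τ y → y 0 = x → y τ ∈ K := by
  have : ProperSpace E := FiniteDimensional.proper_real E
  have hεC' : ε ≤ C := by
    have : (1 : ℝ) ≤ 2 ^ (ν + 2) := one_le_pow₀ one_le_two
    nlinarith
  have hx0 := h.norm_pos hx
  obtain ⟨K, hK0, hK⟩ := h.exists_norm_field_le
  set k := (K + ε) * ‖x‖ ^ ν + 1 with hk
  have hk0 : 0 ≤ k := by positivity
  set c := ‖x‖ * Real.exp (-(k * T)) / 2 with hc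
  have hc0 : 0 < c := by positivity
  obtain ⟨L, hL0, hL⟩ := h.exists_lipschitz_ball (‖x‖ + c)
  obtain ⟨r, hr, hrW⟩ := Metric.isOpen_iff.1 h.isOpen x hx
  set δ := min (min c (r / 2)) (C / 2 * c ^ (ν + 1) / (L + 1)) with hδ
  have hC := h.C_pos
  have hδ0 : 0 < δ := by positivity
  have hδc : δ ≤ c := (min_le_left _ _).trans (min_le_left _ _)
  have hδr : δ ≤ r / 2 := (min_le_left _ _).trans (min_le_right _ _)
  have hδL : (L + 1) * δ ≤ C / 2 * c ^ (ν + 1) := by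
    have := (le_div_iff₀ (by positivity : (0 : ℝ) < L + 1)).1
      (min_le_right (min c (r / 2)) (C / 2 * c ^ (ν + 1) / (L + 1)))
    linarith
  have hne : (Wᶜ).Nonempty := ⟨0, h.zero_notMem⟩
  refine ⟨closedBall 0 ‖x‖ ∩ {z | δ ≤ infDist z Wᶜ}, ?_, fun z hz => ?_, ?_⟩
  · exact (isCompact_closedBall _ _).inter_right
      (isClosed_le continuous_const (continuous_infDist_pt _))
  · by_contra hzW
    have := hz.2
    rw [mem_ofPred_eq, infDist_zero_of_mem (mem_compl hzW)] at this
    linarith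
  intro τ hτ y hy hy0
  have hyW : y 0 ∈ W := hy0 ▸ hx
  have hup : ∀ t ∈ Icc 0 τ, ‖y t‖ ≤ ‖x‖ := fun t ht => hy0 ▸ h.norm_le hy hεC' hεa hyW ht
  refine ⟨by simpa using hup τ ⟨hτ.1, le_rfl⟩, ?_⟩
  have hlow : ∀ t ∈ Icc 0 τ, 2 * c ≤ ‖y t‖ := by
    intro t ht
    refine le_trans ?_ (hy.exp_le_norm hK0 hε hK (by rw [hy0]; exact norm_pos_iff.1 hx0) hup t ht)
    rw [hc, hy0, mul_div_cancel₀ _ two_ne_zero, ← hk]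
    gcongr
    exact ht.2.trans hτ.2
  refine (le_infDist hne).2 fun z hz => ?_
  by_contra! hlt
  have hzn : ‖z - y τ‖ < δ := by rwa [← dist_eq_norm, dist_comm]
  have := h.add_mem hy hεC hε hτ.1 (u := z - y τ) (w := 0) hc0 hlow hL0 hL (δ := δ)
    (fun t ht => add_le_add (hup t ht) hδc) (fun t _ => by simpa using hzn.le) hδc
    (by rw [norm_zero]; nlinarith) ?_
  · rw [smul_zero, add_zero, add_sub_cancel] at this
    exact hz this
  · refine hrW ?_
    rw [hy0, mem_ball, dist_eq_norm, add_sub_cancel_left]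
    linarith

end IsRobustCone

/-- The points whose distance to the complement of the cone `W` is at least `κ` times their norm. -/
def coneZone {E : Type*} [NormedAddCommGroup E] (W : Set E) (κ : ℝ) : Set E :=
  {x | x ≠ 0 ∧ κ * ‖x‖ ≤ infDist x Wᶜ}

section coneZone

variable {E : Type*} [NormedAddCommGroup E] {W : Set E} {κ : ℝ}

theorem coneZone_subset (hκ : 0 < κ) : coneZone W κ ⊆ W := by
  intro x hx
  by_contra hxW
  have h1 := hx.2
  rw [infDist_zero_of_mem (mem_compl hxW)] at h1
  have := norm_pos_iff.2 hx.1
  nlinarith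

variable [NormedSpace ℝ E]

open Pointwise in
theorem infDist_compl_smul (hW : ∀ x ∈ W, ∀ c : ℝ, 0 < c → c • x ∈ W) (x : E) {c : ℝ} (hc : 0 < c) :
    infDist (c • x) Wᶜ = c * infDist x Wᶜ := by
  have hWc : c • Wᶜ = Wᶜ := by
    ext z
    rw [Set.mem_smul_set_iff_inv_smul_mem₀ hc.ne', mem_compl_iff, mem_compl_iff, not_iff_not]
    refine ⟨fun hz => ?_, fun hz => hW z hz _ (inv_pos.2 hc)⟩
    have := hW _ hz c hc
    rwa [smul_smul, mul_inv_cancel₀ hc.ne', one_smul] at this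
  have := infDist_smul₀ hc.ne' Wᶜ x
  rwa [hWc, Real.norm_of_nonneg hc.le] at this

theorem smul_mem_coneZone (hW : ∀ x ∈ W, ∀ c : ℝ, 0 < c → c • x ∈ W) {x : E} (hx : x ∈ coneZone W κ)
    {c : ℝ} (hc : 0 < c) : c • x ∈ coneZone W κ := by
  refine ⟨smul_ne_zero hc.ne' hx.1, ?_⟩
  rw [infDist_compl_smul hW x hc, norm_smul, Real.norm_of_nonneg hc.le]
  have := mul_le_mul_of_nonneg_left hx.2 hc.le
  linarith

theorem isCompact_coneZone_inter_sphere [FiniteDimensional ℝ E] :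
    IsCompact (coneZone W κ ∩ sphere 0 1) := by
  have : ProperSpace E := FiniteDimensional.proper_real E
  have h1 : coneZone W κ ∩ sphere 0 1 = sphere 0 1 ∩ {x | κ * ‖x‖ ≤ infDist x Wᶜ} := by
    ext x
    refine ⟨fun h => ⟨h.2, h.1.2⟩, fun h => ⟨⟨?_, h.2⟩, h.1⟩⟩
    rintro rfl
    simpa using h.1
  rw [h1]
  exact (isCompact_sphere _ _).inter_right
    (isClosed_le (continuous_norm.const_mul κ) (continuous_infDist_pt _))

end coneZone

namespace IsRobustCone

variable {E : Type*} [NormedAddCommGroup E] [NormedSpace ℝ E]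
  {W : Set E} {p : E → E} {ν : ℕ} {a C ε τ : ℝ} {y : ℝ → E} [FiniteDimensional ℝ E]

/-- Perturbed trajectories enter, after a time inversely proportional to `‖x‖ ^ ν`, a closed subcone
with compact base. -/
theorem exists_zone (h : IsRobustCone W p ν a C) (hε : 0 ≤ ε) (hεa : ε ≤ a)
    (hεC : 2 ^ (ν + 2) * ε ≤ C) :
    ∃ κ > 0, ∃ θ > 0, ∀ τ y, PseudoOrbit p ν ε τ y → y 0 ∈ W → θ ≤ τ * ‖y 0‖ ^ ν →
      κ * ‖y τ‖ ≤ infDist (y τ) Wᶜ := by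
  have hεC' : ε ≤ C := by
    have : (1 : ℝ) ≤ 2 ^ (ν + 2) := one_le_pow₀ one_le_two
    nlinarith
  have hC := h.C_pos
  have hne : (Wᶜ).Nonempty := ⟨0, h.zero_notMem⟩
  obtain ⟨K, hK0, hK⟩ := h.exists_norm_field_le
  obtain ⟨L, hL0, hL⟩ := h.exists_lipschitz_ball 2
  set θ := 1 / (4 * (K + ε + 1)) with hθ
  have hθ0 : 0 < θ := by positivity
  have hθK : θ * (K + ε + 1) = 1 / 4 := by rw [hθ]; field_simp
  have hθ4 : θ ≤ 1 / 4 := by nlinarith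
  set κ := min 1 (C / 2 * (1 / 4) ^ (ν + 1) / (L + 1)) with hκ
  have hκ0 : 0 < κ := by positivity
  have hκ1 : κ ≤ 1 := min_le_left _ _
  have hκL : (L + 1) * κ ≤ C / 2 * (1 / 4) ^ (ν + 1) := by
    have := (le_div_iff₀ (by positivity : (0 : ℝ) < L + 1)).1
      (min_le_right 1 (C / 2 * (1 / 4) ^ (ν + 1) / (L + 1)))
    linarith
  -- Trajectories starting on the unit sphere: a drift in any direction keeps them in the cone.
  have unit : ∀ y, PseudoOrbit p ν ε θ y → y 0 ∈ W → ‖y 0‖ = 1 → θ * κ ≤ infDist (y θ) Wᶜ := by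
    intro y hy hyW hy1
    have hup : ∀ t ∈ Icc 0 θ, ‖y t‖ ≤ 1 := fun t ht => hy1 ▸ h.norm_le hy hεC' hεa hyW ht
    have hlow : ∀ t ∈ Icc 0 θ, 2 * (1 / 4) ≤ ‖y t‖ := by
      intro t ht
      choose! v hv hvp using hy.2
      have := norm_image_sub_le_of_norm_deriv_right_le_segment (C := K + ε) hy.1 hv (fun s hs => ?_)
        t ht
      · have h1 := norm_sub_norm_le (y 0) (y t)
        rw [norm_sub_rev, hy1] at h1
        have h2 : (K + ε) * (t - 0) ≤ (K + ε) * θ := by gcongr; linarith [ht.2]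
        nlinarith
      · have h1 := norm_add_le (v s - p (y s)) (p (y s))
        rw [sub_add_cancel] at h1
        have h2 : ‖y s‖ ^ (ν + 1) ≤ 1 := pow_le_one₀ (norm_nonneg _) (hup s ⟨hs.1, hs.2.le⟩)
        have h3 := hvp s hs
        have h4 := hK (y s)
        nlinarith
    refine (le_infDist hne).2 fun z hz => ?_
    by_contra! hlt
    have hw : ‖θ⁻¹ • (z - y θ)‖ ≤ κ := by
      rw [norm_smul, norm_inv, Real.norm_of_nonneg hθ0.le, ← dist_eq_norm, dist_comm,
        inv_mul_le_iff₀ hθ0]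
      exact hlt.le
    have := h.add_mem hy hεC hε hθ0.le (u := 0) (w := θ⁻¹ • (z - y θ)) (c := 1 / 4) (by norm_num)
      hlow hL0 hL (δ := θ * κ) (fun t ht => ?_) (fun t ht => ?_) (by nlinarith) ?_ (by simpa using hyW)
    · rw [zero_add, smul_smul, mul_inv_cancel₀ hθ0.ne', one_smul, add_sub_cancel] at this
      exact hz this
    · have := hup t ht
      nlinarith
    · rw [zero_add, norm_smul, Real.norm_of_nonneg ht.1]
      exact mul_le_mul ht.2 hw (norm_nonneg _) hθ0.le
    · have : L * (θ * κ) ≤ L * κ := by gcongr; nlinarith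
      linarith
  refine ⟨θ * κ, by positivity, θ, hθ0, fun τ y hy hyW hτθ => ?_⟩
  have hy0 := h.norm_pos hyW
  have hτ0 : 0 < τ := by
    by_contra! hle
    have : τ * ‖y 0‖ ^ ν ≤ 0 := mul_nonpos_of_nonpos_of_nonneg hle (by positivity)
    linarith
  -- A starting time from which the scaled elapsed time is exactly `θ`.
  obtain ⟨t₀, ht₀, hte⟩ : ∃ t₀ ∈ Icc 0 τ, (τ - t₀) * ‖y t₀‖ ^ ν = θ := by
    have hcont : ContinuousOn (fun t => (τ - t) * ‖y t‖ ^ ν) (Icc 0 τ) :=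
      (by fun_prop : ContinuousOn (fun t => τ - t) (Icc 0 τ)).mul (hy.1.norm.pow ν)
    exact intermediate_value_Icc' hτ0.le hcont ⟨by simpa using hθ0.le, by simpa using hτθ⟩
  have hyt := h.mem hy hεC' hyW ht₀
  have hyt0 := h.norm_pos hyt
  set c := ‖y t₀‖⁻¹ with hc
  have hc0 : 0 < c := inv_pos.2 hyt0
  have hcν : (τ - t₀) / c ^ ν = θ := by rw [hc, inv_pow, div_inv_eq_mul, hte]
  have hz := (hy.shift ht₀.1).rescale h.homog hc0
  rw [hcν] at hz
  have hcθ : c ^ ν * θ = τ - t₀ := by rw [← hcν]; field_simp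
  have := unit _ hz (by simpa using h.smul_mem _ hyt c hc0) (by
    simp [norm_smul, hc, hyt0.ne'])
  simp only [hcθ, add_sub_cancel] at this
  rw [infDist_compl_smul h.smul_mem _ hc0] at this
  have hnle : ‖y τ‖ ≤ ‖y t₀‖ := by
    have := h.norm_le (hy.shift ht₀.1) hεC' hεa (by simpa using hyt) (t := τ - t₀)
      ⟨by linarith [ht₀.2], le_rfl⟩
    simpa using this
  have hinf : 0 ≤ infDist (y τ) Wᶜ := infDist_nonneg
  calc θ * κ * ‖y τ‖ ≤ (c * infDist (y τ) Wᶜ) * ‖y t₀‖ := by gcongr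
    _ = infDist (y τ) Wᶜ := by rw [hc]; field_simp

/-- Trajectories stay in the cone and within a compact set over bounded times, hence exist for all
positive times. -/
theorem exists_flow (h : IsRobustCone W p ν a C) :
    ∃ φ : ℝ → E → E, ∀ x ∈ W, φ 0 x = x ∧ SolOn (fun _ => p) W (Ici 0) (fun t => φ t x) := by
  have hex : ∀ x ∈ W, ∃ y : ℝ → E, y 0 = x ∧ SolOn (fun _ => p) W (Ici 0) y := by
    intro x hx
    refine exists_solOn_Ici (fun T hT => ?_) (fun T hT y y' h0 h0' hy hy' =>
      solOn_unique h.isOpen h.contDiff.contDiffOn hy hy' (h0.trans h0'.symm))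
    obtain ⟨K, hK, hKW, hconf⟩ := h.exists_compact_confinement le_rfl h.a_pos.le
      (by simpa using h.C_pos.le) hx (T := T)
    refine exists_solOn_of_apriori h.isOpen h.contDiff.contDiffOn hK hKW hT.le ?_
      fun T' hT' y h0 hy => hconf T' hT' y (.of_solOn hy le_rfl) h0
    refine hconf 0 ⟨le_rfl, hT.le⟩ (fun _ => x) ⟨continuousOn_const, fun t ht => ?_⟩ rfl
    exact absurd ht.1 (not_le.2 ht.2)
  choose! y h0 hy using hex
  exact ⟨fun t x => y x t, fun x hx => ⟨h0 x hx, hy x hx⟩⟩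

/-- On a robust cone the field has a flow, which ends up in a closed subcone with compact base. -/
theorem exists_isConeFlow (h : IsRobustCone W p ν a C) {b A : ℝ} (hab : a ≤ b)
    (hb : ∀ x ∈ W, ‖p x‖ ≤ b * ‖x‖ ^ (ν + 1))
    (hA : ∀ x ∈ W, ∀ᶠ s : ℝ in 𝓝[>] 0,
      ‖ContinuousLinearMap.id ℝ E + s • fderiv ℝ p x‖ ≤ 1 + s * (-(A * ‖x‖ ^ ν))) :
    ∃ Z φ, IsConeFlow W Z p φ ν a b A := by
  obtain ⟨κ, hκ, θ, hθ, hzone⟩ := h.exists_zone le_rfl h.a_pos.le (by simpa using h.C_pos.le)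
  obtain ⟨φ, hφ⟩ := h.exists_flow
  have hZW := coneZone_subset (W := W) hκ
  have hweak : ∀ {u v w : ℝ} {l : ℝ → ℝ}, (∀ᶠ s : ℝ in 𝓝[>] 0, l s ≤ u + s * v) → 0 < w →
      ∀ᶠ s : ℝ in 𝓝[>] 0, l s ≤ u + s * (v + w) := by
    intro u v w l hl hw
    filter_upwards [hl, self_mem_nhdsWithin] with s hs hs0
    have := mul_pos (mem_Ioi.1 hs0) hw
    linarith
  have hentry : ∀ x₀ ∈ W, ∃ T₀ : ℝ, 0 ≤ T₀ ∧ ∀ᶠ x in 𝓝 x₀, ∀ t, T₀ ≤ t → φ t x ∈ coneZone W κ := by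
    intro x₀ hx₀
    have hpos := h.norm_pos hx₀
    refine ⟨θ / (‖x₀‖ / 2) ^ ν, by positivity, ?_⟩
    filter_upwards [h.isOpen.mem_nhds hx₀,
      continuous_norm.continuousAt.eventually_const_lt (half_lt_self hpos)] with x hx hxn t ht
    have ht0 : 0 ≤ t := le_trans (by positivity) ht
    refine ⟨norm_pos_iff.1 (h.norm_pos (((hφ x hx).2 t ht0).1)), ?_⟩
    refine hzone t (fun t => φ t x) (.of_solOn ((hφ x hx).2.mono Icc_subset_Ici_self) le_rfl) ?_ ?_
    · rw [(hφ x hx).1]; exact hx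
    · rw [(hφ x hx).1]
      calc θ = θ / (‖x₀‖ / 2) ^ ν * (‖x₀‖ / 2) ^ ν := by field_simp
        _ ≤ t * ‖x‖ ^ ν := by gcongr
  refine ⟨coneZone W κ, φ, ?_⟩
  exact
    { nu_pos := h.nu_pos
      isOpen := h.isOpen
      smul_mem := h.smul_mem
      zero_notMem := h.zero_notMem
      contDiffOn := h.contDiff.contDiffOn
      homog := fun x _ c hc => h.homog x c hc
      flow_zero := fun x hx => (hφ x hx).1
      flow_sol := fun x hx => (hφ x hx).2
      zone_subset := hZW
      zone_smul := fun x hx c hc => smul_mem_coneZone h.smul_mem hx hc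
      zone_compact := isCompact_coneZone_inter_sphere
      a_pos := h.a_pos
      a_le_b := hab
      norm_decay := fun x hx ε hε => hweak (h.norm_decay x (hZW hx)) hε
      norm_field := fun x hx => hb x (hZW hx)
      log_deriv := fun x hx ε hε => hweak (hA x (hZW hx)) hε
      entry := hentry }

end IsRobustCone

/-! ### Extension by homogeneity -/

section Homogeneous

variable {E F : Type*} [NormedAddCommGroup E] [NormedSpace ℝ E] [NormedAddCommGroup F]
  [NormedSpace ℝ F] {V : Set E} {d : ℕ} {T : E → F}

theorem isOpen_posCone (hV : IsOpen V) : IsOpen (posCone V) := by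
  have : posCone V = ⋃ s ∈ Ioi (0 : ℝ), (fun y : E => s • y) ⁻¹' V := by
    ext y; simp [posCone]
  rw [this]
  exact isOpen_biUnion fun s _ => hV.preimage (continuous_const_smul s)

theorem subset_posCone : V ⊆ posCone V := fun x hx => ⟨1, one_pos, by rwa [one_smul]⟩

theorem smul_mem_posCone {x : E} (hx : x ∈ posCone V) {c : ℝ} (hc : 0 < c) : c • x ∈ posCone V := by
  obtain ⟨s, hs, hsx⟩ := hx
  refine ⟨s / c, by positivity, ?_⟩
  rwa [smul_smul, div_mul_cancel₀ _ hc.ne']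

theorem zero_notMem_of_starShaped (hV : IsOpen V) (hs : StarShapedAtZero V) : (0 : E) ∉ V := by
  have := hs.1
  rw [hV.frontier_eq] at this
  exact this.2

theorem zero_notMem_posCone (hV0 : (0 : E) ∉ V) : (0 : E) ∉ posCone V := by
  rintro ⟨s, -, h⟩
  exact hV0 (by rwa [smul_zero] at h)

theorem homExtend_of_mem (hT : IsHomog d V T) {x : E} (hx : x ∈ V) : homExtend V d T x = T x := by
  rw [homExtend_eq hT one_pos (by rwa [one_smul]), one_pow, inv_one, one_smul, one_smul]

theorem homExtend_smul (hT : IsHomog d V T) {x : E} (hx : x ∈ posCone V) {c : ℝ} (hc : 0 < c) :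
    homExtend V d T (c • x) = c ^ d • homExtend V d T x := by
  obtain ⟨s, hs, hsx⟩ := hx
  have e : (s / c) • c • x = s • x := by rw [smul_smul, div_mul_cancel₀ _ hc.ne']
  rw [homExtend_eq hT hs hsx, homExtend_eq hT (s := s / c) (by positivity) (by rwa [e]), e, smul_smul,
    div_pow, inv_div, div_eq_mul_inv]

theorem homExtend_eventuallyEq (hV : IsOpen V) (hT : IsHomog d V T) {x : E} {s : ℝ} (hs : 0 < s)
    (hsx : s • x ∈ V) : homExtend V d T =ᶠ[𝓝 x] fun y => (s ^ d)⁻¹ • T (s • y) := by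
  filter_upwards [(continuous_const_smul s).continuousAt.preimage_mem_nhds (hV.mem_nhds hsx)]
    with y hy using homExtend_eq hT hs hy

theorem contDiffOn_homExtend (hV : IsOpen V) (hT : IsHomog d V T) {r : WithTop ℕ∞}
    (hr : ContDiffOn ℝ r T V) : ContDiffOn ℝ r (homExtend V d T) (posCone V) := by
  rintro x ⟨s, hs, hsx⟩
  have h1 : ContDiffAt ℝ r (fun y => (s ^ d)⁻¹ • T (s • y)) x :=
    ((hr.contDiffAt (hV.mem_nhds hsx)).comp x (contDiff_const_smul s).contDiffAt).const_smul _
  exact (h1.congr_of_eventuallyEq (homExtend_eventuallyEq hV hT hs hsx)).contDiffWithinAt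

theorem continuousOn_homExtend (hV : IsOpen V) (hT : IsHomog d V T) :
    ContinuousOn (homExtend V d T) (posCone V) := by
  have := contDiffOn_homExtend hV hT (r := 0) (contDiffOn_zero.2 hT.1)
  exact contDiffOn_zero.1 this

/-- A homogeneous function is as smooth on the whole space as it is near the origin. -/
theorem contDiff_of_homog {f : E → F} {U : Set E} {r : WithTop ℕ∞} (hU : IsOpen U) (h0 : (0 : E) ∈ U)
    (hfd : ∀ x, ∀ c : ℝ, 0 < c → f (c • x) = c ^ d • f x) (hf : ContDiffOn ℝ r f U) :
    ContDiff ℝ r f := by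
  rw [contDiff_iff_contDiffAt]
  intro x
  have hc : ContinuousAt (fun s : ℝ => s • x) 0 := by fun_prop
  have h1 : ∀ᶠ s : ℝ in 𝓝[>] 0, s • x ∈ U :=
    Filter.Eventually.filter_mono nhdsWithin_le_nhds
      (hc.preimage_mem_nhds (by simpa using hU.mem_nhds h0))
  obtain ⟨s, hsU, hs⟩ := (h1.and self_mem_nhdsWithin).exists
  have hs : 0 < s := hs
  have h2 : f = fun y => (s ^ d)⁻¹ • f (s • y) := by
    ext y
    rw [hfd y s hs, smul_smul, inv_mul_cancel₀ (pow_pos hs d).ne', one_smul]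
  rw [h2]
  exact ((hf.contDiffAt (hU.mem_nhds hsU)).comp x (contDiff_const_smul s).contDiffAt).const_smul _

theorem fderiv_smul_of_homog_pow {f : E → F} (hfd : ∀ x, ∀ c : ℝ, 0 < c → f (c • x) = c ^ (d + 1) • f x)
    (hf : Differentiable ℝ f) (x : E) {c : ℝ} (hc : 0 < c) :
    fderiv ℝ f (c • x) = c ^ d • fderiv ℝ f x := by
  have := fderiv_smul_of_homog (W := univ) (q := ((d + 1 : ℕ) : ℝ)) isOpen_univ (fun _ _ _ _ => trivial)
    (fun x _ c hc => by rw [Real.rpow_natCast]; exact hfd x c hc) (mem_univ x) (hf x) hc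
  rwa [Nat.cast_add_one, add_sub_cancel_right, Real.rpow_natCast] at this

/-- Small multiples of a point of the cone lie in the truncation. The factor is given as `s ^ (1 /
ν)`, since `s` is the time step that corresponds to it under rescaling. -/
theorem eventually_smul_mem_trunc {ν : ℕ} (hν : 0 < ν)
    (hVs : ∀ x ∈ V, ∀ c : ℝ, 0 < c → c ≤ 1 → c • x ∈ V) {ρ : ℝ} (hρ : 0 < ρ) {x : E}
    (hx : x ∈ posCone V) : ∀ᶠ s : ℝ in 𝓝[>] 0, ∃ l : ℝ, 0 < l ∧ l ^ ν = s ∧ l • x ∈ trunc V ρ := by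
  obtain ⟨s₀, hs₀, hsx⟩ := hx
  have hν' : (0 : ℝ) < 1 / ν := by positivity
  have h1 : Tendsto (fun s : ℝ => s ^ (1 / (ν : ℝ))) (𝓝[>] 0) (𝓝 0) := by
    have := (Real.continuous_rpow_const hν'.le).tendsto 0
    rw [Real.zero_rpow hν'.ne'] at this
    exact this.mono_left nhdsWithin_le_nhds
  have h2 := h1.mul_const ‖x‖
  rw [zero_mul] at h2
  filter_upwards [h1.eventually_lt_const hs₀, h2.eventually_lt_const hρ, self_mem_nhdsWithin]
    with s hs1 hs2 hs
  have hs : 0 < s := hs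
  have hl : 0 < s ^ (1 / (ν : ℝ)) := Real.rpow_pos_of_pos hs _
  refine ⟨s ^ (1 / (ν : ℝ)), hl, ?_, ?_, ?_⟩
  · rw [← Real.rpow_natCast, ← Real.rpow_mul hs.le, one_div_mul_cancel (by positivity), Real.rpow_one]
  · have := hVs _ hsx (s ^ (1 / (ν : ℝ)) / s₀) (by positivity) ((div_le_one hs₀).2 hs1.le)
    rwa [smul_smul, div_mul_cancel₀ _ hs₀.ne'] at this
  · rwa [mem_ball_zero_iff, norm_smul, Real.norm_of_nonneg hl.le]

theorem exists_smul_mem_trunc {ν : ℕ} (hν : 0 < ν)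
    (hVs : ∀ x ∈ V, ∀ c : ℝ, 0 < c → c ≤ 1 → c • x ∈ V) {ρ : ℝ} (hρ : 0 < ρ) {x : E}
    (hx : x ∈ posCone V) : ∃ l : ℝ, 0 < l ∧ l • x ∈ trunc V ρ := by
  obtain ⟨s, l, hl, -, hlx⟩ := (eventually_smul_mem_trunc hν hVs hρ hx).exists
  exact ⟨l, hl, hlx⟩

end Homogeneous

/-! ### The constants of the problem -/

/-- The supremum which defines `constA` is attained as a true bound: were it infinite, its junk
value `0` would contradict the positivity of `constA`. -/
theorem norm_add_le_of_constA {E : Type*} [NormedAddCommGroup E] {V : Set E} {ρ : ℝ} {ν : ℕ}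
    {p : E → E} (h : 0 < constA V ρ (ν + 1) p) (hV0 : (0 : E) ∉ V) {x : E}
    (hx : x ∈ trunc V ρ) : ‖x + p x‖ ≤ ‖x‖ - constA V ρ (ν + 1) p * ‖x‖ ^ (ν + 1) := by
  have hbdd : BddAbove (range fun x : trunc V ρ =>
      (‖(x : E) + p x‖ - ‖(x : E)‖) / ‖(x : E)‖ ^ (ν + 1)) := by
    by_contra hcon
    rw [constA, Real.iSup_of_not_bddAbove hcon, neg_zero] at h
    exact lt_irrefl _ h
  have h1 := le_ciSup hbdd ⟨x, hx⟩
  have hx0 : 0 < ‖x‖ := norm_pos_iff.2 fun h0 => hV0 (h0 ▸ hx.1)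
  have h2 : (‖x + p x‖ - ‖x‖) / ‖x‖ ^ (ν + 1) ≤ -constA V ρ (ν + 1) p := by
    rw [constA, neg_neg]; exact h1
  rw [div_le_iff₀ (by positivity)] at h2
  linarith

section Constants

variable {E F : Type*} [NormedAddCommGroup E] [NormedSpace ℝ E] [FiniteDimensional ℝ E]
  [NormedAddCommGroup F] [NormedSpace ℝ F] {V : Set E} {ρ : ℝ} {ν : ℕ} {p : E → E}
  {Q : E → F →L[ℝ] F}

/-- The supremum which defines `constB` is finite, by homogeneity. -/
theorem norm_le_of_constB (hpc : Continuous p)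
    (hp : ∀ x, ∀ c : ℝ, 0 < c → p (c • x) = c ^ (ν + 1) • p x) (hV0 : (0 : E) ∉ V) {x : E}
    (hx : x ∈ trunc V ρ) : ‖p x‖ ≤ constB V ρ (ν + 1) p * ‖x‖ ^ (ν + 1) := by
  obtain ⟨K, hK0, hK⟩ := exists_norm_le_of_homog (Nat.succ_ne_zero ν) hpc hp
  have hpos : ∀ x ∈ trunc V ρ, 0 < ‖x‖ := fun x hx => norm_pos_iff.2 fun h0 => hV0 (h0 ▸ hx.1)
  have hbdd : BddAbove (range fun x : trunc V ρ => ‖p x‖ / ‖(x : E)‖ ^ (ν + 1)) := by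
    refine ⟨K, ?_⟩
    rintro _ ⟨x, rfl⟩
    rw [div_le_iff₀ (pow_pos (hpos x x.2) _)]
    exact hK x
  have h1 := le_ciSup hbdd ⟨x, hx⟩
  rwa [div_le_iff₀ (pow_pos (hpos x hx) _)] at h1

/-- The supremum which defines `constAp` is finite, by homogeneity of the derivative. -/
theorem norm_id_add_le_of_constAp (hν : 0 < ν) (hpc : ContDiff ℝ 1 p)
    (hp : ∀ x, ∀ c : ℝ, 0 < c → p (c • x) = c ^ (ν + 1) • p x) (hV0 : (0 : E) ∉ V) {x : E}
    (hx : x ∈ trunc V ρ) : ‖ContinuousLinearMap.id ℝ E + fderiv ℝ p x‖ ≤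
      1 - constAp V ρ (ν + 1) p * ‖x‖ ^ ν := by
  obtain ⟨K, hK0, hK⟩ := exists_norm_le_of_homog hν.ne' (hpc.continuous_fderiv one_ne_zero)
    fun x c hc => fderiv_smul_of_homog_pow hp (hpc.differentiable one_ne_zero) x hc
  have hpos : ∀ x ∈ trunc V ρ, 0 < ‖x‖ := fun x hx => norm_pos_iff.2 fun h0 => hV0 (h0 ▸ hx.1)
  have hbdd : BddAbove (range fun x : trunc V ρ =>
      (‖ContinuousLinearMap.id ℝ E + fderiv ℝ p x‖ - 1) / ‖(x : E)‖ ^ (ν + 1 - 1)) := by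
    refine ⟨K, ?_⟩
    rintro _ ⟨x, rfl⟩
    rw [div_le_iff₀ (pow_pos (hpos x x.2) _), Nat.add_sub_cancel]
    have h1 := norm_add_le (ContinuousLinearMap.id ℝ E) (fderiv ℝ p x)
    have h2 : ‖ContinuousLinearMap.id ℝ E‖ ≤ 1 := ContinuousLinearMap.norm_id_le
    linarith [hK x]
  have h1 := le_ciSup hbdd ⟨x, hx⟩
  have h2 : (‖ContinuousLinearMap.id ℝ E + fderiv ℝ p x‖ - 1) / ‖x‖ ^ (ν + 1 - 1) ≤
      -constAp V ρ (ν + 1) p := by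
    rw [constAp, neg_neg]; exact h1
  rw [div_le_iff₀ (pow_pos (hpos x hx) _), Nat.add_sub_cancel] at h2
  linarith

/-- The supremum which defines `constBQ` is finite, by homogeneity. -/
theorem norm_id_sub_le_of_constBQ (hν : 0 < ν) (hQc : Continuous Q)
    (hQ : ∀ x, ∀ c : ℝ, 0 < c → Q (c • x) = c ^ ν • Q x) (hV0 : (0 : E) ∉ V) {x : E}
    (hx : x ∈ trunc V ρ) : ‖ContinuousLinearMap.id ℝ F - Q x‖ ≤
      1 - constBQ V ρ (ν + 1) Q * ‖x‖ ^ ν := by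
  obtain ⟨K, hK0, hK⟩ := exists_norm_le_of_homog hν.ne' hQc hQ
  have hpos : ∀ x ∈ trunc V ρ, 0 < ‖x‖ := fun x hx => norm_pos_iff.2 fun h0 => hV0 (h0 ▸ hx.1)
  have hbdd : BddAbove (range fun x : trunc V ρ =>
      (‖ContinuousLinearMap.id ℝ F - Q x‖ - 1) / ‖(x : E)‖ ^ (ν + 1 - 1)) := by
    refine ⟨K, ?_⟩
    rintro _ ⟨x, rfl⟩
    rw [div_le_iff₀ (pow_pos (hpos x x.2) _), Nat.add_sub_cancel]
    have h1 := norm_sub_le (ContinuousLinearMap.id ℝ F) (Q x)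
    have h2 : ‖ContinuousLinearMap.id ℝ F‖ ≤ 1 := ContinuousLinearMap.norm_id_le
    linarith [hK x]
  have h1 := le_ciSup hbdd ⟨x, hx⟩
  have h2 : (‖ContinuousLinearMap.id ℝ F - Q x‖ - 1) / ‖x‖ ^ (ν + 1 - 1) ≤
      -constBQ V ρ (ν + 1) Q := by
    rw [constBQ, neg_neg]; exact h1
  rw [div_le_iff₀ (pow_pos (hpos x hx) _), Nat.add_sub_cancel] at h2
  linarith

theorem constA_le_constB (hρ : 0 < ρ) (hVs : StarShapedAtZero V) (hV0 : (0 : E) ∉ V)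
    (h : 0 < constA V ρ (ν + 1) p) (hpc : Continuous p)
    (hp : ∀ x, ∀ c : ℝ, 0 < c → p (c • x) = c ^ (ν + 1) • p x) :
    constA V ρ (ν + 1) p ≤ constB V ρ (ν + 1) p := by
  obtain ⟨x, hxρ, hxV⟩ := mem_closure_iff.1 (frontier_subset_closure hVs.1) (ball 0 ρ) isOpen_ball
    (mem_ball_self hρ)
  have hx : x ∈ trunc V ρ := ⟨hxV, hxρ⟩
  have h1 := norm_add_le_of_constA h hV0 hx
  have h2 := norm_le_of_constB hpc hp hV0 hx
  have h3 : ‖x‖ ≤ ‖x + p x‖ + ‖p x‖ := by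
    have := norm_sub_le (x + p x) (p x)
    rwa [add_sub_cancel_right] at this
  have hx0 : 0 < ‖x‖ := norm_pos_iff.2 fun h0 => hV0 (h0 ▸ hxV)
  exact le_of_mul_le_mul_right (by linarith) (pow_pos hx0 (ν + 1))

/-- The two hypotheses on the map `x ↦ x + p x` make the cone robust for the field `p`: by
homogeneity, a step of this map at `l x` is an Euler step of length `l ^ ν` at `x`. -/
theorem exists_isRobustCone (hρ : 0 < ρ) (hν : 0 < ν) (hVo : IsOpen V) (hVs : StarShapedAtZero V)
    (hpc : ContDiff ℝ 1 p) (hp : ∀ x, ∀ c : ℝ, 0 < c → p (c • x) = c ^ (ν + 1) • p x)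
    (h1 : 0 < constA V ρ (ν + 1) p) (h2 : HP2 V ρ (ν + 1) p) :
    ∃ C, IsRobustCone (posCone V) p ν (constA V ρ (ν + 1) p) C := by
  have hV0 := zero_notMem_of_starShaped hVo hVs
  obtain ⟨C, hC, hHP2⟩ := h2
  obtain ⟨K, hK0, hK⟩ := exists_norm_le_of_homog (Nat.succ_ne_zero ν) hpc.continuous hp
  refine ⟨C / 2, ?_⟩
  exact
    { nu_pos := hν
      isOpen := isOpen_posCone hVo
      smul_mem := fun x hx c hc => smul_mem_posCone hx hc
      zero_notMem := zero_notMem_posCone hV0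
      contDiff := hpc
      homog := hp
      a_pos := h1
      C_pos := by positivity
      invariant := fun τ hτ y hy h0 => mem_posCone_of_pseudoOrbit hν hVs.2 hV0 hpc.continuous hp hK0 hK
        hC hρ hHP2 hτ hy h0
      norm_decay := fun x hx => by
        filter_upwards [eventually_smul_mem_trunc hν hVs.2 hρ hx] with s ⟨l, hl, hls, hlx⟩
        have := norm_add_le_of_constA h1 hV0 hlx
        rw [hp x l hl, pow_succ', mul_smul, ← smul_add, norm_smul, norm_smul,
          Real.norm_of_nonneg hl.le, mul_pow, pow_succ' l, hls] at this
        refine le_of_mul_le_mul_left (this.trans_eq ?_) hl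
        ring }

theorem log_deriv_of_constAp (hρ : 0 < ρ) (hν : 0 < ν) (hVo : IsOpen V) (hVs : StarShapedAtZero V)
    (hpc : ContDiff ℝ 1 p) (hp : ∀ x, ∀ c : ℝ, 0 < c → p (c • x) = c ^ (ν + 1) • p x) {x : E}
    (hx : x ∈ posCone V) : ∀ᶠ s : ℝ in 𝓝[>] 0,
      ‖ContinuousLinearMap.id ℝ E + s • fderiv ℝ p x‖ ≤
        1 + s * (-(constAp V ρ (ν + 1) p * ‖x‖ ^ ν)) := by
  filter_upwards [eventually_smul_mem_trunc hν hVs.2 hρ hx] with s ⟨l, hl, hls, hlx⟩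
  have := norm_id_add_le_of_constAp hν hpc hp (zero_notMem_of_starShaped hVo hVs) hlx
  rw [fderiv_smul_of_homog_pow hp (hpc.differentiable one_ne_zero) x hl, norm_smul,
    Real.norm_of_nonneg hl.le, mul_pow, hls] at this
  refine this.trans_eq ?_
  ring

theorem log_coeff_of_constBQ (hρ : 0 < ρ) (hν : 0 < ν) (hVo : IsOpen V) (hVs : StarShapedAtZero V)
    (hQc : Continuous Q) (hQ : ∀ x, ∀ c : ℝ, 0 < c → Q (c • x) = c ^ ν • Q x) {x : E}
    (hx : x ∈ posCone V) : ∀ᶠ s : ℝ in 𝓝[>] 0,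
      ‖ContinuousLinearMap.id ℝ F - s • Q x‖ ≤ 1 + s * (-(constBQ V ρ (ν + 1) Q * ‖x‖ ^ ν)) := by
  filter_upwards [eventually_smul_mem_trunc hν hVs.2 hρ hx] with s ⟨l, hl, hls, hlx⟩
  have := norm_id_sub_le_of_constBQ hν hQc hQ (zero_notMem_of_starShaped hVo hVs) hlx
  rw [hQ x l hl, norm_smul, Real.norm_of_nonneg hl.le, mul_pow, hls] at this
  refine this.trans_eq ?_
  ring

theorem norm_field_le_of_constB (hρ : 0 < ρ) (hν : 0 < ν) (hVo : IsOpen V) (hVs : StarShapedAtZero V)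
    (hpc : Continuous p) (hp : ∀ x, ∀ c : ℝ, 0 < c → p (c • x) = c ^ (ν + 1) • p x) {x : E}
    (hx : x ∈ posCone V) : ‖p x‖ ≤ constB V ρ (ν + 1) p * ‖x‖ ^ (ν + 1) := by
  obtain ⟨l, hl, hlx⟩ := exists_smul_mem_trunc hν hVs.2 hρ hx
  have := norm_le_of_constB hpc hp (zero_notMem_of_starShaped hVo hVs) hlx
  rw [hp x l hl, norm_smul, norm_smul, norm_pow, Real.norm_of_nonneg hl.le, mul_pow] at this
  refine le_of_mul_le_mul_left (this.trans_eq ?_) (pow_pos hl (ν + 1))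
  ring

end Constants

/-! ### The solution on the star-shaped set -/

section Solution

variable {E F : Type*} [NormedAddCommGroup E] [NormedSpace ℝ E]
  [NormedAddCommGroup F] [NormedSpace ℝ F] {V Z : Set E} {ν m : ℕ}
  {p : E → E} {Q : E → F →L[ℝ] F} {T : E → F} {φ : ℝ → E → E} {a b A B C : ℝ}

theorem isCohData_homExtend (hV : IsOpen V) (hT : IsHomog (m + (ν + 1)) V T) (hQc : Continuous Q)
    (hQ : ∀ x, ∀ c : ℝ, 0 < c → Q (c • x) = c ^ ν • Q x) (hZ : Z ⊆ posCone V)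
    (hB : ∀ x ∈ posCone V, ∀ᶠ s : ℝ in 𝓝[>] 0,
      ‖ContinuousLinearMap.id ℝ F - s • Q x‖ ≤ 1 + s * (-(B * ‖x‖ ^ ν))) :
    IsCohData (posCone V) Z ν Q (homExtend V (m + (ν + 1)) T) B ((m : ℝ) + 1) where
  cont_Q := hQc.continuousOn
  homog_Q := fun x _ c hc => hQ x c hc
  log_Q := fun x hx ε hε => by
    filter_upwards [hB x (hZ hx), self_mem_nhdsWithin] with s hs hs0
    have := mul_pos (mem_Ioi.1 hs0) hε
    linarith
  cont_T := continuousOn_homExtend hV hT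
  homog_T := fun x hx c hc => by
    rw [homExtend_smul hT hx hc, ← Real.rpow_natCast]
    congr 2
    push_cast
    ring

/-- A differentiable solution on `V`, extended by homogeneity, solves the equation along
trajectories. -/
theorem isFlowSol_of_isSolution (hf : IsConeFlow (posCone V) Z p φ ν a b A) (hV : IsOpen V)
    (hT : IsHomog (m + (ν + 1)) V T) (hQ : ∀ x, ∀ c : ℝ, 0 < c → Q (c • x) = c ^ ν • Q x)
    {h : E → F} (hs : IsSolution V p Q T (m + 1) h) :
    IsFlowSol (posCone V) φ Q (homExtend V (m + (ν + 1)) T) ((m : ℝ) + 1)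
      (homExtend V (m + 1) h) := by
  refine ⟨continuousOn_homExtend hV hs.1, fun x hx c hc => ?_, fun x hx t ht => ?_⟩
  · rw [homExtend_smul hs.1 hx hc, ← Real.rpow_natCast]
    norm_cast
  have hz := hf.flow_mem hx ht
  set z := φ t x with hzdef
  obtain ⟨s, hs0, hsz⟩ := hz
  have hzW : z ∈ posCone V := ⟨s, hs0, hsz⟩
  have hd : HasFDerivAt (homExtend V (m + 1) h)
      ((s ^ (m + 1))⁻¹ • (fderiv ℝ h (s • z)).comp (s • ContinuousLinearMap.id ℝ E)) z := by
    have h1 := (hs.2.1.differentiableAt (hV.mem_nhds hsz)).hasFDerivAt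
    have h2 : HasFDerivAt (fun y : E => s • y) (s • ContinuousLinearMap.id ℝ E) z :=
      (hasFDerivAt_id z).const_smul s
    exact ((h1.comp z h2).const_smul _).congr_of_eventuallyEq
      (homExtend_eventuallyEq hV hs.1 hs0 hsz)
  have h3 := hd.comp_hasDerivWithinAt t (hf.flow_sol x hx t ht).2
  refine h3.congr_deriv ?_
  have heq := hs.2.2 _ hsz
  rw [hf.homog z hzW s hs0, hQ z s hs0, sub_eq_iff_eq_add] at heq
  rw [homExtend_eq hs.1 hs0 hsz, homExtend_eq hT hs0 hsz]
  simp only [← hzdef]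
  simp only [smul_apply, ContinuousLinearMap.comp_apply, ContinuousLinearMap.id_apply, map_smul]
    at heq ⊢
  have hsν : s ^ ν ≠ 0 := (pow_pos hs0 ν).ne'
  have e1 : s • fderiv ℝ h (s • z) (p z) = (s ^ ν)⁻¹ • (T (s • z) + s ^ ν • Q z (h (s • z))) := by
    rw [← heq, smul_smul, pow_succ, ← mul_assoc, inv_mul_cancel₀ hsν, one_mul]
  rw [e1, smul_add, smul_add, smul_smul, smul_smul, smul_smul, mul_assoc,
    inv_mul_cancel₀ hsν, mul_one, add_comm]
  congr 2
  rw [← mul_inv, ← pow_add]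
  congr 2
  omega

/-- A cone on which the norm decays can only contain opposite points if the field is odd. -/
theorem IsRobustCone.even_of_neg_mem {W : Set E} (h : IsRobustCone W p ν a C)
    (hp : ∀ x, ∀ c : ℝ, p (c • x) = c ^ (ν + 1) • p x) {u : E} (hu : u ∈ W) (hu' : -u ∈ W) :
    Even ν := by
  by_contra hcon
  rw [Nat.not_even_iff_odd] at hcon
  have h1 : p (-u) = p u := by
    have := hp u (-1)
    rwa [neg_one_smul, hcon.add_one.neg_one_pow, one_smul] at this
  obtain ⟨s, h2, h3, hs⟩ :=
    ((h.norm_decay u hu).and ((h.norm_decay (-u) hu').and self_mem_nhdsWithin)).exists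
  have hs : 0 < s := hs
  rw [h1, norm_neg] at h3
  have h4 := norm_sub_le (u + s • p u) (-u + s • p u)
  rw [add_sub_add_right_eq_sub, sub_neg_eq_add, ← two_smul ℝ u, norm_smul, Real.norm_two] at h4
  have := mul_pos hs (mul_pos h.a_pos (pow_pos (h.norm_pos hu) (ν + 1)))
  linarith

/-- Differentiating along the trajectory at time `0` turns the equation along trajectories into the
cohomological equation. -/
theorem fderiv_apply_sub_of_isFlowSol {W : Set E} {j : ℝ} (hf : IsConeFlow W Z p φ ν a b A) {h : E → F}
    (hs : IsFlowSol W φ Q T j h) {x : E} (hx : x ∈ W) (hd : DifferentiableAt ℝ h x) :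
    fderiv ℝ h x (p x) - Q x (h x) = T x := by
  have h1 := hs.deriv x hx 0 le_rfl
  have h2 : HasDerivWithinAt (fun s => h (φ s x)) (fderiv ℝ h x (p x)) (Ici 0) 0 := by
    have h3 := (hf.flow_sol x hx 0 self_mem_Ici).2
    have hd' : HasFDerivAt h (fderiv ℝ h x) (φ 0 x) := by
      rw [hf.flow_zero x hx]; exact hd.hasFDerivAt
    have h4 := hd'.comp_hasDerivWithinAt 0 h3
    simp only [hf.flow_zero x hx] at h4
    exact h4
  rw [(uniqueDiffOn_Ici 0 0 self_mem_Ici).eq_deriv _ h2 h1, hf.flow_zero x hx, add_sub_cancel_left]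

variable [CompleteSpace F]

/-- The fundamental matrix as a linear equivalence. -/
def fundEquiv (Q : E → F →L[ℝ] F) (φ : ℝ → E → E) (t : ℝ) (x : E) : F ≃L[ℝ] F :=
  open Classical in
  if h : ((fundPair Q φ x).1 t).comp ((fundPair Q φ x).2 t) = ContinuousLinearMap.id ℝ F ∧
      ((fundPair Q φ x).2 t).comp ((fundPair Q φ x).1 t) = ContinuousLinearMap.id ℝ F then
    ContinuousLinearEquiv.equivOfInverse ((fundPair Q φ x).1 t) ((fundPair Q φ x).2 t)
      (fun v => by rw [← ContinuousLinearMap.comp_apply, h.2, ContinuousLinearMap.id_apply])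
      (fun v => by rw [← ContinuousLinearMap.comp_apply, h.1, ContinuousLinearMap.id_apply])
  else ContinuousLinearEquiv.refl ℝ F

theorem fundEquiv_spec {W : Set E} (hf : IsConeFlow W Z p φ ν a b A) (hQ : ContinuousOn Q W) {x : E}
    (hx : x ∈ W) {t : ℝ} (ht : 0 ≤ t) :
    (fundEquiv Q φ t x : F →L[ℝ] F) = (fundPair Q φ x).1 t ∧
      ((fundEquiv Q φ t x).symm : F →L[ℝ] F) = (fundPair Q φ x).2 t := by
  have hP := hf.fundPair_spec hQ hx
  rw [fundEquiv, dif_pos ⟨hP.M_Y t ht, hP.Y_M t ht⟩]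
  exact ⟨rfl, rfl⟩

theorem isFundamentalMatrix_fundEquiv (hf : IsConeFlow (posCone V) Z p φ ν a b A)
    (hQ : ContinuousOn Q (posCone V)) : IsFundamentalMatrix Q V φ (fundEquiv Q φ) := by
  intro x hx
  have hx := subset_posCone hx
  have hP := hf.fundPair_spec hQ hx
  refine ⟨?_, fun t ht => ?_⟩
  · refine ContinuousLinearEquiv.coe_injective ?_
    rw [(fundEquiv_spec hf hQ hx le_rfl).1, hP.M_zero]
    rfl
  · rw [(fundEquiv_spec hf hQ hx ht).1]
    exact (hP.M_deriv t ht).congr_of_mem (fun s hs => (fundEquiv_spec hf hQ hx hs).1) ht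

variable [FiniteDimensional ℝ E]

/-- Opposite trajectories of an odd field have the same fundamental matrix if `Q` is even, so the
integral solution inherits the parity of `T`. -/
theorem cohIntegral_neg {W : Set E} {j : ℝ} (hf : IsConeFlow W Z p φ ν a b A)
    (hd : IsCohData W Z ν Q T B j) (hpc : ContDiff ℝ 1 p) (hp : ∀ x, p (-x) = -p x)
    (hQ : ∀ x, Q (-x) = Q x) {c : ℝ} (hT : ∀ x ∈ W, -x ∈ W → T (-x) = c • T x) {u : E} (hu : u ∈ W)
    (hu' : -u ∈ W) : cohIntegral Q T φ (-u) = c • cohIntegral Q T φ u := by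
  have hflow : ∀ t, 0 ≤ t → φ t (-u) = -φ t u := by
    refine solOn_Ici_unique isOpen_univ hpc.contDiffOn (y := fun t => φ t (-u))
      (z := fun t => -φ t u) ((hf.flow_sol _ hu').mono_set fun _ _ => trivial) (fun t ht => ?_) ?_
    · refine ⟨trivial, ?_⟩
      have := (hf.flow_sol u hu t ht).2.neg
      rwa [← hp] at this
    · simp only [hf.flow_zero _ hu, hf.flow_zero _ hu']
  have hP := hf.fundPair_spec hd.cont_Q hu
  have hP' := hf.fundPair_spec hd.cont_Q hu'
  have hY : ∀ t, 0 ≤ t → (fundPair Q φ (-u)).2 t = (fundPair Q φ u).2 t := by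
    refine right_mul_solution_unique (R := fun t => Q (φ t (-u)))
      (hf.continuousOn_comp_flow hd.cont_Q hu') (by rw [hP.Y_zero, hP'.Y_zero]) hP'.Y_deriv
      fun t ht => ?_
    have := hP.Y_deriv t ht
    rwa [← hQ, ← hflow t ht] at this
  rw [cohIntegral, cohIntegral, smul_neg, ← integral_smul]
  congr 1
  refine setIntegral_congr_fun measurableSet_Ioi fun t ht => ?_
  have ht : 0 ≤ t := le_of_lt ht
  have h1 := hT (φ t u) (hf.flow_mem hu ht) (by rw [← hflow t ht]; exact hf.flow_mem hu' ht)
  simp only [hY t ht, hflow t ht, h1, map_smul]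

/-- Homogeneity for positive factors follows by rescaling the time. A negative factor between
points of the cone forces `ν` to be even, and parity applies. -/
theorem isHomog_cohIntegral (hf : IsConeFlow (posCone V) Z p φ ν a b A)
    (hr : IsRobustCone (posCone V) p ν a C) (hV0 : (0 : E) ∉ V)
    (hp : ∀ x, ∀ c : ℝ, p (c • x) = c ^ (ν + 1) • p x) (hQ : ∀ x, ∀ c : ℝ, Q (c • x) = c ^ ν • Q x)
    (hVs : StarShapedAtZero V) (hT : IsHomog (m + (ν + 1)) V T)
    (hd : IsCohData (posCone V) Z ν Q (homExtend V (m + (ν + 1)) T) B ((m : ℝ) + 1))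
    (hj : 0 < (m : ℝ) + 1 + rate a b B) :
    IsHomog (m + 1) V (cohIntegral Q (homExtend V (m + (ν + 1)) T) φ) := by
  have hsol := hf.isFlowSol_cohIntegral hd hj
  have hpos : ∀ x ∈ posCone V, ∀ c : ℝ, 0 < c →
      cohIntegral Q (homExtend V (m + (ν + 1)) T) φ (c • x) =
        c ^ (m + 1) • cohIntegral Q (homExtend V (m + (ν + 1)) T) φ x := by
    intro x hx c hc
    rw [hsol.homog x hx c hc, ← Real.rpow_natCast]
    norm_cast
  refine ⟨hsol.cont.mono subset_posCone, fun c u hu hcu => ?_⟩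
  rcases lt_trichotomy c 0 with hc | rfl | hc
  · have hu' : -u ∈ posCone V := by
      refine ⟨-c, by linarith, ?_⟩
      rwa [smul_neg, neg_smul, neg_neg]
    have hev := hr.even_of_neg_mem hp (subset_posCone hu) hu'
    have hTn : ∀ x ∈ posCone V, -x ∈ posCone V → homExtend V (m + (ν + 1)) T (-x) =
        (-1 : ℝ) ^ (m + 1) • homExtend V (m + (ν + 1)) T x := by
      rintro x ⟨s, hs, hsx⟩ ⟨s', hs', hsx'⟩
      have hm : min s s' • x ∈ V := by
        have := hVs.2 _ hsx (min s s' / s) (by positivity) ((div_le_one hs).2 (min_le_left _ _))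
        rwa [smul_smul, div_mul_cancel₀ _ hs.ne'] at this
      have hm' : min s s' • -x ∈ V := by
        have := hVs.2 _ hsx' (min s s' / s') (by positivity) ((div_le_one hs').2 (min_le_right _ _))
        rwa [smul_smul, div_mul_cancel₀ _ hs'.ne'] at this
      have hmin : 0 < min s s' := by positivity
      rw [homExtend_eq hT hmin hm, homExtend_eq hT hmin hm']
      have e : min s s' • -x = (-1 : ℝ) • min s s' • x := by rw [neg_one_smul, smul_neg]
      have hsign : (-1 : ℝ) ^ (m + (ν + 1)) = (-1) ^ (m + 1) := by
        rw [show m + (ν + 1) = (m + 1) + ν by ring, pow_add, hev.neg_one_pow, mul_one]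
      rw [e, hT.2 (-1) _ hm (by rwa [← e]), smul_comm, hsign]
    have hneg := cohIntegral_neg hf hd hr.contDiff
      (fun x => by
        have := hp x (-1)
        rwa [neg_one_smul, hev.add_one.neg_one_pow, neg_one_smul] at this)
      (fun x => by
        have := hQ x (-1)
        rwa [neg_one_smul, hev.neg_one_pow, one_smul] at this) hTn (subset_posCone hu) hu'
    have e : c • u = (-c) • -u := by rw [smul_neg, neg_smul, neg_neg]
    rw [e, hpos _ hu' (-c) (by linarith), hneg, smul_smul, ← mul_pow]
    congr 2
    ring
  · rw [zero_smul] at hcu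
    exact absurd hcu hV0
  · exact hpos u (subset_posCone hu) c hc

end Solution

/-! ### Complex differentiable functions of several variables are analytic -/

section Osgood

open Complex

theorem continuous_torusMap {n : ℕ} (c : Fin n → ℂ) (R : Fin n → ℝ) : Continuous (torusMap c R) := by
  unfold torusMap
  fun_prop

theorem norm_torusMap_sub {n : ℕ} (c : Fin n → ℂ) {R : Fin n → ℝ} (hR : ∀ i, 0 ≤ R i) (θ : Fin n → ℝ)
    (i : Fin n) : ‖torusMap c R θ i - c i‖ = R i := by
  simp [torusMap, Complex.norm_exp, abs_of_nonneg (hR i)]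

/-- Cauchy's integral formula on a polydisc. -/
theorem torusIntegral_prod_inv_smul {n : ℕ} {c w : Fin n → ℂ} {R : Fin n → ℝ}
    (hw : ∀ i, w i ∈ ball (c i) (R i)) {f : (Fin n → ℂ) → ℂ}
    (hf : DifferentiableOn ℂ f (univ.pi fun i => closedBall (c i) (R i))) :
    (∯ ζ in T(c, R), (∏ i, (ζ i - w i)⁻¹) • f ζ) = (2 * Real.pi * I : ℂ) ^ n • f w := by
  induction n with
  | zero =>
    rw [torusIntegral_dim0]
    simp [Subsingleton.elim c w]
  | succ n ih =>
    have hR : ∀ i, 0 ≤ R i := fun i => (dist_nonneg.trans_lt (hw i)).le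
    have hmem : ∀ θ i, torusMap c R θ i ∈ closedBall (c i) (R i) := fun θ i => by
      rw [mem_closedBall, dist_eq_norm, norm_torusMap_sub c hR]
    have hint : TorusIntegrable (fun ζ => (∏ i, (ζ i - w i)⁻¹) • f ζ) c R := by
      have hc := continuous_torusMap c R
      refine ContinuousOn.integrableOn_compact isCompact_Icc (Continuous.continuousOn ?_)
      have hprod : Continuous fun θ => ∏ i, (torusMap c R θ i - w i)⁻¹ := by
        refine continuous_finsetProd _ fun i _ => ?_
        refine Continuous.inv₀ (((continuous_apply i).comp hc).sub continuous_const) fun θ => ?_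
        rw [sub_ne_zero]
        intro h
        have h1 := norm_torusMap_sub c hR θ i
        have h2 := hw i
        rw [mem_ball, dist_eq_norm, ← h] at h2
        exact h2.ne h1
      exact hprod.smul (hf.continuousOn.comp_continuous hc fun θ i _ => hmem θ i)
    rw [torusIntegral_succ hint]
    have h0 : ∀ x ∈ closedBall (c 0) (R 0),
        (∯ y in T(c ∘ Fin.succ, R ∘ Fin.succ), (∏ i, ((Fin.cons x y : Fin (n + 1) → ℂ) i - w i)⁻¹) •
          f (Fin.cons x y)) = (x - w 0)⁻¹ • ((2 * Real.pi * I : ℂ) ^ n •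
            f (Fin.cons x (w ∘ Fin.succ))) := by
      intro x hx
      rw [← ih (f := fun y => f (Fin.cons x y)) (c := c ∘ Fin.succ) (R := R ∘ Fin.succ)
        (w := w ∘ Fin.succ) (fun i => hw i.succ), ← torusIntegral_smul]
      · simp only [Fin.prod_univ_succ, Fin.cons_zero, Fin.cons_succ, smul_smul, Function.comp_apply]
      · refine hf.comp ?_ fun y hy i _ => ?_
        · refine Differentiable.differentiableOn (differentiable_pi.2 fun i => ?_)
          refine Fin.cases ?_ (fun i => ?_) i
          · simp
          · simp only [Fin.cons_succ]; fun_prop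
        · refine Fin.cases ?_ (fun i => ?_) i
          · simpa using hx
          · simpa using hy i trivial
    rw [circleIntegral.integral_congr (hR 0) fun x hx => h0 x (sphere_subset_closedBall hx)]
    have h1 : DifferentiableOn ℂ (fun x => (2 * Real.pi * I : ℂ) ^ n • f (Fin.cons x (w ∘ Fin.succ)))
        (closedBall (c 0) (R 0)) := by
      refine DifferentiableOn.fun_const_smul (hf.comp (t := univ.pi fun i => closedBall (c i) (R i))
        ?_ fun x hx i _ => ?_) _
      · refine Differentiable.differentiableOn (differentiable_pi.2 fun i => ?_)
        refine Fin.cases ?_ (fun i => ?_) i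
        · simp
        · simp
      · refine Fin.cases ?_ (fun i => ?_) i
        · simpa using hx
        · simpa using ball_subset_closedBall (hw i.succ)
    rw [h1.circleIntegral_sub_inv_smul (hw 0), smul_smul, ← pow_succ']
    congr 2
    exact Fin.cons_self_tail w

/-- The function `θ ↦ torusMap c R θ i`. -/
def torusCoord {n : ℕ} (c : Fin n → ℂ) {R : Fin n → ℝ} (hR : ∀ i, 0 ≤ R i) (i : Fin n) :
    BoundedContinuousFunction (Fin n → ℝ) ℂ :=
  BoundedContinuousFunction.ofNormedAddCommGroup (fun θ => torusMap c R θ i)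
    ((continuous_apply i).comp (continuous_torusMap c R)) (‖c i‖ + R i) fun θ => by
      have := norm_add_le (c i) (torusMap c R θ i - c i)
      rwa [norm_torusMap_sub c hR, add_sub_cancel] at this

/-- **Osgood's lemma**. By Cauchy's formula, the function is a continuous linear functional of the
Cauchy kernel, which depends analytically on the point as an element of a Banach algebra. -/
theorem analyticOnNhd_of_differentiableOn {n : ℕ} {f : (Fin n → ℂ) → ℂ} {U : Set (Fin n → ℂ)}
    (hU : IsOpen U) (hf : DifferentiableOn ℂ f U) : AnalyticOnNhd ℂ f U := by
  intro c hc
  obtain ⟨r, hr, hrU⟩ := Metric.nhds_basis_closedBall.mem_iff.1 (hU.mem_nhds hc)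
  let R : Fin n → ℝ := fun _ => r
  have hR : ∀ i, 0 ≤ R i := fun _ => hr.le
  have hpoly : (univ.pi fun i => closedBall (c i) (R i)) ⊆ U := by
    intro z hz
    refine hrU ((dist_pi_le_iff hr.le).2 fun i => hz i trivial)
  let A := BoundedContinuousFunction (Fin n → ℝ) ℂ
  let k : Fin n → (Fin n → ℂ) → A := fun i w => torusCoord c hR i - algebraMap ℂ A (w i)
  have hkc : ∀ i, IsUnit (k i c) := by
    intro i
    have hval : ∀ θ, k i c θ = torusMap c R θ i - c i := fun θ => rfl
    have hne : ∀ θ, k i c θ ≠ 0 := fun θ h => by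
      have := norm_torusMap_sub c hR θ i
      rw [← hval, h, norm_zero] at this
      exact hr.ne this
    let v : A := BoundedContinuousFunction.ofNormedAddCommGroup (fun θ => (k i c θ)⁻¹)
      ((k i c).continuous.inv₀ hne) r⁻¹ fun θ => by
        rw [norm_inv, hval, norm_torusMap_sub c hR]
    refine IsUnit.of_mul_eq_one v ?_
    ext θ
    exact mul_inv_cancel₀ (hne θ)
  have hk : ∀ i, AnalyticAt ℂ (k i) c := fun i => by
    refine analyticAt_const.sub ?_
    have : AnalyticAt ℂ (fun w : Fin n → ℂ => w i) c :=
      (ContinuousLinearMap.proj (R := ℂ) (φ := fun _ : Fin n => ℂ) i).analyticAt c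
    have h2 : (fun w : Fin n → ℂ => algebraMap ℂ A (w i)) = fun w => w i • (1 : A) := by
      ext w : 1
      exact Algebra.algebraMap_eq_smul_one _
    rw [h2]
    exact this.smul analyticAt_const
  have hK : AnalyticAt ℂ (fun w => ∏ i, Ring.inverse (k i w)) c := by
    refine Finset.analyticAt_fun_prod _ fun i _ => ?_
    obtain ⟨u, hu⟩ := hkc i
    have := analyticAt_inverse (𝕜 := ℂ) u
    rw [hu] at this
    exact this.comp (hk i)
  -- The integral against `f` on the torus, as a functional of the kernel.
  let G : (Fin n → ℝ) → ℂ := fun θ => (∏ i, (R i : ℂ) * exp (θ i * I) * I) * f (torusMap c R θ)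
  have hGc : Continuous G := by
    refine Continuous.mul (by fun_prop) (hf.continuousOn.comp_continuous (continuous_torusMap c R)
      fun θ => hpoly fun i _ => ?_)
    rw [mem_closedBall, dist_eq_norm, norm_torusMap_sub c hR]
  have hGi : IntegrableOn G (Icc 0 fun _ => 2 * Real.pi) :=
    hGc.continuousOn.integrableOn_compact isCompact_Icc
  have hGu : ∀ u : A, IntegrableOn (fun θ => G θ * u θ) (Icc 0 fun _ => 2 * Real.pi) := fun u =>
    (hGc.mul u.continuous).continuousOn.integrableOn_compact isCompact_Icc
  let L : A →L[ℂ] ℂ := LinearMap.mkContinuous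
    { toFun := fun u => ∫ θ in Icc 0 fun _ => 2 * Real.pi, G θ * u θ
      map_add' := fun u v => by
        rw [← integral_add (hGu u) (hGu v)]
        exact integral_congr_ae (ae_of_all _ fun θ => mul_add _ _ _)
      map_smul' := fun a u => by
        rw [RingHom.id_apply, ← integral_smul]
        exact integral_congr_ae (ae_of_all _ fun θ => mul_left_comm _ _ _) } (∫ θ in Icc 0 fun _ => 2 * Real.pi, ‖G θ‖) fun u => by
      rw [← integral_mul_const]
      refine norm_integral_le_of_norm_le (hGi.norm.mul_const _) (ae_of_all _ fun θ => ?_)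
      rw [norm_mul]
      gcongr
      exact u.norm_coe_le_norm θ
  have hrep : ∀ᶠ w in 𝓝 c, f w = ((2 * Real.pi * I : ℂ) ^ n)⁻¹ • L (∏ i, Ring.inverse (k i w)) := by
    have hunit : ∀ᶠ w in 𝓝 c, ∀ i, IsUnit (k i w) := by
      rw [eventually_all]
      exact fun i => (hk i).continuousAt.eventually_mem (Units.isOpen.mem_nhds (hkc i))
    filter_upwards [hunit, ball_mem_nhds c hr] with w hw hwr
    have hcauchy := torusIntegral_prod_inv_smul (c := c) (w := w) (R := R) (fun i =>
      (dist_le_pi_dist w c i).trans_lt hwr) (hf.mono hpoly)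
    have hpi : (2 * Real.pi * I : ℂ) ^ n ≠ 0 := pow_ne_zero _ (by simp [Real.pi_ne_zero])
    rw [eq_inv_smul_iff₀ hpi, ← hcauchy, torusIntegral]
    refine integral_congr_ae (ae_of_all _ fun θ => ?_)
    have hval : (∏ i, Ring.inverse (k i w)) θ = ∏ i, (torusMap c R θ i - w i)⁻¹ := by
      have h1 : ∀ i, Ring.inverse (k i w) θ = (torusMap c R θ i - w i)⁻¹ := by
        intro i
        refine eq_inv_of_mul_eq_one_left ?_
        have := congrArg (fun u : A => u θ) (Ring.inverse_mul_cancel _ (hw i))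
        exact this
      have h2 := map_prod ((Pi.evalMonoidHom (fun _ => ℂ) θ).comp
        BoundedContinuousFunction.coeFnMonoidHom) (fun i => (Ring.inverse (k i w) : A)) Finset.univ
      exact h2.trans (Finset.prod_congr rfl fun i _ => h1 i)
    simp only [hval, G, smul_eq_mul]
    ring
  have hL : AnalyticAt ℂ (fun w => L (∏ i, Ring.inverse (k i w))) c := (L.analyticAt _).comp hK
  exact (analyticAt_const.fun_smul hL).congr (hrep.mono fun w hw => hw.symm)

end Osgood

/-! ### Quotients of functions with Dini bounds -/

/-- The quotient rule for Dini derivatives, as an inequality. -/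
theorem DiniLe.div {f g : ℝ → ℝ} {c c' t : ℝ} (hf : DiniLe f c t) (hg : DiniLe (fun s => -g s) c' t)
    (hft : 0 ≤ f t) (hgt : 0 < g t) (hgc : ContinuousWithinAt g (Ici t) t) :
    DiniLe (fun s => f s / g s) ((c * g t + f t * c') / g t ^ 2) t := by
  intro r hr
  rw [div_lt_iff₀ (by positivity)] at hr
  set ε := (r * g t ^ 2 - (c * g t + f t * c')) / (2 * (g t + f t)) with hε
  have hε0 : 0 < ε := div_pos (by linarith) (by linarith)
  have hεe : 2 * (ε * (g t + f t)) = r * g t ^ 2 - (c * g t + f t * c') := by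
    have : g t + f t ≠ 0 := by linarith
    rw [hε]; field_simp
  set M := (c + ε) * g t + f t * (c' + ε) with hM
  have hMr : M / (g t * g t) < r := by
    rw [div_lt_iff₀ (by positivity)]
    nlinarith
  have hgc' : Tendsto g (𝓝[>] t) (𝓝 (g t)) := hgc.mono Ioi_subset_Ici_self
  have hlim : Tendsto (fun z => M / (g z * g t)) (𝓝[>] t) (𝓝 (M / (g t * g t))) :=
    tendsto_const_nhds.div (hgc'.mul_const _) (by positivity)
  filter_upwards [hf (c + ε) (by linarith), hg (c' + ε) (by linarith), hlim.eventually_lt_const hMr,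
    hgc'.eventually_const_lt hgt, self_mem_nhdsWithin] with z h1 h2 h3 h4 hz
  have hz : 0 < z - t := sub_pos.2 hz
  have he : slope (fun s => f s / g s) t z =
      (slope f t z * g t + f t * slope (fun s => -g s) t z) / (g z * g t) := by
    simp only [slope_def_field]
    field_simp
    ring
  rw [he]
  refine lt_of_le_of_lt ?_ h3
  have h5 : slope f t z * g t + f t * slope (fun s => -g s) t z ≤ M := by
    rw [hM]; gcongr
  gcongr

/-- Let `g` decrease at most at the rate `k g ^ (ν + 1)`, and let `f` grow at most at the rate
`L g ^ ν f`, and decrease at least at the rate `α g ^ ν f` after the scaled time `θ`, where `k < α`.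
Then `f / g` stays bounded, and decays like a power of the time. -/
theorem div_le_of_diniLe {f g : ℝ → ℝ} {ν : ℕ} (hν : 0 < ν) {τ L k e α θ : ℝ}
    (hfc : ContinuousOn f (Icc 0 τ)) (hgc : ContinuousOn g (Icc 0 τ)) (hf0 : ∀ t, 0 ≤ f t)
    (hg0 : ∀ t ∈ Icc 0 τ, 0 < g t) (hgX : ∀ t ∈ Icc 0 τ, g t ≤ g 0) (hL : 0 ≤ L) (hk : 0 ≤ k)
    (hke : k < e) (hkα : k ≤ α) (hθ : 0 ≤ θ)
    (hg : ∀ t ∈ Ico 0 τ, DiniLe (fun s => -g s) (k * g t ^ (ν + 1)) t)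
    (hf : ∀ t ∈ Ico 0 τ, DiniLe f (L * g t ^ ν * f t) t)
    (hf' : ∀ t ∈ Ico 0 τ, θ ≤ t * g 0 ^ ν → DiniLe f (-(α * g t ^ ν * f t)) t) :
    (∀ t ∈ Icc 0 τ, f t / g t ≤ f 0 / g 0 * Real.exp ((L + k) * θ)) ∧
    ∀ t ∈ Icc 0 τ, θ ≤ t * g 0 ^ ν → f t / g t ≤ f 0 / g 0 * Real.exp ((L + k) * θ +
      (α - k) / (e * ν) * (Real.log (1 + e * ν * θ) - Real.log (1 + e * ν * (t * g 0 ^ ν)))) := by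
  have he : 0 < e := hk.trans_lt hke
  have hν' : (0 : ℝ) < ν := by positivity
  rcases lt_or_ge τ 0 with hτ | hτ
  · rw [Icc_eq_empty (not_le.2 hτ)]; simp
  have hX : 0 < g 0 := hg0 0 ⟨le_rfl, hτ⟩
  have hXν : 0 < g 0 ^ ν := by positivity
  have hpos : ∀ t : ℝ, 0 ≤ t → 0 < 1 + e * ν * (t * g 0 ^ ν) := fun t ht => by positivity
  have hlow : ∀ t ∈ Icc 0 τ, g 0 ^ ν / (1 + e * ν * (t * g 0 ^ ν)) ≤ g t ^ ν := by
    have hpos' : ∀ t : ℝ, 0 ≤ t → 0 < 1 + e * ν * g 0 ^ ν * t := fun t ht => by positivity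
    have := le_of_diniLe_of_lt (f := fun t => -g t) (f' := fun t => k * g t ^ (ν + 1))
      (B := fun t => -(g 0 * (1 + e * ν * g 0 ^ ν * t) ^ (-(1 / ν : ℝ))))
      (B' := fun t => e * (g 0 * (1 + e * ν * g 0 ^ ν * t) ^ (-(1 / ν : ℝ))) ^ (ν + 1))
      (a := 0) (b := τ) hgc.neg hg (by simp)
      (fun t ht => ((hasDerivAt_scalar_decay hν hX (hpos' t ht.1)).neg.continuousAt).continuousWithinAt)
      (fun t ht => by
        have := (hasDerivAt_scalar_decay hν hX (hpos' t ht.1)).neg.hasDerivWithinAt (s := Ici t)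
        rwa [neg_neg] at this)
      (fun t ht h => by
        have hgt := hg0 t ⟨ht.1, ht.2.le⟩
        rw [← neg_inj.1 h]
        have := pow_pos hgt (ν + 1)
        nlinarith)
    intro t ht
    have h1 : g 0 * (1 + e * ν * g 0 ^ ν * t) ^ (-(1 / ν : ℝ)) ≤ g t := by
      have := this t ht
      linarith
    have h2 := pow_le_pow_left₀ (by have := hpos' t ht.1; positivity) h1 ν
    refine le_trans (le_of_eq ?_) h2
    rw [mul_pow, ← Real.rpow_natCast (_ ^ _) ν, ← Real.rpow_mul (hpos' t ht.1).le, neg_mul,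
      one_div_mul_cancel hν'.ne', Real.rpow_neg_one, div_eq_mul_inv]
    ring_nf
  have huc : ContinuousOn (fun t => f t / g t) (Icc 0 τ) := hfc.div hgc fun t ht => (hg0 t ht).ne'
  have hu0 : ∀ t ∈ Icc 0 τ, 0 ≤ f t / g t := fun t ht => div_nonneg (hf0 t) (hg0 t ht).le
  have hdiv : ∀ t ∈ Ico 0 τ, ∀ l, DiniLe f (l * g t ^ ν * f t) t →
      DiniLe (fun s => f s / g s) ((l + k) * g t ^ ν * (f t / g t)) t := by
    intro t ht l hl
    have hgt := hg0 t ⟨ht.1, ht.2.le⟩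
    have hc : ContinuousWithinAt g (Ici t) t :=
      ((hgc t ⟨ht.1, ht.2.le⟩).mono (Icc_subset_Icc_left ht.1)).mono_of_mem_nhdsWithin
        (Icc_mem_nhdsGE ht.2)
    refine (hl.div (hg t ht) (hf0 t) hgt hc).mono (le_of_eq ?_)
    field_simp
    ring
  have first : ∀ t ∈ Icc 0 τ, t * g 0 ^ ν ≤ θ →
      f t / g t ≤ f 0 / g 0 * Real.exp ((L + k) * θ) := by
    intro t ht htθ
    have := le_mul_exp_of_diniLe (g := fun t => f t / g t) (α := fun _ => (L + k) * g 0 ^ ν)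
      (P := fun t => (L + k) * g 0 ^ ν * t) ht.1 (huc.mono (Icc_subset_Icc_right ht.2))
      (hu0 0 ⟨le_rfl, hτ⟩) (fun s hs => ?_) (by fun_prop)
      (fun s _ => by simpa using (hasDerivWithinAt_id s (Ici s)).const_mul ((L + k) * g 0 ^ ν))
    · refine this.trans ?_
      have hu := hu0 0 ⟨le_rfl, hτ⟩
      gcongr
      rw [mul_zero, sub_zero, mul_assoc, mul_comm (g 0 ^ ν)]
      gcongr
    · have hs' : s ∈ Ico 0 τ := ⟨hs.1, hs.2.trans_le ht.2⟩
      refine (hdiv s hs' L (hf s hs')).mono ?_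
      have hsI : s ∈ Icc 0 τ := ⟨hs'.1, hs'.2.le⟩
      have h1 := hu0 s hsI
      have h2 := (hg0 s hsI).le
      have h3 := hgX s hsI
      gcongr
  have second : ∀ t ∈ Icc 0 τ, θ ≤ t * g 0 ^ ν → f t / g t ≤ f 0 / g 0 * Real.exp ((L + k) * θ +
      (α - k) / (e * ν) * (Real.log (1 + e * ν * θ) - Real.log (1 + e * ν * (t * g 0 ^ ν)))) := by
    intro t ht htθ
    set T := θ / g 0 ^ ν with hT
    have hT0 : 0 ≤ T := by positivity
    have hTθ : T * g 0 ^ ν = θ := by rw [hT]; field_simp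
    have hTt : T ≤ t := by rw [hT, div_le_iff₀ hXν]; exact htθ
    have hTI : T ∈ Icc 0 τ := ⟨hT0, hTt.trans ht.2⟩
    have hPd : ∀ s, 0 ≤ s → HasDerivAt
        (fun s => -((α - k) / (e * ν) * Real.log (1 + e * ν * (s * g 0 ^ ν))))
        (-((α - k) * (g 0 ^ ν / (1 + e * ν * (s * g 0 ^ ν))))) s := by
      intro s hs
      have h1 : HasDerivAt (fun s => 1 + e * ν * (s * g 0 ^ ν)) (e * ν * g 0 ^ ν) s := by
        simpa using (((hasDerivAt_id s).mul_const (g 0 ^ ν)).const_mul (e * ν)).const_add 1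
      refine ((h1.log (hpos s hs).ne').const_mul ((α - k) / (e * ν))).fun_neg.congr_deriv ?_
      have := (hpos s hs).ne'
      field_simp
    have := le_mul_exp_of_diniLe (g := fun t => f t / g t)
      (α := fun s => -((α - k) * (g 0 ^ ν / (1 + e * ν * (s * g 0 ^ ν)))))
      (P := fun s => -((α - k) / (e * ν) * Real.log (1 + e * ν * (s * g 0 ^ ν)))) hTt
      (huc.mono (Icc_subset_Icc hT0 ht.2)) (hu0 T hTI) (fun s hs => ?_)
      (fun s hs => (hPd s (hT0.trans hs.1)).continuousAt.continuousWithinAt)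
      (fun s hs => (hPd s (hT0.trans hs.1)).hasDerivWithinAt)
    · refine this.trans ?_
      rw [Real.exp_add, ← mul_assoc (f 0 / g 0), hTθ]
      have h1 := first T hTI hTθ.le
      have h2 : -((α - k) / (e * ν) * Real.log (1 + e * ν * (t * g 0 ^ ν))) -
          -((α - k) / (e * ν) * Real.log (1 + e * ν * θ)) = (α - k) / (e * ν) *
          (Real.log (1 + e * ν * θ) - Real.log (1 + e * ν * (t * g 0 ^ ν))) := by ring
      rw [h2]
      gcongr
    · have hs0 : 0 ≤ s := hT0.trans hs.1
      have hs' : s ∈ Ico 0 τ := ⟨hs0, hs.2.trans_le ht.2⟩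
      have hsI : s ∈ Icc 0 τ := ⟨hs'.1, hs'.2.le⟩
      have h3 : θ ≤ s * g 0 ^ ν := by
        rw [← hTθ]; gcongr; exact hs.1
      refine (hdiv s hs' (-α) ((hf' s hs' h3).mono (le_of_eq (by ring)))).mono ?_
      have h1 := hu0 s hsI
      have h2 := mul_le_mul_of_nonneg_left (hlow s hsI) (sub_nonneg.2 hkα)
      have h4 := mul_le_mul_of_nonneg_right h2 h1
      linarith
  refine ⟨fun t ht => ?_, second⟩
  rcases le_total (t * g 0 ^ ν) θ with h | h
  · exact first t ht h
  · refine (second t ht h).trans ?_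
    have hu := hu0 0 ⟨le_rfl, hτ⟩
    gcongr
    have h1 : Real.log (1 + e * ν * θ) ≤ Real.log (1 + e * ν * (t * g 0 ^ ν)) :=
      Real.log_le_log (by positivity) (by gcongr)
    have h2 : 0 ≤ (α - k) / (e * ν) := div_nonneg (sub_nonneg.2 hkα) (by positivity)
    nlinarith

/-! ### Complexification -/

/-- Multiplication by `i` on `X × X`, the complexification of `X`. -/
def mulI (X : Type*) [NormedAddCommGroup X] [NormedSpace ℝ X] : X × X →L[ℝ] X × X :=
  (-(ContinuousLinearMap.snd ℝ X X)).prod (ContinuousLinearMap.fst ℝ X X)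

theorem mulI_apply {X : Type*} [NormedAddCommGroup X] [NormedSpace ℝ X] (z : X × X) :
    mulI X z = (-z.2, z.1) := rfl

theorem mulI_mulI {X : Type*} [NormedAddCommGroup X] [NormedSpace ℝ X] (z : X × X) :
    mulI X (mulI X z) = -z := rfl

/-- The points `(x, y)`, standing for `x + i y`, with `x ∈ W` and `‖y‖ < γ ‖x‖`. -/
def omegaCone {E : Type*} [NormedAddCommGroup E] (W : Set E) (γ : ℝ) : Set (E × E) :=
  {z | z.1 ∈ W ∧ ‖z.2‖ < γ * ‖z.1‖}

theorem isOpen_omegaCone {E : Type*} [NormedAddCommGroup E] {W : Set E} (hW : IsOpen W) (γ : ℝ) :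
    IsOpen (omegaCone W γ) :=
  (hW.preimage continuous_fst).inter
    (isOpen_lt continuous_snd.norm (continuous_const.mul continuous_fst.norm))

theorem omegaCone_mono {E : Type*} [NormedAddCommGroup E] {W : Set E} {γ γ' : ℝ} (h : γ ≤ γ') :
    omegaCone W γ ⊆ omegaCone W γ' :=
  fun _ hz => ⟨hz.1, hz.2.trans_le (mul_le_mul_of_nonneg_right h (norm_nonneg _))⟩

theorem mem_omegaCone_real {E : Type*} [NormedAddCommGroup E] {W : Set E} (hW : (0 : E) ∉ W) {γ : ℝ}
    (hγ : 0 < γ) {x : E} (hx : x ∈ W) : (x, (0 : E)) ∈ omegaCone W γ := by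
  refine ⟨hx, ?_⟩
  have := norm_pos_iff.2 fun h : x = 0 => hW (h ▸ hx)
  simpa using mul_pos hγ this

theorem smul_mem_omegaCone {E : Type*} [NormedAddCommGroup E] [NormedSpace ℝ E] {W : Set E} {γ : ℝ}
    {z : E × E} (hz : z ∈ omegaCone W γ) {c : ℝ} (hc : 0 < c) (hcz : c • z.1 ∈ W) :
    c • z ∈ omegaCone W γ := by
  refine ⟨hcz, ?_⟩
  rw [Prod.smul_snd, Prod.smul_fst, norm_smul, norm_smul, Real.norm_of_nonneg hc.le]
  have := mul_lt_mul_of_pos_left hz.2 hc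
  linarith

theorem posCone_omegaCone {E : Type*} [NormedAddCommGroup E] [NormedSpace ℝ E] {V : Set E} {γ : ℝ} :
    posCone (omegaCone V γ) = omegaCone (posCone V) γ := by
  ext z
  constructor
  · rintro ⟨s, hs, h1, h2⟩
    refine ⟨⟨s, hs, h1⟩, ?_⟩
    rw [Prod.smul_snd, Prod.smul_fst, norm_smul, norm_smul, Real.norm_of_nonneg hs.le] at h2
    exact lt_of_mul_lt_mul_left (by linarith) hs.le
  · rintro ⟨⟨s, hs, h1⟩, h2⟩
    refine ⟨s, hs, h1, ?_⟩
    rw [Prod.smul_snd, Prod.smul_fst, norm_smul, norm_smul, Real.norm_of_nonneg hs.le]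
    have := mul_lt_mul_of_pos_left h2 hs
    linarith

section Coordinates

variable {X : Type*} [NormedAddCommGroup X] [NormedSpace ℝ X] {n : ℕ}

/-- The coordinates, in a real basis of `X`, of the points of the complexification of `X`. -/
def complexCoord (b : Module.Basis (Fin n) ℝ X) : (X × X) ≃L[ℝ] (Fin n → ℂ) :=
  have : FiniteDimensional ℝ X := Module.Finite.of_basis b
  LinearEquiv.toContinuousLinearEquiv (show (X × X) ≃ₗ[ℝ] (Fin n → ℂ) from
    { toFun := fun z i => (b.repr z.1 i : ℂ) + Complex.I * (b.repr z.2 i : ℂ)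
      map_add' := fun z w => by
        ext i
        simp only [Prod.fst_add, Prod.snd_add, map_add, Finsupp.add_apply, Pi.add_apply]
        push_cast
        ring
      map_smul' := fun c z => by
        ext i
        simp only [Prod.smul_fst, Prod.smul_snd, map_smul, Finsupp.smul_apply, Pi.smul_apply,
          smul_eq_mul, Complex.real_smul, RingHom.id_apply]
        push_cast
        ring
      invFun := fun w => (rePart b w, imPart b w)
      left_inv := fun z => by
        refine Prod.ext ?_ ?_
        · simp [rePart, b.sum_repr]
        · simp [imPart, b.sum_repr]
      right_inv := fun w => by
        ext i
        simp only [rePart, imPart, b.repr_sum_self]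
        rw [mul_comm]
        exact Complex.re_add_im (w i) })

theorem complexCoord_apply (b : Module.Basis (Fin n) ℝ X) (z : X × X) (i : Fin n) :
    complexCoord b z i = (b.repr z.1 i : ℂ) + Complex.I * (b.repr z.2 i : ℂ) := rfl

theorem complexCoord_mulI (b : Module.Basis (Fin n) ℝ X) (z : X × X) :
    complexCoord b (mulI X z) = Complex.I • complexCoord b z := by
  ext i
  simp only [complexCoord_apply, mulI_apply, map_neg, Finsupp.neg_apply, Pi.smul_apply, smul_eq_mul]
  push_cast
  linear_combination (-(b.repr z.2 i : ℂ)) * Complex.I_mul_I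

theorem complexCoord_symm_I_smul (b : Module.Basis (Fin n) ℝ X) (w : Fin n → ℂ) :
    (complexCoord b).symm (Complex.I • w) = mulI X ((complexCoord b).symm w) := by
  rw [ContinuousLinearEquiv.symm_apply_eq, complexCoord_mulI, ContinuousLinearEquiv.apply_symm_apply]

theorem complexCoord_real (b : Module.Basis (Fin n) ℝ X) (x : X) :
    complexCoord b (x, 0) = toComplex b x := by
  ext i
  simp [complexCoord_apply, toComplex]

theorem mem_Omega_iff (b : Module.Basis (Fin n) ℝ X) {V : Set X} {γ : ℝ} {w : Fin n → ℂ} :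
    w ∈ Omega b V γ ↔ (complexCoord b).symm w ∈ omegaCone V γ := Iff.rfl

theorem complexCoord_mem_Omega (b : Module.Basis (Fin n) ℝ X) {V : Set X} {γ : ℝ} {z : X × X} :
    complexCoord b z ∈ Omega b V γ ↔ z ∈ omegaCone V γ := by
  rw [mem_Omega_iff, ContinuousLinearEquiv.symm_apply_apply]

/-- The analytic extension of a homogeneous function is homogeneous: on the complex line through
`x` and `x + i y`, this holds at the real points, hence everywhere. -/
theorem IsComplexExtension.homog {e : Module.Basis (Fin n) ℝ X} {V : Set X} {γ : ℝ} {f : X → ℝ}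
    {g : (Fin n → ℂ) → ℂ} (hV : IsOpen V) (hg : IsComplexExtension e V γ f g) {d : ℕ} {c : ℝ}
    (hf : ∀ x ∈ V, c • x ∈ V → f (c • x) = c ^ d * f x) {z : X × X} (hz : z ∈ omegaCone V γ)
    (hcz : c • z ∈ omegaCone V γ) :
    g (complexCoord e (c • z)) = (c : ℂ) ^ d * g (complexCoord e z) := by
  obtain ⟨x, y⟩ := z
  let σ : ℂ → X × X := fun w => (x + w.re • y, w.im • y)
  have hσc : Continuous σ := by fun_prop
  have hσ : ∀ w, complexCoord e (σ w) = toComplex e x + w • toComplex e y := by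
    intro w
    ext i
    simp only [complexCoord_apply, σ, map_add, map_smul, Finsupp.add_apply, Finsupp.smul_apply,
      Pi.add_apply, Pi.smul_apply, toComplex, smul_eq_mul]
    push_cast
    linear_combination ((e.repr y i : ℝ) : ℂ) * Complex.re_add_im w
  have hcσ : ∀ w, complexCoord e (c • σ w) = c • (toComplex e x + w • toComplex e y) := by
    intro w; rw [map_smul, hσ]
  have hγx : ∀ x' : X, ∀ c' t : ℝ, t ∈ Icc (0 : ℝ) 1 → ‖c' • y‖ < γ * ‖x'‖ →
      ‖c' • t • y‖ < γ * ‖x'‖ := by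
    intro x' c' t ht h
    refine lt_of_le_of_lt ?_ h
    rw [smul_comm, norm_smul, Real.norm_of_nonneg ht.1]
    exact mul_le_of_le_one_left (norm_nonneg _) ht.2
  set D₀ := {w : ℂ | σ w ∈ omegaCone V γ ∧ c • σ w ∈ omegaCone V γ} with hD₀
  have hopen : IsOpen D₀ := ((isOpen_omegaCone hV γ).preimage hσc).inter
    ((isOpen_omegaCone hV γ).preimage (hσc.const_smul c))
  have hseg : segment ℝ 0 Complex.I ⊆ D₀ := by
    rw [segment_eq_image']
    rintro _ ⟨t, ht, rfl⟩
    have e1 : σ (0 + t • (Complex.I - 0)) = (x, t • y) := by simp [σ]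
    rw [hD₀, mem_ofPred_eq, e1]
    refine ⟨⟨hz.1, ?_⟩, ⟨hcz.1, hγx _ c t ht hcz.2⟩⟩
    have := hγx x 1 t ht (by simpa using hz.2)
    rwa [one_smul] at this
  have hsegc : IsCompact (segment ℝ (0 : ℂ) Complex.I) := by
    rw [segment_eq_image']
    exact isCompact_Icc.image (by fun_prop)
  obtain ⟨δ, hδ, hthick⟩ := hsegc.exists_thickening_subset_open hopen hseg
  set D := thickening δ (segment ℝ 0 Complex.I) with hD
  have hDconv : Convex ℝ D := (convex_segment (0 : ℂ) Complex.I).thickening δ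
  have hsub := self_subset_thickening hδ (segment ℝ (0 : ℂ) Complex.I)
  have h0 : (0 : ℂ) ∈ D := hsub (left_mem_segment ℝ _ _)
  have hI : Complex.I ∈ D := hsub (right_mem_segment ℝ _ _)
  have hd := hg.1.differentiableOn
  have h1 : DifferentiableOn ℂ (fun w => g (complexCoord e (c • σ w))) D := by
    simp only [hcσ]
    refine hd.comp (Differentiable.differentiableOn (by fun_prop)) fun w hw => ?_
    rw [← hcσ]
    exact (complexCoord_mem_Omega e).2 (hthick hw).2
  have h2 : DifferentiableOn ℂ (fun w => (c : ℂ) ^ d * g (complexCoord e (σ w))) D := by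
    simp only [hσ]
    refine (hd.comp (t := Omega e V γ) (Differentiable.differentiableOn (by fun_prop))
      fun w hw => ?_).const_mul _
    rw [← hσ]
    exact (complexCoord_mem_Omega e).2 (hthick hw).1
  have hreal : ∃ᶠ w in 𝓝[≠] (0 : ℂ), g (complexCoord e (c • σ w)) =
      (c : ℂ) ^ d * g (complexCoord e (σ w)) := by
    have ht : Tendsto (fun u : ℝ => (u : ℂ)) (𝓝[≠] 0) (𝓝[≠] 0) := by
      refine tendsto_nhdsWithin_iff.2 ⟨?_, ?_⟩
      · exact (Complex.continuous_ofReal.tendsto' 0 0 rfl).mono_left nhdsWithin_le_nhds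
      · filter_upwards [self_mem_nhdsWithin] with u hu
        simpa using hu
    refine ht.frequently (Eventually.frequently ?_)
    have hev : ∀ᶠ u : ℝ in 𝓝[≠] 0, (u : ℂ) ∈ D :=
      (ht.mono_right nhdsWithin_le_nhds).eventually (isOpen_thickening.mem_nhds h0)
    filter_upwards [hev] with u hu
    have hm := hthick hu
    have e1 : σ u = (x + u • y, 0) := by simp [σ]
    have e2 : c • σ u = (c • (x + u • y), 0) := by rw [e1, Prod.smul_mk, smul_zero]
    rw [hD₀, mem_ofPred_eq, e2, e1] at hm
    rw [e2, e1, complexCoord_real, complexCoord_real, hg.2 _ hm.1.1, hg.2 _ hm.2.1,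
      hf _ hm.1.1 hm.2.1]
    push_cast
    rfl
  have := (h1.analyticOnNhd isOpen_thickening).eqOn_of_preconnected_of_frequently_eq
    (h2.analyticOnNhd isOpen_thickening) hDconv.isPreconnected h0 hreal hI
  simpa [σ] using this

end Coordinates

/-- `f'`, defined on the complex cone over `W`, is complex differentiable, homogeneous of degree `d`,
and extends `f`. -/
structure IsHomogExt {E G : Type*} [NormedAddCommGroup E] [NormedSpace ℝ E] [NormedAddCommGroup G]
    [NormedSpace ℝ G] (W : Set E) (γ : ℝ) (d : ℕ) (f : E → G) (f' : E × E → G × G) : Prop where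
  contDiffOn : ContDiffOn ℝ 1 f' (omegaCone W γ)
  fderiv_mulI : ∀ z ∈ omegaCone W γ, ∀ v, fderiv ℝ f' z (mulI E v) = mulI G (fderiv ℝ f' z v)
  homog : ∀ z ∈ omegaCone W γ, ∀ c : ℝ, 0 < c → f' (c • z) = c ^ d • f' z
  real : ∀ x ∈ W, f' (x, 0) = (f x, 0)

section Extension

variable {E G : Type*} [NormedAddCommGroup E] [NormedSpace ℝ E] [NormedAddCommGroup G]
  [NormedSpace ℝ G] {n k : ℕ} (e : Module.Basis (Fin n) ℝ E) (b : Module.Basis (Fin k) ℝ G)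
  {V : Set E} {γ : ℝ} {f : E → G} {d : ℕ} {g : Fin k → (Fin n → ℂ) → ℂ}

theorem hasFDerivAt_complexCoord_symm {z : E × E} {g' : (Fin n → ℂ) →L[ℂ] (Fin k → ℂ)}
    (hg : HasFDerivAt (fun w i => g i w) g' (complexCoord e z)) :
    HasFDerivAt (fun z => (complexCoord b).symm fun i => g i (complexCoord e z))
      (((complexCoord b).symm : (Fin k → ℂ) →L[ℝ] G × G).comp ((g'.restrictScalars ℝ).comp
        (complexCoord e : E × E →L[ℝ] (Fin n → ℂ)))) z :=
  (complexCoord b).symm.hasFDerivAt.comp z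
    ((hg.restrictScalars ℝ).comp z (complexCoord e).hasFDerivAt)

/-- A homogeneous function with an analytic extension in coordinates has a homogeneous extension to
the complex cone, whose derivative satisfies the same bound up to a constant. -/
theorem exists_isHomogExt (hV : IsOpen V) (hV0 : (0 : E) ∉ V) (hf : IsHomog d V f) (hγ : 0 < γ)
    (hg : ∀ i, IsComplexExtension e V γ (fun x => b.repr (f x) i) (g i)) :
    ∃ f', IsHomogExt (posCone V) γ d (homExtend V d f) f' ∧
      ∀ j L, d = j + 1 → (∀ i, ∀ w ∈ Omega e V γ, ‖fderiv ℂ (g i) w‖ ≤ L * ‖w‖ ^ j) →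
        ∃ L', 0 ≤ L' ∧ ∀ z ∈ omegaCone (posCone V) γ, ‖fderiv ℝ f' z‖ ≤ L' * ‖z‖ ^ j := by
  set f₀ : E × E → G × G := fun z => (complexCoord b).symm fun i => g i (complexCoord e z) with hf₀
  have hΩ := isOpen_omegaCone hV γ
  have han : ∀ z ∈ omegaCone V γ, AnalyticAt ℂ (fun w i => g i w) (complexCoord e z) := fun z hz =>
    AnalyticAt.pi fun i => (hg i).1 _ ((complexCoord_mem_Omega e).2 hz)
  have hD : ∀ z ∈ omegaCone V γ, HasFDerivAt f₀ _ z := fun z hz =>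
    hasFDerivAt_complexCoord_symm e b (han z hz).differentiableAt.hasFDerivAt
  have hC : ContDiffOn ℝ 1 f₀ (omegaCone V γ) := by
    intro z hz
    refine ContDiffAt.contDiffWithinAt ?_
    exact (complexCoord b).symm.contDiff.contDiffAt.comp z
      (((han z hz).contDiffAt.restrict_scalars ℝ).comp z (complexCoord e).contDiff.contDiffAt)
  have hhom : IsHomog d (omegaCone V γ) f₀ := by
    refine ⟨hC.continuousOn, fun c z hz hcz => ?_⟩
    rw [hf₀]
    simp only
    rw [← map_smul]
    congr 1
    ext i
    rw [Pi.smul_apply, (hg i).homog (d := d) hV (fun x hx hcx => by rw [hf.2 c x hx hcx]; simp) hz hcz,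
      Complex.real_smul]
    push_cast
    rfl
  have hloc : ∀ z ∈ omegaCone (posCone V) γ, ∃ s : ℝ, 0 < s ∧ s • z ∈ omegaCone V γ ∧
      HasFDerivAt (homExtend (omegaCone V γ) d f₀)
        ((s ^ d)⁻¹ • (fderiv ℝ f₀ (s • z)).comp (s • ContinuousLinearMap.id ℝ (E × E))) z := by
    intro z hz
    rw [← posCone_omegaCone] at hz
    obtain ⟨s, hs, hsz⟩ := hz
    refine ⟨s, hs, hsz, ?_⟩
    have h1 : HasFDerivAt (fun y : E × E => s • y) (s • ContinuousLinearMap.id ℝ (E × E)) z :=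
      (hasFDerivAt_id z).const_smul s
    exact (((hD _ hsz).differentiableAt.hasFDerivAt.comp z h1).const_smul
      _).congr_of_eventuallyEq (homExtend_eventuallyEq hΩ hhom hs hsz)
  refine ⟨homExtend (omegaCone V γ) d f₀, ⟨?_, ?_, ?_, ?_⟩, ?_⟩
  · rw [← posCone_omegaCone]
    exact contDiffOn_homExtend hΩ hhom hC
  · intro z hz v
    obtain ⟨s, hs, hsz, hd⟩ := hloc z hz
    rw [hd.fderiv, (hD _ hsz).fderiv]
    simp only [smul_apply, ContinuousLinearMap.comp_apply, ContinuousLinearMap.id_apply, map_smul,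
      ContinuousLinearEquiv.coe_coe, ContinuousLinearMap.coe_restrictScalars', complexCoord_mulI]
    rw [complexCoord_symm_I_smul]
  · intro z hz c hc
    rw [← posCone_omegaCone] at hz
    exact homExtend_smul hhom hz hc
  · rintro x ⟨s, hs, hsx⟩
    have h1 : s • ((x, 0) : E × E) = (s • x, 0) := by rw [Prod.smul_mk, smul_zero]
    have h2 : s • ((x, 0) : E × E) ∈ omegaCone V γ := h1 ▸ mem_omegaCone_real hV0 hγ hsx
    rw [homExtend_eq hhom hs h2, homExtend_eq hf hs hsx, h1, hf₀]
    simp only [complexCoord_real]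
    have h3 : (fun i => g i (toComplex e (s • x))) = complexCoord b (f (s • x), 0) := by
      rw [complexCoord_real]
      ext i
      exact (hg i).2 _ hsx
    rw [h3, ContinuousLinearEquiv.symm_apply_apply, Prod.smul_mk, smul_zero]
  · intro j L hdj hL
    set β := ‖((complexCoord b).symm : (Fin k → ℂ) →L[ℝ] G × G)‖ with hβ
    set ε := ‖(complexCoord e : E × E →L[ℝ] (Fin n → ℂ))‖ with hε
    refine ⟨β * (max L 0 * ε ^ j * ε), by positivity, fun z hz => ?_⟩
    obtain ⟨s, hs, hsz, hd⟩ := hloc z hz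
    have hb : ‖fderiv ℝ f₀ (s • z)‖ ≤ β * (max L 0 * (ε * ‖s • z‖) ^ j * ε) := by
      rw [(hD _ hsz).fderiv]
      refine (ContinuousLinearMap.opNorm_comp_le _ _).trans ?_
      gcongr
      refine (ContinuousLinearMap.opNorm_comp_le _ _).trans ?_
      gcongr
      rw [ContinuousLinearMap.norm_restrictScalars]
      refine ContinuousLinearMap.opNorm_le_bound _ (by positivity) fun v => ?_
      refine (pi_norm_le_iff_of_nonneg (by positivity)).2 fun i => ?_
      have hmem := (complexCoord_mem_Omega e).2 hsz
      rw [fderiv_pi fun i => ((hg i).1 _ hmem).differentiableAt, ContinuousLinearMap.pi_apply]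
      refine (ContinuousLinearMap.le_opNorm _ _).trans ?_
      gcongr
      refine (hL i _ hmem).trans ?_
      gcongr
      · exact le_max_left _ _
      · exact (complexCoord e : E × E →L[ℝ] (Fin n → ℂ)).le_opNorm (s • z)
    rw [hd.fderiv, norm_smul, norm_inv, norm_pow, Real.norm_of_nonneg hs.le]
    have h4 : ‖(fderiv ℝ f₀ (s • z)).comp (s • ContinuousLinearMap.id ℝ (E × E))‖ ≤
        s * ‖fderiv ℝ f₀ (s • z)‖ := by
      rw [ContinuousLinearMap.comp_smul, ContinuousLinearMap.comp_id, norm_smul,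
        Real.norm_of_nonneg hs.le]
    calc _ ≤ (s ^ d)⁻¹ * (s * (β * (max L 0 * (ε * ‖s • z‖) ^ j * ε))) := by
          gcongr
          exact h4.trans (by gcongr)
      _ = _ := by
        rw [hdj, norm_smul, Real.norm_of_nonneg hs.le, pow_succ, mul_pow, mul_pow]
        field_simp

end Extension

/-! ### Flows on the set of points that reach an absorbing cone -/

section Trap

variable {E : Type*} [NormedAddCommGroup E] [NormedSpace ℝ E] {p : E → E} {D : Set E} {y : ℝ → E}
  {τ : ℝ}

theorem SolOn.shift (h : SolOn (fun _ => p) D (Icc 0 τ) y) {t₀ : ℝ} (ht₀ : 0 ≤ t₀) :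
    SolOn (fun _ => p) D (Icc 0 (τ - t₀)) (fun t => y (t₀ + t)) := by
  have hmaps : MapsTo (fun t => t₀ + t) (Icc 0 (τ - t₀)) (Icc 0 τ) := fun t ht =>
    ⟨by linarith [ht.1], by linarith [ht.2]⟩
  intro t ht
  refine ⟨(h _ (hmaps ht)).1, ?_⟩
  have h2 := (h _ (hmaps ht)).2.scomp t ((hasDerivWithinAt_id t _).const_add t₀) hmaps
  rw [one_smul] at h2
  exact h2

theorem SolOn.rescale (h : SolOn (fun _ => p) D (Icc 0 τ) y) {ν : ℕ}
    (hD : ∀ x ∈ D, ∀ c : ℝ, 0 < c → c • x ∈ D)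
    (hp : ∀ x ∈ D, ∀ c : ℝ, 0 < c → p (c • x) = c ^ (ν + 1) • p x) {c : ℝ} (hc : 0 < c) :
    SolOn (fun _ => p) D (Icc 0 (τ / c ^ ν)) (fun t => c • y (c ^ ν * t)) := by
  have hcν : 0 < c ^ ν := pow_pos hc ν
  have hmaps : MapsTo (fun t => c ^ ν * t) (Icc 0 (τ / c ^ ν)) (Icc 0 τ) := fun t ht =>
    ⟨mul_nonneg hcν.le ht.1, by have := (le_div_iff₀ hcν).1 ht.2; linarith⟩
  intro t ht
  have hm := h _ (hmaps ht)
  refine ⟨hD _ hm.1 c hc, ?_⟩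
  have h1 : HasDerivWithinAt (fun t => c ^ ν * t) (c ^ ν) (Icc 0 (τ / c ^ ν)) t := by
    simpa using (hasDerivWithinAt_id t (Icc 0 (τ / c ^ ν))).const_mul (c ^ ν)
  have h3 := (hm.2.scomp t h1 hmaps).const_smul c
  change HasDerivWithinAt _ (p (c • y (c ^ ν * t))) _ _
  rw [hp _ hm.1 c hc, pow_succ', mul_smul]
  exact h3

/-- The points from which a solution within `D` reaches `N` in finite time. -/
def reachSet (p : E → E) (D N : Set E) : Set E :=
  {z | ∃ T, 0 ≤ T ∧ ∃ y, y 0 = z ∧ SolOn (fun _ => p) D (Icc 0 T) y ∧ y T ∈ N}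

theorem mem_reachSet_of_solOn {N : Set E} (hy : SolOn (fun _ => p) D (Icc 0 τ) y) (hN : y τ ∈ N)
    {t : ℝ} (ht : t ∈ Icc 0 τ) : y t ∈ reachSet p D N :=
  ⟨τ - t, sub_nonneg.2 ht.2, fun s => y (t + s), by simp, hy.shift ht.1, by simpa using hN⟩

theorem subset_reachSet {N : Set E} (hND : N ⊆ D) : N ⊆ reachSet p D N := by
  refine fun z hz => ⟨0, le_rfl, fun _ => z, rfl, fun t ht => ⟨hND hz, ?_⟩, hz⟩
  rw [Icc_self, mem_singleton_iff] at ht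
  subst ht
  rw [Icc_self]
  exact HasFDerivWithinAt.of_subsingleton subsingleton_singleton

variable [FiniteDimensional ℝ E]

theorem isOpen_reachSet {N : Set E} (hD : IsOpen D) (hp : ContDiffOn ℝ 1 p D) (hN : IsOpen N) :
    IsOpen (reachSet p D N) := by
  refine isOpen_iff_mem_nhds.2 ?_
  rintro _ ⟨T, hT, y, rfl, hy, hyN⟩
  obtain ⟨C, hC, r, hr, hex, hlip⟩ := exists_solOn_near hD hp hT hy
  obtain ⟨δ, hδ, hδN⟩ := Metric.isOpen_iff.1 hN _ hyN
  filter_upwards [ball_mem_nhds _ hr, ball_mem_nhds (y 0) (div_pos hδ hC)] with x hx hx'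
  obtain ⟨z, hz0, hz⟩ := hex x hx
  refine ⟨T, hT, z, hz0, hz, hδN ?_⟩
  have h1 := hlip z y (hz0 ▸ hx) (mem_ball_self hr) hz hy T ⟨hT, le_rfl⟩
  rw [hz0] at h1
  refine lt_of_le_of_lt h1 ?_
  rw [mul_comm]
  exact (lt_div_iff₀ hC).1 hx'

/-- Let the solutions within an open cone `D` that start in the open cone `N ⊆ D` be confined to
compact subsets of `D` in bounded time, and be captured by the closed cone `Z ⊆ N`. Then the field
has a flow on the set of points from which `N` is reached. -/
theorem exists_isConeFlow_of_trap {N Z : Set E} {ν : ℕ} {a b A : ℝ} (hν : 0 < ν) (hD : IsOpen D)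
    (hDs : ∀ x ∈ D, ∀ c : ℝ, 0 < c → c • x ∈ D) (hD0 : (0 : E) ∉ D) (hp : ContDiffOn ℝ 1 p D)
    (hph : ∀ x ∈ D, ∀ c : ℝ, 0 < c → p (c • x) = c ^ (ν + 1) • p x)
    (hN : IsOpen N) (hNs : ∀ x ∈ N, ∀ c : ℝ, 0 < c → c • x ∈ N) (hND : N ⊆ D) (hZN : Z ⊆ N)
    (hZs : ∀ x ∈ Z, ∀ c : ℝ, 0 < c → c • x ∈ Z) (hZc : IsCompact (Z ∩ sphere 0 1))
    (hconf : ∀ z ∈ N, ∀ T : ℝ, 0 ≤ T → ∃ K, IsCompact K ∧ K ⊆ D ∧ ∀ τ ∈ Icc 0 T, ∀ y, y 0 = z →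
      SolOn (fun _ => p) D (Icc 0 τ) y → y τ ∈ K)
    (hentry : ∀ z₀ ∈ N, ∃ T₀ : ℝ, 0 ≤ T₀ ∧ ∀ᶠ z in 𝓝 z₀, ∀ t, T₀ ≤ t → ∀ y, y 0 = z →
      SolOn (fun _ => p) D (Icc 0 t) y → y t ∈ Z)
    (ha : 0 < a) (hab : a ≤ b)
    (hnd : ∀ x ∈ Z, ∀ ε > 0, ∀ᶠ s : ℝ in 𝓝[>] 0,
      ‖x + s • p x‖ ≤ ‖x‖ + s * (-(a * ‖x‖ ^ (ν + 1)) + ε))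
    (hnf : ∀ x ∈ Z, ‖p x‖ ≤ b * ‖x‖ ^ (ν + 1))
    (hld : ∀ x ∈ Z, ∀ ε > 0, ∀ᶠ s : ℝ in 𝓝[>] 0,
      ‖ContinuousLinearMap.id ℝ E + s • fderiv ℝ p x‖ ≤ 1 + s * (-(A * ‖x‖ ^ ν) + ε)) :
    ∃ φ, IsConeFlow (reachSet p D N) Z p φ ν a b A := by
  have hglob : ∀ z ∈ reachSet p D N, ∃ y, y 0 = z ∧ SolOn (fun _ => p) D (Ici 0) y := by
    rintro _ ⟨T, hT, y, rfl, hy, hyN⟩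
    refine exists_solOn_Ici (fun T' hT' => ?_) fun T' hT' y y' h0 h0' hy hy' =>
      solOn_unique hD hp hy hy' (h0.trans h0'.symm)
    obtain ⟨K, hK, hKD, hKc⟩ := hconf _ hyN T' hT'.le
    have hyc := isCompact_Icc.image_of_continuousOn hy.continuousOn
    refine exists_solOn_of_apriori hD hp (hyc.union hK)
      (union_subset (image_subset_iff.2 fun t ht => (hy t ht).1) hKD) hT'.le
      (Or.inl ⟨0, ⟨le_rfl, hT⟩, rfl⟩) fun τ hτ y' h0 hy' => ?_
    rcases le_total τ T with hle | hle
    · refine Or.inl ⟨τ, ⟨hτ.1, hle⟩, ?_⟩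
      exact solOn_unique hD hp (hy.mono (Icc_subset_Icc_right hle)) hy' h0.symm ⟨hτ.1, le_rfl⟩
    · have he := solOn_unique hD hp hy (hy'.mono (Icc_subset_Icc_right hle)) h0.symm ⟨hT, le_rfl⟩
      have := hKc (τ - T) ⟨sub_nonneg.2 hle, by linarith [hτ.2]⟩ _ (by simp [he]) (hy'.shift hT)
      rw [add_sub_cancel] at this
      exact Or.inr this
  choose! Y hY0 hY using hglob
  have hYI : ∀ z ∈ reachSet p D N, ∀ t, SolOn (fun _ => p) D (Icc 0 t) (Y z) := fun z hz t =>
    (hY z hz).mono Icc_subset_Ici_self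
  have hreach : ∀ z ∈ reachSet p D N, ∃ T, 0 ≤ T ∧ Y z T ∈ N := by
    intro z hz
    obtain ⟨T, hT, y, hy0, hy, hyN⟩ := id hz
    refine ⟨T, hT, ?_⟩
    rwa [← solOn_unique hD hp hy (hYI z hz T) (hy0.trans (hY0 z hz).symm) ⟨hT, le_rfl⟩]
  have hcapture : ∀ z₀ ∈ reachSet p D N, ∃ T₀ : ℝ, 0 ≤ T₀ ∧ ∀ᶠ z in 𝓝 z₀, ∀ t, T₀ ≤ t →
      Y z t ∈ Z := by
    intro z₀ hz₀
    obtain ⟨T, hT, hTN⟩ := hreach z₀ hz₀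
    obtain ⟨T₀, hT₀, hev⟩ := hentry _ hTN
    obtain ⟨C, hC, r, hr, hex, hlip⟩ := exists_solOn_near hD hp hT (hYI z₀ hz₀ T)
    rw [hY0 z₀ hz₀] at hex hlip
    obtain ⟨δ, hδ, hδZ⟩ := Metric.eventually_nhds_iff_ball.1 hev
    refine ⟨T + T₀, by positivity, ?_⟩
    filter_upwards [ball_mem_nhds _ hr, ball_mem_nhds z₀ (div_pos hδ hC),
      (isOpen_reachSet hD hp hN).mem_nhds hz₀] with z hz hz' hzR t ht
    have h1 := hlip (Y z) (Y z₀) (by rwa [hY0 z hzR]) (by rw [hY0 z₀ hz₀]; exact mem_ball_self hr)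
      (hYI z hzR T) (hYI z₀ hz₀ T) T ⟨hT, le_rfl⟩
    rw [hY0 z hzR, hY0 z₀ hz₀] at h1
    have h2 : Y z T ∈ ball (Y z₀ T) δ := by
      refine lt_of_le_of_lt h1 ?_
      rw [mul_comm]
      exact (lt_div_iff₀ hC).1 hz'
    have := hδZ _ h2 (t - T) (by linarith) (fun s => Y z (T + s)) (by simp) ((hYI z hzR t).shift hT)
    simpa using this
  have hflow : ∀ z ∈ reachSet p D N, ∀ t, 0 ≤ t → Y z t ∈ reachSet p D N := by
    intro z hz t ht
    obtain ⟨T₀, hT₀, hev⟩ := hcapture z hz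
    exact mem_reachSet_of_solOn (hYI z hz (max t T₀))
      (hZN (hev.self_of_nhds _ (le_max_right _ _))) ⟨ht, le_max_left _ _⟩
  have hsub : reachSet p D N ⊆ D := by
    rintro _ ⟨T, hT, y, rfl, hy, -⟩
    exact (hy 0 ⟨le_rfl, hT⟩).1
  refine ⟨fun t z => Y z t, ?_⟩
  exact
    { nu_pos := hν
      isOpen := isOpen_reachSet hD hp hN
      smul_mem := by
        rintro _ ⟨T, hT, y, rfl, hy, hyN⟩ c hc
        refine ⟨T / c ^ ν, by positivity, _, by simp, hy.rescale hDs hph hc, ?_⟩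
        rw [mul_div_cancel₀ _ (pow_pos hc ν).ne']
        exact hNs _ hyN c hc
      zero_notMem := fun h0 => hD0 (hsub h0)
      contDiffOn := hp.mono hsub
      homog := fun x hx => hph x (hsub hx)
      flow_zero := hY0
      flow_sol := fun z hz => (hY z hz).mono_set fun t ht => hflow z hz t ht
      zone_subset := hZN.trans (subset_reachSet hND)
      zone_smul := hZs
      zone_compact := hZc
      entry := hcapture
      a_pos := ha
      a_le_b := hab
      norm_decay := hnd
      norm_field := hnf
      log_deriv := hld }

end Trap

/-! ### The complexified field near the real cone -/

section Extension

variable {E G : Type*} [NormedAddCommGroup E] [NormedSpace ℝ E] [NormedAddCommGroup G]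
  [NormedSpace ℝ G] {W Z : Set E} {γ γ' : ℝ} {d : ℕ} {f : E → G} {f' : E × E → G × G}

theorem norm_of_mem_omegaCone {E : Type*} [NormedAddCommGroup E] {W : Set E} {γ : ℝ} (hγ : γ ≤ 1)
    {z : E × E} (hz : z ∈ omegaCone W γ) : ‖z‖ = ‖z.1‖ := by
  rw [Prod.norm_def, max_eq_left]
  exact hz.2.le.trans (mul_le_of_le_one_left (norm_nonneg _) hγ)

theorem smul_snd_mem_omegaCone {x y : E} (hz : (x, y) ∈ omegaCone W γ) {t : ℝ} (ht : t ∈ Icc 0 1) :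
    (x, t • y) ∈ omegaCone W γ := by
  refine ⟨hz.1, lt_of_le_of_lt ?_ hz.2⟩
  rw [norm_smul, Real.norm_of_nonneg ht.1]
  exact mul_le_of_le_one_left (norm_nonneg _) ht.2

theorem IsHomogExt.mono (h : IsHomogExt W γ d f f') (hγ : γ' ≤ γ) : IsHomogExt W γ' d f f' :=
  ⟨h.contDiffOn.mono (omegaCone_mono hγ), fun z hz => h.fderiv_mulI z (omegaCone_mono hγ hz),
    fun z hz => h.homog z (omegaCone_mono hγ hz), h.real⟩

theorem IsHomogExt.differentiableAt (h : IsHomogExt W γ d f f') (hW : IsOpen W) {z : E × E}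
    (hz : z ∈ omegaCone W γ) : DifferentiableAt ℝ f' z :=
  (h.contDiffOn.contDiffAt ((isOpen_omegaCone hW γ).mem_nhds hz)).differentiableAt one_ne_zero

theorem IsHomogExt.norm_sub_le (h : IsHomogExt W γ d f f') (hW : IsOpen W) {x y : E}
    (hz : (x, y) ∈ omegaCone W γ) (M : E × E →L[ℝ] G × G) {c : ℝ}
    (hM : ∀ t ∈ Icc (0 : ℝ) 1, ‖fderiv ℝ f' (x, t • y) - M‖ ≤ c) :
    ‖f' (x, y) - (f x, 0) - M (0, y)‖ ≤ c * ‖y‖ := by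
  have hseg : ∀ w ∈ segment ℝ ((x, 0) : E × E) (x, y), ∃ t ∈ Icc (0 : ℝ) 1, w = (x, t • y) := by
    rw [segment_eq_image']
    rintro _ ⟨t, ht, rfl⟩
    exact ⟨t, ht, by simp⟩
  have := (convex_segment ((x, 0) : E × E) (x, y)).norm_image_sub_le_of_norm_fderiv_le'
    (f := f') (φ := M) (C := c) (𝕜 := ℝ) (fun w hw => ?_) (fun w hw => ?_)
    (left_mem_segment ℝ _ _) (right_mem_segment ℝ _ _)
  · simpa [h.real x hz.1, Prod.norm_def] using this
  · obtain ⟨t, ht, rfl⟩ := hseg w hw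
    exact h.differentiableAt hW (smul_snd_mem_omegaCone hz ht)
  · obtain ⟨t, ht, rfl⟩ := hseg w hw
    exact hM t ht

/-- At the real points, the derivative of the extension is the complexification of the derivative. -/
theorem IsHomogExt.fderiv_real (h : IsHomogExt W γ d f f') (hW : IsOpen W) (hW0 : (0 : E) ∉ W)
    (hγ : 0 < γ) {x : E} (hx : x ∈ W) (z : E × E) :
    fderiv ℝ f' (x, 0) z = (fderiv ℝ f x z.1, fderiv ℝ f x z.2) := by
  have hm := mem_omegaCone_real hW0 hγ hx
  set D := fderiv ℝ f' (x, 0) with hD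
  have h1 : HasFDerivAt (fun x => ((f x, 0) : G × G)) (D.comp (ContinuousLinearMap.inl ℝ E E)) x := by
    refine HasFDerivAt.congr_of_eventuallyEq ((h.differentiableAt hW hm).hasFDerivAt.comp x
      (ContinuousLinearMap.inl ℝ E E).hasFDerivAt) ?_
    filter_upwards [hW.mem_nhds hx] with x' hx'
    exact (h.real x' hx').symm
  have h2 := h1.fst.fderiv
  have h3 := h1.snd.unique (hasFDerivAt_const (0 : G) x)
  have h4 : ∀ u, D (u, 0) = (fderiv ℝ f x u, 0) := by
    intro u
    refine Prod.ext ?_ ?_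
    · rw [h2]; rfl
    · exact congrArg (fun l : E →L[ℝ] G => l u) h3
  have h5 : ∀ u, D (0, u) = (0, fderiv ℝ f x u) := by
    intro u
    have := h.fderiv_mulI _ hm (u, 0)
    rw [← hD, h4] at this
    simpa [mulI_apply] using this
  have h6 : z = (z.1, 0) + (0, z.2) := by simp
  rw [h6, map_add, h4, h5]
  simp

/-- Homogeneous functions near the real points of a cone with compact base vary little. -/
theorem exists_norm_sub_real_le {X : Type*} [NormedAddCommGroup X] [NormedSpace ℝ X]
    {Φ : E × E → X} (hW : IsOpen W) (hW0 : (0 : E) ∉ W) (hγ : 0 < γ) (hZ : Z ⊆ W)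
    (hZs : ∀ x ∈ Z, ∀ c : ℝ, 0 < c → c • x ∈ Z) (hZc : IsCompact (Z ∩ sphere 0 1))
    (hΦ : ContinuousOn Φ (omegaCone W γ))
    (hΦh : ∀ z ∈ omegaCone W γ, ∀ c : ℝ, 0 < c → Φ (c • z) = c ^ d • Φ z) {ε : ℝ} (hε : 0 < ε) :
    ∃ δ > 0, δ < γ ∧ ∀ x ∈ Z, ∀ y, ‖y‖ ≤ δ * ‖x‖ → ‖Φ (x, y) - Φ (x, 0)‖ ≤ ε * ‖x‖ ^ d := by
  have hreal : ∀ x ∈ W, ((x, 0) : E × E) ∈ omegaCone W γ := fun x hx => mem_omegaCone_real hW0 hγ hx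
  have hΦ0 : ContinuousOn (fun z : E × E => Φ (z.1, 0)) (omegaCone W γ) :=
    hΦ.comp (by fun_prop) fun z hz => hreal _ hz.1
  have hO := (hΦ.sub hΦ0).norm.isOpen_inter_preimage (isOpen_omegaCone hW γ) (isOpen_Iio (a := ε))
  have hK : IsCompact ((fun x : E => ((x, 0) : E × E)) '' (Z ∩ sphere 0 1)) :=
    hZc.image (by fun_prop)
  obtain ⟨δ, hδ, hthick⟩ := hK.exists_thickening_subset_open hO (by
    rintro _ ⟨x, hx, rfl⟩
    exact ⟨hreal x (hZ hx.1), by simpa using hε⟩)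
  refine ⟨min (δ / 2) (γ / 2), by positivity, (min_le_right _ _).trans_lt (half_lt_self hγ),
    fun x hx y hy => ?_⟩
  have hx0 : 0 < ‖x‖ := norm_pos_iff.2 fun h0 => hW0 (hZ (h0 ▸ hx))
  have hmem : (x, y) ∈ omegaCone W γ := by
    refine ⟨hZ hx, hy.trans_lt ?_⟩
    have := min_le_right (δ / 2) (γ / 2)
    dsimp only
    nlinarith
  have hc := inv_pos.2 hx0
  have h1 : ‖x‖⁻¹ • ((x, y) : E × E) ∈ thickening δ
      ((fun x : E => ((x, 0) : E × E)) '' (Z ∩ sphere 0 1)) := by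
    refine mem_thickening_iff.2 ⟨_, ⟨‖x‖⁻¹ • x, ⟨hZs x hx _ hc, by simp [norm_smul, hx0.ne']⟩, rfl⟩, ?_⟩
    have h2 : ‖x‖⁻¹ * ‖y‖ < δ := by
      rw [inv_mul_lt_iff₀ hx0]
      have := min_le_left (δ / 2) (γ / 2)
      nlinarith
    simpa [dist_eq_norm, Prod.norm_def, norm_smul] using ⟨hδ, h2⟩
  have h2 : ‖Φ (‖x‖⁻¹ • (x, y)) - Φ ((‖x‖⁻¹ • ((x, y) : E × E)).1, 0)‖ < ε := (hthick h1).2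
  have h3 : ((‖x‖⁻¹ • ((x, y) : E × E)).1, (0 : E)) = ‖x‖⁻¹ • ((x, 0) : E × E) := by simp
  rw [h3, hΦh _ hmem _ hc, hΦh _ (hreal x (hZ hx)) _ hc, ← smul_sub, norm_smul, inv_pow, norm_inv,
    norm_pow, norm_norm, inv_mul_lt_iff₀ (by positivity)] at h2
  linarith

end Extension

section Field

variable {E : Type*} [NormedAddCommGroup E] [NormedSpace ℝ E] {W Z : Set E} {γ L ε a b A : ℝ} {ν : ℕ}
  {p : E → E} {p' : E × E → E × E}

/-- The complexified field at `z` differs from the real field at the real part of `z` by `O(‖Re z‖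
^ ν ‖Im z‖)`. -/
theorem IsHomogExt.norm_field_sub_le (h : IsHomogExt W γ (ν + 1) p p') (hW : IsOpen W) (hγ : γ ≤ 1)
    (hL : ∀ z ∈ omegaCone W γ, ‖fderiv ℝ p' z‖ ≤ L * ‖z‖ ^ ν) {z : E × E} (hz : z ∈ omegaCone W γ) :
    ‖p' z - (p z.1, 0)‖ ≤ L * ‖z.1‖ ^ ν * ‖z.2‖ := by
  have := h.norm_sub_le hW (x := z.1) (y := z.2) hz 0 (c := L * ‖z.1‖ ^ ν) fun t ht => ?_
  · simpa using this
  · have h1 := smul_snd_mem_omegaCone (x := z.1) (y := z.2) hz ht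
    have := hL _ h1
    rw [norm_of_mem_omegaCone hγ h1] at this
    simpa using this

/-- The real part of a trajectory of the complexified field is a perturbed trajectory of the real
field. -/
theorem IsHomogExt.pseudoOrbit (h : IsHomogExt W γ (ν + 1) p p') (hW : IsOpen W) (hγ : γ ≤ 1)
    (hL0 : 0 ≤ L) (hL : ∀ z ∈ omegaCone W γ, ‖fderiv ℝ p' z‖ ≤ L * ‖z‖ ^ ν) (hε : L * γ ≤ ε) {τ : ℝ}
    {z : ℝ → E × E} (hz : SolOn (fun _ => p') (omegaCone W γ) (Icc 0 τ) z) :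
    PseudoOrbit p ν ε τ (fun t => (z t).1) := by
  refine ⟨hz.continuousOn.fst, fun t ht => ⟨_, (hz.hasDerivWithinAt_Ici_of_Icc ht).fst, ?_⟩⟩
  have hm := (hz t ⟨ht.1, ht.2.le⟩).1
  refine (norm_fst_le (p' (z t) - (p (z t).1, 0))).trans ?_
  refine (h.norm_field_sub_le hW hγ hL hm).trans ?_
  calc _ ≤ L * ‖(z t).1‖ ^ ν * (γ * ‖(z t).1‖) := by gcongr; exact hm.2.le
    _ = L * γ * ‖(z t).1‖ ^ (ν + 1) := by ring
    _ ≤ _ := by gcongr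

/-- The norm of the imaginary part decays at a rate close to that of the real variational
equation. -/
theorem IsHomogExt.diniLe_norm_snd (h : IsHomogExt W γ (ν + 1) p p') (hW : IsOpen W)
    (hW0 : (0 : E) ∉ W) (hγ : 0 < γ) (hA : ∀ x ∈ W, ∀ᶠ s : ℝ in 𝓝[>] 0,
      ‖ContinuousLinearMap.id ℝ E + s • fderiv ℝ p x‖ ≤ 1 + s * (-(A * ‖x‖ ^ ν)))
    {z : ℝ → E × E} {t : ℝ} (hz : HasDerivWithinAt z (p' (z t)) (Ici t) t)
    (hm : z t ∈ omegaCone W γ) (hε : ∀ s ∈ Icc (0 : ℝ) 1,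
      ‖fderiv ℝ p' ((z t).1, s • (z t).2) - fderiv ℝ p' ((z t).1, 0)‖ ≤ ε * ‖(z t).1‖ ^ ν) :
    DiniLe (fun s => ‖(z s).2‖) (-((A - ε) * ‖(z t).1‖ ^ ν * ‖(z t).2‖)) t := by
  refine diniLe_norm hz.snd fun η hη => ?_
  set x := (z t).1 with hx
  set y := (z t).2 with hy
  have h1 := h.norm_sub_le hW (x := x) (y := y) hm _ hε
  rw [h.fderiv_real hW hW0 hγ hm.1] at h1
  have h2 := (norm_snd_le _).trans h1
  simp only [Prod.snd_sub, sub_zero] at h2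
  filter_upwards [hA x hm.1, self_mem_nhdsWithin] with s hs hs0
  have hs0 : 0 < s := hs0
  have h3 : y + s • (p' (z t)).2 = (ContinuousLinearMap.id ℝ E + s • fderiv ℝ p x) y +
      s • ((p' (x, y)).2 - fderiv ℝ p x y) := by
    simp only [add_apply, smul_apply, ContinuousLinearMap.id_apply, smul_sub]
    rw [add_assoc, add_sub_cancel]
  rw [h3]
  refine (norm_add_le _ _).trans ?_
  rw [norm_smul, Real.norm_of_nonneg hs0.le]
  have h4 := (ContinuousLinearMap.le_opNorm (ContinuousLinearMap.id ℝ E + s • fderiv ℝ p x) y).trans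
    (mul_le_mul_of_nonneg_right hs (norm_nonneg y))
  have h5 := mul_le_mul_of_nonneg_left h2 hs0.le
  have h6 := mul_pos hs0 hη
  nlinarith

/-- Near the real cone the norm, which is that of the real part, decays along the complexified
field at almost the same rate as along the real field. -/
theorem norm_add_smul_ext_le (hγ : γ < 1) {z : E × E} (hz : z ∈ omegaCone W γ)
    (hd : ∀ᶠ s : ℝ in 𝓝[>] 0, ‖z.1 + s • p z.1‖ ≤ ‖z.1‖ + s * (-(a * ‖z.1‖ ^ (ν + 1))))
    (hε : ‖p' z - (p z.1, 0)‖ ≤ ε * ‖z.1‖ ^ (ν + 1)) :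
    ∀ᶠ s : ℝ in 𝓝[>] 0, ‖z + s • p' z‖ ≤ ‖z‖ + s * (-((a - ε) * ‖z‖ ^ (ν + 1))) := by
  rw [norm_of_mem_omegaCone hγ.le hz]
  have hlt : ‖z.2‖ < ‖z.1‖ := by
    have := norm_nonneg z.2
    have := hz.2
    nlinarith [norm_nonneg z.1]
  have hc1 : Tendsto (fun s : ℝ => ‖z.2 + s • (p' z).2‖) (𝓝[>] 0) (𝓝 ‖z.2‖) := by
    have : Continuous fun s : ℝ => ‖z.2 + s • (p' z).2‖ := by fun_prop
    exact (this.tendsto' 0 _ (by simp)).mono_left nhdsWithin_le_nhds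
  have hc2 : Tendsto (fun s : ℝ => ‖z.1‖ + s * (-((a - ε) * ‖z.1‖ ^ (ν + 1)))) (𝓝[>] 0)
      (𝓝 ‖z.1‖) := by
    have : Continuous fun s : ℝ => ‖z.1‖ + s * (-((a - ε) * ‖z.1‖ ^ (ν + 1))) := by fun_prop
    exact (this.tendsto' 0 _ (by simp)).mono_left nhdsWithin_le_nhds
  filter_upwards [hd, hc1.eventually_lt hc2 hlt, self_mem_nhdsWithin] with s hs hs2 hs0
  have hs0 : 0 < s := hs0
  rw [Prod.norm_def]
  refine max_le ?_ hs2.le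
  have h1 : (z + s • p' z).1 = (z.1 + s • p z.1) + s • ((p' z).1 - p z.1) := by
    rw [Prod.fst_add, Prod.smul_fst, smul_sub, add_assoc, add_sub_cancel]
  have h2 : ‖(p' z).1 - p z.1‖ ≤ ε * ‖z.1‖ ^ (ν + 1) := (norm_fst_le (p' z - (p z.1, 0))).trans hε
  rw [h1]
  refine (norm_add_le _ _).trans ?_
  rw [norm_smul, Real.norm_of_nonneg hs0.le]
  have := mul_le_mul_of_nonneg_left h2 hs0.le
  linarith

/-- Near the real cone the derivative of the complexified field has almost the same logarithmic
norm as that of the real field. -/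
theorem IsHomogExt.norm_id_add_fderiv_le (h : IsHomogExt W γ (ν + 1) p p') (hW : IsOpen W)
    (hW0 : (0 : E) ∉ W) (hγ : 0 < γ) (hγ1 : γ ≤ 1) {z : E × E} (hz : z ∈ omegaCone W γ)
    (hA : ∀ᶠ s : ℝ in 𝓝[>] 0,
      ‖ContinuousLinearMap.id ℝ E + s • fderiv ℝ p z.1‖ ≤ 1 + s * (-(A * ‖z.1‖ ^ ν)))
    (hε : ‖fderiv ℝ p' z - fderiv ℝ p' (z.1, 0)‖ ≤ ε * ‖z.1‖ ^ ν) :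
    ∀ᶠ s : ℝ in 𝓝[>] 0, ‖ContinuousLinearMap.id ℝ (E × E) + s • fderiv ℝ p' z‖ ≤
      1 + s * (-((A - ε) * ‖z‖ ^ ν)) := by
  rw [norm_of_mem_omegaCone hγ1 hz]
  filter_upwards [hA, self_mem_nhdsWithin] with s hs hs0
  have hs0 : 0 < s := hs0
  have h1 : ContinuousLinearMap.id ℝ (E × E) + s • fderiv ℝ p' z =
      (ContinuousLinearMap.id ℝ (E × E) + s • fderiv ℝ p' (z.1, 0)) +
        s • (fderiv ℝ p' z - fderiv ℝ p' (z.1, 0)) := by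
    rw [smul_sub, add_assoc, add_sub_cancel]
  have h2 : ‖ContinuousLinearMap.id ℝ (E × E) + s • fderiv ℝ p' (z.1, 0)‖ ≤
      ‖ContinuousLinearMap.id ℝ E + s • fderiv ℝ p z.1‖ := by
    refine ContinuousLinearMap.opNorm_le_bound _ (norm_nonneg _) fun w => ?_
    simp only [add_apply, smul_apply, ContinuousLinearMap.id_apply, h.fderiv_real hW hW0 hγ hz.1]
    rw [Prod.norm_def]
    refine max_le ?_ ?_
    · exact ((ContinuousLinearMap.id ℝ E + s • fderiv ℝ p z.1).le_opNorm w.1).trans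
        (by gcongr; exact norm_fst_le w)
    · exact ((ContinuousLinearMap.id ℝ E + s • fderiv ℝ p z.1).le_opNorm w.2).trans
        (by gcongr; exact norm_snd_le w)
  rw [h1]
  refine (norm_add_le _ _).trans ?_
  rw [norm_smul, Real.norm_of_nonneg hs0.le]
  have := mul_le_mul_of_nonneg_left hε hs0.le
  linarith

end Field

/-! ### The flow of the complexified field -/

section ComplexFlow

theorem IsHomogExt.fderiv_homog {E G : Type*} [NormedAddCommGroup E] [NormedSpace ℝ E]
    [NormedAddCommGroup G] [NormedSpace ℝ G] {W : Set E} {γ : ℝ} {d : ℕ} {f : E → G}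
    {f' : E × E → G × G} (h : IsHomogExt W γ (d + 1) f f') (hW : IsOpen W)
    (hWs : ∀ x ∈ W, ∀ c : ℝ, 0 < c → c • x ∈ W) :
    ∀ z ∈ omegaCone W γ, ∀ c : ℝ, 0 < c → fderiv ℝ f' (c • z) = c ^ d • fderiv ℝ f' z := by
  intro z hz c hc
  have := fderiv_smul_of_homog (q := (d + 1 : ℕ)) (isOpen_omegaCone hW γ)
    (fun z hz c hc => smul_mem_omegaCone hz hc (hWs _ hz.1 c hc))
    (fun z hz c hc => by rw [Real.rpow_natCast]; exact h.homog z hz c hc) hz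
    (h.differentiableAt hW hz) hc
  rwa [Nat.cast_succ, add_sub_cancel_right, Real.rpow_natCast] at this

theorem exists_forall_exp_le_half (c l : ℝ) {q w : ℝ} (hq : 0 < q) (hw : 0 < w) (θ : ℝ) :
    ∃ Θ ≥ θ, ∀ s ≥ Θ, Real.exp (c + q * (l - Real.log (1 + w * s))) ≤ 1 / 2 := by
  have h1 : Tendsto (fun s : ℝ => Real.log (1 + w * s)) atTop atTop :=
    Real.tendsto_log_atTop.comp (tendsto_atTop_add_const_left _ _ (tendsto_id.const_mul_atTop hw))
  obtain ⟨Θ, hΘ⟩ := eventually_atTop.1 (h1.eventually_ge_atTop (l + (c + Real.log 2) / q))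
  refine ⟨max θ Θ, le_max_left _ _, fun s hs => ?_⟩
  have h2 := hΘ s ((le_max_right _ _).trans hs)
  have h3 : q * (l - Real.log (1 + w * s)) ≤ -(c + Real.log 2) := by
    have : l - Real.log (1 + w * s) ≤ -((c + Real.log 2) / q) := by linarith
    calc _ ≤ q * -((c + Real.log 2) / q) := by gcongr
      _ = _ := by field_simp
  calc _ ≤ Real.exp (-Real.log 2) := by gcongr; linarith
    _ = 1 / 2 := by rw [Real.exp_neg, Real.exp_log two_pos, one_div]

variable {E : Type*} [NormedAddCommGroup E] [NormedSpace ℝ E] {W Z : Set E} {γ L ε a b A C κ θ : ℝ}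
  {ν : ℕ} {p : E → E} {p' : E × E → E × E}

/-- The slope `‖Im z‖ / ‖Re z‖` stays bounded along the trajectories of the complexified field, and
tends to `0` at a uniform rate, if the real variational equation contracts faster than the norm
can decay. -/
theorem IsHomogExt.slope_le (hE : IsHomogExt W γ (ν + 1) p p') (hrob : IsRobustCone W p ν a C)
    (hγ : 0 < γ) (hγ1 : γ ≤ 1) (hL0 : 0 ≤ L)
    (hL : ∀ z ∈ omegaCone W γ, ‖fderiv ℝ p' z‖ ≤ L * ‖z‖ ^ ν) (hb0 : 0 ≤ b)
    (hb : ∀ x ∈ W, ‖p x‖ ≤ b * ‖x‖ ^ (ν + 1))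
    (hA : ∀ x ∈ W, ∀ᶠ s : ℝ in 𝓝[>] 0,
      ‖ContinuousLinearMap.id ℝ E + s • fderiv ℝ p x‖ ≤ 1 + s * (-(A * ‖x‖ ^ ν)))
    (hε : 0 < ε) (hεa : ε ≤ a) (hεC : ε ≤ C) (hεA : b + ε < A - ε) (hLγ : L * γ ≤ ε) (hθ : 0 ≤ θ)
    (hzone : ∀ τ y, PseudoOrbit p ν ε τ y → y 0 ∈ W → θ ≤ τ * ‖y 0‖ ^ ν →
      κ * ‖y τ‖ ≤ infDist (y τ) Wᶜ)
    (hnear : ∀ x ∈ coneZone W κ, ∀ y, ‖y‖ ≤ γ * ‖x‖ →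
      ‖fderiv ℝ p' (x, y) - fderiv ℝ p' (x, 0)‖ ≤ ε * ‖x‖ ^ ν) :
    ∃ c ≥ 1, ∃ Θ ≥ θ, ∀ τ z, SolOn (fun _ => p') (omegaCone W γ) (Icc 0 τ) z → ∀ t ∈ Icc 0 τ,
      ‖(z t).2‖ / ‖(z t).1‖ ≤ ‖(z 0).2‖ / ‖(z 0).1‖ * c ∧ (Θ ≤ t * ‖(z 0).1‖ ^ ν →
        ‖(z t).2‖ / ‖(z t).1‖ ≤ ‖(z 0).2‖ / ‖(z 0).1‖ * (1 / 2)) := by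
  have hν := hrob.nu_pos
  have hW := hrob.isOpen
  have hk : 0 ≤ b + ε := by positivity
  have he : 0 < (b + 2 * ε) * ν := by positivity
  have hν' : (0 : ℝ) < ν := by exact_mod_cast hν
  obtain ⟨Θ, hΘθ, hΘ⟩ := exists_forall_exp_le_half ((L + (b + ε)) * θ)
    (Real.log (1 + (b + 2 * ε) * ν * θ))
    (div_pos (by linarith : 0 < A - ε - (b + ε)) he) he θ
  refine ⟨Real.exp ((L + (b + ε)) * θ), Real.one_le_exp (by positivity), Θ, hΘθ,
    fun τ z hz t ht => ?_⟩
  have hps := hE.pseudoOrbit hW hγ1 hL0 hL hLγ hz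
  have hz0 : (z 0).1 ∈ W := (hz 0 ⟨le_rfl, ht.1.trans ht.2⟩).1.1
  have hm : ∀ s ∈ Ico 0 τ, z s ∈ omegaCone W γ := fun s hs => (hz s ⟨hs.1, hs.2.le⟩).1
  have hfield : ∀ s ∈ Ico 0 τ, ‖p' (z s) - (p (z s).1, 0)‖ ≤ L * ‖(z s).1‖ ^ ν * ‖(z s).2‖ :=
    fun s hs => hE.norm_field_sub_le hW hγ1 hL (hm s hs)
  have hmain := div_le_of_diniLe (f := fun t => ‖(z t).2‖) (g := fun t => ‖(z t).1‖) hν (τ := τ)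
    (L := L) (k := b + ε) (e := b + 2 * ε) (α := A - ε) (θ := θ) hz.continuousOn.snd.norm
    hz.continuousOn.fst.norm (fun _ => norm_nonneg _)
    (fun t ht => hrob.norm_pos (hz t ht).1.1)
    (fun t ht => hrob.norm_le hps hεC hεa hz0 ht) hL0 hk (by linarith) hεA.le hθ
    (fun s hs => ?_) (fun s hs => ?_) (fun s hs hsθ => ?_)
  · refine ⟨hmain.1 t ht, fun hts => (hmain.2 t ht (hΘθ.trans hts)).trans ?_⟩
    gcongr
    exact hΘ _ hts
  · refine diniLe_neg_norm_of_norm_le (hz.hasDerivWithinAt_Ici_of_Icc hs).fst ?_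
    have h1 := (norm_fst_le _).trans (hfield s hs)
    have h2 : L * ‖(z s).1‖ ^ ν * ‖(z s).2‖ ≤ ε * ‖(z s).1‖ ^ (ν + 1) := by
      calc _ ≤ L * ‖(z s).1‖ ^ ν * (γ * ‖(z s).1‖) := by gcongr; exact (hm s hs).2.le
        _ = L * γ * ‖(z s).1‖ ^ (ν + 1) := by ring
        _ ≤ _ := by gcongr
    have h3 := norm_add_le ((p' (z s)).1 - p (z s).1) (p (z s).1)
    rw [sub_add_cancel] at h3
    have h4 := hb _ (hm s hs).1
    have h5 : ‖(p' (z s)).1 - p (z s).1‖ ≤ L * ‖(z s).1‖ ^ ν * ‖(z s).2‖ := h1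
    linarith
  · refine (diniLe_norm_of_norm_le (hz.hasDerivWithinAt_Ici_of_Icc hs).snd le_rfl).mono ?_
    have h1 := (norm_snd_le _).trans (hfield s hs)
    simpa using h1
  · refine hE.diniLe_norm_snd hW hrob.zero_notMem hγ hA (hz.hasDerivWithinAt_Ici_of_Icc hs)
      (hm s hs) fun r hr => ?_
    have h1 := smul_snd_mem_omegaCone (x := (z s).1) (y := (z s).2) (hm s hs) hr
    exact hnear _ ⟨norm_pos_iff.1 (hrob.norm_pos (hm s hs).1),
      hzone s _ (hps.mono le_rfl hs.2.le) hz0 hsθ⟩ _ h1.2.le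

theorem isCompact_slope_le {E : Type*} [NormedAddCommGroup E] [NormedSpace ℝ E]
    [FiniteDimensional ℝ E] {K : Set E} (hK : IsCompact K) (δ : ℝ) :
    IsCompact {z : E × E | z.1 ∈ K ∧ ‖z.2‖ ≤ δ * ‖z.1‖} := by
  have : ProperSpace E := FiniteDimensional.proper_real E
  obtain ⟨R, hR⟩ := hK.isBounded.exists_norm_le
  refine (hK.prod (isCompact_closedBall (0 : E) (|δ| * R))).of_isClosed_subset ?_ ?_
  · exact (hK.isClosed.preimage continuous_fst).inter
      (isClosed_le continuous_snd.norm (continuous_const.mul continuous_fst.norm))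
  · rintro z ⟨h1, h2⟩
    refine ⟨h1, mem_closedBall_zero_iff.2 (h2.trans ?_)⟩
    have := hR _ h1
    gcongr
    exact le_abs_self δ

variable [FiniteDimensional ℝ E]

/-- If the variational equation contracts faster than the norm can decay, the complexified field has
a flow, with almost the same rates, on a neighborhood of the real cone. -/
theorem IsHomogExt.exists_isConeFlow (hE : IsHomogExt W γ (ν + 1) p p')
    (hrob : IsRobustCone W p ν a C) (hγ : 0 < γ) (hL0 : 0 ≤ L)
    (hL : ∀ z ∈ omegaCone W γ, ‖fderiv ℝ p' z‖ ≤ L * ‖z‖ ^ ν) (hab : a ≤ b)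
    (hb : ∀ x ∈ W, ‖p x‖ ≤ b * ‖x‖ ^ (ν + 1))
    (hA : ∀ x ∈ W, ∀ᶠ s : ℝ in 𝓝[>] 0,
      ‖ContinuousLinearMap.id ℝ E + s • fderiv ℝ p x‖ ≤ 1 + s * (-(A * ‖x‖ ^ ν)))
    (hε : 0 < ε) (hεa : ε < a) (hεC : 2 ^ (ν + 2) * ε ≤ C) (hεA : b + ε < A - ε) :
    ∃ κ > 0, ∃ δ₀ > 0, ∀ δ, 0 < δ → δ ≤ δ₀ → ∃ W' φ', omegaCone W δ ⊆ W' ∧ W' ⊆ omegaCone W γ ∧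
      IsConeFlow W' {z | z.1 ∈ coneZone W κ ∧ ‖z.2‖ ≤ δ / 2 * ‖z.1‖} p' φ' ν (a - ε) (b + ε)
        (A - ε) := by
  have hν := hrob.nu_pos
  have hW := hrob.isOpen
  have hW0 := hrob.zero_notMem
  have hb0 : 0 ≤ b := hrob.a_pos.le.trans hab
  have hεC' : ε ≤ C := by
    have : (1 : ℝ) ≤ 2 ^ (ν + 2) := one_le_pow₀ one_le_two
    nlinarith
  obtain ⟨κ, hκ, θ, hθ, hzone⟩ := hrob.exists_zone hε.le hεa.le hεC
  have hZW := coneZone_subset (W := W) hκ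
  set γ₁ := min γ (min (1 / 2) (ε / (L + 1))) with hγ₁
  have hγ₁0 : 0 < γ₁ := by positivity
  have hγ₁γ : γ₁ ≤ γ := min_le_left _ _
  have hγ₁2 : γ₁ ≤ 1 / 2 := (min_le_right _ _).trans (min_le_left _ _)
  have hγ₁L : L * γ₁ ≤ ε := by
    have h1 : γ₁ ≤ ε / (L + 1) := (min_le_right _ _).trans (min_le_right _ _)
    rw [le_div_iff₀ (by positivity)] at h1
    nlinarith
  have hE₁ := hE.mono hγ₁γ
  obtain ⟨γ₂, hγ₂0, hγ₂, hnear⟩ := exists_norm_sub_real_le (d := ν) hW hW0 hγ₁0 hZW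
    (fun x hx c hc => smul_mem_coneZone hrob.smul_mem hx hc) isCompact_coneZone_inter_sphere
    (hE₁.contDiffOn.continuousOn_fderiv_of_isOpen (isOpen_omegaCone hW γ₁) le_rfl)
    (hE₁.fderiv_homog hW hrob.smul_mem) hε
  have hE₂ := hE₁.mono hγ₂.le
  have hγ₂1 : γ₂ ≤ 1 / 2 := hγ₂.le.trans hγ₁2
  have hγ₂L : L * γ₂ ≤ ε := (mul_le_mul_of_nonneg_left hγ₂.le hL0).trans hγ₁L
  have hsubγ : omegaCone W γ₂ ⊆ omegaCone W γ := omegaCone_mono (hγ₂.le.trans hγ₁γ)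
  have hL₂ : ∀ z ∈ omegaCone W γ₂, ‖fderiv ℝ p' z‖ ≤ L * ‖z‖ ^ ν := fun z hz => hL z (hsubγ hz)
  obtain ⟨c, hc1, Θ, hΘθ, hslope⟩ := hE₂.slope_le hrob hγ₂0 (by linarith) hL0 hL₂ hb0 hb hA hε hεa.le
    hεC' hεA hγ₂L hθ.le hzone hnear
  have hps : ∀ {τ z}, SolOn (fun _ => p') (omegaCone W γ₂) (Icc 0 τ) z →
      PseudoOrbit p ν ε τ (fun t => (z t).1) := fun hz =>
    hE₂.pseudoOrbit hW (by linarith) hL0 hL₂ hγ₂L hz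
  have hc0 : 0 < c := by linarith
  refine ⟨κ, hκ, γ₂ / (2 * c), by positivity, fun δ hδ hδ₀ => ?_⟩
  have hδc : δ * c ≤ γ₂ / 2 := by
    rw [le_div_iff₀ (by positivity)] at hδ₀
    linarith
  have hδγ : δ ≤ γ₂ := by nlinarith
  have hcone : ∀ γ', ∀ z ∈ omegaCone W γ', ∀ c : ℝ, 0 < c → c • z ∈ omegaCone W γ' :=
    fun γ' z hz c hc => smul_mem_omegaCone hz hc (hrob.smul_mem _ hz.1 c hc)
  have hzoneδ : {z : E × E | z.1 ∈ coneZone W κ ∧ ‖z.2‖ ≤ δ / 2 * ‖z.1‖} ⊆ omegaCone W δ := by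
    rintro z ⟨h1, h2⟩
    have := hrob.norm_pos (hZW h1)
    exact ⟨hZW h1, h2.trans_lt (by nlinarith)⟩
  have hε₁ : ∀ z ∈ omegaCone W γ₂, ‖p' z - (p z.1, 0)‖ ≤ ε * ‖z.1‖ ^ (ν + 1) := fun z hz => by
    refine (hE₂.norm_field_sub_le hW (by linarith) hL₂ hz).trans ?_
    calc _ ≤ L * ‖z.1‖ ^ ν * (γ₂ * ‖z.1‖) := by gcongr; exact hz.2.le
      _ = L * γ₂ * ‖z.1‖ ^ (ν + 1) := by ring
      _ ≤ _ := by gcongr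
  have hweak : ∀ {u v w : ℝ} {l : ℝ → ℝ}, (∀ᶠ s : ℝ in 𝓝[>] 0, l s ≤ u + s * v) → 0 < w →
      ∀ᶠ s : ℝ in 𝓝[>] 0, l s ≤ u + s * (v + w) := by
    intro u v w l hl hw
    filter_upwards [hl, self_mem_nhdsWithin] with s hs hs0
    have := mul_pos (mem_Ioi.1 hs0) hw
    linarith
  have hflow := exists_isConeFlow_of_trap (p := p') (D := omegaCone W γ₂) (N := omegaCone W δ)
    (Z := {z | z.1 ∈ coneZone W κ ∧ ‖z.2‖ ≤ δ / 2 * ‖z.1‖}) (a := a - ε) (b := b + ε) (A := A - ε)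
    hν (isOpen_omegaCone hW γ₂) (hcone γ₂) (fun h0 => hW0 h0.1) hE₂.contDiffOn hE₂.homog
    (isOpen_omegaCone hW δ) (hcone δ) (omegaCone_mono hδγ) hzoneδ (fun z hz c hc => ?_) ?_
    (fun z hz T hT => ?_) (fun z₀ hz₀ => ?_) (by linarith) (by linarith) (fun z hz η hη => ?_)
    (fun z hz => ?_) (fun z hz η hη => ?_)
  · obtain ⟨φ', hφ'⟩ := hflow
    refine ⟨_, φ', subset_reachSet (omegaCone_mono hδγ), ?_, hφ'⟩
    rintro _ ⟨T, hT, y, rfl, hy, -⟩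
    exact hsubγ (hy 0 ⟨le_rfl, hT⟩).1
  · refine ⟨smul_mem_coneZone hrob.smul_mem hz.1 hc, ?_⟩
    rw [Prod.smul_snd, Prod.smul_fst, norm_smul, norm_smul, Real.norm_of_nonneg hc.le]
    have := mul_le_mul_of_nonneg_left hz.2 hc.le
    linarith
  · have hset : {z : E × E | z.1 ∈ coneZone W κ ∧ ‖z.2‖ ≤ δ / 2 * ‖z.1‖} ∩ sphere 0 1 =
        {z : E × E | z.1 ∈ coneZone W κ ∩ sphere 0 1 ∧ ‖z.2‖ ≤ δ / 2 * ‖z.1‖} := by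
      ext z
      constructor
      · rintro ⟨hz, hs⟩
        rw [mem_sphere_zero_iff_norm, norm_of_mem_omegaCone (by linarith) (hzoneδ hz)] at hs
        exact ⟨⟨hz.1, mem_sphere_zero_iff_norm.2 hs⟩, hz.2⟩
      · rintro ⟨⟨h1, h2⟩, h3⟩
        refine ⟨⟨h1, h3⟩, ?_⟩
        rw [mem_sphere_zero_iff_norm, norm_of_mem_omegaCone (by linarith) (hzoneδ ⟨h1, h3⟩)]
        exact mem_sphere_zero_iff_norm.1 h2
    rw [hset]
    exact isCompact_slope_le isCompact_coneZone_inter_sphere _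
  · obtain ⟨K, hK, hKW, hKc⟩ := hrob.exists_compact_confinement hε.le hεa.le hεC hz.1 (T := T)
    refine ⟨_, isCompact_slope_le hK (γ₂ / 2), ?_, fun τ hτ y hy0 hy => ?_⟩
    · rintro w ⟨h1, h2⟩
      have := hrob.norm_pos (hKW h1)
      exact ⟨hKW h1, h2.trans_lt (by nlinarith)⟩
    · have h1 := (hslope τ y hy τ ⟨hτ.1, le_rfl⟩).1
      rw [hy0] at h1
      have h2 := hrob.norm_pos (hy τ ⟨hτ.1, le_rfl⟩).1.1
      refine ⟨hKc τ hτ _ (hps hy) (by rw [hy0]), ?_⟩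
      rw [div_le_iff₀ h2] at h1
      refine h1.trans ?_
      have h3 : ‖z.2‖ / ‖z.1‖ ≤ δ := (div_le_iff₀ (hrob.norm_pos hz.1)).2 hz.2.le
      gcongr
      exact (mul_le_mul_of_nonneg_right h3 hc0.le).trans hδc
  · have hpos := hrob.norm_pos hz₀.1
    have hΘ0 : 0 ≤ Θ := hθ.le.trans hΘθ
    refine ⟨Θ / (‖z₀.1‖ / 2) ^ ν, by positivity, ?_⟩
    filter_upwards [(isOpen_omegaCone hW δ).mem_nhds hz₀,
      continuous_fst.norm.continuousAt.eventually_const_lt (half_lt_self hpos)] with z hz hzn t ht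
      y hy0 hy
    have ht0 : 0 ≤ t := le_trans (by positivity) ht
    have hs : Θ ≤ t * ‖(y 0).1‖ ^ ν := by
      rw [hy0]
      calc Θ = Θ / (‖z₀.1‖ / 2) ^ ν * (‖z₀.1‖ / 2) ^ ν := by field_simp
        _ ≤ t * ‖z.1‖ ^ ν := by gcongr
    have hyt := (hy t ⟨ht0, le_rfl⟩).1
    have h2 := hrob.norm_pos hyt.1
    refine ⟨⟨norm_pos_iff.1 h2, hzone t _ (hps hy) (hy0 ▸ hz.1) (hΘθ.trans hs)⟩, ?_⟩
    have h1 := (hslope t y hy t ⟨ht0, le_rfl⟩).2 hs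
    rw [hy0, div_le_iff₀ h2] at h1
    have h3 : ‖z.2‖ / ‖z.1‖ ≤ δ := (div_le_iff₀ (hrob.norm_pos hz.1)).2 hz.2.le
    refine h1.trans ?_
    gcongr
    linarith
  · have hz' := omegaCone_mono hδγ (hzoneδ hz)
    exact hweak (norm_add_smul_ext_le (by linarith) hz' (hrob.norm_decay _ hz'.1) (hε₁ z hz')) hη
  · have hz' := omegaCone_mono hδγ (hzoneδ hz)
    rw [norm_of_mem_omegaCone (by linarith) hz']
    have h1 := norm_add_le (p' z - (p z.1, 0)) (p z.1, 0)
    rw [sub_add_cancel] at h1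
    have h2 := hε₁ z hz'
    have h3 := hb _ hz'.1
    have h4 : ‖((p z.1, 0) : E × E)‖ = ‖p z.1‖ := by simp [Prod.norm_def]
    linarith
  · have hz' := omegaCone_mono hδγ (hzoneδ hz)
    exact hweak (hE₂.norm_id_add_fderiv_le hW hW0 hγ₂0 (by linarith) hz' (hA _ hz'.1)
      (hnear _ hz.1 _ hz'.2.le)) hη

end ComplexFlow

/-! ### The complexified cohomological equation -/

section Action

variable {F : Type*} [NormedAddCommGroup F] [NormedSpace ℝ F] [FiniteDimensional ℝ F]

/-- The action `(R₁ + i R₂) (u + i v)` of the complexification of the endomorphisms of `F` on the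
complexification of `F`. -/
def complexAct (F : Type*) [NormedAddCommGroup F] [NormedSpace ℝ F] [FiniteDimensional ℝ F] :
    (F →L[ℝ] F) × (F →L[ℝ] F) →L[ℝ] (F × F →L[ℝ] F × F) :=
  LinearMap.toContinuousLinearMap (show (F →L[ℝ] F) × (F →L[ℝ] F) →ₗ[ℝ] (F × F →L[ℝ] F × F) from
    { toFun := fun R =>
        (R.1.comp (ContinuousLinearMap.fst ℝ F F) - R.2.comp (ContinuousLinearMap.snd ℝ F F)).prod
          (R.2.comp (ContinuousLinearMap.fst ℝ F F) + R.1.comp (ContinuousLinearMap.snd ℝ F F))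
      map_add' := fun R S => by
        ext v <;> simp
        abel
      map_smul' := fun c R => by
        ext v <;> simp })

theorem complexAct_apply (R : (F →L[ℝ] F) × (F →L[ℝ] F)) (v : F × F) :
    complexAct F R v = (R.1 v.1 - R.2 v.2, R.2 v.1 + R.1 v.2) := rfl

theorem complexAct_mulI_apply (R : (F →L[ℝ] F) × (F →L[ℝ] F)) (v : F × F) :
    complexAct F R (mulI F v) = mulI F (complexAct F R v) := by
  simp only [complexAct_apply, mulI_apply, map_neg]
  refine Prod.ext ?_ ?_ <;> simp <;> abel

theorem complexAct_mulI (R : (F →L[ℝ] F) × (F →L[ℝ] F)) (v : F × F) :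
    complexAct F (mulI (F →L[ℝ] F) R) v = mulI F (complexAct F R v) := by
  simp only [complexAct_apply, mulI_apply, neg_apply]
  refine Prod.ext ?_ ?_ <;> simp <;> abel

theorem complexAct_real (R : F →L[ℝ] F) (v : F × F) : complexAct F (R, 0) v = (R v.1, R v.2) := by
  simp [complexAct_apply]

/-- The logarithmic norm of the complexified coefficient is close to that of the real one. -/
theorem norm_id_sub_complexAct_le {B ε η r : ℝ} (hr : 0 ≤ r) (hη : ‖complexAct F‖ * η ≤ ε)
    {R₀ : F →L[ℝ] F} {R : (F →L[ℝ] F) × (F →L[ℝ] F)}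
    (hB : ∀ᶠ s : ℝ in 𝓝[>] 0, ‖ContinuousLinearMap.id ℝ F - s • R₀‖ ≤ 1 + s * (-(B * r)))
    (hR : ‖R - (R₀, 0)‖ ≤ η * r) :
    ∀ᶠ s : ℝ in 𝓝[>] 0, ‖ContinuousLinearMap.id ℝ (F × F) - s • complexAct F R‖ ≤
      1 + s * (-((B - ε) * r)) := by
  filter_upwards [hB, self_mem_nhdsWithin] with s hs hs0
  have hs0 : 0 < s := hs0
  have h1 : ContinuousLinearMap.id ℝ (F × F) - s • complexAct F R =
      (ContinuousLinearMap.id ℝ (F × F) - s • complexAct F (R₀, 0)) -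
        s • complexAct F (R - (R₀, 0)) := by
    rw [map_sub, smul_sub]; abel
  have h2 : ‖ContinuousLinearMap.id ℝ (F × F) - s • complexAct F (R₀, 0)‖ ≤
      ‖ContinuousLinearMap.id ℝ F - s • R₀‖ := by
    refine ContinuousLinearMap.opNorm_le_bound _ (norm_nonneg _) fun w => ?_
    simp only [sub_apply, smul_apply, ContinuousLinearMap.id_apply, complexAct_real]
    rw [Prod.norm_def]
    refine max_le ?_ ?_
    · exact ((ContinuousLinearMap.id ℝ F - s • R₀).le_opNorm w.1).trans
        (by gcongr; exact norm_fst_le w)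
    · exact ((ContinuousLinearMap.id ℝ F - s • R₀).le_opNorm w.2).trans
        (by gcongr; exact norm_snd_le w)
  have h3 : ‖complexAct F (R - (R₀, 0))‖ ≤ ε * r := by
    refine ((complexAct F).le_opNorm _).trans ?_
    calc _ ≤ ‖complexAct F‖ * (η * r) := by gcongr
      _ = ‖complexAct F‖ * η * r := by ring
      _ ≤ _ := by gcongr
  rw [h1]
  refine (norm_sub_le _ _).trans ?_
  rw [norm_smul, Real.norm_of_nonneg hs0.le]
  have := mul_le_mul_of_nonneg_left h3 hs0.le
  linarith

/-- Conjugation of real linear maps between complexifications by the multiplication by `i`, whose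
fixed points are the complex linear maps. -/
def conjI (E F : Type*) [NormedAddCommGroup E] [NormedSpace ℝ E] [NormedAddCommGroup F]
    [NormedSpace ℝ F] : (E × E →L[ℝ] F × F) →L[ℝ] (E × E →L[ℝ] F × F) :=
  -((ContinuousLinearMap.compL ℝ (E × E) (F × F) (F × F) (mulI F)).comp
    ((ContinuousLinearMap.compL ℝ (E × E) (E × E) (F × F)).flip (mulI E)))

theorem conjI_apply {E F : Type*} [NormedAddCommGroup E] [NormedSpace ℝ E] [NormedAddCommGroup F]
    [NormedSpace ℝ F] (H : E × E →L[ℝ] F × F) (v : E × E) :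
    conjI E F H v = -(mulI F (H (mulI E v))) := rfl

end Action

section Data

variable {E F : Type*} [NormedAddCommGroup E] [NormedSpace ℝ E] [NormedAddCommGroup F]
  [NormedSpace ℝ F] [FiniteDimensional ℝ F] {W W' Z Z' : Set E} {γ δ a b A B ε η j : ℝ} {ν m : ℕ}
  {p : E → E} {Q : E → F →L[ℝ] F} {T : E → F} {φ : ℝ → E → E} {p' : E × E → E × E}
  {Q' : E × E → (F →L[ℝ] F) × (F →L[ℝ] F)} {T' : E × E → F × F}

variable {D Ζ : Set (E × E)} {φ' : ℝ → E × E → E × E} {a' b' A' B' : ℝ}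

/-- The data extended to the complexification are data of a cohomological equation there. -/
theorem isCohData_complex (hD : D ⊆ omegaCone W γ) (hΖD : Ζ ⊆ D)
    (hQ : IsHomogExt W γ ν Q Q') (hT : IsHomogExt W γ (m + (ν + 1)) T T')
    (hnorm : ∀ z ∈ Ζ, ‖z‖ = ‖z.1‖) (hη : ‖complexAct F‖ * η ≤ ε)
    (hB : ∀ x ∈ W, ∀ᶠ s : ℝ in 𝓝[>] 0,
      ‖ContinuousLinearMap.id ℝ F - s • Q x‖ ≤ 1 + s * (-(B * ‖x‖ ^ ν)))
    (hnear : ∀ z ∈ Ζ, ‖Q' z - (Q z.1, 0)‖ ≤ η * ‖z.1‖ ^ ν) :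
    IsCohData D Ζ ν (fun z => complexAct F (Q' z)) T' (B - ε) ((m : ℝ) + 1) where
  cont_Q := (complexAct F).continuous.comp_continuousOn (hQ.contDiffOn.continuousOn.mono hD)
  homog_Q := fun z hz c hc => by rw [hQ.homog z (hD hz) c hc, map_smul]
  log_Q := fun z hz κ hκ => by
    rw [hnorm z hz]
    filter_upwards [norm_id_sub_complexAct_le (by positivity) hη (hB _ (hD (hΖD hz)).1) (hnear z hz),
      self_mem_nhdsWithin] with s hs hs0
    have := mul_pos (mem_Ioi.1 hs0) hκ
    linarith
  cont_T := hT.contDiffOn.continuousOn.mono hD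
  homog_T := fun z hz c hc => by
    rw [hT.homog z (hD hz) c hc, ← Real.rpow_natCast]
    congr 2
    push_cast
    ring

variable [FiniteDimensional ℝ E]

/-- On the real points, the solution of the complexified equation is the solution of the real one. -/
theorem cohIntegral_complex_real (hf' : IsConeFlow D Ζ p' φ' ν a' b' A')
    (hf : IsConeFlow W Z p φ ν a b A) (hWD : ∀ x ∈ W, (x, (0 : E)) ∈ D) {d₁ d₂ d₃ : ℕ}
    (hp : IsHomogExt W γ d₁ p p') (hQ : IsHomogExt W γ d₂ Q Q') (hT : IsHomogExt W γ d₃ T T')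
    (hd' : IsCohData D Ζ ν (fun z => complexAct F (Q' z)) T' B' j)
    (hd : IsCohData W Z ν Q T B j) (hj' : 0 < j + rate a' b' B') (hj : 0 < j + rate a b B) {x : E}
    (hx : x ∈ W) :
    cohIntegral (fun z => complexAct F (Q' z)) T' φ' (x, 0) = (cohIntegral Q T φ x, 0) := by
  have : CompleteSpace F := FiniteDimensional.complete ℝ F
  have hflow : ∀ x ∈ W, ∀ t, 0 ≤ t → φ' t (x, 0) = (φ t x, 0) := by
    intro x hx t ht
    refine (hf'.flow_unique (hWD x hx) (y := fun t => (φ t x, 0)) (fun s hs => ?_)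
      (by simp [hf.flow_zero x hx]) ht).symm
    have hs : 0 ≤ s := hs
    have hm := hf.flow_mem hx hs
    refine ⟨hWD _ hm, ?_⟩
    change HasDerivWithinAt _ (p' (φ s x, 0)) _ _
    rw [hp.real _ hm]
    exact (hf.flow_sol x hx s hs).2.prodMk (hasDerivWithinAt_const _ _ _)
  have hs := hf'.isFlowSol_cohIntegral hd' hj'
  set h := cohIntegral (fun z => complexAct F (Q' z)) T' φ' with hh
  have hcont : ContinuousOn (fun x => h (x, 0)) W :=
    hs.cont.comp (by fun_prop) fun x hx => hWD x hx
  have hhom : ∀ x ∈ W, ∀ c : ℝ, 0 < c → h (c • x, 0) = c ^ j • h (x, 0) := by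
    intro x hx c hc
    rw [← hs.homog _ (hWD x hx) c hc]
    simp
  have hder : ∀ x ∈ W, ∀ t, 0 ≤ t → HasDerivWithinAt (fun s => h (φ s x, 0))
      (Q (φ t x) (h (φ t x, 0)).1 + T (φ t x), Q (φ t x) (h (φ t x, 0)).2) (Ici 0) t := by
    intro x hx t ht
    have hm := hf.flow_mem hx ht
    have h1 : HasDerivWithinAt (fun s => h (φ s x, 0)) _ (Ici 0) t :=
      (hs.deriv _ (hWD x hx) t ht).congr_of_mem (fun s hs => by simp only [hflow x hx s hs]) ht
    rw [hflow x hx t ht, hQ.real _ hm, hT.real _ hm, complexAct_real] at h1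
    simpa using h1
  have e1 : IsFlowSol W φ Q T j (fun x => (h (x, 0)).1) :=
    ⟨hcont.fst, fun x hx c hc => by rw [hhom x hx c hc]; rfl, fun x hx t ht => (hder x hx t ht).fst⟩
  have hd0 : IsCohData W Z ν Q (fun _ => (0 : F)) B j :=
    ⟨hd.cont_Q, hd.homog_Q, hd.log_Q, continuousOn_const, fun _ _ _ _ => by simp⟩
  have e2 : IsFlowSol W φ Q (fun _ => (0 : F)) j (fun x => (h (x, 0)).2) :=
    ⟨hcont.snd, fun x hx c hc => by rw [hhom x hx c hc]; rfl, fun x hx t ht => by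
      simp only [add_zero]
      exact (hder x hx t ht).snd⟩
  have e3 : IsFlowSol W φ Q (fun _ => (0 : F)) j (fun _ => (0 : F)) :=
    ⟨continuousOn_const, fun _ _ _ _ => by simp, fun x hx t ht => by
      simpa using hasDerivWithinAt_const t (Ici 0) (0 : F)⟩
  exact Prod.ext (hf.eq_cohIntegral hd hj e1 hx)
    ((hf.eq_cohIntegral hd0 hj e2 hx).trans (hf.eq_cohIntegral hd0 hj e3 hx).symm)


/-- The derivative of the solution of the complexified equation is complex linear, since its
conjugate by the multiplication by `i` solves the same differentiated equation. -/
theorem fderiv_cohIntegral_mulI (hf : IsConeFlow D Ζ p' φ' ν a' b' A') (hD : D ⊆ omegaCone W γ)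
    (hW : IsOpen W) {d₁ d₂ d₃ : ℕ} (hp : IsHomogExt W γ d₁ p p') (hQ : IsHomogExt W γ d₂ Q Q')
    (hT : IsHomogExt W γ d₃ T T')
    (hd : IsCohData D Ζ ν (fun z => complexAct F (Q' z)) T' B' j) (hj : 0 < j + rate a' b' B')
    (hj' : 0 < j - 1 + rate a' b' B' + rate a' b' A') {z : E × E} (hz : z ∈ D) (v : E × E) :
    fderiv ℝ (cohIntegral (fun z => complexAct F (Q' z)) T' φ') z (mulI E v) =
      mulI F (fderiv ℝ (cohIntegral (fun z => complexAct F (Q' z)) T' φ') z v) := by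
  have : CompleteSpace F := FiniteDimensional.complete ℝ F
  have hQC : ContDiffOn ℝ 1 (fun z => complexAct F (Q' z)) D :=
    (complexAct F).contDiff.comp_contDiffOn (hQ.contDiffOn.mono hD)
  have hTC := hT.contDiffOn.mono hD
  have hsol := hf.isFlowSol_deriv hd hQC hTC hj hj'
  have hs := hf.isFlowSol_cohIntegral hd hj
  have hfd := fun z (hz : z ∈ D) => (hf.hasFDerivAt_cohIntegral hd hQC hTC hj hj' hz).fderiv
  set h := cohIntegral (fun z => complexAct F (Q' z)) T' φ' with hh
  set H := cohIntegral (derivCoeff p' fun z => complexAct F (Q' z))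
    (derivRhs (fun z => complexAct F (Q' z)) T' h) φ' with hH
  have hDQ : ∀ w ∈ D, ∀ u, fderiv ℝ (fun z => complexAct F (Q' z)) w u =
      complexAct F (fderiv ℝ Q' w u) := by
    intro w hw u
    have := (complexAct F).hasFDerivAt.comp w (hQ.differentiableAt hW (hD hw)).hasFDerivAt
    rw [show (fun z => complexAct F (Q' z)) = complexAct F ∘ Q' from rfl, this.fderiv]
    rfl
  have hcomm : ∀ w ∈ D, ∀ G, conjI E F (derivCoeff p' (fun z => complexAct F (Q' z)) w G +
      derivRhs (fun z => complexAct F (Q' z)) T' h w) =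
      derivCoeff p' (fun z => complexAct F (Q' z)) w (conjI E F G) +
        derivRhs (fun z => complexAct F (Q' z)) T' h w := by
    intro w hw G
    refine ContinuousLinearMap.ext fun u => ?_
    simp only [conjI_apply, add_apply, derivCoeff_apply, derivRhs_apply, hDQ w hw,
      hQ.fderiv_mulI w (hD hw), hp.fderiv_mulI w (hD hw), hT.fderiv_mulI w (hD hw), complexAct_mulI,
      map_neg, map_add, map_sub, complexAct_mulI_apply, mulI_mulI]
    abel
  have hsol' : IsFlowSol D φ' (derivCoeff p' fun z => complexAct F (Q' z))
      (derivRhs (fun z => complexAct F (Q' z)) T' h) (j - 1) (fun w => conjI E F (H w)) := by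
    refine ⟨(conjI E F).continuous.comp_continuousOn hsol.cont, fun w hw c hc => ?_,
      fun w hw t ht => ?_⟩
    · rw [hsol.homog w hw c hc, map_smul]
    · have h1 := (conjI E F).hasFDerivAt.comp_hasDerivWithinAt t (hsol.deriv w hw t ht)
      rw [hcomm _ (hf.flow_mem hw ht)] at h1
      exact h1
  have huniq := hf.eq_cohIntegral (hf.isCohData_deriv hd hQC hTC hs.cont hs.homog) (by
    have := rate_add_le hf.a_pos hf.a_le_b B' A'
    linarith) hsol' hz
  rw [hfd z hz]
  have h2 := congrArg (fun G : E × E →L[ℝ] F × F => mulI F (G v)) huniq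
  simp only [conjI_apply, map_neg, mulI_mulI, neg_neg] at h2
  exact h2

end Data

/-! ### Analyticity of the solution -/

/-- Strict inequalities for `rate` survive a slight worsening of the constants. -/
theorem eventually_lt_rate {a b β c : ℝ} (ha : 0 < a) (hb : 0 < b) (h : c < rate a b β) :
    ∀ᶠ ε in 𝓝[>] (0 : ℝ), c < rate (a - ε) (b + ε) (β - ε) := by
  rcases le_or_gt β 0 with hβ | hβ
  · rw [rate, if_pos hβ] at h
    have h1 : ContinuousAt (fun ε : ℝ => (β - ε) / (a - ε)) 0 :=
      ContinuousAt.div (by fun_prop) (by fun_prop) (by simpa using ha.ne')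
    have h2 := h1.eventually_const_lt (by simpa using h)
    filter_upwards [h2.filter_mono nhdsWithin_le_nhds, self_mem_nhdsWithin] with ε hε hε0
    rwa [rate, if_pos (by linarith [mem_Ioi.1 hε0])]
  · rw [rate, if_neg hβ.not_ge] at h
    have h1 : ContinuousAt (fun ε : ℝ => (β - ε) / (b + ε)) 0 :=
      ContinuousAt.div (by fun_prop) (by fun_prop) (by simpa using hb.ne')
    have h2 := h1.eventually_const_lt (by simpa using h)
    filter_upwards [h2.filter_mono nhdsWithin_le_nhds,
      nhdsWithin_le_nhds (Iio_mem_nhds hβ)] with ε hε hεβ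
    rwa [rate, if_neg (by linarith [mem_Iio.1 hεβ])]

section Functional

variable {F : Type*} [NormedAddCommGroup F] [NormedSpace ℝ F]

/-- The complex linear extension of a real functional to the complexification. -/
def complexFunctional (l : F →L[ℝ] ℝ) : F × F →L[ℝ] ℂ :=
  Complex.ofRealCLM.comp (l.comp (ContinuousLinearMap.fst ℝ F F)) +
    Complex.I • Complex.ofRealCLM.comp (l.comp (ContinuousLinearMap.snd ℝ F F))

theorem complexFunctional_apply (l : F →L[ℝ] ℝ) (v : F × F) :
    complexFunctional l v = (l v.1 : ℂ) + Complex.I * (l v.2 : ℂ) := rfl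

theorem complexFunctional_mulI (l : F →L[ℝ] ℝ) (v : F × F) :
    complexFunctional l (mulI F v) = Complex.I * complexFunctional l v := by
  simp only [complexFunctional_apply, mulI_apply, map_neg]
  push_cast
  linear_combination (-(l v.2 : ℂ)) * Complex.I_mul_I

end Functional

section Omega

variable {E F : Type*} [NormedAddCommGroup E] [NormedSpace ℝ E] [NormedAddCommGroup F]
  [NormedSpace ℝ F] {n : ℕ} (e : Module.Basis (Fin n) ℝ E) {V : Set E} {γ : ℝ}

theorem isOpen_Omega (hV : IsOpen V) (γ : ℝ) : IsOpen (Omega e V γ) :=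
  (isOpen_omegaCone hV γ).preimage (complexCoord e).symm.continuous

theorem toComplex_mem_Omega (hV0 : (0 : E) ∉ V) (hγ : 0 < γ) {x : E} (hx : x ∈ V) :
    toComplex e x ∈ Omega e V γ := by
  rw [← complexCoord_real]
  exact (complexCoord_mem_Omega e).2 (mem_omegaCone_real hV0 hγ hx)

theorem ExtendsToOmega.mono {f : E → F} {γ' : ℝ} (h : ExtendsToOmega e V γ f) (hγ : γ' ≤ γ) :
    ExtendsToOmega e V γ' f := by
  intro l
  obtain ⟨g, hg, hgf⟩ := h l
  exact ⟨g, hg.mono fun z hz => ⟨hz.1, hz.2.trans_le (by gcongr)⟩, hgf⟩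

/-- A real differentiable map between complexifications whose derivative commutes with the
multiplication by `i` is complex differentiable in coordinates. -/
theorem differentiableAt_complexFunctional {f : E × E → F × F} {z : E × E}
    (hf : DifferentiableAt ℝ f z)
    (hI : ∀ v, fderiv ℝ f z (mulI E v) = mulI F (fderiv ℝ f z v)) (l : F →L[ℝ] ℝ) :
    DifferentiableAt ℂ (fun w => complexFunctional l (f ((complexCoord e).symm w)))
      (complexCoord e z) := by
  set G : (Fin n → ℂ) →L[ℝ] ℂ := (complexFunctional l).comp ((fderiv ℝ f z).comp
    ((complexCoord e).symm : (Fin n → ℂ) →L[ℝ] E × E)) with hG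
  have hd : HasFDerivAt (fun w => complexFunctional l (f ((complexCoord e).symm w))) G
      (complexCoord e z) := by
    have h1 : HasFDerivAt f (fderiv ℝ f z) ((complexCoord e).symm (complexCoord e z)) := by
      rw [ContinuousLinearEquiv.symm_apply_apply]
      exact hf.hasFDerivAt
    exact (complexFunctional l).hasFDerivAt.comp _
      (h1.comp _ (complexCoord e).symm.hasFDerivAt)
  have hGI : ∀ w, G (Complex.I • w) = Complex.I * G w := by
    intro w
    have h1 : ∀ w, G w = complexFunctional l (fderiv ℝ f z ((complexCoord e).symm w)) := fun _ => rfl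
    rw [h1, h1, complexCoord_symm_I_smul, hI, complexFunctional_mulI]
  refine (differentiableAt_iff_restrictScalars ℝ hd.differentiableAt).2
    ⟨{ toFun := G, map_add' := map_add G, map_smul' := fun c w => ?_, cont := G.continuous }, ?_⟩
  · have h1 : c • w = c.re • w + c.im • (Complex.I • w) := by
      ext i
      simp only [Pi.smul_apply, Pi.add_apply, smul_eq_mul, Complex.real_smul]
      linear_combination (-(w i)) * Complex.re_add_im c
    rw [h1, map_add, map_smul, map_smul, hGI, Complex.real_smul, Complex.real_smul, RingHom.id_apply,
      smul_eq_mul]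
    linear_combination G w * Complex.re_add_im c
  · rw [hd.fderiv]
    rfl

/-- A real differentiable map on the complex cone whose derivative is complex linear is an analytic
extension of its restriction to the real points. -/
theorem extendsToOmega_of_fderiv_mulI {f : E × E → F × F} {h : E → F} (hV : IsOpen V)
    (hf : ∀ z ∈ omegaCone V γ, DifferentiableAt ℝ f z)
    (hI : ∀ z ∈ omegaCone V γ, ∀ v, fderiv ℝ f z (mulI E v) = mulI F (fderiv ℝ f z v))
    (hreal : ∀ x ∈ V, f (x, 0) = (h x, 0)) : ExtendsToOmega e V γ h := by
  refine fun l => ⟨fun w => complexFunctional l (f ((complexCoord e).symm w)),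
    analyticOnNhd_of_differentiableOn (isOpen_Omega e hV γ) fun w hw => ?_, fun x hx => ?_⟩
  · have h1 := (mem_Omega_iff e).1 hw
    have := differentiableAt_complexFunctional e (hf _ h1) (hI _ h1) l
    rw [ContinuousLinearEquiv.apply_symm_apply] at this
    exact this.differentiableWithinAt
  · beta_reduce
    rw [← complexCoord_real, ContinuousLinearEquiv.symm_apply_apply, hreal x hx,
      complexFunctional_apply]
    simp

variable [FiniteDimensional ℝ F]

theorem exists_isComplexExtension_repr {k : ℕ} (b : Module.Basis (Fin k) ℝ F) {f : E → F}
    (hf : ExtendsToOmega e V γ f) :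
    ∃ g : Fin k → (Fin n → ℂ) → ℂ, ∀ i, IsComplexExtension e V γ (fun x => b.repr (f x) i) (g i) := by
  choose g hg using fun i => hf (LinearMap.toContinuousLinearMap (b.coord i))
  exact ⟨g, hg⟩

/-- A function which extends analytically to a complex neighborhood is real analytic. -/
theorem ExtendsToOmega.analyticOnNhd {f : E → F} (hf : ExtendsToOmega e V γ f) (hV : IsOpen V)
    (hV0 : (0 : E) ∉ V) (hγ : 0 < γ) : AnalyticOnNhd ℝ f V := by
  obtain ⟨g, hg⟩ := exists_isComplexExtension_repr e (Module.finBasis ℝ F) hf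
  set ι : E →L[ℝ] (Fin n → ℂ) :=
    (complexCoord e : E × E →L[ℝ] (Fin n → ℂ)).comp (ContinuousLinearMap.inl ℝ E E) with hι
  have hιx : ∀ x, ι x = toComplex e x := fun x => complexCoord_real e x
  intro x hx
  have h1 : ∀ i, AnalyticAt ℝ (fun x => Complex.reCLM (g i (ι x)) • Module.finBasis ℝ F i) x := by
    intro i
    have h2 : AnalyticAt ℂ (g i) (ι x) := (hg i).1 _ (hιx x ▸ toComplex_mem_Omega e hV0 hγ hx)
    have h3 : AnalyticAt ℝ (fun x => g i (ι x)) x := h2.restrictScalars.comp (ι.analyticAt x)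
    exact ((Complex.reCLM.analyticAt _).comp h3).smul analyticAt_const
  have h4 : AnalyticAt ℝ (fun x => ∑ i, Complex.reCLM (g i (ι x)) • Module.finBasis ℝ F i) x :=
    Finset.analyticAt_fun_sum _ fun i _ => h1 i
  refine h4.congr ?_
  filter_upwards [hV.mem_nhds hx] with y hy
  conv_rhs => rw [← (Module.finBasis ℝ F).sum_repr (f y)]
  refine Finset.sum_congr rfl fun i _ => ?_
  rw [hιx, (hg i).2 y hy]
  simp

end Omega

section Analytic

variable {E F : Type*} [NormedAddCommGroup E] [NormedSpace ℝ E] [NormedAddCommGroup F]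
  [NormedSpace ℝ F] {n : ℕ} (e : Module.Basis (Fin n) ℝ E) {V Z : Set E} {γ a b A B C : ℝ} {ν m : ℕ}
  {p : E → E} {Q : E → F →L[ℝ] F} {T : E → F} {φ : ℝ → E → E}

theorem homExtend_eq_of_homog {G : Type*} [NormedAddCommGroup G] [NormedSpace ℝ G] {f : E → G} {d : ℕ}
    (hf : IsHomog d univ f) {x : E} (hx : x ∈ posCone V) : homExtend V d f x = f x := by
  have hf' : IsHomog d V f := ⟨hf.1.mono (subset_univ _), fun c u _ _ => hf.2 c u trivial trivial⟩
  obtain ⟨s, hs, hsx⟩ := hx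
  rw [homExtend_eq hf' hs hsx, hf.2 s x trivial trivial, smul_smul,
    inv_mul_cancel₀ (pow_ne_zero _ hs.ne'), one_smul]

/-- A globally homogeneous function with an analytic extension near `V` has a homogeneous extension
to the complex cone. -/
theorem exists_isHomogExt_of_extendsToOmega {G : Type*} [NormedAddCommGroup G] [NormedSpace ℝ G]
    [FiniteDimensional ℝ G] {f : E → G} {d : ℕ} (hV : IsOpen V) (hV0 : (0 : E) ∉ V)
    (hf : IsHomog d univ f) (hγ : 0 < γ) (hext : ExtendsToOmega e V γ f) :
    ∃ f', IsHomogExt (posCone V) γ d f f' := by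
  obtain ⟨g, hg⟩ := exists_isComplexExtension_repr e (Module.finBasis ℝ G) hext
  obtain ⟨f', hf', -⟩ := exists_isHomogExt e (Module.finBasis ℝ G) hV hV0 (d := d)
    ⟨hf.1.mono (subset_univ _), fun c u _ _ => hf.2 c u trivial trivial⟩ hγ hg
  exact ⟨f', hf'.contDiffOn, hf'.fderiv_mulI, hf'.homog, fun x hx => by
    rw [hf'.real x hx, homExtend_eq_of_homog hf hx]⟩

/-- The field itself has a homogeneous extension to the complex cone, whose derivative obeys the
assumed bound. -/
theorem exists_isHomogExt_field (hV : IsOpen V) (hV0 : (0 : E) ∉ V) (hp : IsHomog (ν + 1) univ p)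
    (hγ : 0 < γ) (hext : ExtendsToOmegaWithBound e V γ ν p) :
    ∃ p', IsHomogExt (posCone V) γ (ν + 1) p p' ∧ ∃ L, 0 ≤ L ∧
      ∀ z ∈ omegaCone (posCone V) γ, ‖fderiv ℝ p' z‖ ≤ L * ‖z‖ ^ ν := by
  have : FiniteDimensional ℝ E := Module.Finite.of_basis e
  choose g hg L hL using fun i => hext (LinearMap.toContinuousLinearMap (e.coord i))
  obtain ⟨p', hp', hb⟩ := exists_isHomogExt e e hV hV0 (d := ν + 1)
    (f := p) ⟨hp.1.mono (subset_univ _), fun c u _ _ => hp.2 c u trivial trivial⟩ hγ hg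
  refine ⟨p', ⟨hp'.contDiffOn, hp'.fderiv_mulI, hp'.homog, fun x hx => by
    rw [hp'.real x hx, homExtend_eq_of_homog hp hx]⟩, hb ν (∑ i, |L i|) rfl fun i w hw => ?_⟩
  refine (hL i w hw).trans ?_
  gcongr
  exact (le_abs_self _).trans (Finset.single_le_sum (f := fun i => |L i|)
    (fun j _ => abs_nonneg _) (Finset.mem_univ i))

variable [FiniteDimensional ℝ F]

/-- If the variational equation contracts faster than the norm can decay, the integral solution
extends analytically along with the data: it is the restriction of the integral solution of the
complexified equation. -/
theorem extendsToOmega_cohIntegral (hV : IsOpen V) (hV0 : (0 : E) ∉ V)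
    (hrob : IsRobustCone (posCone V) p ν a C) (hf : IsConeFlow (posCone V) Z p φ ν a b A)
    (hb : ∀ x ∈ posCone V, ‖p x‖ ≤ b * ‖x‖ ^ (ν + 1))
    (hA : ∀ x ∈ posCone V, ∀ᶠ s : ℝ in 𝓝[>] 0,
      ‖ContinuousLinearMap.id ℝ E + s • fderiv ℝ p x‖ ≤ 1 + s * (-(A * ‖x‖ ^ ν)))
    (hB : ∀ x ∈ posCone V, ∀ᶠ s : ℝ in 𝓝[>] 0,
      ‖ContinuousLinearMap.id ℝ F - s • Q x‖ ≤ 1 + s * (-(B * ‖x‖ ^ ν)))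
    (hp : IsHomog (ν + 1) univ p) (hQ : IsHomog ν univ Q) (hT : IsHomog (m + (ν + 1)) V T)
    (hd : IsCohData (posCone V) Z ν Q (homExtend V (m + (ν + 1)) T) B ((m : ℝ) + 1))
    (hj : 0 < (m : ℝ) + 1 + rate a b B) (hbA : b < A) (hγ : 0 < γ)
    (hpe : ExtendsToOmegaWithBound e V γ ν p) (hQe : ExtendsToOmega e V γ Q)
    (hTe : ExtendsToOmega e V γ T) :
    ∃ δ, 0 < δ ∧ ExtendsToOmega e V δ (cohIntegral Q (homExtend V (m + (ν + 1)) T) φ) := by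
  have : FiniteDimensional ℝ E := Module.Finite.of_basis e
  have : CompleteSpace F := FiniteDimensional.complete ℝ F
  have hWo := isOpen_posCone hV
  have hW0 := zero_notMem_posCone hV0
  obtain ⟨p', hp', L, hL0, hL⟩ := exists_isHomogExt_field e hV hV0 hp hγ hpe
  obtain ⟨Q', hQ'⟩ := exists_isHomogExt_of_extendsToOmega e hV hV0 hQ hγ hQe
  obtain ⟨g, hg⟩ := exists_isComplexExtension_repr e (Module.finBasis ℝ F) hTe
  obtain ⟨T', hT', -⟩ := exists_isHomogExt e (Module.finBasis ℝ F) hV hV0 hT hγ hg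
  -- The constants may be worsened by a small `ε`.
  obtain ⟨ε, hε, hεa, hεC, hεA, hεj⟩ : ∃ ε : ℝ, 0 < ε ∧ ε < a ∧ 2 ^ (ν + 2) * ε ≤ C ∧
      b + ε < A - ε ∧ -((m : ℝ) + 1) < rate (a - ε) (b + ε) (B - ε) := by
    have h1 : ∀ᶠ ε : ℝ in 𝓝[>] 0, ε < a := nhdsWithin_le_nhds (Iio_mem_nhds hrob.a_pos)
    have h2 : ∀ᶠ ε : ℝ in 𝓝[>] 0, ε < C / 2 ^ (ν + 2) :=
      nhdsWithin_le_nhds (Iio_mem_nhds (div_pos hrob.C_pos (by positivity)))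
    have h3 : ∀ᶠ ε : ℝ in 𝓝[>] 0, ε < (A - b) / 2 :=
      nhdsWithin_le_nhds (Iio_mem_nhds (by linarith))
    have h4 := eventually_lt_rate hf.a_pos hf.b_pos (by linarith : -((m : ℝ) + 1) < rate a b B)
    obtain ⟨ε, e1, e2, e3, e4, e5⟩ :=
      (h1.and (h2.and (h3.and (h4.and self_mem_nhdsWithin)))).exists
    refine ⟨ε, e5, e1, ?_, by linarith, e4⟩
    rw [lt_div_iff₀ (by positivity)] at e2
    linarith
  obtain ⟨κ, hκ, δ₀, hδ₀, hflow⟩ := hp'.exists_isConeFlow hrob hγ hL0 hL hf.a_le_b hb hA hε hεa hεC hεA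
  obtain ⟨δ₁, hδ₁, -, hnear⟩ := exists_norm_sub_real_le (d := ν) hWo hW0 hγ (coneZone_subset hκ)
    (fun x hx c hc => smul_mem_coneZone hrob.smul_mem hx hc) isCompact_coneZone_inter_sphere
    hQ'.contDiffOn.continuousOn hQ'.homog
    (div_pos hε (by positivity : (0 : ℝ) < ‖complexAct F‖ + 1))
  set δ := min δ₀ (min δ₁ 1) with hδ
  have hδ0 : 0 < δ := by positivity
  have hδδ₁ : δ ≤ δ₁ := (min_le_right _ _).trans (min_le_left _ _)
  have hδ1 : δ ≤ 1 := (min_le_right _ _).trans (min_le_right _ _)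
  obtain ⟨D, φ', hδD, hD, hf'⟩ := hflow δ hδ0 (min_le_left _ _)
  have hreal : ∀ x ∈ posCone V, ((x, 0) : E × E) ∈ D := fun x hx =>
    hδD (mem_omegaCone_real hW0 hδ0 hx)
  have hd' := isCohData_complex (m := m) (ε := ε) (η := ε / (‖complexAct F‖ + 1)) hD hf'.zone_subset
    hQ' hT' (fun z hz => ?_) ?_ hB fun z hz => ?_
  · have hj' : 0 < (m : ℝ) + 1 + rate (a - ε) (b + ε) (B - ε) := by linarith
    have hrA : 1 ≤ rate (a - ε) (b + ε) (A - ε) := by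
      have hbε : 0 < b + ε := hf'.b_pos
      rw [rate, if_neg (by linarith), one_le_div hbε]
      exact hεA.le
    have hj'' : 0 < (m : ℝ) + 1 - 1 + rate (a - ε) (b + ε) (B - ε) +
        rate (a - ε) (b + ε) (A - ε) := by linarith
    have hVD : omegaCone V δ ⊆ D := fun z hz => hδD ⟨subset_posCone hz.1, hz.2⟩
    refine ⟨δ, hδ0, extendsToOmega_of_fderiv_mulI e
      (f := cohIntegral (fun z => complexAct F (Q' z)) T' φ') hV (fun z hz => ?_) (fun z hz v => ?_)
      fun x hx => ?_⟩
    · exact (hf'.hasFDerivAt_cohIntegral hd'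
        ((complexAct F).contDiff.comp_contDiffOn (hQ'.contDiffOn.mono hD)) (hT'.contDiffOn.mono hD)
        hj' hj'' (hVD hz)).differentiableAt
    · exact fderiv_cohIntegral_mulI hf' hD hWo hp' hQ' hT' hd' hj' hj'' (hVD hz) v
    · exact cohIntegral_complex_real hf' hf hreal hp' hQ' hT' hd' hd hj' hj (subset_posCone hx)
  · exact norm_of_mem_omegaCone (W := univ) (γ := 1) le_rfl ⟨trivial, hz.2.trans_lt (by
      have := hrob.norm_pos (coneZone_subset hκ hz.1)
      nlinarith)⟩
  · rw [← mul_div_assoc, div_le_iff₀ (by positivity)]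
    nlinarith [norm_nonneg (complexAct F)]
  · rw [← hQ'.real z.1 (coneZone_subset hκ hz.1)]
    refine hnear z.1 hz.1 z.2 (hz.2.trans ?_)
    gcongr
    linarith

end Analytic

end Cohomological

end

open Cohomological Set Filter Topology MeasureTheory

theorem mainTheorem2
    {E F : Type*} [NormedAddCommGroup E] [NormedSpace ℝ E]
    [NormedAddCommGroup F] [NormedSpace ℝ F] [FiniteDimensional ℝ F]
    {n : ℕ} (e : Module.Basis (Fin n) ℝ E)
    (N m : ℕ) (hN : 2 ≤ N) (hm : 1 ≤ m)
    (r : ℕ∞) (hr : 1 ≤ r)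
    (V : Set E) (hVopen : IsOpen V) (hVstar : Cohomological.StarShapedAtZero V)
    (U : Set E) (hUopen : IsOpen U) (hU0 : (0 : E) ∈ U)
    (p : E → E) (Q : E → F →L[ℝ] F) (T : E → F)
    (hp : Cohomological.IsHomog N Set.univ p)
    (hQ : Cohomological.IsHomog (N - 1) Set.univ Q)
    (hT : Cohomological.IsHomog (m + N) V T)
    (hpr : ContDiffOn ℝ r p U) (hQr : ContDiffOn ℝ r Q U) (hTr : ContDiffOn ℝ r T V)
    (ρ : ℝ) (hρ : 0 < ρ)
    (hHP1 : Cohomological.HP1 V ρ N p) (hHP2 : Cohomological.HP2 V ρ N p)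
    (A B c d : ℝ)
    (hA : A = Cohomological.constAp V ρ N p) (hB : B = Cohomological.constBQ V ρ N Q)
    (hc : c = Cohomological.constC V ρ N p Q) (hd : d = Cohomological.constD V ρ N p)
    (hdeg : (m : ℝ) + 1 + B / c > max (1 - A / d) 0) :
    ∃ (φ : ℝ → E → E) (M : ℝ → E → F ≃L[ℝ] F) (h : E → F),
      Cohomological.IsForwardFlow p V φ ∧
      (∀ x ∈ V, ∀ t : ℝ, 0 ≤ t → φ t x ∈ Cohomological.posCone V) ∧
      Cohomological.IsFundamentalMatrix Q V φ M ∧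
      Cohomological.IsSolution V p Q T (m + 1) h ∧
      (∀ h' : E → F, Cohomological.IsSolution V p Q T (m + 1) h' → Set.EqOn h' h V) ∧
      (∀ x ∈ V,
        MeasureTheory.IntegrableOn
          (fun t => (M t x).symm (Cohomological.homExtend V (m + N) T (φ t x))) (Set.Ioi 0) ∧
        h x = -∫ t in Set.Ioi (0 : ℝ),
          (M t x).symm (Cohomological.homExtend V (m + N) T (φ t x))) ∧
      ContDiffOn ℝ 1 h V ∧
      (d ≤ A → ContDiffOn ℝ r h V) ∧
      (A < d → ∃ r₀ : ℕ,
        IsGreatest {i : ℕ | 1 ≤ i ∧ (i : ℕ∞) ≤ r ∧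
          0 < (m : ℝ) + 1 + B / c - i * (1 - A / d)} r₀ ∧
        ContDiffOn ℝ r₀ h V) ∧
      (d < A →
        (∃ γ₀ : ℝ, 0 < γ₀ ∧
          Cohomological.ExtendsToOmegaWithBound e V γ₀ (N - 1) p ∧
          Cohomological.ExtendsToOmega e V γ₀ Q ∧
          Cohomological.ExtendsToOmega e V γ₀ T) →
        (∃ γ₁ : ℝ, 0 < γ₁ ∧ ∀ γ : ℝ, 0 < γ → γ ≤ γ₁ →
          Cohomological.ExtendsToOmega e V γ h) ∧
        AnalyticOnNhd ℝ h V) := by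
  obtain ⟨ν, rfl⟩ : ∃ ν, N = ν + 1 := ⟨N - 1, by omega⟩
  have hν : 0 < ν := by omega
  rw [Nat.add_sub_cancel] at hQ
  have : FiniteDimensional ℝ E := Module.Finite.of_basis e
  have : CompleteSpace F := FiniteDimensional.complete ℝ F
  have hV0 := zero_notMem_of_starShaped hVopen hVstar
  have hp' : ∀ x, ∀ c : ℝ, p (c • x) = c ^ (ν + 1) • p x := fun x c => hp.2 c x trivial trivial
  have hQ' : ∀ x, ∀ c : ℝ, Q (c • x) = c ^ ν • Q x := fun x c => hQ.2 c x trivial trivial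
  have hpC := contDiff_of_homog hUopen hU0 (fun x c _ => hp' x c) hpr
  have hQC := contDiff_of_homog hUopen hU0 (fun x c _ => hQ' x c) hQr
  have h1r : (1 : WithTop ℕ∞) ≤ r := by exact_mod_cast hr
  have hp1 : ContDiff ℝ 1 p := hpC.of_le h1r
  obtain ⟨C, hrob⟩ := exists_isRobustCone hρ hν hVopen hVstar hp1
    (fun x c _ => hp' x c) hHP1.2 hHP2
  have hab := constA_le_constB hρ hVstar hV0 hHP1.2 hp1.continuous
    (fun x c _ => hp' x c)
  obtain ⟨Z, φ, hf⟩ := hrob.exists_isConeFlow (A := A) hab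
    (fun x hx => norm_field_le_of_constB hρ hν hVopen hVstar hp1.continuous
      (fun x c _ => hp' x c) hx)
    (fun x hx => hA ▸ log_deriv_of_constAp hρ hν hVopen hVstar hp1
      (fun x c _ => hp' x c) hx)
  have hlogQ : ∀ x ∈ posCone V, ∀ᶠ s : ℝ in 𝓝[>] 0,
      ‖ContinuousLinearMap.id ℝ F - s • Q x‖ ≤ 1 + s * (-(B * ‖x‖ ^ ν)) := fun x hx =>
    hB ▸ log_coeff_of_constBQ hρ hν hVopen hVstar hQC.continuous
      (fun x c _ => hQ' x c) hx
  have hdat := isCohData_homExtend hVopen hT hQC.continuous (fun x c _ => hQ' x c)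
    hf.zone_subset hlogQ
  have hrB : rate (constA V ρ (ν + 1) p)
      (constB V ρ (ν + 1) p) B = B / c := by
    rw [hc, constC, ← hB, rate]
    split_ifs <;> rfl
  -- The convention at `A = 0` differs from that of `rate`, but both give `0`.
  have hrA : rate (constA V ρ (ν + 1) p)
      (constB V ρ (ν + 1) p) A = A / d := by
    rw [hd, constD, ← hA, rate]
    rcases lt_trichotomy A 0 with h0 | h0 | h0
    · rw [if_pos h0.le, if_pos h0]
    · simp [h0]
    · rw [if_neg h0.not_ge, if_neg h0.not_gt]
  have hd0 : 0 < d := by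
    rw [hd, constD]
    split_ifs
    exacts [hf.a_pos, hf.b_pos]
  have hj : 0 < (m : ℝ) + 1 + B / c := (le_max_right _ _).trans_lt hdeg
  have hj1 : 1 - A / d < (m : ℝ) + 1 + B / c := (le_max_left _ _).trans_lt hdeg
  rw [← hrB] at hj
  set Tw := homExtend V (m + (ν + 1)) T with hTw
  have hTC : ContDiffOn ℝ r Tw (posCone V) :=
    contDiffOn_homExtend hVopen hT hTr
  set h := cohIntegral Q Tw φ with hh
  have hsol := hf.isFlowSol_cohIntegral hdat hj
  have hsub := subset_posCone (V := V)
  have hreg : ∀ k : ℕ, (k : ℕ∞) ≤ r → 0 < (m : ℝ) + 1 + B / c - k * (1 - A / d) →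
      ContDiffOn ℝ k h V := by
    intro k hk hpos
    have hk' : ((k : ℕ) : WithTop ℕ∞) ≤ r := by exact_mod_cast hk
    rw [← hrB, ← hrA] at hpos
    exact (hf.contDiffOn_cohIntegral hdat (hpC.of_le hk').contDiffOn (hQC.of_le hk').contDiffOn
      (hTC.of_le hk') hj hpos).mono hsub
  have hC1 : ContDiffOn ℝ 1 h V := by
    have := hreg 1 (by exact_mod_cast hr) (by push_cast; linarith)
    exact_mod_cast this
  have hdiff : ∀ x ∈ V, DifferentiableAt ℝ h x := fun x hx =>
    (hC1.differentiableOn one_ne_zero).differentiableAt (hVopen.mem_nhds hx)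
  have hS : IsSolution V p Q T (m + 1) h := by
    refine ⟨isHomog_cohIntegral hf hrob hV0 hp' hQ' hVstar hT hdat hj,
      fun x hx => (hdiff x hx).differentiableWithinAt, fun x hx => ?_⟩
    rw [fderiv_apply_sub_of_isFlowSol hf hsol (hsub hx) (hdiff x hx), hTw,
      homExtend_of_mem hT hx]
  have huniq : ∀ h' : E → F, IsSolution V p Q T (m + 1) h' → EqOn h' h V := by
    intro h' hS' x hx
    have := hf.eq_cohIntegral hdat hj (isFlowSol_of_isSolution hf hVopen hT
      (fun x c _ => hQ' x c) hS') (hsub hx)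
    rwa [homExtend_of_mem hS'.1 hx] at this
  refine ⟨φ, fundEquiv Q φ, h, fun x hx => ⟨hf.flow_zero x (hsub hx),
    fun t ht => (hf.flow_sol x (hsub hx) t ht).2⟩, fun x hx t ht => hf.flow_mem (hsub hx) ht,
    isFundamentalMatrix_fundEquiv hf hQC.continuous.continuousOn, hS, huniq,
    fun x hx => ?_, hC1, fun hdA => ?_, fun hAd => ?_, fun hdA => ?_⟩
  · have hsymm : ∀ t ∈ Ioi (0 : ℝ), (fundPair Q φ x).2 t (Tw (φ t x)) =
        (fundEquiv Q φ t x).symm (Tw (φ t x)) := fun t ht => by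
      rw [← (fundEquiv_spec hf hQC.continuous.continuousOn (hsub hx)
        (le_of_lt ht)).2]
      rfl
    refine ⟨(hf.integrand_integrableOn hdat hj (hsub hx)).congr_fun hsymm measurableSet_Ioi, ?_⟩
    rw [← setIntegral_congr_fun measurableSet_Ioi hsymm]
    rfl
  · refine contDiffOn_iff_forall_nat_le.2 fun k hk => hreg k hk ?_
    have h1 : 1 - A / d ≤ 0 := by rw [sub_nonpos, one_le_div hd0]; exact hdA
    have h2 : (k : ℝ) * (1 - A / d) ≤ 0 := mul_nonpos_of_nonneg_of_nonpos k.cast_nonneg h1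
    rw [hrB] at hj
    linarith
  · have h1 : 0 < 1 - A / d := by rw [sub_pos, div_lt_one hd0]; exact hAd
    set S : Set ℕ := {i | 1 ≤ i ∧ (i : ℕ∞) ≤ r ∧ 0 < (m : ℝ) + 1 + B / c - i * (1 - A / d)} with hSdef
    have hne : S.Nonempty := ⟨1, le_rfl, by exact_mod_cast hr, by push_cast; linarith⟩
    have hbdd : BddAbove S := by
      obtain ⟨k, hk⟩ := exists_nat_gt (((m : ℝ) + 1 + B / c) / (1 - A / d))
      refine ⟨k, fun i hi => ?_⟩
      rw [div_lt_iff₀ h1] at hk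
      have : (i : ℝ) * (1 - A / d) < k * (1 - A / d) := by linarith [hi.2.2]
      exact_mod_cast (lt_of_mul_lt_mul_right this h1.le).le
    have hmem := Nat.sSup_mem hne hbdd
    exact ⟨sSup S, ⟨hmem, fun i hi => le_csSup hbdd hi⟩, hreg _ hmem.2.1 hmem.2.2⟩
  · rintro ⟨γ₀, hγ₀, hpe, hQe, hTe⟩
    have hA0 : 0 ≤ A := by
      by_contra! h0
      rw [hd, constD, ← hA, if_pos h0] at hdA
      linarith [hf.a_pos]
    -- As `A ≥ 0`, the constant which `A` exceeds is `b`, the bound for the fastest decay of the norm.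
    have hdb : d = constB V ρ (ν + 1) p := by
      rw [hd, constD, ← hA, if_neg hA0.not_gt]
    obtain ⟨γ₁, hγ₁, hext⟩ := extendsToOmega_cohIntegral e hVopen hV0 hrob hf
      (fun x hx => norm_field_le_of_constB hρ hν hVopen hVstar hp1.continuous
        (fun x c _ => hp' x c) hx)
      (fun x hx => hA ▸ log_deriv_of_constAp hρ hν hVopen hVstar hp1
        (fun x c _ => hp' x c) hx)
      hlogQ hp hQ hT hdat hj (hdb ▸ hdA) hγ₀ hpe hQe hTe
    exact ⟨⟨γ₁, hγ₁, fun γ _ hγ => hext.mono e hγ⟩, hext.analyticOnNhd e hVopen hV0 hγ₁⟩
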